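/- **Setting.** Let $K$ be a finite-dimensional ribbon Hopf algebra over a field $\mathbb F$ of characteristic zero, with ribbon element $\nu$, Drinfel'd element $u$, grouplike element $g=u^{-1}\nu$ and antipode $S$, and let $R\in K\otimes K$ be an $R$-matrix of $K$ (possibly different from the one for which $\nu$ is a ribbon element). Let $\Gamma$ be a finite ciliated ribbon graph with vertex set $V$ and edge set $E$: a directed graph with a linear ordering of the edge ends at each vertex; $t(e)$ and $s(e)$ denote the target end and the starting end of the edge $e$. Choose for each edge one of its two ends, called selected. Write $\alpha\mapsto\alpha_{(1)}\otimes\alpha_{(2)}$ for the comultiplication of $K^*$ and $(\alpha)_e\in (K^{*})^{\otimes E}$ for the tensor with entry $\alpha$ at $e$ and $\epsilon$ elsewhere. **The gauge theory algebra $\mathcal A^*_\Gamma$.** To each edge end assign the right $K$-module algebra $K^*$ with action $\langle\alpha\lhd h,k\rangle=\langle\alpha,hk\rangle$ if it is incoming and $\langle\alpha\lhd h,k\rangle=\langle\alpha,kS(h)\rangle$ if it is outgoing, and with product $\alpha\cdot\beta=\langle\beta_{(1)}\otimes\alpha_{(1)},R\rangle\,\beta_{(2)}\alpha_{(2)}$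 (incoming, selected), $\langle\beta_{(2)}\otimes\alpha_{(2)},R\rangle\,\alpha_{(1)}\beta_{(1)}$ (outgoing, selected), $\alpha\beta$ (incoming, not selected), $\beta\alpha$ (outgoing, not selected). For an $n$-valent vertex $v$ let $\mathcal A^*_v$ be their braided tensor product: the space $(K^{*})^{\otimes n}$ with $(\alpha)_i(\beta)_j=\alpha\otimes\beta$ in positions $i,j$ for $i<j$, with $(\alpha)_i(\beta)_j=(\beta\lhd R_{(1)})_j(\alpha\lhd R_{(2)})_i$ for $i>j$, and with $(\alpha^1\otimes\cdots\otimes\alpha^n)\lhd h=\alpha^1\lhd h_{(1)}\otimes\cdots\otimes\alpha^n\lhd h_{(n)}$. Then $\bigotimes_v\mathcal A^*_v$ is a right $K^{\otimes V}$-module algebra. Let $G^*:(K^{*})^{\otimes E}\to\bigotimes_v\mathcal A^*_v$ be the tensor product over the edges of the maps $(\alpha)_e\mapsto(\alpha_{(2)}\otimes\alpha_{(1)})_{s(e)t(e)}$. **The lattice algebra $\mathcal L_P$** (Alekseev–Grosse–Schomerus, Buffenoir–Roche). Let $P$ be a class of finite-dimensional matrix representations of $K$. For $I,J\in P$ put $R_{IJ}=(I\otimes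 J)(R)$, and let $R_{JI}$ denote $(I\otimes J)(R_{21})$, both acting on $V_I\otimes V_J$; for a matrix $M$ put $M_1=M\otimes 1$, $M_2=1\otimes M$. An oriented edge $x$ is an edge $e$ or its reverse $e^{-1}$, whose target and starting ends are exchanged; call $x$ admissible if it is not a loop or if $t(x)<s(x)$. For edge ends $y\ne z$ put $\mathcal R(y,z)=1$ if they are at different vertices, $\mathcal R(y,z)=R$ if $y<z$ and $\mathcal R(y,z)=R_{21}^{-1}$ if $y>z$; in matrix formulas it stands for $(I\otimes J)(\mathcal R(y,z))$. $\mathcal L_P$ is the unital associative $\mathbb F$-algebra generated by the entries of matrices $M_I[x]$ ($I\in P$, $x$ an oriented edge) subject to: 1. $M_I[x]\,T=T\,M_J[x]$ for all intertwiners $T:V_J\to V_I$; 2. $M_I[x]=1$ if $I(k)=\epsilon(k)1$ for all $k$; 3. $M_I[x^{-1}]=I(g)\,M_{I^*}[x]^{\mathsf T}$ for the dual representation $I^*(k)=I(S(k))^{\mathsf T}$, if it is in $P$; 4. $M_J[x]_2\,\mathcal R(t(x),s(x))\,M_I[x]_1=R_{IJ}\sum_k C_kM_{N_k}[x]D_k$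 for admissible $x$ and all finite families $N_k\in P$ with intertwiners $D_k:V_I\otimes V_J\to V_{N_k}$, $C_k:V_{N_k}\to V_I\otimes V_J$ such that $\sum_kC_kD_k=1$; 5. $M_J[x]_2\,\mathcal R(t(x),s(x))\,M_I[x]_1=R_{IJ}\,M_I[x]_1\,\mathcal R(s(x),t(x))^{-1}M_J[x]_2\,R_{JI}^{-1}$ for admissible $x$; 6. $\mathcal R(t(x),t(y))^{-1}M_J[y]_2\,\mathcal R(t(x),s(y))\,M_I[x]_1=M_I[x]_1\,\mathcal R(s(x),t(y))^{-1}M_J[y]_2\,\mathcal R(s(x),s(y))$ for admissible $x,y$ on different edges. A gauge transformation $h\in K$ at a vertex $v$ acts on holonomies by $M_I[x]\mapsto I(w_{(1)})\,M_I[x]\,I(S(w_{(2)}))$, where $w\in K\otimes K$ is $\epsilon(h)\,1\otimes1$ if $x$ is not incident at $v$, $h\otimes1$ if $x$ only ends at $v$, $1\otimes h$ if $x$ only starts at $v$, and, for a loop at $v$, $\Delta(h)$ if $t(x)<s(x)$ and $\Delta^{op}(h)$ if $s(x)<t(x)$. **Proposition.** There are a unique bilinear product and a unique bilinear right action of $K^{\otimes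 V}$ on $(K^{*})^{\otimes E}$ for which $G^*$ is multiplicative and equivariant; this is $\mathcal A^*_\Gamma$. It coincides with the lattice algebra $\mathcal L_P$, where $P$ is the class of all finite-dimensional representations of $K$, and also, if $K$ is semisimple, where $P$ is the class of all irreducible ones. That is, in both cases: the assignment $$M_I[e]_{ab}\mapsto (I_{ab})_e,\qquad M_I[e^{-1}]_{ab}\mapsto (T^*I_{ab})_e,\qquad \langle I_{ab},k\rangle=I(k)_{ab},\quad \langle T^*\alpha,k\rangle=\langle\alpha,g\,S(k)\rangle,$$ defines an isomorphism of unital algebras $\mathcal L_P\to\mathcal A^*_\Gamma$; the action of gauge transformations on holonomies extends uniquely to a right $K^{\otimes V}$-module algebra structure on $\mathcal L_P$; and the isomorphism is $K^{\otimes V}$-equivariant. In particular $\mathcal A^*_\Gamma$ does not depend on the choice of the selected ends. -/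

import Mathlib

open scoped TensorProduct Kronecker

noncomputable section

namespace HopfGauge

/-! ### Quasitriangular and ribbon Hopf algebras -/

section HopfAlgebraData

variable {F K : Type*} [Field F] [Ring K] [HopfAlgebra F K]

/-- The flip `x ⊗ y ↦ y ⊗ x` of `K ⊗ K`, as an algebra automorphism. -/
abbrev flip : K ⊗[F] K ≃ₐ[F] K ⊗[F] K := Algebra.TensorProduct.comm F K K

/-- `R₂₁`, for an invertible element `R` of `K ⊗ K`. -/
def flipUnit (R : (K ⊗[F] K)ˣ) : (K ⊗[F] K)ˣ :=
  Units.map (flip : K ⊗[F] K ≃ₐ[F] K ⊗[F] K).toAlgHom.toMonoidHom R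

/-- `R` is an `R`-matrix of `K`: it intertwines `Δ` and `Δᵒᵖ`, and
`(Δ ⊗ id)(R) = R₁₃ R₂₃`, `(id ⊗ Δ)(R) = R₁₃ R₁₂`. -/
structure IsRMatrix (R : (K ⊗[F] K)ˣ) : Prop where
  mul_comul : ∀ h : K,
    (R : K ⊗[F] K) * Coalgebra.comul (R := F) h = flip (Coalgebra.comul (R := F) h) * R
  comul_left :
    TensorProduct.map (Coalgebra.comul : K →ₗ[F] K ⊗[F] K) (LinearMap.id : K →ₗ[F] K) R
      = Algebra.TensorProduct.map
          (Algebra.TensorProduct.includeLeft : K →ₐ[F] K ⊗[F] K) (AlgHom.id F K) R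
        * Algebra.TensorProduct.map
          (Algebra.TensorProduct.includeRight : K →ₐ[F] K ⊗[F] K) (AlgHom.id F K) R
  comul_right :
    (TensorProduct.assoc F K K K).symm
      (TensorProduct.map (LinearMap.id : K →ₗ[F] K) (Coalgebra.comul : K →ₗ[F] K ⊗[F] K) R)
      = Algebra.TensorProduct.map
          (Algebra.TensorProduct.includeLeft : K →ₐ[F] K ⊗[F] K) (AlgHom.id F K) R
        * ((R : K ⊗[F] K) ⊗ₜ[F] (1 : K))

/-- The Drinfel'd element `u = m ((S ⊗ id)(R₂₁))`. -/
def drinfeldElement (R : (K ⊗[F] K)ˣ) : K :=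
  LinearMap.mul' F K
    (TensorProduct.map (HopfAlgebra.antipode F) (LinearMap.id : K →ₗ[F] K) (flip (R : K ⊗[F] K)))

/-- `ν` is a ribbon element of the quasitriangular Hopf algebra `(K, R)`. -/
structure IsRibbonElement (R : (K ⊗[F] K)ˣ) (ν : K) : Prop where
  central : ∀ h : K, ν * h = h * ν
  isUnit : IsUnit ν
  sq : drinfeldElement R * HopfAlgebra.antipode F (drinfeldElement R) = ν ^ 2
  counit : Coalgebra.counit (R := F) ν = 1
  antipode : HopfAlgebra.antipode F ν = ν
  comul : Coalgebra.comul (R := F) ν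
    = ((R⁻¹ : (K ⊗[F] K)ˣ) : K ⊗[F] K) * (((flipUnit R)⁻¹ : (K ⊗[F] K)ˣ) : K ⊗[F] K) * (ν ⊗ₜ[F] ν)

/-- The grouplike element `g = u⁻¹ ν` of a ribbon Hopf algebra. -/
def grouplike (R : (K ⊗[F] K)ˣ) (ν : K) : K := Ring.inverse (drinfeldElement R) * ν

/-- The involution `T*` of `K*`, `⟨T* α, k⟩ = ⟨α, g S(k)⟩`, that implements edge reversal. -/
def revDual (g : K) : Module.Dual F K →ₗ[F] Module.Dual F K :=
  (LinearMap.mulLeft F g ∘ₗ HopfAlgebra.antipode F).dualMap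

end HopfAlgebraData

/-! ### Ciliated ribbon graphs -/

/-- A directed graph with vertices `V` and edges `E`, together with a linear ordering of the edge
ends at each vertex: `ends ⟨v, i⟩` is the `i`-th edge end at `v`, where `Sum.inl e` stands for the
target end `t(e)` and `Sum.inr e` for the starting end `s(e)` of the edge `e`. -/
structure CiliatedRibbonGraph (V E : Type*) where
  valence : V → ℕ
  ends : (Σ v, Fin (valence v)) ≃ E ⊕ E

namespace CiliatedRibbonGraph

variable {V E : Type*} (Γ : CiliatedRibbonGraph V E)

/-- The vertex at which an edge end is incident. -/
def vertexOf (x : E ⊕ E) : V := (Γ.ends.symm x).1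

/-- The position of an edge end in the linear ordering at its vertex. -/
def position (x : E ⊕ E) : ℕ := ((Γ.ends.symm x).2 : ℕ)

/-- The relation `x < y` between edge ends (both at the same vertex). -/
def Before (x y : E ⊕ E) : Prop := Γ.vertexOf x = Γ.vertexOf y ∧ Γ.position x < Γ.position y

/-- `outgoing v i` says whether the `i`-th edge end at `v` is outgoing (the map `τ`). -/
def outgoing (v : V) (i : Fin (Γ.valence v)) : Bool := (Γ.ends ⟨v, i⟩).isRight

/-- For a choice `ρ` of one end of each edge (`true` selects the target end, `false` the starting
end), `selected ρ v i` says whether the `i`-th edge end at `v` is selected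
(that is, whether `σ(i) = 0`). -/
def selected (ρ : E → Bool) (v : V) (i : Fin (Γ.valence v)) : Bool :=
  match Γ.ends ⟨v, i⟩ with
  | Sum.inl e => ρ e
  | Sum.inr e => !(ρ e)

end CiliatedRibbonGraph

/-- The target end of an oriented edge; `(e, true)` is `e` and `(e, false)` is `e⁻¹`. -/
def tEnd {E : Type*} : E × Bool → E ⊕ E
  | (e, true) => Sum.inl e
  | (e, false) => Sum.inr e

/-- The starting end of an oriented edge. -/
def sEnd {E : Type*} : E × Bool → E ⊕ E
  | (e, true) => Sum.inr e
  | (e, false) => Sum.inl e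

/-! ### The module algebra of a vertex neighbourhood -/

section Vertex

variable {F K : Type*} [Field F] [Ring K] [HopfAlgebra F K]

/-- The action of gauge transformations on the functions of one edge end: `α ◁ h = ⟨α₍₁₎, h⟩ α₍₂₎`
for an incoming and `α ◁ h = ⟨α₍₂₎, S(h)⟩ α₍₁₎` for an outgoing one, so that
`⟨α ◁ h, k⟩ = ⟨α, h k⟩` and `⟨α ◁ h, k⟩ = ⟨α, k S(h)⟩`. -/
def endAct (out : Bool) : K →ₗ[F] Module.Dual F K →ₗ[F] Module.Dual F K :=
  match out with
  | false => Module.Dual.transpose ∘ₗ LinearMap.mul F K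
  | true => Module.Dual.transpose ∘ₗ (LinearMap.mul F K).flip ∘ₗ HopfAlgebra.antipode F

/-- The product on `K*` given by `⟨α · β, k⟩ = ⟨α ⊗ β, W k⟩`. For `W = Δ` it is the usual product
of `K*`. -/
def dualMul (W : K →ₗ[F] K ⊗[F] K) :
    Module.Dual F K →ₗ[F] Module.Dual F K →ₗ[F] Module.Dual F K :=
  (TensorProduct.mk F (Module.Dual F K) (Module.Dual F K)).compr₂
    (W.dualMap ∘ₗ TensorProduct.dualDistrib F K K)

/-- The product of the functions of one edge end:
* incoming, selected: `α · β = ⟨β₍₁₎ ⊗ α₍₁₎, R⟩ β₍₂₎ α₍₂₎`,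
* outgoing, selected: `α · β = ⟨β₍₂₎ ⊗ α₍₂₎, R⟩ α₍₁₎ β₍₁₎`,
* incoming, not selected: `α · β = α β`,
* outgoing, not selected: `α · β = β α`. -/
def endMul (R : K ⊗[F] K) (out sel : Bool) :
    Module.Dual F K →ₗ[F] Module.Dual F K →ₗ[F] Module.Dual F K :=
  match sel, out with
  | true, false => (dualMul (LinearMap.mulLeft F R ∘ₗ Coalgebra.comul)).flip
  | true, true =>
      (dualMul (LinearMap.mulRight F R ∘ₗ (flip : K ⊗[F] K ≃ₐ[F] K ⊗[F] K).toLinearMap ∘ₗ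
        Coalgebra.comul)).flip
  | false, false => dualMul Coalgebra.comul
  | false, true => (dualMul Coalgebra.comul).flip

variable (F K) in
/-- `(K*)^{⊗ n}`. -/
abbrev DualPow (n : ℕ) : Type _ := PiTensorProduct F (fun _ : Fin n => Module.Dual F K)

variable {n : ℕ}

/-- An endomorphism of `K*` acting on the `i`-th factor of `(K*)^{⊗ n}`. -/
def slot (i : Fin n) : Module.End F (Module.Dual F K) →ₗ[F] Module.End F (DualPow F K n) :=
  (PiTensorProduct.mapMultilinear F (fun _ : Fin n => Module.Dual F K)
    (fun _ : Fin n => Module.Dual F K)).toLinearMap (fun _ => LinearMap.id) i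

/-- The diagonal action of `K`, through the iterated comultiplication, on the factors of
`(K*)^{⊗ n}` that are listed in `l`, in the order of `l`. -/
def jointAct (out : Fin n → Bool) : List (Fin n) → (K →ₗ[F] Module.End F (DualPow F K n))
  | [] => (Coalgebra.counit : K →ₗ[F] F).smulRight 1
  | i :: l =>
      LinearMap.mul' F (Module.End F (DualPow F K n)) ∘ₗ
        TensorProduct.map (slot i ∘ₗ endAct (out i)) (jointAct out l) ∘ₗ Coalgebra.comul

/-- The action of a gauge transformation at a vertex on the functions of its neighbourhood:
`(α¹ ⊗ ⋯ ⊗ αⁿ) ◁ h = (α¹ ◁ h₍₁₎) ⊗ ⋯ ⊗ (αⁿ ◁ h₍ₙ₎)`. -/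
def vertexAct (out : Fin n → Bool) : K →ₗ[F] Module.End F (DualPow F K n) :=
  jointAct out (List.finRange n)

/-- Left multiplication by `(α)ᵢ` in the braided tensor product of the module algebras of the edge
ends at a vertex:
`(α)ᵢ · (β¹ ⊗ ⋯ ⊗ βⁿ) = ((β¹ ⊗ ⋯ ⊗ βⁱ⁻¹) ◁ R₍₁₎) ⊗ ((α ◁ R₍₂₎) · βⁱ) ⊗ βⁱ⁺¹ ⊗ ⋯ ⊗ βⁿ`. -/
def leftMul (R : K ⊗[F] K) (out sel : Fin n → Bool) (i : Fin n) :
    Module.Dual F K →ₗ[F] Module.End F (DualPow F K n) :=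
  (LinearMap.mul' F (Module.End F (DualPow F K n)) ∘ₗ LinearMap.applyₗ R) ∘ₗ
    (TensorProduct.mapBilinear (.id F) K K (Module.End F (DualPow F K n))
        (Module.End F (DualPow F K n)) (jointAct out ((List.finRange n).filter (· < i)))) ∘ₗ
    (endAct (out i)).flip.compr₂ (slot i ∘ₗ endMul R (out i) (sel i))

/-- The product of the braided tensor product of the module algebras of the edge ends at a vertex,
in which `α¹ ⊗ ⋯ ⊗ αⁿ = (α¹)₁ ⋯ (αⁿ)ₙ`; it is written as `x ↦ (y ↦ x · y)`. -/
def vertexMul (R : K ⊗[F] K) (out sel : Fin n → Bool) :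
    DualPow F K n →ₗ[F] Module.End F (DualPow F K n) :=
  PiTensorProduct.lift
    ((MultilinearMap.mkPiAlgebraFin F n (Module.End F (DualPow F K n))).compLinearMap
      (leftMul R out sel))

end Vertex

/-! ### Tensor products over the vertices and edges of a graph -/

section TensorPowers

variable {F : Type*} [Field F]

/-- The canonical isomorphism `⨂ᵢ (M ⊗ M) ≃ (⨂ᵢ M) ⊗ (⨂ᵢ M)`; see `unshuffle_tprod`. -/
def unshuffle (F ι M : Type*) [Field F] [Finite ι] [AddCommGroup M] [Module F M]
    [FiniteDimensional F M] :
    (⨂[F] _ : ι, M ⊗[F] M) ≃ₗ[F] (⨂[F] _ : ι, M) ⊗[F] (⨂[F] _ : ι, M) :=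
  (Basis.piTensorProduct fun _ : ι =>
      (Module.finBasis F M).tensorProduct (Module.finBasis F M)).equiv
    ((Basis.piTensorProduct fun _ : ι => Module.finBasis F M).tensorProduct
      (Basis.piTensorProduct fun _ : ι => Module.finBasis F M))
    (Equiv.arrowProdEquivProdArrow ι (fun _ => _) (fun _ => _))

theorem unshuffle_tprod {ι M : Type*} [Finite ι] [AddCommGroup M] [Module F M]
    [FiniteDimensional F M] (x y : ι → M) :
    unshuffle F ι M (PiTensorProduct.tprod F fun i => x i ⊗ₜ[F] y i)
      = PiTensorProduct.tprod F x ⊗ₜ[F] PiTensorProduct.tprod F y := by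
  set b := Module.finBasis F M
  have key : (unshuffle F ι M).symm.toLinearMap =
      TensorProduct.lift (PiTensorProduct.map₂ fun _ : ι => TensorProduct.mk F M M) := by
    refine ((Basis.piTensorProduct fun _ : ι => b).tensorProduct
      (Basis.piTensorProduct fun _ : ι => b)).ext ?_
    rintro ⟨p, q⟩
    simp only [unshuffle, LinearEquiv.coe_coe, Module.Basis.equiv_symm]
    rw [Module.Basis.equiv_apply]
    simp [Module.Basis.tensorProduct_apply, Basis.piTensorProduct_apply,
      Equiv.arrowProdEquivProdArrow, PiTensorProduct.map₂_tprod_tprod, b]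
  rw [← LinearEquiv.eq_symm_apply, ← LinearEquiv.coe_coe, key]
  simp [PiTensorProduct.map₂_tprod_tprod]

theorem nest_aux {M : Type*} [AddCommGroup M] [Module F M] {V : Type*} {n : V → ℕ}
    [DecidableEq V] [DecidableEq (Σ v, Fin (n v))] (x : (Σ v, Fin (n v)) → M)
    (p : Σ v, Fin (n v)) (m : M) :
    (fun v => PiTensorProduct.tprod F fun i => Function.update x p m ⟨v, i⟩)
      = Function.update (fun v => PiTensorProduct.tprod F fun i => x ⟨v, i⟩) p.1
          (PiTensorProduct.tprod F (Function.update (fun i => x ⟨p.1, i⟩) p.2 m)) := by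
  obtain ⟨w, j⟩ := p
  funext v
  by_cases h : v = w
  · subst h
    simp only [Function.update_self]
    congr 1
    funext i
    by_cases hi : i = j
    · subst hi; simp
    · rw [Function.update_of_ne hi, Function.update_of_ne (by simpa using hi)]
  · rw [Function.update_of_ne h]
    congr 1
    funext i
    rw [Function.update_of_ne (fun H => h (congrArg Sigma.fst H))]

/-- The canonical map from a tensor product over all pairs `(v, i)` to the iterated tensor product
over `v` and `i`. -/
def nest (F M : Type*) [Field F] [AddCommGroup M] [Module F M] {V : Type*} (n : V → ℕ) :
    (⨂[F] _ : (Σ v, Fin (n v)), M) →ₗ[F] ⨂[F] v, ⨂[F] _ : Fin (n v), M :=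
  PiTensorProduct.lift
    { toFun := fun x =>
        PiTensorProduct.tprod F fun v => PiTensorProduct.tprod F fun i => x ⟨v, i⟩
      map_update_add' := by
        classical
        intro _ x p a b
        simp only [nest_aux, MultilinearMap.map_update_add]
      map_update_smul' := by
        classical
        intro _ x p c a
        simp only [nest_aux, MultilinearMap.map_update_smul] }

theorem nest_tprod {M : Type*} [AddCommGroup M] [Module F M] {V : Type*} (n : V → ℕ)
    (x : (Σ v, Fin (n v)) → M) :
    nest F M n (PiTensorProduct.tprod F x)
      = PiTensorProduct.tprod F fun v => PiTensorProduct.tprod F fun i => x ⟨v, i⟩ := by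
  simp [nest]

end TensorPowers

/-! ### The algebra of functions of the Hopf algebra gauge theory -/

section GaugeTheory

variable {F K : Type*} [Field F] [Ring K] [HopfAlgebra F K]
variable {V E : Type*}

variable (F K V) in
/-- The algebra `K^{⊗ V}` of gauge transformations. -/
abbrev GaugeAlg : Type _ := PiTensorProduct F (fun _ : V => K)

variable (F K E) in
/-- The vector space `(K*)^{⊗ E}` of functions on connections. -/
abbrev EdgeFun : Type _ := PiTensorProduct F (fun _ : E => Module.Dual F K)

variable (F K) in
/-- The vector space `⨂ᵥ (K*)^{⊗ |v|}` underlying the tensor product `⨂ᵥ A*ᵥ` of the algebras of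
the vertex neighbourhoods. -/
abbrev VertexFun (Γ : CiliatedRibbonGraph V E) : Type _ :=
  PiTensorProduct F (fun v : V => DualPow F K (Γ.valence v))

/-- The function `(α)ₑ`, which is `α` in the factor of the edge `e` and `ε` in all others. -/
def single [DecidableEq E] (e : E) (α : Module.Dual F K) : EdgeFun F K E :=
  PiTensorProduct.tprod F (Function.update (fun _ => (Coalgebra.counit : K →ₗ[F] F)) e α)

/-- The comultiplication of the Hopf algebra `K^{⊗ V}`. -/
def comulPi [Finite V] [FiniteDimensional F K] :
    GaugeAlg F K V →ₗ[F] GaugeAlg F K V ⊗[F] GaugeAlg F K V :=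
  (unshuffle F V K).toLinearMap ∘ₗ PiTensorProduct.map (fun _ => Coalgebra.comul)

/-- The counit of the Hopf algebra `K^{⊗ V}`. -/
def counitPi [Fintype V] : GaugeAlg F K V →ₗ[F] F :=
  (PiTensorProduct.constantBaseRingEquiv V F).toLinearMap ∘ₗ
    PiTensorProduct.map (fun _ => Coalgebra.counit)

/-- The comultiplication `α ↦ α₍₁₎ ⊗ α₍₂₎` of `K*`, dual to the product of `K`. -/
def comulDual [FiniteDimensional F K] :
    Module.Dual F K →ₗ[F] Module.Dual F K ⊗[F] Module.Dual F K :=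
  (TensorProduct.dualDistribEquiv F K K).symm.toLinearMap ∘ₗ (LinearMap.mul' F K).dualMap

variable (Γ : CiliatedRibbonGraph V E)

/-- The embedding `G* : (K*)^{⊗ E} → ⨂ᵥ (K*)^{⊗ |v|}`, the tensor product over all edges `e` of the
maps `(α)ₑ ↦ (α₍₂₎ ⊗ α₍₁₎)_{s(e) t(e)}`. -/
def Gstar [Finite E] [FiniteDimensional F K] : EdgeFun F K E →ₗ[F] VertexFun F K Γ :=
  nest F (Module.Dual F K) Γ.valence ∘ₗ
    (PiTensorProduct.reindex F (fun _ : E ⊕ E => Module.Dual F K) Γ.ends.symm).toLinearMap ∘ₗ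
    (PiTensorProduct.tmulEquiv F (Module.Dual F K)).toLinearMap ∘ₗ
    (unshuffle F E (Module.Dual F K)).toLinearMap ∘ₗ
    PiTensorProduct.map (fun _ => comulDual)

/-- The product of the tensor product `⨂ᵥ A*ᵥ` of the algebras of the vertex neighbourhoods. -/
def totalMul (R : K ⊗[F] K) (ρ : E → Bool) :
    VertexFun F K Γ →ₗ[F] VertexFun F K Γ →ₗ[F] VertexFun F K Γ :=
  PiTensorProduct.map₂ (fun v => vertexMul R (Γ.outgoing v) (Γ.selected ρ v))

/-- The right action of `K^{⊗ V}` on `⨂ᵥ A*ᵥ`; `totalAct Γ h x` is `x ◁ h`. -/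
def totalAct : GaugeAlg F K V →ₗ[F] VertexFun F K Γ →ₗ[F] VertexFun F K Γ :=
  PiTensorProduct.piTensorHomMap ∘ₗ PiTensorProduct.map (fun v => vertexAct (Γ.outgoing v))

/-- `m` is the product of the algebra of functions `A*_Γ` of the Hopf algebra gauge theory, that is,
the one for which `G*` is multiplicative. -/
def IsGaugeProduct [Finite E] [FiniteDimensional F K] (R : (K ⊗[F] K)ˣ) (ρ : E → Bool)
    (m : EdgeFun F K E →ₗ[F] EdgeFun F K E →ₗ[F] EdgeFun F K E) : Prop :=
  ∀ x y, Gstar Γ (m x y) = totalMul Γ (R : K ⊗[F] K) ρ (Gstar Γ x) (Gstar Γ y)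

/-- `a` is the right action of `K^{⊗ V}` on the algebra of functions `A*_Γ` of the Hopf algebra gauge
theory, that is, the one for which `G*` is equivariant; `a h x` is `x ◁ h`. -/
def IsGaugeAction [Finite E] [FiniteDimensional F K]
    (a : GaugeAlg F K V →ₗ[F] EdgeFun F K E →ₗ[F] EdgeFun F K E) : Prop :=
  ∀ h x, Gstar Γ (a h x) = totalAct Γ h (Gstar Γ x)

end GaugeTheory

/-! ### Matrix representations -/

section Representations

variable {F K : Type*} [Field F] [Ring K] [HopfAlgebra F K]

variable (F K) in
/-- A finite-dimensional matrix representation of `K`. -/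
structure MatRep where
  dim : ℕ
  rep : K →ₐ[F] Matrix (Fin dim) (Fin dim) F

namespace MatRep

/-- The matrix element `k ↦ I(k)_{ab}`. -/
def coef (I : MatRep F K) (a b : Fin I.dim) : Module.Dual F K :=
  Matrix.entryLinearMap F F a b ∘ₗ I.rep.toLinearMap

/-- The representation `I` is irreducible. -/
def IsIrreducible (I : MatRep F K) : Prop :=
  0 < I.dim ∧ ∀ W : Submodule F (Fin I.dim → F),
    (∀ k, ∀ w ∈ W, (I.rep k).mulVec w ∈ W) → W = ⊥ ∨ W = ⊤

/-- `(I ⊗ J)(w)` for `w ∈ K ⊗ K`. -/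
def kron (I J : MatRep F K) :
    K ⊗[F] K →ₗ[F] Matrix (Fin I.dim × Fin J.dim) (Fin I.dim × Fin J.dim) F :=
  TensorProduct.lift
    ((Matrix.kroneckerBilinear (R := F) (α := F)).compl₁₂ I.rep.toLinearMap J.rep.toLinearMap)

end MatRep

end Representations

/-! ### The lattice algebra of combinatorial quantisation -/

section Lattice

variable {F K : Type*} [Field F] [Ring K] [HopfAlgebra F K]
variable {V E : Type*} [DecidableEq V]

namespace CiliatedRibbonGraph

variable (Γ : CiliatedRibbonGraph V E)

/-- The oriented edge `x` is not a loop, or it is a loop with `t(x) < s(x)`. -/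
def Admissible (x : E × Bool) : Prop :=
  Γ.vertexOf (tEnd x) ≠ Γ.vertexOf (sEnd x) ∨ Γ.position (tEnd x) < Γ.position (sEnd x)

/-- The braiding of two distinct edge ends `x`, `y`: `R` if `x < y`, `R₂₁⁻¹` if `x > y`, and `1` if
they are at different vertices. -/
def braid (R : (K ⊗[F] K)ˣ) (x y : E ⊕ E) : (K ⊗[F] K)ˣ :=
  if Γ.vertexOf x = Γ.vertexOf y then
    if Γ.position x < Γ.position y then R else (flipUnit R)⁻¹
  else 1

/-- The element `w ∈ K ⊗ K` for which a gauge transformation `h` at the vertex `v` acts on the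
holonomy `M` of the oriented edge `x` by `M ↦ w₁ M S(w₂)`. -/
def gaugeTensor (v : V) (x : E × Bool) (h : K) : K ⊗[F] K :=
  if Γ.vertexOf (tEnd x) = v then
    if Γ.vertexOf (sEnd x) = v then
      if Γ.position (tEnd x) < Γ.position (sEnd x) then Coalgebra.comul h
      else flip (Coalgebra.comul (R := F) h)
    else h ⊗ₜ[F] (1 : K)
  else if Γ.vertexOf (sEnd x) = v then (1 : K) ⊗ₜ[F] h
  else Coalgebra.counit (R := F) h • (1 : K ⊗[F] K)

end CiliatedRibbonGraph

/-- The generators `M_I[x]_{ab}` of the lattice algebra, where `I` runs through the class `P` of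
representations and `x` through the oriented edges. -/
structure Gen (P : Set (MatRep F K)) (E : Type*) where
  rep : P
  edge : E × Bool
  row : Fin rep.1.dim
  col : Fin rep.1.dim

/-- The matrix `M_I[x]` of generators. -/
def genMat {P : Set (MatRep F K)} (I : P) (x : E × Bool) :
    Matrix (Fin I.1.dim) (Fin I.1.dim) (FreeAlgebra F (Gen P E)) :=
  Matrix.of fun a b => FreeAlgebra.ι F ⟨I, x, a, b⟩

/-- A matrix of scalars. -/
def sc (P : Set (MatRep F K)) (E : Type*) {m n : Type*} (A : Matrix m n F) :
    Matrix m n (FreeAlgebra F (Gen P E)) :=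
  A.map (algebraMap F _)

/-- The matrix `M₁ = M ⊗ 1` on `V_I ⊗ V_J`. -/
def inFst {A : Type*} [Semiring A] {m : Type*} (n : Type*) [DecidableEq n]
    (M : Matrix m m A) : Matrix (m × n) (m × n) A :=
  M ⊗ₖ (1 : Matrix n n A)

/-- The matrix `M₂ = 1 ⊗ M` on `V_I ⊗ V_J`. -/
def inSnd {A : Type*} [Semiring A] (m : Type*) {n : Type*} [DecidableEq m]
    (M : Matrix n n A) : Matrix (m × n) (m × n) A :=
  (1 : Matrix m m A) ⊗ₖ M

/-- The defining relations of the lattice algebra, in matrix form. -/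
inductive MatrixRel (Γ : CiliatedRibbonGraph V E) (R : (K ⊗[F] K)ˣ) (g : K)
    (P : Set (MatRep F K)) :
    ∀ {m n : Type}, Matrix m n (FreeAlgebra F (Gen P E)) → Matrix m n (FreeAlgebra F (Gen P E)) →
      Prop
  /-- Naturality: `M_I[x] T = T M_J[x]` for all intertwiners `T : V_J → V_I`. -/
  | natural (I J : P) (x : E × Bool) (T : Matrix (Fin I.1.dim) (Fin J.1.dim) F)
      (hT : ∀ k, I.1.rep k * T = T * J.1.rep k) :
      MatrixRel Γ R g P (genMat I x * sc P E T) (sc P E T * genMat J x)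
  /-- The holonomy in the trivial representation is `1`. -/
  | trivial (I : P) (x : E × Bool)
      (hI : ∀ k, I.1.rep k = Coalgebra.counit (R := F) k • (1 : Matrix _ _ F)) :
      MatrixRel Γ R g P (genMat I x) 1
  /-- Edge reversal: `M_I[x⁻¹] = I(g) M_{I*}[x]ᵀ`, where `I*` is the dual representation. -/
  | reversal (I I' : P) (x : E × Bool) (σ : Fin I.1.dim ≃ Fin I'.1.dim)
      (hI : ∀ k a b, I'.1.rep k (σ a) (σ b) = I.1.rep (HopfAlgebra.antipode F k) b a) :
      MatrixRel Γ R g P (genMat I (x.1, !x.2))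
        (sc P E (I.1.rep g) * (Matrix.submatrix (genMat I' x) σ σ).transpose)
  /-- Functoriality: `M_J[x]₂ 𝓡(t(x), s(x)) M_I[x]₁ = R_{IJ} ∑ₖ Cₖ M_{Nₖ}[x] Dₖ` for every
  decomposition of the identity of `V_I ⊗ V_J` by intertwiners
  `Dₖ : V_I ⊗ V_J → V_{Nₖ}` and `Cₖ : V_{Nₖ} → V_I ⊗ V_J`. -/
  | functorial (I J : P) (x : E × Bool) (hx : Γ.Admissible x) (r : ℕ) (N : Fin r → P)
      (C : ∀ k, Matrix (Fin I.1.dim × Fin J.1.dim) (Fin (N k).1.dim) F)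
      (D : ∀ k, Matrix (Fin (N k).1.dim) (Fin I.1.dim × Fin J.1.dim) F)
      (hC : ∀ k h, I.1.kron J.1 (Coalgebra.comul h) * C k = C k * (N k).1.rep h)
      (hD : ∀ k h, D k * I.1.kron J.1 (Coalgebra.comul h) = (N k).1.rep h * D k)
      (hCD : ∑ k, C k * D k = 1) :
      MatrixRel Γ R g P
        (inSnd _ (genMat J x)
          * sc P E (I.1.kron J.1 (Γ.braid R (tEnd x) (sEnd x) : (K ⊗[F] K)ˣ))
          * inFst _ (genMat I x))
        (sc P E (I.1.kron J.1 (R : K ⊗[F] K))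
          * ∑ k, sc P E (C k) * genMat (N k) x * sc P E (D k))
  /-- Exchange relation of one edge:
  `M_J[x]₂ 𝓡(t(x), s(x)) M_I[x]₁ = R_{IJ} M_I[x]₁ 𝓡(s(x), t(x))⁻¹ M_J[x]₂ R_{JI}⁻¹`. -/
  | exchange_same (I J : P) (x : E × Bool) (hx : Γ.Admissible x) :
      MatrixRel Γ R g P
        (inSnd _ (genMat J x)
          * sc P E (I.1.kron J.1 (Γ.braid R (tEnd x) (sEnd x) : (K ⊗[F] K)ˣ))
          * inFst _ (genMat I x))
        (sc P E (I.1.kron J.1 (R : K ⊗[F] K))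
          * inFst _ (genMat I x)
          * sc P E (I.1.kron J.1 ((Γ.braid R (sEnd x) (tEnd x))⁻¹ : (K ⊗[F] K)ˣ))
          * inSnd _ (genMat J x)
          * sc P E (I.1.kron J.1 ((flipUnit R)⁻¹ : (K ⊗[F] K)ˣ)))
  /-- Exchange relation of two different edges:
  `𝓡(t(x), t(y))⁻¹ M_J[y]₂ 𝓡(t(x), s(y)) M_I[x]₁
    = M_I[x]₁ 𝓡(s(x), t(y))⁻¹ M_J[y]₂ 𝓡(s(x), s(y))`. -/
  | exchange (I J : P) (x y : E × Bool) (hx : Γ.Admissible x) (hy : Γ.Admissible y)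
      (hxy : x.1 ≠ y.1) :
      MatrixRel Γ R g P
        (sc P E (I.1.kron J.1 ((Γ.braid R (tEnd x) (tEnd y))⁻¹ : (K ⊗[F] K)ˣ))
          * inSnd _ (genMat J y)
          * sc P E (I.1.kron J.1 (Γ.braid R (tEnd x) (sEnd y) : (K ⊗[F] K)ˣ))
          * inFst _ (genMat I x))
        (inFst _ (genMat I x)
          * sc P E (I.1.kron J.1 ((Γ.braid R (sEnd x) (tEnd y))⁻¹ : (K ⊗[F] K)ˣ))
          * inSnd _ (genMat J y)
          * sc P E (I.1.kron J.1 (Γ.braid R (sEnd x) (sEnd y) : (K ⊗[F] K)ˣ)))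

/-- The entries of the defining relations. -/
inductive LatticeRel (Γ : CiliatedRibbonGraph V E) (R : (K ⊗[F] K)ˣ) (g : K)
    (P : Set (MatRep F K)) : FreeAlgebra F (Gen P E) → FreeAlgebra F (Gen P E) → Prop
  | entry {m n : Type} (A B : Matrix m n (FreeAlgebra F (Gen P E)))
      (h : MatrixRel Γ R g P A B) (i : m) (j : n) : LatticeRel Γ R g P (A i j) (B i j)

/-- The lattice algebra of combinatorial quantisation for a class `P` of representations. -/
abbrev LatticeAlgebra (Γ : CiliatedRibbonGraph V E) (R : (K ⊗[F] K)ˣ) (g : K)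
    (P : Set (MatRep F K)) : Type _ := RingQuot (LatticeRel Γ R g P)

/-- The element `M_I[x]_{ab}` of the lattice algebra. -/
def holonomy (Γ : CiliatedRibbonGraph V E) (R : (K ⊗[F] K)ˣ) (g : K) {P : Set (MatRep F K)}
    (I : P) (x : E × Bool) (a b : Fin I.1.dim) : LatticeAlgebra Γ R g P :=
  RingQuot.mkAlgHom F (LatticeRel Γ R g P) (genMat I x a b)

/-- `act` is the right `K^{⊗ V}`-module algebra structure of the lattice algebra, for which gauge
transformations act on holonomies by `M_I[x] ↦ I(w₁) M_I[x] I(S(w₂))`, with `w` the element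
`gaugeTensor`; `act h x` is `x ◁ h`. -/
structure IsLatticeAction [Fintype V] [FiniteDimensional F K]
    (Γ : CiliatedRibbonGraph V E) (R : (K ⊗[F] K)ˣ) (g : K) (P : Set (MatRep F K))
    (act : GaugeAlg F K V →ₗ[F] LatticeAlgebra Γ R g P →ₗ[F] LatticeAlgebra Γ R g P) : Prop where
  one_act : ∀ x, act 1 x = x
  mul_act : ∀ h h' x, act (h * h') x = act h' (act h x)
  act_one : ∀ h, act h 1 = algebraMap F _ (counitPi h)
  act_mul : ∀ h x y, act h (x * y)
    = LinearMap.mul' F _ (TensorProduct.map (act.flip x) (act.flip y) (comulPi h))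
  act_holonomy : ∀ (v : V) (h : K) (I : P) (x : E × Bool) (a b : Fin I.1.dim),
    act (PiTensorProduct.singleAlgHom v h) (holonomy Γ R g I x a b)
      = ∑ c, ∑ d, TensorProduct.dualDistrib F K K
          (I.1.coef a c ⊗ₜ[F] (I.1.coef d b ∘ₗ HopfAlgebra.antipode F)) (Γ.gaugeTensor v x h)
            • holonomy Γ R g I x c d

/-- The module algebra structure `(m, a)` on `(K*)^{⊗ E}` coincides with the lattice algebra for the
class `P` of representations: the assignment `M_I[e]_{ab} ↦ (M_I_{ab})ₑ`,
`M_I[e⁻¹]_{ab} ↦ (T* M_I_{ab})ₑ` of matrix elements defines an isomorphism of unital algebras,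
the gauge transformations of holonomies define a unique right module algebra structure on the
lattice algebra, and the isomorphism is equivariant. -/
def Coincides [Fintype V] [DecidableEq E] [FiniteDimensional F K]
    (Γ : CiliatedRibbonGraph V E) (R : (K ⊗[F] K)ˣ) (g : K) (P : Set (MatRep F K))
    (m : EdgeFun F K E →ₗ[F] EdgeFun F K E →ₗ[F] EdgeFun F K E)
    (a : GaugeAlg F K V →ₗ[F] EdgeFun F K E →ₗ[F] EdgeFun F K E) : Prop :=
  ∃ Φ : LatticeAlgebra Γ R g P ≃ₗ[F] EdgeFun F K E,
    Φ 1 = PiTensorProduct.tprod F (fun _ => (Coalgebra.counit : K →ₗ[F] F)) ∧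
    (∀ x y, Φ (x * y) = m (Φ x) (Φ y)) ∧
    (∀ (I : P) (e : E) (i j : Fin I.1.dim),
      Φ (holonomy Γ R g I (e, true) i j) = single e (I.1.coef i j) ∧
      Φ (holonomy Γ R g I (e, false) i j) = single e (revDual g (I.1.coef i j))) ∧
    (∃! act, IsLatticeAction Γ R g P act) ∧
    ∀ act, IsLatticeAction Γ R g P act → ∀ h x, Φ (act h x) = a h (Φ x)

end Lattice

end HopfGauge

end

open HopfGauge

noncomputable section

namespace HopfGauge

open Coalgebra HopfAlgebra

/-! ### The antipode and `R`-matrices -/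

section HopfFacts

variable {F K : Type*} [Field F] [Ring K] [HopfAlgebra F K]

/-! The relations are first freed from representations. A linear map f : K* → B is the same thing as
an element `univ f` of K ⊗ B, and a matrix of holonomies is the image of that element in a
representation. In K ⊗ K ⊗ B each relation of the lattice algebra becomes a single identity; the
list of these identities is `IsHolonomy`. A family satisfying them defines a homomorphism out of L_P
(`map_matrixRel`, `latticeLift`). Conversely, if every representation splits into retracts from P,
and P has the trivial representation and duals, then naturality makes the holonomies of L_P into
such a family (`exists_latticeHol`, `isHolonomy_latticeHol`).

On the gauge theory side the algebra ⨂ᵥ A*ᵥ acts on itself by left multiplication. Composing the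
functions of an outgoing end with T* makes every end transform like an incoming one. Two ends at a
vertex then satisfy N₂ M₁ = R M₁ N₂ (`leftMat_exchange`), by the Yang–Baxter equation and the
hexagon identities, and the functions of one end multiply through Δᵒᵖ, with a factor R exactly if
the end is selected (`leftMat_same`). The holonomy of an admissible edge is the matrix of its target
end times the reversed matrix of its starting end (`univ_holMap`), so the lattice relations follow
by multiplying relations of ends (`isHolonomy_holMap`). One end of each edge is selected, so exactly
one R appears and the choice drops out. Applying the resulting operators to the unit gives `orbit` :
L_P → ⨂ᵥ A*ᵥ.

The isomorphism comes from a dimension count. The braiding at a vertex can be undone with R⁻¹, so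
the image of `orbit` contains the image of G* (`range_Gstar_le`); and L_P is spanned by products
with one holonomy per edge in a fixed order, so it is a quotient of (K*)^{⊗E}
(`exists_surjective_of_isHolonomy`). As G* is injective, `orbit` is injective with the same image as
G* (`exists_latticeEquiv`). In particular that image is closed under multiplication, which is how
the product of A*_Γ is obtained. Gauge transformations are treated at one vertex at a time: left
multiplication by functions of an end is covariant, covariance passes to products
(`covariant_orbit`), and the module algebra axioms are pulled back along `orbit`.

Of the ribbon structure only `IsPivotal` is used: g is grouplike with inverse S(g), and g S²(h) = h
g. This is why R may differ from the R-matrix that defines g. -/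

theorem comul_antipode (h : K) :
    comul (R := F) (antipode F h)
      = TensorProduct.map (antipode F) (antipode F) (flip (comul (R := F) h)) := by
  -- In the convolution algebra of maps K → K ⊗ K, Δ is the product of the two embeddings, each of
  -- which is inverted by composing it with S. Hence (S ⊗ S)Δᵒᵖ is a left inverse of Δ, while Δ ∘ S
  -- is a right inverse.
  let i₁ : K →ₐ[F] K ⊗[F] K := Algebra.TensorProduct.includeLeft
  let i₂ : K →ₐ[F] K ⊗[F] K := Algebra.TensorProduct.includeRight
  have h1 : WithConv.toConv i₁.toLinearMap * WithConv.toConv i₂.toLinearMap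
      = WithConv.toConv (comul : K →ₗ[F] K ⊗[F] K) := by
    ext k
    rw [(ℛ F k).convMul_apply]
    change _ = comul k
    rw [← (ℛ F k).eq]
    simp [i₁, i₂]
  have h2 : WithConv.toConv (i₂.toLinearMap ∘ₗ antipode F) *
        WithConv.toConv (i₁.toLinearMap ∘ₗ antipode F)
      = WithConv.toConv (TensorProduct.map (antipode F) (antipode F) ∘ₗ
          (flip : K ⊗[F] K ≃ₐ[F] K ⊗[F] K).toLinearMap ∘ₗ comul) := by
    ext k
    rw [(ℛ F k).convMul_apply]
    change _ = TensorProduct.map (antipode F) (antipode F) (flip (comul k))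
    conv_rhs => rw [← (ℛ F k).eq]
    simp [i₁, i₂]
  have inv : ∀ i : K →ₐ[F] K ⊗[F] K, WithConv.toConv (i.toLinearMap ∘ₗ antipode F) *
      WithConv.toConv i.toLinearMap = 1 := by
    intro i
    have := LinearMap.algHom_comp_convMul_distrib (R := F) i
      (WithConv.toConv (antipode F)) (WithConv.toConv (LinearMap.id : K →ₗ[F] K))
    rw [LinearMap.antipode_mul_id] at this
    ext k
    have := LinearMap.congr_fun this k
    simpa using this.symm
  have h3 : WithConv.toConv (TensorProduct.map (antipode F) (antipode F) ∘ₗ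
          (flip : K ⊗[F] K ≃ₐ[F] K ⊗[F] K).toLinearMap ∘ₗ comul) *
      WithConv.toConv (comul : K →ₗ[F] K ⊗[F] K) = 1 := by
    rw [← h1, ← h2, mul_assoc, ← mul_assoc _ _ (WithConv.toConv i₂.toLinearMap), inv, one_mul, inv]
  have := left_inv_eq_right_inv h3 LinearMap.comul_right_inv
  exact (LinearMap.congr_fun (congrArg WithConv.ofConv this) h).symm

theorem exists_sum_tmul (W : K ⊗[F] K) :
    ∃ (n : ℕ) (x y : Fin n → K), W = ∑ i, x i ⊗ₜ[F] y i := by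
  obtain ⟨s, hs⟩ := TensorProduct.exists_finset W
  refine ⟨s.card, fun i => (s.equivFin.symm i).1.1, fun i => (s.equivFin.symm i).1.2, ?_⟩
  rw [hs, ← Finset.sum_coe_sort, ← s.equivFin.symm.sum_comp]

/-! ### Consequences of the R-matrix axioms. -/

namespace IsRMatrix

variable {R : (K ⊗[F] K)ˣ} (hR : IsRMatrix R)
include hR

/-- The hexagon identity in Sweedler form, tested on an arbitrary linear map. The identities for the
antipode and the braiding relations below are instances with a suitable `f`. -/
theorem sum_left {n : ℕ} {x y : Fin n → K} (hxy : (R : K ⊗[F] K) = ∑ i, x i ⊗ₜ[F] y i)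
    {M : Type*} [AddCommGroup M] [Module F M] (f : K ⊗[F] K →ₗ[F] K →ₗ[F] M) :
    ∑ i, f (comul (x i)) (y i) = ∑ p, ∑ q, f (x p ⊗ₜ x q) (y p * y q) := by
  have := congrArg (TensorProduct.lift f) hR.comul_left
  rw [hxy] at this
  simpa [Finset.sum_mul_sum] using this

theorem sum_right {n : ℕ} {x y : Fin n → K} (hxy : (R : K ⊗[F] K) = ∑ i, x i ⊗ₜ[F] y i)
    {M : Type*} [AddCommGroup M] [Module F M] (f : K →ₗ[F] K ⊗[F] K →ₗ[F] M) :
    ∑ i, f (x i) (comul (y i)) = ∑ p, ∑ q, f (x p * x q) (y q ⊗ₜ y p) := by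
  have := congrArg (TensorProduct.lift f ∘ TensorProduct.assoc F K K K) hR.comul_right
  rw [hxy] at this
  simpa [Finset.sum_mul_sum, TensorProduct.sum_tmul] using this

/-- Applying ε to the first leg of (Δ ⊗ id)(R) = R₁₃R₂₃ gives R = (1 ⊗ (ε ⊗ id)(R)) R, and R can be
cancelled. -/
theorem counit_left :
    TensorProduct.lid F K (TensorProduct.map (counit (R := F)) LinearMap.id (R : K ⊗[F] K))
      = 1 := by
  obtain ⟨n, x, y, hxy⟩ := exists_sum_tmul (R : K ⊗[F] K)
  let f : K ⊗[F] K →ₗ[F] K →ₗ[F] K ⊗[F] K :=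
    TensorProduct.mk F K K ∘ₗ (TensorProduct.lid F K).toLinearMap ∘ₗ
      TensorProduct.map (counit (R := F)) LinearMap.id
  have h := hR.sum_left hxy f
  have h1 : ∀ k : K, TensorProduct.lid F K (TensorProduct.map (counit (R := F)) LinearMap.id
      (comul (R := F) k)) = k := by
    intro k
    have := Coalgebra.rTensor_counit_comul (R := F) k
    rw [LinearMap.rTensor] at this
    rw [this]; simp
  have h2 : (R : K ⊗[F] K) = (1 ⊗ₜ TensorProduct.lid F K (TensorProduct.map (counit (R := F))
      LinearMap.id (R : K ⊗[F] K))) * (R : K ⊗[F] K) := by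
    rw [hxy]
    simp only [f, LinearMap.comp_apply, LinearEquiv.coe_coe, h1, TensorProduct.mk_apply] at h
    refine h.trans ?_
    simp [TensorProduct.tmul_sum, Finset.sum_mul_sum, TensorProduct.smul_tmul']
  have h3 := congrArg (fun z => z * ((R⁻¹ : (K ⊗[F] K)ˣ) : K ⊗[F] K)) h2
  simp only [Units.mul_inv, mul_assoc, mul_one] at h3
  have h4 := congrArg (fun z => TensorProduct.lid F K
    (TensorProduct.map (counit (R := F)) LinearMap.id z)) h3
  simpa [Algebra.TensorProduct.one_def] using h4.symm

theorem counit_right :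
    TensorProduct.rid F K (TensorProduct.map LinearMap.id (counit (R := F)) (R : K ⊗[F] K))
      = 1 := by
  obtain ⟨n, x, y, hxy⟩ := exists_sum_tmul (R : K ⊗[F] K)
  let f : K →ₗ[F] K ⊗[F] K →ₗ[F] K ⊗[F] K :=
    (TensorProduct.mk F K K).compl₂ ((TensorProduct.rid F K).toLinearMap ∘ₗ
      TensorProduct.map LinearMap.id (counit (R := F)))
  have h := hR.sum_right hxy f
  have h1 : ∀ k : K, TensorProduct.rid F K (TensorProduct.map LinearMap.id (counit (R := F))
      (comul (R := F) k)) = k := by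
    intro k
    have := Coalgebra.lTensor_counit_comul (R := F) k
    rw [LinearMap.lTensor] at this
    rw [this]; simp
  have h2 : (R : K ⊗[F] K) = (TensorProduct.rid F K (TensorProduct.map LinearMap.id
      (counit (R := F)) (R : K ⊗[F] K)) ⊗ₜ 1) * (R : K ⊗[F] K) := by
    rw [hxy]
    simp only [f, LinearMap.compl₂_apply, LinearMap.comp_apply, LinearEquiv.coe_coe, h1,
      TensorProduct.mk_apply] at h
    refine h.trans ?_
    simp [TensorProduct.sum_tmul, Finset.sum_mul_sum,
      TensorProduct.smul_tmul', TensorProduct.tmul_smul]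
  have h3 := congrArg (fun z => z * ((R⁻¹ : (K ⊗[F] K)ˣ) : K ⊗[F] K)) h2
  simp only [Units.mul_inv, mul_assoc, mul_one] at h3
  have h4 := congrArg (fun z => TensorProduct.rid F K
    (TensorProduct.map LinearMap.id (counit (R := F)) z)) h3
  simpa [Algebra.TensorProduct.one_def] using h4.symm

theorem sum_counit_left {n : ℕ} {x y : Fin n → K}
    (hxy : (R : K ⊗[F] K) = ∑ i, x i ⊗ₜ[F] y i) : ∑ i, counit (R := F) (x i) • y i = 1 := by
  have := hR.counit_left
  rw [hxy] at this
  simpa using this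

theorem sum_counit_right {n : ℕ} {x y : Fin n → K}
    (hxy : (R : K ⊗[F] K) = ∑ i, x i ⊗ₜ[F] y i) : ∑ i, counit (R := F) (y i) • x i = 1 := by
  have := hR.counit_right
  rw [hxy] at this
  simpa using this

/-- `(S ⊗ id)(R) = R⁻¹`. -/
theorem map_antipode_left :
    TensorProduct.map (antipode F) LinearMap.id (R : K ⊗[F] K)
      = ((R⁻¹ : (K ⊗[F] K)ˣ) : K ⊗[F] K) := by
  obtain ⟨n, x, y, hxy⟩ := exists_sum_tmul (R : K ⊗[F] K)
  -- With S(x₍₁₎)x₍₂₎ formed in the first leg, the hexagon reads (S ⊗ id)(R) R = 1 ⊗ (ε ⊗ id)(R).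
  let f : K ⊗[F] K →ₗ[F] K →ₗ[F] K ⊗[F] K :=
    TensorProduct.mk F K K ∘ₗ LinearMap.mul' F K ∘ₗ (antipode F).rTensor K
  have h := hR.sum_left hxy f
  rw [← mul_one (TensorProduct.map _ _ _), ← Units.mul_inv R, ← mul_assoc]
  suffices TensorProduct.map (antipode F) LinearMap.id (R : K ⊗[F] K) * R = 1 by
    rw [this, one_mul]
  calc TensorProduct.map (antipode F) LinearMap.id (R : K ⊗[F] K) * R
      = ∑ p, ∑ q, f (x p ⊗ₜ x q) (y p * y q) := by
        rw [hxy]; simp [f, Finset.sum_mul_sum]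
    _ = (1 : K) ⊗ₜ[F] ∑ i, counit (R := F) (x i) • y i := by
        rw [← h]
        simp [f, Algebra.algebraMap_eq_smul_one, TensorProduct.tmul_sum]
    _ = 1 := by rw [hR.sum_counit_left hxy, Algebra.TensorProduct.one_def]

/-- Together with `sum_mul_mul_antipode` this says that (id ⊗ S)(R) is the two-sided inverse of R in
K ⊗ Kᵒᵖ. In this form no inverse of the antipode is needed. -/
theorem sum_mul_antipode_mul {n : ℕ} {x y : Fin n → K}
    (hxy : (R : K ⊗[F] K) = ∑ i, x i ⊗ₜ[F] y i) :
    ∑ i, ∑ j, (x i * x j) ⊗ₜ[F] (antipode F (y j) * y i) = 1 := by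
  let f : K →ₗ[F] K ⊗[F] K →ₗ[F] K ⊗[F] K :=
    (TensorProduct.mk F K K).compl₂ (LinearMap.mul' F K ∘ₗ (antipode F).rTensor K)
  have h := hR.sum_right hxy f
  calc _ = ∑ p, ∑ q, f (x p * x q) (y q ⊗ₜ y p) := by simp [f]
    _ = (∑ i, counit (R := F) (y i) • x i) ⊗ₜ[F] (1 : K) := by
        rw [← h]
        simp [f, Algebra.algebraMap_eq_smul_one, TensorProduct.sum_tmul, TensorProduct.smul_tmul]
    _ = 1 := by rw [hR.sum_counit_right hxy, Algebra.TensorProduct.one_def]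

theorem sum_mul_mul_antipode {n : ℕ} {x y : Fin n → K}
    (hxy : (R : K ⊗[F] K) = ∑ i, x i ⊗ₜ[F] y i) :
    ∑ i, ∑ j, (x i * x j) ⊗ₜ[F] (y j * antipode F (y i)) = 1 := by
  let f : K →ₗ[F] K ⊗[F] K →ₗ[F] K ⊗[F] K :=
    (TensorProduct.mk F K K).compl₂ (LinearMap.mul' F K ∘ₗ (antipode F).lTensor K)
  have h := hR.sum_right hxy f
  calc _ = ∑ p, ∑ q, f (x p * x q) (y q ⊗ₜ y p) := by simp [f]
    _ = (∑ i, counit (R := F) (y i) • x i) ⊗ₜ[F] (1 : K) := by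
        rw [← h]
        simp [f, Algebra.algebraMap_eq_smul_one, TensorProduct.sum_tmul, TensorProduct.smul_tmul]
    _ = 1 := by rw [hR.sum_counit_right hxy, Algebra.TensorProduct.one_def]

/-- `(S ⊗ S)(R) = R`. -/
theorem map_antipode_antipode :
    TensorProduct.map (antipode F) (antipode F) (R : K ⊗[F] K) = R := by
  obtain ⟨n, x, y, hxy⟩ := exists_sum_tmul (R : K ⊗[F] K)
  -- Applying S ⊗ id to the inverse identity in K ⊗ Kᵒᵖ turns it into (S ⊗ S)(R) · (S ⊗ id)(R) = 1,
  -- and the second factor is R⁻¹.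
  have h1 := congrArg (TensorProduct.map (antipode F) LinearMap.id)
    (hR.sum_mul_antipode_mul hxy)
  have h2 : TensorProduct.map (antipode F) (antipode F) (R : K ⊗[F] K) *
      TensorProduct.map (antipode F) LinearMap.id (R : K ⊗[F] K) = 1 := by
    rw [hxy]
    simp only [map_sum, TensorProduct.map_tmul, LinearMap.id_apply, antipode_mul_antidistrib,
      Algebra.TensorProduct.one_def, antipode_one] at h1
    simp only [map_sum, TensorProduct.map_tmul, LinearMap.id_apply, Finset.sum_mul_sum,
      Algebra.TensorProduct.tmul_mul_tmul, Algebra.TensorProduct.one_def]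
    rw [Finset.sum_comm, h1]
  rw [hR.map_antipode_left] at h2
  exact (Units.eq_mul_inv_iff_mul_eq R⁻¹).2 h2 |>.trans (by simp)

omit hR in
theorem flip_flip (z : K ⊗[F] K) : flip (flip z) = z := by
  induction z using TensorProduct.induction_on with
  | zero => simp
  | tmul a b => simp
  | add a b ha hb => simp only [map_add, ha, hb]

/-- The Yang–Baxter equation `R₁₂ R₁₃ R₂₃ = R₂₃ R₁₃ R₁₂`. -/
theorem yangBaxter :
    ((R : K ⊗[F] K) ⊗ₜ[F] (1 : K)) *
      (Algebra.TensorProduct.map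
          (Algebra.TensorProduct.includeLeft : K →ₐ[F] K ⊗[F] K) (AlgHom.id F K) R
        * Algebra.TensorProduct.map
          (Algebra.TensorProduct.includeRight : K →ₐ[F] K ⊗[F] K) (AlgHom.id F K) R)
    = (Algebra.TensorProduct.map
          (Algebra.TensorProduct.includeRight : K →ₐ[F] K ⊗[F] K) (AlgHom.id F K) R
        * Algebra.TensorProduct.map
          (Algebra.TensorProduct.includeLeft : K →ₐ[F] K ⊗[F] K) (AlgHom.id F K) R)
      * ((R : K ⊗[F] K) ⊗ₜ[F] (1 : K)) := by
  -- R intertwines Δ and Δᵒᵖ in the first two legs. For z = R both sides expand by the hexagon.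
  have h1 : ∀ z : K ⊗[F] K, ((R : K ⊗[F] K) ⊗ₜ[F] (1 : K)) *
      TensorProduct.map (comul : K →ₗ[F] K ⊗[F] K) (LinearMap.id : K →ₗ[F] K) z
      = Algebra.TensorProduct.map (flip : K ⊗[F] K ≃ₐ[F] K ⊗[F] K).toAlgHom (AlgHom.id F K)
          (TensorProduct.map (comul : K →ₗ[F] K ⊗[F] K) (LinearMap.id : K →ₗ[F] K) z) *
        ((R : K ⊗[F] K) ⊗ₜ[F] (1 : K)) := by
    intro z
    induction z using TensorProduct.induction_on with
    | zero => simp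
    | tmul a b => simp [hR.mul_comul]
    | add a b ha hb => simp only [map_add, mul_add, add_mul, ha, hb]
  have h2 : ∀ z : K ⊗[F] K, Algebra.TensorProduct.map
      (flip : K ⊗[F] K ≃ₐ[F] K ⊗[F] K).toAlgHom (AlgHom.id F K)
      (Algebra.TensorProduct.map
          (Algebra.TensorProduct.includeLeft : K →ₐ[F] K ⊗[F] K) (AlgHom.id F K) z)
      = Algebra.TensorProduct.map
          (Algebra.TensorProduct.includeRight : K →ₐ[F] K ⊗[F] K) (AlgHom.id F K) z := by
    intro z
    induction z using TensorProduct.induction_on with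
    | zero => simp
    | tmul a b => simp
    | add a b ha hb => simp only [map_add, ha, hb]
  have h3 : ∀ z : K ⊗[F] K, Algebra.TensorProduct.map
      (flip : K ⊗[F] K ≃ₐ[F] K ⊗[F] K).toAlgHom (AlgHom.id F K)
      (Algebra.TensorProduct.map
          (Algebra.TensorProduct.includeRight : K →ₐ[F] K ⊗[F] K) (AlgHom.id F K) z)
      = Algebra.TensorProduct.map
          (Algebra.TensorProduct.includeLeft : K →ₐ[F] K ⊗[F] K) (AlgHom.id F K) z := by
    intro z
    induction z using TensorProduct.induction_on with
    | zero => simp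
    | tmul a b => simp
    | add a b ha hb => simp only [map_add, ha, hb]
  have := h1 R
  rw [hR.comul_left, map_mul, h2, h3] at this
  exact this

/-- `R₂₁⁻¹` is an `R`-matrix. -/
theorem flipUnit_inv : IsRMatrix (flipUnit R)⁻¹ where
  mul_comul h := by
    have h1 : ((flipUnit R : (K ⊗[F] K)ˣ) : K ⊗[F] K) * flip (comul (R := F) h)
        = comul (R := F) h * (flipUnit R : (K ⊗[F] K)ˣ) := by
      have := congrArg flip (hR.mul_comul h)
      simpa [map_mul, flip_flip, flipUnit] using this
    rw [Units.inv_mul_eq_iff_eq_mul, ← mul_assoc, h1, mul_assoc, Units.mul_inv, mul_one]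
  comul_left := by
    let Δ₁ : K ⊗[F] K →ₐ[F] (K ⊗[F] K) ⊗[F] K :=
      Algebra.TensorProduct.map (Bialgebra.comulAlgHom F K) (AlgHom.id F K)
    let j₁ : K ⊗[F] K →ₐ[F] (K ⊗[F] K) ⊗[F] K := Algebra.TensorProduct.map
          (Algebra.TensorProduct.includeLeft : K →ₐ[F] K ⊗[F] K) (AlgHom.id F K)
    let j₂ : K ⊗[F] K →ₐ[F] (K ⊗[F] K) ⊗[F] K := Algebra.TensorProduct.map
          (Algebra.TensorProduct.includeRight : K →ₐ[F] K ⊗[F] K) (AlgHom.id F K)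
    -- The hexagon for R₂₁ is the other hexagon of R with legs permuted. It is stated in the group
    -- of units because inversion then puts the factors into the required order.
    have key : Units.map Δ₁.toMonoidHom (flipUnit R)
        = Units.map j₂.toMonoidHom (flipUnit R) * Units.map j₁.toMonoidHom (flipUnit R) := by
      apply Units.ext
      obtain ⟨n, x, y, hxy⟩ := exists_sum_tmul (R : K ⊗[F] K)
      have := hR.sum_right hxy (TensorProduct.mk F (K ⊗[F] K) K).flip
      simp only [flipUnit, Units.coe_map, Units.val_mul, hxy]
      simp [Δ₁, j₁, j₂, Finset.sum_mul_sum] at this ⊢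
      exact this
    have key' := congrArg (fun z => ((z⁻¹ : ((K ⊗[F] K) ⊗[F] K)ˣ) : (K ⊗[F] K) ⊗[F] K)) key
    simp only [mul_inv_rev, ← map_inv, Units.val_mul] at key'
    exact key'
  comul_right := by
    let Δ₂ : K ⊗[F] K →ₐ[F] (K ⊗[F] K) ⊗[F] K :=
      (Algebra.TensorProduct.assoc F F F K K K).symm.toAlgHom.comp
      (Algebra.TensorProduct.map (AlgHom.id F K) (Bialgebra.comulAlgHom F K))
    let j₁ : K ⊗[F] K →ₐ[F] (K ⊗[F] K) ⊗[F] K := Algebra.TensorProduct.map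
          (Algebra.TensorProduct.includeLeft : K →ₐ[F] K ⊗[F] K) (AlgHom.id F K)
    let j₃ : K ⊗[F] K →ₐ[F] (K ⊗[F] K) ⊗[F] K := Algebra.TensorProduct.includeLeft
    have key : Units.map Δ₂.toMonoidHom (flipUnit R)
        = Units.map j₃.toMonoidHom (flipUnit R) * Units.map j₁.toMonoidHom (flipUnit R) := by
      apply Units.ext
      obtain ⟨n, x, y, hxy⟩ := exists_sum_tmul (R : K ⊗[F] K)
      have := hR.sum_left hxy ((TensorProduct.mk F K (K ⊗[F] K)).flip.compr₂
        (TensorProduct.assoc F K K K).symm.toLinearMap)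
      simp only [flipUnit, Units.coe_map, Units.val_mul, hxy]
      simp [Δ₂, j₁, j₃, Finset.sum_mul_sum] at this ⊢
      exact this
    have key' := congrArg (fun z => ((z⁻¹ : ((K ⊗[F] K) ⊗[F] K)ˣ) : (K ⊗[F] K) ⊗[F] K)) key
    simp only [mul_inv_rev, ← map_inv, Units.val_mul] at key'
    exact key'

end IsRMatrix

/-! ### Drinfeld and ribbon elements -/

theorem drinfeldElement_eq {R : (K ⊗[F] K)ˣ} {n : ℕ} {x y : Fin n → K}
    (hxy : (R : K ⊗[F] K) = ∑ i, x i ⊗ₜ[F] y i) :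
    drinfeldElement R = ∑ i, antipode F (y i) * x i := by
  simp [drinfeldElement, hxy]

theorem sum_comul_comul {ι : Type*} {h : K} (r : Coalgebra.Repr F h ι)
    {M : Type*} [AddCommGroup M] [Module F M] (f : K →ₗ[F] K →ₗ[F] K →ₗ[F] M) :
    ∑ i ∈ r.index, TensorProduct.lift f (comul (r.left i)) (r.right i)
      = ∑ i ∈ r.index, TensorProduct.lift (f (r.left i)) (comul (r.right i)) := by
  have h1 := congrArg (TensorProduct.lift (TensorProduct.lift f)) (coassoc_symm_apply (R := F) h)
  rw [← r.eq] at h1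
  have h2 : ∀ (a : K) (w : K ⊗[F] K), TensorProduct.lift (TensorProduct.lift f)
      ((TensorProduct.assoc F K K K).symm (a ⊗ₜ[F] w)) = TensorProduct.lift (f a) w := by
    intro a w
    induction w using TensorProduct.induction_on with
    | zero => simp
    | tmul a b => simp
    | add a b ha hb => simp only [TensorProduct.tmul_add, map_add, ha, hb]
  simpa [h2] using h1.symm

/-- Apply a ⊗ b ⊗ c ↦ S²(c)S(b)a to (R ⊗ 1)(h₍₁₎ ⊗ h₍₂₎ ⊗ h₍₃₎). Moving Δ through R makes the first
two components of h collapse and leaves S²(h)u; without moving anything the last two collapse and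
leave u h. -/
theorem antipode_antipode_mul_drinfeldElement {R : (K ⊗[F] K)ˣ} (hR : IsRMatrix R) (h : K) :
    antipode F (antipode F h) * drinfeldElement R = drinfeldElement R * h := by
  obtain ⟨n, x, y, hxy⟩ := exists_sum_tmul (R : K ⊗[F] K)
  let G : K ⊗[F] K →ₗ[F] K := LinearMap.mul' F K ∘ₗ (antipode F).rTensor K ∘ₗ
    (flip : K ⊗[F] K ≃ₐ[F] K ⊗[F] K).toLinearMap
  let f₀ : K ⊗[F] K →ₗ[F] K →ₗ[F] K :=
    ((LinearMap.mul F K).flip ∘ₗ G).compl₂ (antipode F ∘ₗ antipode F)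
  have hf₀ : ∀ a b c, f₀ (a ⊗ₜ b) c = antipode F (antipode F c) * (antipode F b * a) := by
    intro a b c; simp [f₀, G]
  have key := sum_comul_comul (ℛ F h) ((TensorProduct.mk F K K).compr₂
    (f₀ ∘ₗ LinearMap.mulLeft F (R : K ⊗[F] K)))
  simp only [TensorProduct.lift_compr₂, TensorProduct.lift_mk, LinearMap.comp_id,
    LinearMap.comp_apply, LinearMap.mulLeft_apply] at key
  have hL : ∀ (l r : K), f₀ ((R : K ⊗[F] K) * comul l) r
      = counit (R := F) l • (antipode F (antipode F r) * drinfeldElement R) := by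
    intro l r
    rw [hR.mul_comul, ← (ℛ F l).eq, hxy, drinfeldElement_eq hxy]
    simp only [map_sum, Algebra.TensorProduct.comm_tmul, Finset.sum_mul_sum,
      Algebra.TensorProduct.tmul_mul_tmul, LinearMap.sum_apply, hf₀, antipode_mul_antidistrib]
    rw [Finset.sum_comm, Finset.mul_sum, Finset.smul_sum]
    refine Finset.sum_congr rfl fun i _ => ?_
    have := sum_antipode_mul_eq_smul (ℛ F l)
    calc _ = antipode F (antipode F r) * (antipode F (y i) *
          ((∑ j ∈ (ℛ F l).index, antipode F ((ℛ F l).left j) * (ℛ F l).right j) * x i)) := by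
          simp only [Finset.mul_sum, Finset.sum_mul, mul_assoc]
      _ = _ := by rw [this]; simp
  have hRt : ∀ (l r : K), TensorProduct.lift (((TensorProduct.mk F K K).compr₂
      (f₀ ∘ₗ LinearMap.mulLeft F (R : K ⊗[F] K))) l) (comul r)
      = counit (R := F) r • (drinfeldElement R * l) := by
    intro l r
    rw [← (ℛ F r).eq, hxy, drinfeldElement_eq hxy]
    simp only [map_sum, TensorProduct.lift.tmul, LinearMap.compr₂_apply, TensorProduct.mk_apply,
      LinearMap.comp_apply, LinearMap.mulLeft_apply, Finset.sum_mul,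
      Algebra.TensorProduct.tmul_mul_tmul, LinearMap.sum_apply, hf₀, antipode_mul_antidistrib]
    rw [Finset.sum_comm, Finset.smul_sum]
    refine Finset.sum_congr rfl fun i _ => ?_
    have := congrArg (antipode F) (sum_mul_antipode_eq_smul (ℛ F r))
    simp only [map_sum, antipode_mul_antidistrib, map_smul, antipode_one] at this
    calc _ = (∑ j ∈ (ℛ F r).index, antipode F (antipode F ((ℛ F r).right j)) *
          antipode F ((ℛ F r).left j)) * (antipode F (y i) * (x i * l)) := by
          simp only [Finset.sum_mul, mul_assoc]
      _ = _ := by rw [this]; simp [mul_assoc]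
  simp only [hL, hRt] at key
  have e1 : ∑ i ∈ (ℛ F h).index, counit (R := F) ((ℛ F h).left i) • (ℛ F h).right i = h :=
    sum_counit_smul (ℛ F h)
  have e2 : ∑ i ∈ (ℛ F h).index, counit (R := F) ((ℛ F h).right i) • (ℛ F h).left i = h := by
    have := congrArg (TensorProduct.rid F K) (sum_tmul_counit_eq (ℛ F h))
    simpa only [map_sum, TensorProduct.rid_tmul, one_smul] using this
  calc _ = antipode F (antipode F (∑ i ∈ (ℛ F h).index,
          counit (R := F) ((ℛ F h).left i) • (ℛ F h).right i)) * drinfeldElement R := by rw [e1]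
    _ = drinfeldElement R * (∑ i ∈ (ℛ F h).index,
          counit (R := F) ((ℛ F h).right i) • (ℛ F h).left i) := by
        simpa [Finset.sum_mul, Finset.mul_sum] using key
    _ = _ := by rw [e2]

/-- Equivalently Δ(u) = (u ⊗ u)(R₂₁R)⁻¹. In Δ(S(y)x) the element R₂₁R commutes with coproducts, and
the hexagon splits S(y) over the two legs. One of the resulting sums contracts to (u ⊗ 1)R
(`inner`), the other to 1 ⊗ u (`outer`, `last`); the final contraction uses S²(h)u = u h. -/
theorem comul_drinfeldElement_mul {R : (K ⊗[F] K)ˣ} (hR : IsRMatrix R) :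
    comul (R := F) (drinfeldElement R) * (flip (R : K ⊗[F] K) * (R : K ⊗[F] K))
      = drinfeldElement R ⊗ₜ[F] drinfeldElement R := by
  obtain ⟨n, x, y, hxy⟩ := exists_sum_tmul (R : K ⊗[F] K)
  set u := drinfeldElement R with hu
  have hu' : u = ∑ i, antipode F (y i) * x i := drinfeldElement_eq hxy
  have hflip : ∀ h : K, flip (R : K ⊗[F] K) * flip (comul (R := F) h)
      = comul (R := F) h * flip (R : K ⊗[F] K) := by
    intro h
    have := congrArg flip (hR.mul_comul h)
    simpa [map_mul, IsRMatrix.flip_flip] using this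
  have hZ : ∀ h : K, (flip (R : K ⊗[F] K) * (R : K ⊗[F] K)) * comul (R := F) h
      = comul (R := F) h * (flip (R : K ⊗[F] K) * (R : K ⊗[F] K)) := by
    intro h
    rw [mul_assoc, hR.mul_comul, ← mul_assoc, hflip, mul_assoc]
  have inner : ∑ p, (antipode F (y p) ⊗ₜ[F] (1 : K)) * (flip (R : K ⊗[F] K) * (R : K ⊗[F] K)) * comul (x p)
      = (u ⊗ₜ[F] (1 : K)) * (R : K ⊗[F] K) := by
    let f : K ⊗[F] K →ₗ[F] K →ₗ[F] K ⊗[F] K :=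
      ((LinearMap.mul F (K ⊗[F] K)).flip ∘ₗ LinearMap.mulRight F (R : K ⊗[F] K) ∘ₗ
        LinearMap.mulLeft F (flip (R : K ⊗[F] K)) ∘ₗ
          (flip : K ⊗[F] K ≃ₐ[F] K ⊗[F] K).toLinearMap).compl₂
        ((Algebra.TensorProduct.includeLeft : K →ₐ[F] K ⊗[F] K).toLinearMap ∘ₗ antipode F)
    have hf : ∀ w b, f w b = (antipode F b ⊗ₜ 1) * (flip (R : K ⊗[F] K) * flip w * (R : K ⊗[F] K)) := by
      intro w b; rfl
    have h1 := hR.sum_left hxy f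
    simp only [hf] at h1
    calc _ = ∑ i, (antipode F (y i) ⊗ₜ[F] (1 : K)) *
          (flip (R : K ⊗[F] K) * flip (comul (x i)) * (R : K ⊗[F] K)) := by
          refine Finset.sum_congr rfl fun i _ => ?_
          simp only [mul_assoc, hR.mul_comul]
      _ = (∑ q, TensorProduct.map (LinearMap.mulRight F (x q) ∘ₗ
            LinearMap.mulLeft F (antipode F (y q))) (LinearMap.id : K →ₗ[F] K)
            (flip (∑ k, ∑ p, (x k * x p) ⊗ₜ[F] (antipode F (y p) * y k)))) * (R : K ⊗[F] K) := by
          rw [h1, Finset.sum_comm, Finset.sum_mul]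
          refine Finset.sum_congr rfl fun q _ => ?_
          simp only [← mul_assoc]
          rw [← Finset.sum_mul]
          congr 1
          conv_lhs => rw [hxy]
          simp only [map_sum, Algebra.TensorProduct.comm_tmul, Finset.sum_mul, Finset.mul_sum,
            Algebra.TensorProduct.tmul_mul_tmul, TensorProduct.map_tmul, LinearMap.comp_apply,
            LinearMap.mulLeft_apply, LinearMap.mulRight_apply, LinearMap.id_apply,
            antipode_mul_antidistrib, one_mul, mul_assoc]
          rw [Finset.sum_comm]
      _ = _ := by
          rw [hR.sum_mul_antipode_mul hxy, hu']
          simp [Algebra.TensorProduct.one_def, TensorProduct.sum_tmul]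
  have outer : ∑ q, ((1 : K) ⊗ₜ[F] antipode F (y q)) * flip (comul (x q))
      = ∑ q, x q ⊗ₜ[F] (antipode F (y q) * u) := by
    let f : K ⊗[F] K →ₗ[F] K →ₗ[F] K ⊗[F] K :=
      ((LinearMap.mul F (K ⊗[F] K)).flip ∘ₗ
          (flip : K ⊗[F] K ≃ₐ[F] K ⊗[F] K).toLinearMap).compl₂
        ((Algebra.TensorProduct.includeRight : K →ₐ[F] K ⊗[F] K).toLinearMap ∘ₗ antipode F)
    have hf : ∀ w b, f w b = (1 ⊗ₜ antipode F b) * flip w := by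
      intro w b; rfl
    have h1 := hR.sum_left hxy f
    simp only [hf] at h1
    rw [h1, Finset.sum_comm]
    refine Finset.sum_congr rfl fun q _ => ?_
    rw [hu', Finset.mul_sum, TensorProduct.tmul_sum]
    refine Finset.sum_congr rfl fun p _ => ?_
    simp [antipode_mul_antidistrib, mul_assoc]
  have last : (∑ q, x q ⊗ₜ[F] (antipode F (y q) * u)) * (R : K ⊗[F] K) = 1 ⊗ₜ u := by
    have h1 := congrArg (fun z => TensorProduct.map LinearMap.id (antipode F) z *
      ((1 : K) ⊗ₜ[F] u)) (hR.sum_mul_antipode_mul hxy)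
    conv_lhs => rw [hxy]
    simp only [map_sum, TensorProduct.map_tmul, LinearMap.id_apply, Finset.sum_mul,
      Algebra.TensorProduct.tmul_mul_tmul, mul_one, antipode_mul_antidistrib,
      Algebra.TensorProduct.one_def, antipode_one, one_mul] at h1
    rw [← h1, Finset.sum_mul]
    refine Finset.sum_congr rfl fun q _ => ?_
    rw [Finset.mul_sum]
    refine Finset.sum_congr rfl fun p _ => ?_
    rw [Algebra.TensorProduct.tmul_mul_tmul, mul_assoc, mul_assoc, hu,
      antipode_antipode_mul_drinfeldElement hR]
  let f : K →ₗ[F] K ⊗[F] K →ₗ[F] K ⊗[F] K :=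
    ((LinearMap.mul F (K ⊗[F] K)).flip ∘ₗ LinearMap.mulLeft F (flip (R : K ⊗[F] K) * (R : K ⊗[F] K)) ∘ₗ
      comul).compl₂ (TensorProduct.map (antipode F) (antipode F) ∘ₗ
        (flip : K ⊗[F] K ≃ₐ[F] K ⊗[F] K).toLinearMap)
  have hf : ∀ a w, f a w = TensorProduct.map (antipode F) (antipode F) (flip w) *
      ((flip (R : K ⊗[F] K) * (R : K ⊗[F] K)) * comul a) := by
    intro w b; rfl
  have h1 := hR.sum_right hxy f
  simp only [hf] at h1
  calc comul (R := F) u * (flip (R : K ⊗[F] K) * (R : K ⊗[F] K))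
      = ∑ i, TensorProduct.map (antipode F) (antipode F) (flip (comul (y i))) *
          ((flip (R : K ⊗[F] K) * (R : K ⊗[F] K)) * comul (x i)) := by
        conv_lhs => rw [hu']
        rw [map_sum, Finset.sum_mul]
        refine Finset.sum_congr rfl fun i _ => ?_
        rw [Bialgebra.comul_mul, comul_antipode, mul_assoc, hZ]
    _ = ∑ q, ((1 : K) ⊗ₜ[F] antipode F (y q)) *
          (∑ p, (antipode F (y p) ⊗ₜ[F] (1 : K)) * (flip (R : K ⊗[F] K) * (R : K ⊗[F] K)) * comul (x p))
            * comul (x q) := by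
        rw [h1, Finset.sum_comm]
        refine Finset.sum_congr rfl fun q _ => ?_
        rw [Finset.mul_sum, Finset.sum_mul]
        refine Finset.sum_congr rfl fun p _ => ?_
        have : TensorProduct.map (antipode F) (antipode F) (flip (y q ⊗ₜ[F] y p))
          = ((1 : K) ⊗ₜ[F] antipode F (y q)) * (antipode F (y p) ⊗ₜ[F] (1 : K)) := by simp
        rw [this, Bialgebra.comul_mul]
        simp only [mul_assoc]
    _ = (u ⊗ₜ[F] (1 : K)) * ((∑ q, ((1 : K) ⊗ₜ[F] antipode F (y q)) * flip (comul (x q))) * (R : K ⊗[F] K)) := by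
        rw [inner, Finset.sum_mul, Finset.mul_sum]
        refine Finset.sum_congr rfl fun q _ => ?_
        rw [mul_assoc, mul_assoc, hR.mul_comul, ← mul_assoc, ← mul_assoc (u ⊗ₜ[F] (1 : K)),
          ← mul_assoc (u ⊗ₜ[F] (1 : K))]
        simp [mul_assoc]
    _ = u ⊗ₜ[F] u := by
        rw [outer, last]; simp

/-- The properties of the grouplike element of a ribbon Hopf algebra that are used for edge
reversal. -/
structure IsPivotal (F : Type*) {K : Type*} [Field F] [Ring K] [HopfAlgebra F K] (g : K) : Prop where
  comul : comul (R := F) g = g ⊗ₜ[F] g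
  counit : counit (R := F) g = 1
  mul_antipode : g * antipode F g = 1
  antipode_mul : antipode F g * g = 1
  mul_antipode_antipode : ∀ h, g * antipode F (antipode F h) = h * g

/-- From u S(u) = ν² the element u has the right inverse S(u)ν⁻², which is two-sided since a
finite-dimensional algebra is Dedekind finite. The factors R₂₁R in Δ(u) and Δ(ν) cancel, so g is
grouplike. S(g)g = 1 follows from u S(u) = ν² and S(ν) = ν, and the conjugation rule from S²(h)u = u
h with ν central. -/
theorem isPivotal_grouplike [FiniteDimensional F K] {R : (K ⊗[F] K)ˣ} (hR : IsRMatrix R)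
    {ν : K} (hν : IsRibbonElement R ν) : IsPivotal F (grouplike R ν) := by
  obtain ⟨n, hn⟩ := hν.isUnit
  set u := drinfeldElement R with hu
  have hSu : u * (antipode F u * ((n⁻¹ : Kˣ) * (n⁻¹ : Kˣ))) = 1 := by
    rw [← mul_assoc, hν.sq, ← hn, pow_two]
    simp [mul_assoc]
  have hSu' : (antipode F u * ((n⁻¹ : Kˣ) * (n⁻¹ : Kˣ))) * u = 1 := by
    have : IsDedekindFiniteMonoid K := by
      have := IsNoetherianRing.of_finite F K
      infer_instance
    exact mul_eq_one_symm hSu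
  let U : Kˣ := ⟨u, _, hSu, hSu'⟩
  have hg : grouplike R ν = (U⁻¹ : Kˣ) * n := by
    rw [grouplike, ← hn]
    congr 1
    exact Ring.inverse_unit U
  have hUu : (U : K) = u := rfl
  have nc : ∀ h : K, (n : K) * h = h * n := fun h => by rw [hn]; exact hν.central h
  have hUn : U * n = n * U := Units.ext (nc _).symm
  have ncU : ∀ W : Kˣ, n * W = W * n := fun W => Units.ext (nc _)
  let G : Kˣ := U⁻¹ * n
  have hG : grouplike R ν = (G : K) := hg
  have hinvS : ∀ (W : Kˣ), antipode F (W : K) * antipode F ((W⁻¹ : Kˣ) : K) = 1 := by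
    intro W; rw [← antipode_mul_antidistrib]; simp
  have hSG : antipode F (G : K) * G = 1 := by
    have h1 : antipode F (G : K) = n * antipode F ((U⁻¹ : Kˣ) : K) := by
      simp only [G, Units.val_mul, antipode_mul_antidistrib]
      congr 1
      rw [hn]; exact hν.antipode
    have h2 : antipode F u = ((U⁻¹ * n * n : Kˣ) : K) := by
      have := hν.sq
      rw [← hn, pow_two] at this
      have h3 : (U : K) * antipode F u = ((n * n : Kˣ) : K) := this
      rw [Units.val_mul, Units.val_mul, mul_assoc, ← Units.val_mul n n, ← h3, ← mul_assoc]
      simp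
    have h4 : antipode F ((U⁻¹ : Kˣ) : K) = (((U⁻¹ * n * n)⁻¹ : Kˣ) : K) := by
      have := hinvS U
      rw [hUu, h2] at this
      exact Units.eq_inv_of_mul_eq_one_left this
    rw [h1, h4, ← Units.val_mul, ← Units.val_mul]
    have : n * (U⁻¹ * n * n)⁻¹ * G = 1 := by
      simp only [G, mul_inv_rev, inv_inv, mul_assoc]
      rw [← mul_assoc n⁻¹ U, ← mul_assoc]
      simp
    rw [this, Units.val_one]
  have hcomul : comul (R := F) (G : K) = (G : K) ⊗ₜ[F] (G : K) := by
    have h1 := comul_drinfeldElement_mul hR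
    let t : Kˣ →* (K ⊗[F] K)ˣ := 
      { toFun := fun W => ⟨(W : K) ⊗ₜ[F] (W : K), ((W⁻¹ : Kˣ) : K) ⊗ₜ[F] ((W⁻¹ : Kˣ) : K),
          by simp [Algebra.TensorProduct.one_def], by simp [Algebra.TensorProduct.one_def]⟩
        map_one' := Units.ext (by simp [Algebra.TensorProduct.one_def])
        map_mul' := fun a b => Units.ext (by simp) }
    let D : Kˣ →* (K ⊗[F] K)ˣ := Units.map (Bialgebra.comulAlgHom F K).toMonoidHom
    have hu1 : D U * (flipUnit R * R) = t U := Units.ext h1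
    have hn1 : D n = R⁻¹ * (flipUnit R)⁻¹ * t n := Units.ext (by
      have := hν.comul
      rw [← hn] at this
      exact this)
    -- Commuting R₂₁R with coproducts is what lets the factor in Δ(u⁻¹) meet the inverse factor in
    -- Δ(ν).
    have hflip : ∀ W : Kˣ, (flipUnit R * R) * D W = D W * (flipUnit R * R) := by
      intro W
      apply Units.ext
      have e1 : ∀ h : K, flip (R : K ⊗[F] K) * flip (Coalgebra.comul (R := F) h)
          = Coalgebra.comul (R := F) h * flip (R : K ⊗[F] K) := by
        intro h
        have := congrArg flip (hR.mul_comul h)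
        simpa [map_mul, IsRMatrix.flip_flip] using this
      change flip (R : K ⊗[F] K) * (R : K ⊗[F] K) * Coalgebra.comul (R := F) (W : K)
        = Coalgebra.comul (R := F) (W : K) * (flip (R : K ⊗[F] K) * (R : K ⊗[F] K))
      rw [mul_assoc, hR.mul_comul, ← mul_assoc, e1, mul_assoc]
    have : D G = t G := by
      have e : t U⁻¹ = (flipUnit R * R)⁻¹ * D U⁻¹ := by
        rw [map_inv, ← hu1, mul_inv_rev, map_inv]
      have e2 : D U⁻¹ = (flipUnit R * R) * t U⁻¹ := by rw [e, mul_inv_cancel_left]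
      have e3 : D U⁻¹ * (flipUnit R * R)⁻¹ = (flipUnit R * R)⁻¹ * D U⁻¹ := by
        rw [mul_inv_eq_iff_eq_mul, mul_assoc, ← hflip, inv_mul_cancel_left]
      simp only [G, map_mul]
      rw [hn1, ← mul_inv_rev, ← mul_assoc, e3, ← e]
    exact congrArg Units.val this
  rw [hG]
  refine ⟨hcomul, ?_, ?_, hSG, ?_⟩
  · have h1 := sum_counit_smul (R := F) (a := (G : K)) ⟨{()}, fun _ => (G : K), fun _ => (G : K),
      by simp [hcomul]⟩
    simp only [Finset.sum_singleton] at h1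
    have h2 := congrArg (fun z => counit (R := F) (z * ((G⁻¹ : Kˣ) : K))) h1
    simpa using h2
  · have : antipode F (G : K) = ((G⁻¹ : Kˣ) : K) := Units.eq_inv_of_mul_eq_one_right hSG
    rw [this, Units.mul_inv]
  · intro h
    have h1 : antipode F (antipode F h) * (U : K) = U * h :=
      antipode_antipode_mul_drinfeldElement hR h
    have h2 : ((U⁻¹ : Kˣ) : K) * antipode F (antipode F h) = h * ((U⁻¹ : Kˣ) : K) := by
      rw [Units.inv_mul_eq_iff_eq_mul, ← mul_assoc, Units.eq_mul_inv_iff_mul_eq, h1]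
    simp only [G, Units.val_mul]
    rw [mul_assoc, nc, ← mul_assoc, h2, mul_assoc]

end HopfFacts

end HopfGauge

end

noncomputable section

namespace HopfGauge

open Coalgebra HopfAlgebra

/-! ### Holonomies as elements of `K ⊗ B` -/

section Legs

variable {F K B : Type*} [Field F] [Ring K] [HopfAlgebra F K] [Semiring B] [Algebra F B]

/-- `k ⊗ b ↦ k ⊗ 1 ⊗ b`. -/
def leg₁ : K ⊗[F] B →ₐ[F] (K ⊗[F] K) ⊗[F] B :=
  Algebra.TensorProduct.map Algebra.TensorProduct.includeLeft (AlgHom.id F B)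

/-- `k ⊗ b ↦ 1 ⊗ k ⊗ b`. -/
def leg₂ : K ⊗[F] B →ₐ[F] (K ⊗[F] K) ⊗[F] B :=
  Algebra.TensorProduct.map Algebra.TensorProduct.includeRight (AlgHom.id F B)

/-- `w ↦ w ⊗ 1`. -/
def scal : K ⊗[F] K →ₐ[F] (K ⊗[F] K) ⊗[F] B := Algebra.TensorProduct.includeLeft

/-- `Δ ⊗ id`. -/
def copr : K ⊗[F] B →ₐ[F] (K ⊗[F] K) ⊗[F] B :=
  Algebra.TensorProduct.map (Bialgebra.comulAlgHom F K) (AlgHom.id F B)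

/-- `Δᵒᵖ ⊗ id`. -/
def coprOp : K ⊗[F] B →ₐ[F] (K ⊗[F] K) ⊗[F] B :=
  Algebra.TensorProduct.map ((flip : K ⊗[F] K ≃ₐ[F] K ⊗[F] K).toAlgHom.comp
    (Bialgebra.comulAlgHom F K)) (AlgHom.id F B)

@[simp] theorem leg₁_tmul (k : K) (b : B) : leg₁ (k ⊗ₜ[F] b) = (k ⊗ₜ[F] (1 : K)) ⊗ₜ[F] b := rfl
@[simp] theorem leg₂_tmul (k : K) (b : B) : leg₂ (k ⊗ₜ[F] b) = ((1 : K) ⊗ₜ[F] k) ⊗ₜ[F] b := rfl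
@[simp] theorem copr_tmul (k : K) (b : B) : copr (k ⊗ₜ[F] b) = comul (R := F) k ⊗ₜ[F] b := rfl
@[simp] theorem coprOp_tmul (k : K) (b : B) :
    coprOp (k ⊗ₜ[F] b) = flip (comul (R := F) k) ⊗ₜ[F] b := rfl
theorem scal_apply (w : K ⊗[F] K) : (scal w : (K ⊗[F] K) ⊗[F] B) = w ⊗ₜ[F] (1 : B) := rfl

theorem legs_commute {N N' : Type*} [AddCommMonoid N] [Module F N] [AddCommMonoid N'] [Module F N']
    (f : N →ₗ[F] B) (f' : N' →ₗ[F] B) (h : ∀ n n', f n * f' n' = f' n' * f n)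
    (z : K ⊗[F] N) (z' : K ⊗[F] N') :
    leg₁ (f.lTensor K z) * leg₂ (f'.lTensor K z') = leg₂ (f'.lTensor K z') * leg₁ (f.lTensor K z) := by
  induction z using TensorProduct.induction_on with
  | zero => simp
  | add a b ha hb => simp only [map_add, mul_add, add_mul, ha, hb]
  | tmul k n =>
    induction z' using TensorProduct.induction_on with
    | zero => simp
    | add a b ha hb => simp only [map_add, mul_add, add_mul, ha, hb]
    | tmul k' n' => simp [h]

theorem scal_left_mul_leg₂ (k : K) (z : K ⊗[F] B) :
    scal (k ⊗ₜ[F] (1 : K)) * leg₂ z = leg₂ z * scal (k ⊗ₜ[F] (1 : K)) := by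
  induction z using TensorProduct.induction_on with
  | zero => simp
  | add a b ha hb => simp only [map_add, mul_add, add_mul, ha, hb]
  | tmul k n => simp [scal_apply]

theorem scal_right_mul_leg₁ (k : K) (z : K ⊗[F] B) :
    scal ((1 : K) ⊗ₜ[F] k) * leg₁ z = leg₁ z * scal ((1 : K) ⊗ₜ[F] k) := by
  induction z using TensorProduct.induction_on with
  | zero => simp
  | add a b ha hb => simp only [map_add, mul_add, add_mul, ha, hb]
  | tmul k n => simp [scal_apply]

/-- `a` is a right action of `K` by elements of `B`. -/
structure IsRightAct (a : K →ₗ[F] B) : Prop where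
  one : a 1 = 1
  mul : ∀ h k, a (h * k) = a k * a h

/-- The element `R₍₂₎ ⊗ a(R₍₁₎)`. -/
def twist (R : K ⊗[F] K) (a : K →ₗ[F] B) : K ⊗[F] B := a.lTensor K (flip R)

theorem twist_sum {R : K ⊗[F] K} {n : ℕ} {x y : Fin n → K} (hxy : R = ∑ i, x i ⊗ₜ[F] y i)
    (a : K →ₗ[F] B) : twist R a = ∑ i, y i ⊗ₜ[F] a (x i) := by
  rw [twist, hxy]; simp

/-- The convolution product of two linear maps from `K` to an algebra. -/
def conv (a c : K →ₗ[F] B) : K →ₗ[F] B :=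
  LinearMap.mul' F B ∘ₗ TensorProduct.map a c ∘ₗ comul

/-- The hexagon (Δ ⊗ id)(R) = R₁₃R₂₃: the braiding with several edge ends factors into braidings
with each of them. -/
theorem twist_conv {R : (K ⊗[F] K)ˣ} (hR : IsRMatrix R) (a c : K →ₗ[F] B) :
    twist (R : K ⊗[F] K) (conv a c) = twist (R : K ⊗[F] K) a * twist (R : K ⊗[F] K) c := by
  obtain ⟨n, x, y, hxy⟩ := exists_sum_tmul (R : K ⊗[F] K)
  have h := hR.sum_left hxy ((TensorProduct.mk F K B).flip ∘ₗ LinearMap.mul' F B ∘ₗ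
    TensorProduct.map a c)
  simp only [twist_sum hxy, Finset.sum_mul_sum]
  simpa [conv] using h

/-- The Yang–Baxter equation with `a` applied to the first leg of R₁₂R₁₃R₂₃. As `a` reverses
products, the two twists stand in the order opposite to that of the factors of R. -/
theorem twist_yangBaxter {R : (K ⊗[F] K)ˣ} (hR : IsRMatrix R) {a : K →ₗ[F] B}
    (ha : IsRightAct a) :
    leg₂ (twist (R : K ⊗[F] K) a) * leg₁ (twist (R : K ⊗[F] K) a) * scal (R : K ⊗[F] K)
      = scal (R : K ⊗[F] K) * (leg₁ (twist (R : K ⊗[F] K) a) * leg₂ (twist (R : K ⊗[F] K) a)) := by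
  let Θ : (K ⊗[F] K) ⊗[F] K →ₗ[F] (K ⊗[F] K) ⊗[F] B :=
    (TensorProduct.comm F B (K ⊗[F] K)).toLinearMap ∘ₗ TensorProduct.map a LinearMap.id ∘ₗ
      (TensorProduct.assoc F K K K).toLinearMap
  have hΘ : ∀ p q r, Θ ((p ⊗ₜ q) ⊗ₜ r) = (q ⊗ₜ r) ⊗ₜ a p := fun p q r => rfl
  have e1 : ∀ r₁ r₂ r₃ : K ⊗[F] K, Θ ((r₁ ⊗ₜ[F] (1 : K)) *
      (Algebra.TensorProduct.map
          (Algebra.TensorProduct.includeLeft : K →ₐ[F] K ⊗[F] K) (AlgHom.id F K) r₂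
        * Algebra.TensorProduct.map
          (Algebra.TensorProduct.includeRight : K →ₐ[F] K ⊗[F] K) (AlgHom.id F K) r₃))
      = leg₂ (twist r₂ a) * leg₁ (twist r₁ a) * scal r₃ := by
    intro r₁ r₂ r₃
    unfold twist
    induction r₁ using TensorProduct.induction_on with
    | zero => simp
    | add u v hu hv => simp only [map_add, TensorProduct.add_tmul, mul_add, add_mul, hu, hv]
    | tmul x₁ y₁ =>
      induction r₂ using TensorProduct.induction_on with
      | zero => simp
      | add u v hu hv => simp only [map_add, mul_add, add_mul, hu, hv]
      | tmul x₂ y₂ =>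
        induction r₃ using TensorProduct.induction_on with
        | zero => simp
        | add u v hu hv => simp only [map_add, mul_add, hu, hv]
        | tmul x₃ y₃ => simp [hΘ, scal_apply, ha.mul]
  have e2 : ∀ r₁ r₂ r₃ : K ⊗[F] K, Θ (
      (Algebra.TensorProduct.map
          (Algebra.TensorProduct.includeRight : K →ₐ[F] K ⊗[F] K) (AlgHom.id F K) r₃
        * Algebra.TensorProduct.map
          (Algebra.TensorProduct.includeLeft : K →ₐ[F] K ⊗[F] K) (AlgHom.id F K) r₂) *
          (r₁ ⊗ₜ[F] (1 : K)))
      = scal r₃ * (leg₁ (twist r₁ a) * leg₂ (twist r₂ a)) := by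
    intro r₁ r₂ r₃
    unfold twist
    induction r₁ using TensorProduct.induction_on with
    | zero => simp
    | add u v hu hv => simp only [map_add, TensorProduct.add_tmul, mul_add, add_mul, hu, hv]
    | tmul x₁ y₁ =>
      induction r₂ using TensorProduct.induction_on with
      | zero => simp
      | add u v hu hv => simp only [map_add, mul_add, add_mul, hu, hv]
      | tmul x₂ y₂ =>
        induction r₃ using TensorProduct.induction_on with
        | zero => simp
        | add u v hu hv => simp only [map_add, add_mul, hu, hv]
        | tmul x₃ y₃ => simp [hΘ, scal_apply, ha.mul]
  rw [← e1, ← e2, hR.yangBaxter]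

/-- The linear map `p ⊗ q ↦ (p ⊗ 1) M (1 ⊗ c(q))`. -/
def smash (M : K ⊗[F] B) (c : K →ₗ[F] B) : K ⊗[F] K →ₗ[F] K ⊗[F] B :=
  TensorProduct.lift ((LinearMap.mul F (K ⊗[F] B)).compl₁₂
    (LinearMap.mulRight F M ∘ₗ Algebra.TensorProduct.includeLeft.toLinearMap)
    ((Algebra.TensorProduct.includeRight : B →ₐ[F] K ⊗[F] B).toLinearMap ∘ₗ c))

@[simp] theorem smash_tmul (M : K ⊗[F] B) (c : K →ₗ[F] B) (p q : K) :
    smash M c (p ⊗ₜ q) = (p ⊗ₜ 1) * M * (1 ⊗ₜ c q) := by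
  simp [smash]

/-- `M` transforms under the right action `c` like the holonomy of an incoming edge end. -/
def Transforms (c : K →ₗ[F] B) (M : K ⊗[F] B) : Prop :=
  ∀ h, ((1 : K) ⊗ₜ[F] c h) * M = smash M c (comul h)

/-- Moving c(R₍₁₎) past M splits R₍₁₎ by the coproduct. By the hexagon one half acts on the matrix
leg of M and contributes R, the other half reassembles to the twist. -/
theorem Transforms.twist_mul {R : (K ⊗[F] K)ˣ} (hR : IsRMatrix R) {c : K →ₗ[F] B}
    {M : K ⊗[F] B} (h : Transforms c M) :
    leg₂ (twist (R : K ⊗[F] K) c) * leg₁ M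
      = scal (R : K ⊗[F] K) * leg₁ M * leg₂ (twist (R : K ⊗[F] K) c) := by
  obtain ⟨n, x, y, hxy⟩ := exists_sum_tmul (R : K ⊗[F] K)
  have key := hR.sum_left hxy ((LinearMap.mul F ((K ⊗[F] K) ⊗[F] B)).flip.compl₁₂
    (leg₁.toLinearMap ∘ₗ smash M c)
    (scal.toLinearMap ∘ₗ (Algebra.TensorProduct.includeRight : K →ₐ[F] K ⊗[F] K).toLinearMap))
  have h' : ∀ h, smash M c (comul h) = ((1 : K) ⊗ₜ[F] c h) * M := fun k => (h k).symm
  simp only [LinearMap.compl₁₂_apply, LinearMap.flip_apply, LinearMap.mul_apply', smash_tmul,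
    LinearMap.comp_apply, AlgHom.toLinearMap_apply, h',
    Algebra.TensorProduct.includeRight_apply] at key
  have e : ∀ i, leg₂ (y i ⊗ₜ[F] c (x i)) =
      scal ((1 : K) ⊗ₜ[F] y i) * leg₁ ((1 : K) ⊗ₜ[F] c (x i)) := by
    intro i; simp [scal_apply]
  rw [twist_sum hxy, map_sum, Finset.sum_mul]
  simp only [e, mul_assoc, ← map_mul leg₁]
  rw [key]
  conv_rhs => rw [hxy]
  simp only [map_sum, Finset.sum_mul]
  refine Finset.sum_congr rfl fun p _ => ?_
  rw [Finset.mul_sum, Finset.mul_sum]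
  refine Finset.sum_congr rfl fun q _ => ?_
  have e1 : (1 : K) ⊗ₜ[F] (y p * y q) = ((1 : K) ⊗ₜ[F] y p) * ((1 : K) ⊗ₜ[F] y q) := by simp
  have e2 : leg₁ (x p ⊗ₜ[F] (1 : B)) = scal (x p ⊗ₜ[F] (1 : K)) := rfl
  have e3 : scal (x p ⊗ₜ[F] y p) = (scal ((1 : K) ⊗ₜ[F] y p) * scal (x p ⊗ₜ[F] (1 : K)) :
    (K ⊗[F] K) ⊗[F] B) := by rw [← map_mul]; simp
  have e4 := scal_right_mul_leg₁ (B := B) (y q) ((x p ⊗ₜ[F] (1 : B)) * M)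
  rw [e1, map_mul scal, e3, map_mul leg₁, mul_assoc, ← mul_assoc (scal (1 ⊗ₜ[F] y q)), e4,
    map_mul leg₁, e2]
  simp only [mul_assoc]

/-- The hexagon (id ⊗ Δ)(R) = R₁₃R₁₂ with the action in the first leg. It lets the functions of one
end multiply in the same way with and without braiding. -/
theorem twist_coprOp {R : (K ⊗[F] K)ˣ} (hR : IsRMatrix R) {a : K →ₗ[F] B}
    (ha : IsRightAct a) :
    leg₂ (twist (R : K ⊗[F] K) a) * leg₁ (twist (R : K ⊗[F] K) a)
      = coprOp (twist (R : K ⊗[F] K) a) := by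
  obtain ⟨n, x, y, hxy⟩ := exists_sum_tmul (R : K ⊗[F] K)
  have key := hR.sum_right hxy ((TensorProduct.mk F (K ⊗[F] K) B).flip.compl₁₂ a
    (flip : K ⊗[F] K ≃ₐ[F] K ⊗[F] K).toLinearMap)
  simp only [twist_sum hxy, map_sum, Finset.sum_mul_sum]
  rw [Finset.sum_comm]
  simp [ha.mul] at key ⊢
  exact key.symm

/-- The braiding of the holonomies of two incoming edge ends at a vertex. -/
theorem braided_exchange {R : (K ⊗[F] K)ˣ} (hR : IsRMatrix R)
    {N N' : Type*} [AddCommMonoid N] [Module F N] [AddCommMonoid N'] [Module F N']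
    {a c d : K →ₗ[F] B} (μ : N →ₗ[F] B) (μ' : N' →ₗ[F] B) (z : K ⊗[F] N) (z' : K ⊗[F] N')
    (ha : IsRightAct a) (hac : ∀ h k, a h * c k = c k * a h) (had : ∀ h k, a h * d k = d k * a h)
    (haμ : ∀ h n, a h * μ n = μ n * a h) (haμ' : ∀ h n, a h * μ' n = μ' n * a h)
    (hdμ : ∀ h n, d h * μ n = μ n * d h) (hμ : ∀ n n', μ n * μ' n' = μ' n' * μ n)
    (hc : Transforms c (μ.lTensor K z)) :
    leg₂ (twist (R : K ⊗[F] K) (conv a (conv c d)) * μ'.lTensor K z')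
        * leg₁ (twist (R : K ⊗[F] K) a * μ.lTensor K z)
      = scal (R : K ⊗[F] K) * (leg₁ (twist (R : K ⊗[F] K) a * μ.lTensor K z)
        * leg₂ (twist (R : K ⊗[F] K) (conv a (conv c d)) * μ'.lTensor K z')) := by
  -- The later end is braided with the ends before the earlier one (`a`), with the earlier end
  -- itself (`c`) and with those in between (`d`). Everything commutes except `c` with the earlier
  -- matrix, which produces R (`q7`), and the two copies of `a`, which are exchanged by the
  -- Yang–Baxter equation in the presence of this R (`q8`).
  rw [twist_conv hR, twist_conv hR]
  simp only [map_mul]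
  have q1 : leg₂ (μ'.lTensor K z') * leg₁ (twist (R : K ⊗[F] K) a)
      = leg₁ (twist (R : K ⊗[F] K) a) * leg₂ (μ'.lTensor K z') := (legs_commute _ _ haμ' _ _).symm
  have q2 : leg₂ (twist (R : K ⊗[F] K) d) * leg₁ (twist (R : K ⊗[F] K) a)
      = leg₁ (twist (R : K ⊗[F] K) a) * leg₂ (twist (R : K ⊗[F] K) d) :=
    (legs_commute _ _ had _ _).symm
  have q3 : leg₂ (twist (R : K ⊗[F] K) c) * leg₁ (twist (R : K ⊗[F] K) a)
      = leg₁ (twist (R : K ⊗[F] K) a) * leg₂ (twist (R : K ⊗[F] K) c) :=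
    (legs_commute _ _ hac _ _).symm
  have q4 : leg₂ (μ'.lTensor K z') * leg₁ (μ.lTensor K z)
      = leg₁ (μ.lTensor K z) * leg₂ (μ'.lTensor K z') := (legs_commute _ _ hμ _ _).symm
  have q5 : leg₂ (twist (R : K ⊗[F] K) d) * leg₁ (μ.lTensor K z)
      = leg₁ (μ.lTensor K z) * leg₂ (twist (R : K ⊗[F] K) d) :=
    (legs_commute _ _ (fun n h => (hdμ h n).symm) _ _).symm
  have q6 : leg₂ (twist (R : K ⊗[F] K) a) * leg₁ (μ.lTensor K z)
      = leg₁ (μ.lTensor K z) * leg₂ (twist (R : K ⊗[F] K) a) :=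
    (legs_commute _ _ (fun n h => (haμ h n).symm) _ _).symm
  have q7 := hc.twist_mul hR
  have q8 := twist_yangBaxter hR ha
  generalize leg₂ (twist (R : K ⊗[F] K) a) = a2 at *
  generalize leg₁ (twist (R : K ⊗[F] K) a) = a1 at *
  generalize leg₂ (twist (R : K ⊗[F] K) c) = c2 at *
  generalize leg₂ (twist (R : K ⊗[F] K) d) = d2 at *
  generalize leg₁ (μ.lTensor K z) = m at *
  generalize leg₂ (μ'.lTensor K z') = m' at *
  generalize (scal (R : K ⊗[F] K) : (K ⊗[F] K) ⊗[F] B) = r at *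
  calc a2 * (c2 * d2) * m' * (a1 * m) = a2 * c2 * d2 * (m' * a1) * m := by simp only [mul_assoc]
    _ = a2 * c2 * (d2 * a1) * (m' * m) := by rw [q1]; simp only [mul_assoc]
    _ = a2 * (c2 * a1) * d2 * m * m' := by rw [q2, q4]; simp only [mul_assoc]
    _ = a2 * a1 * c2 * (d2 * m) * m' := by rw [q3]; simp only [mul_assoc]
    _ = a2 * a1 * (c2 * m) * d2 * m' := by rw [q5]; simp only [mul_assoc]
    _ = (a2 * a1 * r) * m * c2 * d2 * m' := by rw [q7]; simp only [mul_assoc]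
    _ = r * a1 * (a2 * m) * c2 * d2 * m' := by rw [q8]; simp only [mul_assoc]
    _ = _ := by rw [q6]; simp only [mul_assoc]

/-- The product of the holonomies of one edge end. -/
theorem braided_same {R : (K ⊗[F] K)ˣ} (hR : IsRMatrix R)
    {N : Type*} [AddCommMonoid N] [Module F N]
    {a : K →ₗ[F] B} (μ : N →ₗ[F] B) (z : K ⊗[F] N)
    (ha : IsRightAct a) (haμ : ∀ h n, a h * μ n = μ n * a h) (w : K ⊗[F] K)
    (hμ : leg₂ (μ.lTensor K z) * leg₁ (μ.lTensor K z) = coprOp (μ.lTensor K z) * scal w) :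
    leg₂ (twist (R : K ⊗[F] K) a * μ.lTensor K z) * leg₁ (twist (R : K ⊗[F] K) a * μ.lTensor K z)
      = coprOp (twist (R : K ⊗[F] K) a * μ.lTensor K z) * scal w := by
  have q1 : leg₂ (μ.lTensor K z) * leg₁ (twist (R : K ⊗[F] K) a)
      = leg₁ (twist (R : K ⊗[F] K) a) * leg₂ (μ.lTensor K z) := (legs_commute _ _ haμ _ _).symm
  rw [map_mul leg₂, map_mul leg₁, map_mul coprOp, mul_assoc, ← mul_assoc (leg₂ (μ.lTensor K z)), q1,
    mul_assoc, mul_assoc, ← hμ, ← twist_coprOp hR ha, mul_assoc]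

/-! ### Reversal of holonomies -/

/-- `γ S ⊗ id`. -/
def rev (γ : K) : K ⊗[F] B →ₗ[F] K ⊗[F] B :=
  (LinearMap.mulLeft F γ ∘ₗ antipode F).rTensor B

@[simp] theorem rev_tmul (γ k : K) (b : B) :
    rev γ (k ⊗ₜ[F] b) = (γ * antipode F k) ⊗ₜ[F] b := rfl

/-- `z ↦ (x ⊗ 1) z (1 ⊗ y)`, for `x ⊗ y ∈ K ⊗ K`. -/
def outer : K ⊗[F] K →ₗ[F] (K ⊗[F] K) ⊗[F] B →ₗ[F] (K ⊗[F] K) ⊗[F] B :=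
  TensorProduct.lift (LinearMap.mk₂ F
    (fun x y => LinearMap.mulRight F (scal ((1 : K) ⊗ₜ[F] y)) ∘ₗ
      LinearMap.mulLeft F (scal (x ⊗ₜ[F] (1 : K))))
    (fun a b c => by ext z; simp [TensorProduct.add_tmul, add_mul])
    (fun t a c => by ext z; simp [← TensorProduct.smul_tmul', smul_mul_assoc])
    (fun a b c => by ext z; simp [TensorProduct.tmul_add, mul_add])
    (fun t a c => by ext z; simp [mul_smul_comm]))

@[simp] theorem outer_tmul (x y : K) (z : (K ⊗[F] K) ⊗[F] B) :
    outer (x ⊗ₜ y) z = scal (x ⊗ₜ[F] (1 : K)) * z * scal ((1 : K) ⊗ₜ[F] y) := rfl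

/-- The properties of `1`, `R` and `R₂₁⁻¹` that are used for the exchange relations. -/
structure IsBraiding (W : (K ⊗[F] K)ˣ) : Prop where
  map_left : TensorProduct.map (antipode F) LinearMap.id (W : K ⊗[F] K)
    = ((W⁻¹ : (K ⊗[F] K)ˣ) : K ⊗[F] K)
  map_both : TensorProduct.map (antipode F) (antipode F) (W : K ⊗[F] K) = W
  sum_mul_antipode_mul : ∀ {n : ℕ} {x y : Fin n → K}, (W : K ⊗[F] K) = ∑ i, x i ⊗ₜ[F] y i →
    ∑ i, ∑ j, (x i * x j) ⊗ₜ[F] (antipode F (y j) * y i) = 1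
  sum_mul_mul_antipode : ∀ {n : ℕ} {x y : Fin n → K}, (W : K ⊗[F] K) = ∑ i, x i ⊗ₜ[F] y i →
    ∑ i, ∑ j, (x i * x j) ⊗ₜ[F] (y j * antipode F (y i)) = 1

theorem IsRMatrix.isBraiding {R : (K ⊗[F] K)ˣ} (hR : IsRMatrix R) : IsBraiding R :=
  ⟨hR.map_antipode_left, hR.map_antipode_antipode, hR.sum_mul_antipode_mul,
    hR.sum_mul_mul_antipode⟩

theorem isBraiding_one : IsBraiding (1 : (K ⊗[F] K)ˣ) := by
  refine ⟨by simp [Algebra.TensorProduct.one_def], by simp [Algebra.TensorProduct.one_def], ?_, ?_⟩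
  · intro n x y hxy
    -- The expansion of 1 ∈ K ⊗ K is arbitrary. The sum depends on it only through a bilinear map,
    -- which is evaluated at 1 ⊗ 1.
    let f : K ⊗[F] K →ₗ[F] K ⊗[F] K →ₗ[F] K ⊗[F] K := TensorProduct.lift (LinearMap.mk₂ F
      (fun x y => TensorProduct.map (LinearMap.mulLeft F x)
        (LinearMap.mulRight F y ∘ₗ antipode F))
      (fun a b c => by ext z; simp [TensorProduct.add_tmul, add_mul])
      (fun t a c => by ext z; simp [TensorProduct.smul_tmul'])
      (fun a b c => by ext z; simp [TensorProduct.tmul_add, mul_add])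
      (fun t a c => by ext z; simp))
    have h : f (∑ i, x i ⊗ₜ[F] y i) (∑ i, x i ⊗ₜ[F] y i) = 1 := by
      rw [← hxy]
      simp [f, Algebra.TensorProduct.one_def]
    rw [Finset.sum_comm]
    simpa [f] using h
  · intro n x y hxy
    let f : K ⊗[F] K →ₗ[F] K ⊗[F] K →ₗ[F] K ⊗[F] K := TensorProduct.lift (LinearMap.mk₂ F
      (fun x y => TensorProduct.map (LinearMap.mulLeft F x)
        (LinearMap.mulRight F (antipode F y)))
      (fun a b c => by ext z; simp [TensorProduct.add_tmul, add_mul])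
      (fun t a c => by ext z; simp [TensorProduct.smul_tmul'])
      (fun a b c => by ext z; simp [TensorProduct.tmul_add, mul_add])
      (fun t a c => by ext z; simp))
    have h : f (∑ i, x i ⊗ₜ[F] y i) (∑ i, x i ⊗ₜ[F] y i) = 1 := by
      rw [← hxy]
      simp [f, Algebra.TensorProduct.one_def]
    rw [Finset.sum_comm]
    simpa [f] using h

theorem rev_eq (γ : K) (N : K ⊗[F] B) : rev γ N = (γ ⊗ₜ[F] (1 : B)) * rev 1 N := by
  induction N using TensorProduct.induction_on with
  | zero => simp
  | add a b ha hb => simp only [map_add, mul_add, ha, hb]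
  | tmul k b => simp

/-! ### Exchange relations in which one or both holonomies are reversed. -/

section Exchange

variable {W : (K ⊗[F] K)ˣ} (hW : IsBraiding W) {M N : K ⊗[F] B}
  (h : leg₂ N * leg₁ M = scal (W : K ⊗[F] K) * (leg₁ M * leg₂ N)) (γ γ' : K)
include hW h

/-- S on the second leg reverses products there, so left multiplication by W becomes the two-sided
multiplication `outer` by (id ⊗ S)(W). Since `outer` is a module structure over K ⊗ Kᵒᵖ, inserting W
between the factors cancels it. -/
theorem exchange_out_in :
    leg₂ (rev γ N) * scal (W : K ⊗[F] K) * leg₁ M = leg₁ M * leg₂ (rev γ N) := by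
  -- The constant γ is a left factor in the second leg and commutes with the first leg, so it may be
  -- dropped.
  suffices hs : leg₂ (rev 1 N) * scal (W : K ⊗[F] K) * leg₁ M = leg₁ M * leg₂ (rev 1 N) by
    rw [rev_eq, map_mul, mul_assoc, mul_assoc, ← mul_assoc (leg₂ (rev 1 N)), hs, ← mul_assoc,
      ← mul_assoc]
    congr 1
    exact scal_right_mul_leg₁ γ M
  obtain ⟨n, x, y, hxy⟩ := exists_sum_tmul (W : K ⊗[F] K)
  let σ : (K ⊗[F] K) ⊗[F] B →ₗ[F] (K ⊗[F] K) ⊗[F] B := ((antipode F).lTensor K).rTensor B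
  have e1 : ∀ (M N : K ⊗[F] B), σ (leg₂ N * leg₁ M) = leg₂ (rev 1 N) * leg₁ M := by
    intro M N
    induction M using TensorProduct.induction_on with
    | zero => simp
    | add a b ha hb => simp only [map_add, mul_add, ha, hb]
    | tmul k b =>
      induction N using TensorProduct.induction_on with
      | zero => simp
      | add a b ha hb => simp only [map_add, add_mul, ha, hb]
      | tmul k' b' => simp [σ]
  have e2 : ∀ (M N : K ⊗[F] B) (p q : K), σ (scal (p ⊗ₜ[F] q) * (leg₁ M * leg₂ N))
      = outer (p ⊗ₜ antipode F q) (leg₁ M * leg₂ (rev 1 N)) := by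
    intro M N p q
    induction M using TensorProduct.induction_on with
    | zero => simp
    | add a b ha hb => simp only [map_add, add_mul, mul_add, ha, hb]
    | tmul k b =>
      induction N using TensorProduct.induction_on with
      | zero => simp
      | add a b ha hb => simp only [map_add, mul_add, ha, hb]
      | tmul k' b' => simp [σ, scal_apply, antipode_mul_antidistrib]
  have e3 : ∀ (p q p' q' : K) (z : (K ⊗[F] K) ⊗[F] B),
      outer (p ⊗ₜ q) (outer (p' ⊗ₜ q') z) = outer ((p * p') ⊗ₜ (q' * q)) z := by
    intro p q p' q' z
    have h1 : ((p * p') ⊗ₜ[F] (1 : K)) = (p ⊗ₜ[F] (1 : K)) * (p' ⊗ₜ[F] (1 : K)) := by simp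
    have h2 : ((1 : K) ⊗ₜ[F] (q' * q)) = ((1 : K) ⊗ₜ[F] q') * ((1 : K) ⊗ₜ[F] q) := by simp
    simp only [outer_tmul, h1, h2, map_mul, mul_assoc]
  have e4 : ∀ (M N : K ⊗[F] B) (p q : K), leg₂ N * scal (p ⊗ₜ[F] q) * leg₁ M
      = outer (p ⊗ₜ q) (leg₂ N * leg₁ M) := by
    intro M N p q
    have h1 : (p ⊗ₜ[F] q) = (p ⊗ₜ[F] (1 : K)) * ((1 : K) ⊗ₜ[F] q) := by simp
    rw [outer_tmul, h1, map_mul, ← mul_assoc, ← scal_left_mul_leg₂, mul_assoc, scal_right_mul_leg₁]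
    simp only [mul_assoc]
  have h' := congrArg σ h
  rw [e1, hxy] at h'
  simp only [map_sum, Finset.sum_mul, e2] at h'
  rw [hxy]
  simp only [map_sum, Finset.sum_mul, Finset.mul_sum, e4]
  simp only [h', map_sum, e3]
  have h5 := congrArg (fun w => outer w (leg₁ M * leg₂ (rev 1 N))) (hW.sum_mul_antipode_mul hxy)
  simp only [map_sum, LinearMap.sum_apply] at h5
  rw [h5, Algebra.TensorProduct.one_def, outer_tmul, ← Algebra.TensorProduct.one_def, map_one,
    one_mul, mul_one]

/-- S on the first leg moves W between the two matrices, where it appears as (S ⊗ id)(W) = W⁻¹. -/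
theorem exchange_in_out :
    leg₂ N * leg₁ (rev γ M)
      = leg₁ (rev γ M) * scal ((W⁻¹ : (K ⊗[F] K)ˣ) : K ⊗[F] K) * leg₂ N := by
  suffices hs : leg₂ N * leg₁ (rev 1 M)
      = leg₁ (rev 1 M) * scal ((W⁻¹ : (K ⊗[F] K)ˣ) : K ⊗[F] K) * leg₂ N by
    have h1 : leg₂ N * leg₁ (γ ⊗ₜ[F] (1 : B)) = leg₁ (γ ⊗ₜ[F] (1 : B)) * leg₂ N :=
      (scal_left_mul_leg₂ γ N).symm
    rw [rev_eq, map_mul, ← mul_assoc, h1, mul_assoc, hs]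
    simp only [mul_assoc]
  rw [← hW.map_left]
  let σ : (K ⊗[F] K) ⊗[F] B →ₗ[F] (K ⊗[F] K) ⊗[F] B := ((antipode F).rTensor K).rTensor B
  have e1 : ∀ (M N : K ⊗[F] B), σ (leg₂ N * leg₁ M) = leg₂ N * leg₁ (rev 1 M) := by
    intro M N
    induction M using TensorProduct.induction_on with
    | zero => simp
    | add a b ha hb => simp only [map_add, mul_add, ha, hb]
    | tmul k b =>
      induction N using TensorProduct.induction_on with
      | zero => simp
      | add a b ha hb => simp only [map_add, add_mul, ha, hb]
      | tmul k' b' => simp [σ]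
  have e2 : ∀ (w : K ⊗[F] K) (M N : K ⊗[F] B), σ (scal w * (leg₁ M * leg₂ N))
      = leg₁ (rev 1 M) * scal (TensorProduct.map (antipode F) LinearMap.id w) * leg₂ N := by
    intro w M N
    induction w using TensorProduct.induction_on with
    | zero => simp
    | add a b ha hb => simp only [map_add, add_mul, mul_add, ha, hb]
    | tmul p q =>
      induction M using TensorProduct.induction_on with
      | zero => simp
      | add a b ha hb => simp only [map_add, add_mul, mul_add, ha, hb]
      | tmul k b =>
        induction N using TensorProduct.induction_on with
        | zero => simp
        | add a b ha hb => simp only [map_add, mul_add, ha, hb]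
        | tmul k' b' => simp [σ, scal_apply, antipode_mul_antidistrib]
  rw [← e1, h, e2]

/-- S ⊗ S moves W from the left end to the right end and leaves it unchanged. -/
theorem exchange_out_out :
    leg₂ (rev γ N) * leg₁ (rev γ' M)
      = leg₁ (rev γ' M) * leg₂ (rev γ N) * scal (W : K ⊗[F] K) := by
  suffices hs : leg₂ (rev 1 N) * leg₁ (rev 1 M)
      = leg₁ (rev 1 M) * leg₂ (rev 1 N) * scal (W : K ⊗[F] K) by
    have h1 := scal_left_mul_leg₂ γ' (rev 1 N)
    have h2 := scal_right_mul_leg₁ γ (rev 1 M)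
    have h3 : (scal (γ' ⊗ₜ[F] (1 : K)) * scal ((1 : K) ⊗ₜ[F] γ) : (K ⊗[F] K) ⊗[F] B)
      = scal ((1 : K) ⊗ₜ[F] γ) * scal (γ' ⊗ₜ[F] (1 : K)) := by simp only [← map_mul]; simp
    have e1 : leg₁ (γ' ⊗ₜ[F] (1 : B)) = scal (γ' ⊗ₜ[F] (1 : K)) := rfl
    have e2 : leg₂ (γ ⊗ₜ[F] (1 : B)) = scal ((1 : K) ⊗ₜ[F] γ) := rfl
    rw [rev_eq γ, rev_eq γ', map_mul, map_mul, e1, e2]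
    generalize (scal (γ' ⊗ₜ[F] (1 : K)) : (K ⊗[F] K) ⊗[F] B) = s at *
    generalize (scal ((1 : K) ⊗ₜ[F] γ) : (K ⊗[F] K) ⊗[F] B) = t at *
    generalize leg₂ (rev 1 N) = n at *
    generalize leg₁ (rev 1 M) = m at *
    calc t * n * (s * m) = t * (n * s) * m := by simp only [mul_assoc]
      _ = (t * s) * (n * m) := by rw [← h1]; simp only [mul_assoc]
      _ = s * (t * m) * n * scal (W : K ⊗[F] K) := by rw [← h3, hs]; simp only [mul_assoc]
      _ = _ := by rw [h2]; simp only [mul_assoc]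
  let σ : (K ⊗[F] K) ⊗[F] B →ₗ[F] (K ⊗[F] K) ⊗[F] B :=
    (TensorProduct.map (antipode F) (antipode F)).rTensor B
  have e1 : ∀ (M N : K ⊗[F] B), σ (leg₂ N * leg₁ M) = leg₂ (rev 1 N) * leg₁ (rev 1 M) := by
    intro M N
    induction M using TensorProduct.induction_on with
    | zero => simp
    | add a b ha hb => simp only [map_add, mul_add, ha, hb]
    | tmul k b =>
      induction N using TensorProduct.induction_on with
      | zero => simp
      | add a b ha hb => simp only [map_add, add_mul, ha, hb]
      | tmul k' b' => simp [σ]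
  have e2 : ∀ (w : K ⊗[F] K) (M N : K ⊗[F] B), σ (scal w * (leg₁ M * leg₂ N))
      = leg₁ (rev 1 M) * leg₂ (rev 1 N) *
        scal (TensorProduct.map (antipode F) (antipode F) w) := by
    intro w M N
    induction w using TensorProduct.induction_on with
    | zero => simp
    | add a b ha hb => simp only [map_add, add_mul, mul_add, ha, hb]
    | tmul p q =>
      induction M using TensorProduct.induction_on with
      | zero => simp
      | add a b ha hb => simp only [map_add, add_mul, mul_add, ha, hb]
      | tmul k b =>
        induction N using TensorProduct.induction_on with
        | zero => simp
        | add a b ha hb => simp only [map_add, mul_add, add_mul, ha, hb]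
        | tmul k' b' => simp [σ, scal_apply, antipode_mul_antidistrib]
  rw [← e1, h, e2, hW.map_both]

end Exchange

/-- The product of a reversed holonomy. -/
theorem rev_same {w : K ⊗[F] K} (hw : TensorProduct.map (antipode F) (antipode F) w = w)
    {γ : K} (hγ : comul (R := F) γ = γ ⊗ₜ[F] γ)
    (hγw : (γ ⊗ₜ[F] γ) * w = w * (γ ⊗ₜ[F] γ)) {M : K ⊗[F] B}
    (h : leg₂ M * leg₁ M = coprOp M * scal w) :
    leg₂ (rev γ M) * leg₁ (rev γ M) = scal w * copr (rev γ M) := by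
  let σ : (K ⊗[F] K) ⊗[F] B →ₗ[F] (K ⊗[F] K) ⊗[F] B :=
    (LinearMap.mulLeft F (γ ⊗ₜ[F] γ) ∘ₗ TensorProduct.map (antipode F) (antipode F)).rTensor B
  have e1 : ∀ (M N : K ⊗[F] B), σ (leg₂ N * leg₁ M) = leg₂ (rev γ N) * leg₁ (rev γ M) := by
    intro M N
    induction M using TensorProduct.induction_on with
    | zero => simp
    | add a b ha hb => simp only [map_add, mul_add, ha, hb]
    | tmul k b =>
      induction N using TensorProduct.induction_on with
      | zero => simp
      | add a b ha hb => simp only [map_add, add_mul, ha, hb]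
      | tmul k' b' => simp [σ]
  have e0 : ∀ (w v : K ⊗[F] K), TensorProduct.map (antipode F) (antipode F) (v * w)
      = TensorProduct.map (antipode F) (antipode F) w *
        TensorProduct.map (antipode F) (antipode F) v := by
    intro w v
    induction w using TensorProduct.induction_on with
    | zero => simp
    | add a b ha hb => simp only [map_add, add_mul, mul_add, ha, hb]
    | tmul p q =>
      induction v using TensorProduct.induction_on with
      | zero => simp
      | add a b ha hb => simp only [map_add, add_mul, mul_add, ha, hb]
      | tmul p q => simp [antipode_mul_antidistrib]
  have e2 : ∀ (M : K ⊗[F] B), σ (coprOp M * scal w) = scal w * copr (rev γ M) := by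
    intro M
    induction M using TensorProduct.induction_on with
    | zero => simp
    | add a b ha hb => simp only [map_add, add_mul, mul_add, ha, hb]
    | tmul k b =>
      simp only [σ, scal_apply, coprOp_tmul, rev_tmul, copr_tmul, Algebra.TensorProduct.tmul_mul_tmul,
        mul_one, one_mul, LinearMap.rTensor_tmul, LinearMap.comp_apply, LinearMap.mulLeft_apply,
        e0, hw, Bialgebra.comul_mul, hγ, comul_antipode]
      rw [← mul_assoc, hγw, mul_assoc]
  rw [← e1, h, e2]

/-- The counterpart of `rev_same` with Δ and Δᵒᵖ exchanged. S ⊗ S now carries w to the right of the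
coproduct, so γ ⊗ γ need not be commuted with it. -/
theorem rev_same' {w : K ⊗[F] K} (hw : TensorProduct.map (antipode F) (antipode F) w = w)
    {γ : K} (hγ : comul (R := F) γ = γ ⊗ₜ[F] γ) {M : K ⊗[F] B}
    (h : leg₂ M * leg₁ M = scal w * copr M) :
    leg₂ (rev γ M) * leg₁ (rev γ M) = coprOp (rev γ M) * scal w := by
  let σ : (K ⊗[F] K) ⊗[F] B →ₗ[F] (K ⊗[F] K) ⊗[F] B :=
    (LinearMap.mulLeft F (γ ⊗ₜ[F] γ) ∘ₗ TensorProduct.map (antipode F) (antipode F)).rTensor B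
  have e1 : ∀ (M N : K ⊗[F] B), σ (leg₂ N * leg₁ M) = leg₂ (rev γ N) * leg₁ (rev γ M) := by
    intro M N
    induction M using TensorProduct.induction_on with
    | zero => simp
    | add a b ha hb => simp only [map_add, mul_add, ha, hb]
    | tmul k b =>
      induction N using TensorProduct.induction_on with
      | zero => simp
      | add a b ha hb => simp only [map_add, add_mul, ha, hb]
      | tmul k' b' => simp [σ]
  have e0 : ∀ (w v : K ⊗[F] K), TensorProduct.map (antipode F) (antipode F) (v * w)
      = TensorProduct.map (antipode F) (antipode F) w *
        TensorProduct.map (antipode F) (antipode F) v := by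
    intro w v
    induction w using TensorProduct.induction_on with
    | zero => simp
    | add a b ha hb => simp only [map_add, add_mul, mul_add, ha, hb]
    | tmul p q =>
      induction v using TensorProduct.induction_on with
      | zero => simp
      | add a b ha hb => simp only [map_add, add_mul, mul_add, ha, hb]
      | tmul p q => simp [antipode_mul_antidistrib]
  have e3 : ∀ v : K ⊗[F] K, flip (TensorProduct.map (antipode F) (antipode F) (flip v))
      = TensorProduct.map (antipode F) (antipode F) v := by
    intro v
    induction v using TensorProduct.induction_on with
    | zero => simp
    | add a b ha hb => simp only [map_add, ha, hb]
    | tmul p q => simp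
  have e2 : ∀ (M : K ⊗[F] B), σ (scal w * copr M) = coprOp (rev γ M) * scal w := by
    intro M
    induction M using TensorProduct.induction_on with
    | zero => simp
    | add a b ha hb => simp only [map_add, add_mul, mul_add, ha, hb]
    | tmul k b =>
      simp only [σ, scal_apply, coprOp_tmul, rev_tmul, copr_tmul, Algebra.TensorProduct.tmul_mul_tmul,
        mul_one, one_mul, LinearMap.rTensor_tmul, LinearMap.comp_apply, LinearMap.mulLeft_apply,
        e0, hw, Bialgebra.comul_mul, hγ, comul_antipode, map_mul, e3,
        Algebra.TensorProduct.comm_tmul]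
      rw [← mul_assoc]
  rw [← e1, h, e2]

end Legs

end HopfGauge

end

noncomputable section

namespace HopfGauge

open Coalgebra HopfAlgebra

/-! ### Linear maps on `K*` as elements of `K ⊗ B` -/

section Universal

variable {F K B : Type*} [Field F] [Ring K] [HopfAlgebra F K] [Semiring B] [Algebra F B]

/-- Evaluation of the first factor of `K ⊗ B`. -/
def ev (α : Module.Dual F K) : K ⊗[F] B →ₗ[F] B :=
  (TensorProduct.lid F B).toLinearMap ∘ₗ α.rTensor B

@[simp] theorem ev_tmul (α : Module.Dual F K) (k : K) (b : B) : ev α (k ⊗ₜ[F] b) = α k • b := by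
  simp [ev]

/-- Evaluation of the first two factors of `K ⊗ K ⊗ B`. -/
def ev₂ (α β : Module.Dual F K) : (K ⊗[F] K) ⊗[F] B →ₗ[F] B :=
  (TensorProduct.lid F B).toLinearMap ∘ₗ (TensorProduct.dualDistrib F K K (α ⊗ₜ β)).rTensor B

@[simp] theorem ev₂_tmul (α β : Module.Dual F K) (w : K ⊗[F] K) (b : B) :
    ev₂ α β (w ⊗ₜ[F] b) = TensorProduct.dualDistrib F K K (α ⊗ₜ β) w • b := by
  simp [ev₂]

@[simp] theorem dualMul_apply (W : K →ₗ[F] K ⊗[F] K) (α β : Module.Dual F K) (k : K) :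
    dualMul W α β k = TensorProduct.dualDistrib F K K (α ⊗ₜ β) (W k) := rfl

@[simp] theorem revDual_apply (g : K) (α : Module.Dual F K) (k : K) :
    revDual g α k = α (g * antipode F k) := rfl

theorem ev_mul_left (α : Module.Dual F K) (h : K) (z : K ⊗[F] B) :
    ev α ((h ⊗ₜ 1) * z) = ev (α ∘ₗ LinearMap.mulLeft F h) z := by
  induction z using TensorProduct.induction_on with
  | zero => simp
  | add a b ha hb => simp only [map_add, mul_add, ha, hb]
  | tmul k b => simp

theorem ev_one_tmul_mul (α : Module.Dual F K) (b : B) (z : K ⊗[F] B) :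
    ev α ((1 ⊗ₜ b) * z) = b * ev α z := by
  induction z using TensorProduct.induction_on with
  | zero => simp
  | add a b ha hb => simp only [map_add, mul_add, ha, hb]
  | tmul k b => simp

theorem ev_mul_one_tmul (α : Module.Dual F K) (b : B) (z : K ⊗[F] B) :
    ev α (z * (1 ⊗ₜ b)) = ev α z * b := by
  induction z using TensorProduct.induction_on with
  | zero => simp
  | add a b ha hb => simp only [map_add, add_mul, ha, hb]
  | tmul k b => simp

theorem ev_rev (α : Module.Dual F K) (γ : K) (z : K ⊗[F] B) :
    ev α (rev γ z) = ev (revDual γ α) z := by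
  induction z using TensorProduct.induction_on with
  | zero => simp
  | add a b ha hb => simp only [map_add, ha, hb]
  | tmul k b => simp

theorem ev₂_leg₂_mul_leg₁ (α β : Module.Dual F K) (z z' : K ⊗[F] B) :
    ev₂ α β (leg₂ z * leg₁ z') = ev β z * ev α z' := by
  induction z using TensorProduct.induction_on with
  | zero => simp
  | add a b ha hb => simp only [map_add, add_mul, ha, hb]
  | tmul k b =>
    induction z' using TensorProduct.induction_on with
    | zero => simp
    | add a b ha hb => simp only [map_add, mul_add, ha, hb]
    | tmul k b => simp [mul_smul]

theorem ev₂_leg₁_mul_leg₂ (α β : Module.Dual F K) (z z' : K ⊗[F] B) :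
    ev₂ α β (leg₁ z * leg₂ z') = ev α z * ev β z' := by
  induction z using TensorProduct.induction_on with
  | zero => simp
  | add a b ha hb => simp only [map_add, add_mul, ha, hb]
  | tmul k b =>
    induction z' using TensorProduct.induction_on with
    | zero => simp
    | add a b ha hb => simp only [map_add, mul_add, ha, hb]
    | tmul k' b' => simp [mul_smul, smul_comm (α k)]

theorem ev₂_scal_mul (α β : Module.Dual F K) (x y : K) (z : (K ⊗[F] K) ⊗[F] B) :
    ev₂ α β (scal (x ⊗ₜ y) * z)
      = ev₂ (α ∘ₗ LinearMap.mulLeft F x) (β ∘ₗ LinearMap.mulLeft F y) z := by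
  induction z using TensorProduct.induction_on with
  | zero => simp
  | add a b ha hb => simp only [map_add, mul_add, ha, hb]
  | tmul w b =>
    induction w using TensorProduct.induction_on with
    | zero => simp
    | add a b ha hb => simp only [TensorProduct.add_tmul, map_add, mul_add, ha, hb]
    | tmul k l => simp [scal_apply]

theorem ev₂_scal_mul_copr (α β : Module.Dual F K) (w : K ⊗[F] K) (z : K ⊗[F] B) :
    ev₂ α β (scal w * copr z) = ev (dualMul (LinearMap.mulLeft F w ∘ₗ comul) α β) z := by
  induction z using TensorProduct.induction_on with
  | zero => simp
  | add a b ha hb => simp only [map_add, mul_add, ha, hb]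
  | tmul k b => simp [scal_apply]

theorem ev₂_coprOp_mul_scal (α β : Module.Dual F K) (w : K ⊗[F] K) (z : K ⊗[F] B) :
    ev₂ α β (coprOp z * scal w)
      = ev (dualMul (LinearMap.mulRight F w ∘ₗ
          (flip : K ⊗[F] K ≃ₐ[F] K ⊗[F] K).toLinearMap ∘ₗ comul) α β) z := by
  induction z using TensorProduct.induction_on with
  | zero => simp
  | add a b ha hb => simp only [map_add, add_mul, ha, hb]
  | tmul k b => 
    rw [coprOp_tmul, scal_apply, Algebra.TensorProduct.tmul_mul_tmul, ev₂_tmul, ev_tmul, mul_one]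
    rfl

theorem coprOp_mul_scal {R : (K ⊗[F] K)ˣ} (hR : IsRMatrix R) (z : K ⊗[F] B) :
    coprOp z * scal (R : K ⊗[F] K) = scal (R : K ⊗[F] K) * copr z := by
  induction z using TensorProduct.induction_on with
  | zero => simp
  | add a b ha hb => simp only [map_add, add_mul, mul_add, ha, hb]
  | tmul k b => simp [scal_apply, hR.mul_comul]

variable [FiniteDimensional F K]

/-- Finite dimension of K enters here: an element of K ⊗ B is recovered from its coordinates, so
identities in K ⊗ B can be tested on functionals and conversely. -/
theorem ev_ext {z z' : K ⊗[F] B} (h : ∀ α, ev α z = ev α z') : z = z' := by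
  set b := Module.finBasis F K
  have key : ∀ z : K ⊗[F] B, z = ∑ i, b i ⊗ₜ[F] ev (b.coord i) z := by
    intro z
    induction z using TensorProduct.induction_on with
    | zero => simp
    | add x y hx hy =>
      simp only [map_add, TensorProduct.tmul_add, Finset.sum_add_distrib]; rw [← hx, ← hy]
    | tmul k x =>
      simp only [ev_tmul, ← TensorProduct.smul_tmul, ← TensorProduct.sum_tmul]
      congr 1
      exact (b.sum_repr k).symm
  rw [key z, key z']
  simp only [h]

theorem ev₂_ext {z z' : (K ⊗[F] K) ⊗[F] B} (h : ∀ α β, ev₂ α β z = ev₂ α β z') : z = z' := by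
  set b := Module.finBasis F K
  have key : ∀ z : (K ⊗[F] K) ⊗[F] B,
      z = ∑ i, ∑ j, (b i ⊗ₜ[F] b j) ⊗ₜ[F] ev₂ (b.coord i) (b.coord j) z := by
    intro z
    induction z using TensorProduct.induction_on with
    | zero => simp
    | add x y hx hy =>
      simp only [map_add, TensorProduct.tmul_add, Finset.sum_add_distrib]; rw [← hx, ← hy]
    | tmul w x =>
      induction w using TensorProduct.induction_on with
      | zero => simp
      | add u v hu hv =>
        simp only [TensorProduct.add_tmul, map_add, TensorProduct.tmul_add,
          Finset.sum_add_distrib]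
        rw [← hu, ← hv]
      | tmul k l =>
        simp only [ev₂_tmul, TensorProduct.dualDistrib_apply, ← TensorProduct.smul_tmul,
          ← TensorProduct.sum_tmul]
        congr 1
        calc k ⊗ₜ[F] l = (∑ i, b.repr k i • b i) ⊗ₜ[F] (∑ j, b.repr l j • b j) := by
              rw [b.sum_repr k, b.sum_repr l]
          _ = _ := by
              simp only [TensorProduct.sum_tmul, TensorProduct.tmul_sum, ← TensorProduct.smul_tmul',
                TensorProduct.tmul_smul, Module.Basis.coord_apply, mul_smul]
              simp only [Finset.smul_sum]
              rw [Finset.sum_comm]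
              exact Finset.sum_congr rfl fun i _ => Finset.sum_congr rfl fun j _ => smul_comm _ _ _
  rw [key z, key z']
  simp only [h]

variable (F K) in
/-- The canonical element of `K ⊗ K*`. -/
def canon : K ⊗[F] Module.Dual F K :=
  ∑ i, Module.finBasis F K i ⊗ₜ[F] (Module.finBasis F K).coord i

/-- The element of `K ⊗ B` that corresponds to a linear map `K* → B`. -/
def univ (f : Module.Dual F K →ₗ[F] B) : K ⊗[F] B := f.lTensor K (canon F K)

@[simp] theorem ev_univ (α : Module.Dual F K) (f : Module.Dual F K →ₗ[F] B) :
    ev α (univ f) = f α := by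
  simp only [univ, canon, map_sum, LinearMap.lTensor_tmul, ev_tmul, ← map_smul]
  rw [← map_sum]
  congr 1
  exact (Module.finBasis F K).sum_dual_apply_smul_coord α

theorem rev_univ (γ : K) (f : Module.Dual F K →ₗ[F] B) :
    rev γ (univ f) = univ (f ∘ₗ revDual γ) :=
  ev_ext fun α => by simp [ev_rev]

theorem dualDistrib_comulDual (α : Module.Dual F K) :
    TensorProduct.dualDistrib F K K (comulDual α) = α ∘ₗ LinearMap.mul' F K :=
  (TensorProduct.dualDistribEquiv F K K).apply_symm_apply _

theorem comulDual_eq (α : Module.Dual F K) :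
    comulDual α = ∑ i, ∑ j, α (Module.finBasis F K i * Module.finBasis F K j) •
      ((Module.finBasis F K).coord i ⊗ₜ[F] (Module.finBasis F K).coord j) := by
  set b := Module.finBasis F K
  refine (TensorProduct.dualDistribEquiv F K K).injective ?_
  change TensorProduct.dualDistrib F K K _ = TensorProduct.dualDistrib F K K _
  rw [dualDistrib_comulDual]
  refine (b.tensorProduct b).ext fun p => ?_
  obtain ⟨p, q⟩ := p
  simp [Module.Basis.tensorProduct_apply, Finsupp.single_apply, Finset.sum_ite_eq]

/-- Multiplication in K ⊗ B is convolution of maps on K*. Since G* is built from the coproduct of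
K*, it turns a function of an edge into a product of the matrices of its two ends. -/
theorem ev_univ_mul (α : Module.Dual F K) (f f' : Module.Dual F K →ₗ[F] B) :
    ev α (univ f * univ f') = LinearMap.mul' F B (TensorProduct.map f f' (comulDual α)) := by
  rw [comulDual_eq]
  simp [univ, canon, Finset.sum_mul_sum]

end Universal

/-! ### The module algebras of the edge ends -/

section EdgeEnds

variable {F K : Type*} [Field F] [Ring K] [HopfAlgebra F K]

theorem endAct_false_apply (h : K) (α : Module.Dual F K) :
    endAct false h α = α ∘ₗ LinearMap.mulLeft F h := rfl

theorem endAct_true_apply (h : K) (α : Module.Dual F K) :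
    endAct true h α = α ∘ₗ LinearMap.mulRight F (antipode F h) := rfl

theorem isRightAct_endAct (out : Bool) :
    IsRightAct (F := F) (K := K) (B := Module.End F (Module.Dual F K)) (endAct out) := by
  cases out
  · exact ⟨by ext α k; simp [endAct_false_apply],
      fun h k => by ext α l; simp [endAct_false_apply]⟩
  · exact ⟨by ext α k; simp [endAct_true_apply],
      fun h k => by ext α l; simp [endAct_true_apply, antipode_mul_antidistrib]⟩

theorem endAct_counit (out : Bool) (h : K) :
    endAct (F := F) out h (counit : K →ₗ[F] F) = counit (R := F) h • (counit : K →ₗ[F] F) := by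
  cases out
  · ext k; simp [endAct_false_apply]
  · ext k; simp [endAct_true_apply, mul_comm]

/-- The structure constants of the product of the functions of one edge end. -/
def endTwist (R : (K ⊗[F] K)ˣ) (sel : Bool) : (K ⊗[F] K)ˣ := if sel then R else 1

/-- Because R Δ = Δᵒᵖ R, the two products of a selected end agree; the orientation matters only for
ends that are not selected. -/
theorem endMul_true {R : (K ⊗[F] K)ˣ} (hR : IsRMatrix R) (out : Bool) (α β : Module.Dual F K) :
    endMul (R : K ⊗[F] K) out true α β
      = dualMul (LinearMap.mulLeft F (R : K ⊗[F] K) ∘ₗ comul) β α := by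
  cases out
  · rfl
  · ext k
    have := hR.mul_comul k
    simp only [endMul, LinearMap.flip_apply, dualMul_apply, LinearMap.comp_apply,
      LinearMap.mulRight_apply, LinearMap.mulLeft_apply]
    rw [this]; rfl

theorem dualMul_assoc {W : K →ₗ[F] K ⊗[F] K}
    (hW : ∀ k, TensorProduct.map W LinearMap.id (W k)
      = (TensorProduct.assoc F K K K).symm (TensorProduct.map LinearMap.id W (W k)))
    (α β γ : Module.Dual F K) :
    dualMul W (dualMul W α β) γ = dualMul W α (dualMul W β γ) := by
  ext k
  let T : (K ⊗[F] K) ⊗[F] K →ₗ[F] F :=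
    TensorProduct.dualDistrib F (K ⊗[F] K) K (TensorProduct.dualDistrib F K K (α ⊗ₜ β) ⊗ₜ γ)
  have h1 : ∀ z : K ⊗[F] K, TensorProduct.dualDistrib F K K (dualMul W α β ⊗ₜ γ) z
      = T (TensorProduct.map W LinearMap.id z) := by
    intro z
    induction z using TensorProduct.induction_on with
    | zero => simp
    | add a b ha hb => simp only [map_add, ha, hb]
    | tmul k b => simp [T]
  have h3 : ∀ (k : K) (w : K ⊗[F] K), T ((TensorProduct.assoc F K K K).symm (k ⊗ₜ w))
      = α k * TensorProduct.dualDistrib F K K (β ⊗ₜ γ) w := by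
    intro k w
    induction w using TensorProduct.induction_on with
    | zero => simp
    | add a b ha hb => simp only [TensorProduct.tmul_add, map_add, mul_add, ha, hb]
    | tmul k b => simp [T, mul_assoc]
  have h2 : ∀ z : K ⊗[F] K, TensorProduct.dualDistrib F K K (α ⊗ₜ dualMul W β γ) z
      = T ((TensorProduct.assoc F K K K).symm (TensorProduct.map LinearMap.id W z)) := by
    intro z
    induction z using TensorProduct.induction_on with
    | zero => simp
    | add a b ha hb => simp only [map_add, ha, hb]
    | tmul k b => simp [h3]
  rw [dualMul_apply, dualMul_apply, h1, h2, hW]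

theorem dualMul_comul_assoc (α β γ : Module.Dual F K) :
    dualMul (comul : K →ₗ[F] _) (dualMul comul α β) γ = dualMul comul α (dualMul comul β γ) :=
  dualMul_assoc (fun k => (coassoc_symm_apply (R := F) k).symm) α β γ

/-- The twisted coproduct R Δ is coassociative: after coassociativity of Δ the claim is R₁₂R₁₃R₂₃ =
R₂₃R₁₃R₁₂. -/
theorem dualMul_twist_assoc {R : (K ⊗[F] K)ˣ} (hR : IsRMatrix R) (α β γ : Module.Dual F K) :
    dualMul (LinearMap.mulLeft F (R : K ⊗[F] K) ∘ₗ comul)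
        (dualMul (LinearMap.mulLeft F (R : K ⊗[F] K) ∘ₗ comul) α β) γ
      = dualMul (LinearMap.mulLeft F (R : K ⊗[F] K) ∘ₗ comul) α
        (dualMul (LinearMap.mulLeft F (R : K ⊗[F] K) ∘ₗ comul) β γ) := by
  refine dualMul_assoc (fun k => ?_) α β γ
  let Δ₁ : K ⊗[F] K →ₐ[F] (K ⊗[F] K) ⊗[F] K :=
    Algebra.TensorProduct.map (Bialgebra.comulAlgHom F K) (AlgHom.id F K)
  let Δ₂ : K ⊗[F] K →ₐ[F] (K ⊗[F] K) ⊗[F] K :=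
    (Algebra.TensorProduct.assoc F F F K K K).symm.toAlgHom.comp
      (Algebra.TensorProduct.map (AlgHom.id F K) (Bialgebra.comulAlgHom F K))
  let j₂₃ : K ⊗[F] K →ₐ[F] (K ⊗[F] K) ⊗[F] K := Algebra.TensorProduct.map
          (Algebra.TensorProduct.includeRight : K →ₐ[F] K ⊗[F] K) (AlgHom.id F K)
  have h1 : ∀ z : K ⊗[F] K, TensorProduct.map
      (LinearMap.mulLeft F (R : K ⊗[F] K) ∘ₗ comul : K →ₗ[F] _) LinearMap.id z
      = ((R : K ⊗[F] K) ⊗ₜ[F] (1 : K)) * Δ₁ z := by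
    intro z
    induction z using TensorProduct.induction_on with
    | zero => simp
    | add a b ha hb => simp only [map_add, mul_add, ha, hb]
    | tmul k b => simp [Δ₁]
  have h3 : ∀ (k : K) (w v : K ⊗[F] K), (TensorProduct.assoc F K K K).symm (k ⊗ₜ[F] (v * w))
      = j₂₃ v * (TensorProduct.assoc F K K K).symm (k ⊗ₜ[F] w) := by
    intro k w v
    induction w using TensorProduct.induction_on with
    | zero => simp
    | add a b ha hb => simp only [TensorProduct.tmul_add, map_add, mul_add, ha, hb]
    | tmul p q =>
      induction v using TensorProduct.induction_on with
      | zero => simp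
      | add a b ha hb => simp only [TensorProduct.tmul_add, map_add, add_mul, ha, hb]
      | tmul r s => simp [j₂₃]
  have h2 : ∀ z : K ⊗[F] K, (TensorProduct.assoc F K K K).symm (TensorProduct.map LinearMap.id
      (LinearMap.mulLeft F (R : K ⊗[F] K) ∘ₗ comul : K →ₗ[F] _) z)
      = j₂₃ R * Δ₂ z := by
    intro z
    induction z using TensorProduct.induction_on with
    | zero => simp
    | add a b ha hb => simp only [map_add, mul_add, ha, hb]
    | tmul k b =>
      simp only [TensorProduct.map_tmul, LinearMap.id_apply, LinearMap.comp_apply,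
        LinearMap.mulLeft_apply, h3]
      rfl
  rw [h1, h2]
  simp only [LinearMap.comp_apply, LinearMap.mulLeft_apply, map_mul]
  have e1 := hR.comul_left
  have e2 := hR.comul_right
  have e3 : Δ₁ (comul k) = Δ₂ (comul k) := (coassoc_symm_apply (R := F) k).symm
  have e4 := hR.yangBaxter
  rw [e3, ← mul_assoc, ← mul_assoc]
  congr 1
  change _ * TensorProduct.map _ _ (R : K ⊗[F] K) = _ * (TensorProduct.assoc F K K K).symm
    (TensorProduct.map _ _ (R : K ⊗[F] K))
  erw [e1, e2, e4]
  rw [mul_assoc]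

/-- Associativity, in the form that left multiplications are closed under composition. All products
are studied through left multiplication operators. -/
theorem endMul_endMul {R : (K ⊗[F] K)ˣ} (hR : IsRMatrix R) (out sel : Bool)
    (α β : Module.Dual F K) :
    endMul (R : K ⊗[F] K) out sel α * endMul (R : K ⊗[F] K) out sel β
      = endMul (R : K ⊗[F] K) out sel (endMul (R : K ⊗[F] K) out sel α β) := by
  refine LinearMap.ext fun γ => ?_
  rw [Module.End.mul_apply]
  cases sel
  · cases out
    · exact (dualMul_comul_assoc α β γ).symm
    · exact dualMul_comul_assoc γ β α
  · simp only [endMul_true hR]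
    exact dualMul_twist_assoc hR γ β α

theorem dualDistrib_counit_left (α : Module.Dual F K) (w : K ⊗[F] K) :
    TensorProduct.dualDistrib F K K ((counit : K →ₗ[F] F) ⊗ₜ α) w
      = α (TensorProduct.lid F K (TensorProduct.map counit LinearMap.id w)) := by
  induction w using TensorProduct.induction_on with
  | zero => simp
  | add a b ha hb => simp only [map_add, ha, hb]
  | tmul k l => simp

theorem dualDistrib_counit_right (α : Module.Dual F K) (w : K ⊗[F] K) :
    TensorProduct.dualDistrib F K K (α ⊗ₜ (counit : K →ₗ[F] F)) w
      = α (TensorProduct.rid F K (TensorProduct.map LinearMap.id counit w)) := by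
  induction w using TensorProduct.induction_on with
  | zero => simp
  | add a b ha hb => simp only [map_add, ha, hb]
  | tmul k l => simp [mul_comm]

theorem lid_counit_mul (w v : K ⊗[F] K) :
    TensorProduct.lid F K (TensorProduct.map (counit (R := F)) LinearMap.id (w * v))
      = TensorProduct.lid F K (TensorProduct.map (counit (R := F)) LinearMap.id w) *
        TensorProduct.lid F K (TensorProduct.map (counit (R := F)) LinearMap.id v) := by
  induction w using TensorProduct.induction_on with
  | zero => simp
  | add a b ha hb => simp only [map_add, add_mul, ha, hb]
  | tmul k l =>
    induction v using TensorProduct.induction_on with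
    | zero => simp
    | add a b ha hb => simp only [map_add, mul_add, ha, hb]
    | tmul k' l' =>
      simp only [TensorProduct.map_tmul, Algebra.TensorProduct.tmul_mul_tmul, LinearMap.id_apply,
        TensorProduct.lid_tmul, Bialgebra.counit_mul, smul_mul_smul_comm]

theorem rid_counit_mul (w v : K ⊗[F] K) :
    TensorProduct.rid F K (TensorProduct.map LinearMap.id (counit (R := F)) (w * v))
      = TensorProduct.rid F K (TensorProduct.map LinearMap.id (counit (R := F)) w) *
        TensorProduct.rid F K (TensorProduct.map LinearMap.id (counit (R := F)) v) := by
  induction w using TensorProduct.induction_on with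
  | zero => simp
  | add a b ha hb => simp only [map_add, add_mul, ha, hb]
  | tmul k l =>
    induction v using TensorProduct.induction_on with
    | zero => simp
    | add a b ha hb => simp only [map_add, mul_add, ha, hb]
    | tmul k' l' =>
      simp only [TensorProduct.map_tmul, Algebra.TensorProduct.tmul_mul_tmul, LinearMap.id_apply,
        TensorProduct.rid_tmul, Bialgebra.counit_mul, smul_mul_smul_comm]

theorem lid_counit_comul (k : K) :
    TensorProduct.lid F K (TensorProduct.map (counit (R := F)) LinearMap.id (comul k)) = k := by
  have := Coalgebra.rTensor_counit_comul (R := F) k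
  rw [LinearMap.rTensor] at this
  rw [this]; simp

theorem rid_counit_comul (k : K) :
    TensorProduct.rid F K (TensorProduct.map LinearMap.id (counit (R := F)) (comul k)) = k := by
  have := Coalgebra.lTensor_counit_comul (R := F) k
  rw [LinearMap.lTensor] at this
  rw [this]; simp

theorem endMul_counit_right {R : (K ⊗[F] K)ˣ} (hR : IsRMatrix R) (out sel : Bool)
    (α : Module.Dual F K) :
    endMul (R : K ⊗[F] K) out sel α (counit : K →ₗ[F] F) = α := by
  cases sel
  · cases out
    · refine LinearMap.ext fun k => ?_
      change TensorProduct.dualDistrib F K K (α ⊗ₜ (counit : K →ₗ[F] F)) (comul k) = α k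
      rw [dualDistrib_counit_right, rid_counit_comul]
    · refine LinearMap.ext fun k => ?_
      change TensorProduct.dualDistrib F K K ((counit : K →ₗ[F] F) ⊗ₜ α) (comul k) = α k
      rw [dualDistrib_counit_left, lid_counit_comul]
  · rw [endMul_true hR]
    refine LinearMap.ext fun k => ?_
    rw [dualMul_apply, dualDistrib_counit_left, LinearMap.comp_apply, LinearMap.mulLeft_apply,
      lid_counit_mul, hR.counit_left, lid_counit_comul, one_mul]

theorem endMul_counit {R : (K ⊗[F] K)ˣ} (hR : IsRMatrix R) (out sel : Bool) :
    endMul (R : K ⊗[F] K) out sel (counit : K →ₗ[F] F) = 1 := by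
  refine LinearMap.ext fun α => ?_
  rw [Module.End.one_apply]
  cases sel
  · cases out
    · refine LinearMap.ext fun k => ?_
      change TensorProduct.dualDistrib F K K ((counit : K →ₗ[F] F) ⊗ₜ α) (comul k) = α k
      rw [dualDistrib_counit_left, lid_counit_comul]
    · refine LinearMap.ext fun k => ?_
      change TensorProduct.dualDistrib F K K (α ⊗ₜ (counit : K →ₗ[F] F)) (comul k) = α k
      rw [dualDistrib_counit_right, rid_counit_comul]
  · rw [endMul_true hR]
    refine LinearMap.ext fun k => ?_
    rw [dualMul_apply, dualDistrib_counit_right, LinearMap.comp_apply, LinearMap.mulLeft_apply,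
      rid_counit_mul, hR.counit_right, rid_counit_comul, one_mul]

theorem dualDistrib_mul_left (α β : Module.Dual F K) (x y : K) (w : K ⊗[F] K) :
    TensorProduct.dualDistrib F K K (α ⊗ₜ β) ((x ⊗ₜ y) * w)
      = TensorProduct.dualDistrib F K K
        ((α ∘ₗ LinearMap.mulLeft F x) ⊗ₜ (β ∘ₗ LinearMap.mulLeft F y)) w := by
  induction w using TensorProduct.induction_on with
  | zero => simp
  | add a b ha hb => simp only [map_add, mul_add, ha, hb]
  | tmul k l => simp

theorem dualDistrib_mul_right (α β : Module.Dual F K) (x y : K) (w : K ⊗[F] K) :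
    TensorProduct.dualDistrib F K K (α ⊗ₜ β) (w * (x ⊗ₜ y))
      = TensorProduct.dualDistrib F K K
        ((α ∘ₗ LinearMap.mulRight F x) ⊗ₜ (β ∘ₗ LinearMap.mulRight F y)) w := by
  induction w using TensorProduct.induction_on with
  | zero => simp
  | add a b ha hb => simp only [map_add, add_mul, ha, hb]
  | tmul k l => simp

/-- The functions of one edge end form a module algebra. -/
theorem endAct_mul_endMul {R : (K ⊗[F] K)ˣ} (hR : IsRMatrix R) (out sel : Bool) (h : K)
    (α : Module.Dual F K) :
    endAct out h * endMul (R : K ⊗[F] K) out sel α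
      = conv (endMul (R : K ⊗[F] K) out sel ∘ₗ (endAct out).flip α) (endAct out) h := by
  refine LinearMap.ext fun β => LinearMap.ext fun k => ?_
  rw [conv, LinearMap.comp_apply, LinearMap.comp_apply]
  have hS := comul_antipode (F := F) h
  have hRh := hR.mul_comul h
  rw [← (ℛ F h).eq] at hS hRh ⊢
  simp only [map_sum, Algebra.TensorProduct.comm_tmul, TensorProduct.map_tmul, LinearMap.comp_apply,
    LinearMap.sum_apply, LinearMap.mul'_apply, Module.End.mul_apply] at hS hRh ⊢
  cases sel
  · cases out
    · change TensorProduct.dualDistrib F K K (α ⊗ₜ β) (comul (h * k)) = _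
      rw [Bialgebra.comul_mul, ← (ℛ F h).eq, Finset.sum_mul, map_sum]
      refine Finset.sum_congr rfl fun i _ => ?_
      rw [dualDistrib_mul_left]
      rfl
    · change TensorProduct.dualDistrib F K K (β ⊗ₜ α) (comul (k * antipode F h)) = _
      rw [Bialgebra.comul_mul, hS, Finset.mul_sum, map_sum]
      refine Finset.sum_congr rfl fun i _ => ?_
      rw [dualDistrib_mul_right]
      rfl
  -- The selected product evaluates β ⊗ α. For an incoming end R Δ(h) = Δᵒᵖ(h) R flips the
  -- components of h, for an outgoing end Δ(S(h)) does; either flip matches the exchanged order of α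
  -- and β.
  · simp only [endMul_true hR, dualMul_apply]
    cases out
    · change TensorProduct.dualDistrib F K K (β ⊗ₜ α)
        ((R : K ⊗[F] K) * comul (h * k)) = _
      rw [Bialgebra.comul_mul, ← mul_assoc, ← (ℛ F h).eq, hRh, Finset.sum_mul, Finset.sum_mul,
        map_sum]
      refine Finset.sum_congr rfl fun i _ => ?_
      rw [mul_assoc, dualDistrib_mul_left]
      rfl
    · change TensorProduct.dualDistrib F K K (β ⊗ₜ α)
        ((R : K ⊗[F] K) * comul (k * antipode F h)) = _
      rw [Bialgebra.comul_mul, hS, ← mul_assoc, Finset.mul_sum, map_sum]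
      refine Finset.sum_congr rfl fun i _ => ?_
      rw [dualDistrib_mul_right]
      rfl

/-- The map `κ` of `K*` under which the functions of an edge end transform like those of an
incoming one. -/
def straighten (g : K) (out : Bool) : Module.Dual F K →ₗ[F] Module.Dual F K :=
  if out then revDual g else LinearMap.id

theorem revDual_revDual {g : K} (hg : IsPivotal F g) (α : Module.Dual F K) :
    revDual g (revDual g α) = α := by
  ext k
  rw [revDual_apply, revDual_apply, antipode_mul_antidistrib, ← mul_assoc, hg.mul_antipode_antipode,
    mul_assoc, hg.mul_antipode, mul_one]

theorem revDual_comp_revDual {g : K} (hg : IsPivotal F g) :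
    (revDual g ∘ₗ revDual g : Module.Dual F K →ₗ[F] Module.Dual F K) = LinearMap.id :=
  LinearMap.ext fun α => revDual_revDual hg α

theorem straighten_straighten {g : K} (hg : IsPivotal F g) (out : Bool) (α : Module.Dual F K) :
    straighten g out (straighten g out α) = α := by
  cases out
  · rfl
  · exact revDual_revDual hg α

/-- The rule g S²(h) = h g turns right multiplication by S(h) into left multiplication by h. Hence
after κ the orientation of an edge end no longer shows in the action. -/
theorem endAct_straighten {g : K} (hg : IsPivotal F g) (out : Bool) (h : K)
    (α : Module.Dual F K) :
    endAct out h (straighten g out α) = straighten g out (α ∘ₗ LinearMap.mulLeft F h) := by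
  cases out
  · rfl
  · ext k
    simp only [endAct_true_apply, straighten, if_true, LinearMap.comp_apply, revDual_apply,
      LinearMap.mulRight_apply, LinearMap.mulLeft_apply, antipode_mul_antidistrib]
    rw [← mul_assoc, hg.mul_antipode_antipode, mul_assoc]

/-- On a grouplike element Δ and Δᵒᵖ agree, so g ⊗ g commutes with every R-matrix of K and not only
with the one from which g arises. -/
theorem IsPivotal.comm {g : K} (hg : IsPivotal F g) {R : (K ⊗[F] K)ˣ} (hR : IsRMatrix R) :
    (g ⊗ₜ[F] g) * (R : K ⊗[F] K) = (R : K ⊗[F] K) * (g ⊗ₜ[F] g) := by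
  have := hR.mul_comul g
  rw [hg.comul] at this
  rw [this]; rfl

theorem endTwist_map_antipode {R : (K ⊗[F] K)ˣ} (hR : IsRMatrix R) (sel : Bool) :
    TensorProduct.map (antipode F) (antipode F) (endTwist R sel : K ⊗[F] K) = endTwist R sel := by
  cases sel
  · exact isBraiding_one.map_both
  · exact hR.map_antipode_antipode

variable [FiniteDimensional F K]

/-- Left multiplication by the functions of an edge end. -/
def endLeft (R : K ⊗[F] K) (out sel : Bool) :
    Module.Dual F K →ₗ[F] Module.End F (Module.Dual F K) :=
  endMul R out sel

/-- Left multiplication by the functions of an edge end, composed with `κ`. -/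
def straightMul (R : K ⊗[F] K) (g : K) (out sel : Bool) :
    Module.Dual F K →ₗ[F] Module.End F (Module.Dual F K) :=
  endLeft R out sel ∘ₗ straighten g out

variable {B : Type*} [Semiring B] [Algebra F B]

/-- The product of the matrices of functions of one edge end. -/
theorem univ_straightMul_same {g : K} (hg : IsPivotal F g) {R : (K ⊗[F] K)ˣ} (hR : IsRMatrix R)
    (out sel : Bool) (ι : Module.End F (Module.Dual F K) →ₐ[F] B) :
    leg₂ (univ (ι.toLinearMap ∘ₗ straightMul (R : K ⊗[F] K) g out sel))
        * leg₁ (univ (ι.toLinearMap ∘ₗ straightMul (R : K ⊗[F] K) g out sel))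
      = coprOp (univ (ι.toLinearMap ∘ₗ straightMul (R : K ⊗[F] K) g out sel))
        * scal (endTwist R sel : K ⊗[F] K) := by
  have hmul : ∀ α β : Module.Dual F K, ι (endMul (R : K ⊗[F] K) out sel α) *
      ι (endMul (R : K ⊗[F] K) out sel β)
      = ι (endMul (R : K ⊗[F] K) out sel (endMul (R : K ⊗[F] K) out sel α β)) := by
    intro α β
    rw [← map_mul, endMul_endMul hR]
  cases out
  · refine ev₂_ext fun α β => ?_
    rw [ev₂_leg₂_mul_leg₁, ev_univ, ev_univ]
    refine (hmul β α).trans ?_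
    cases sel
    · rw [ev₂_coprOp_mul_scal, ev_univ, LinearMap.comp_apply, AlgHom.toLinearMap_apply]
      congr 2
      refine LinearMap.ext fun k => ?_
      change TensorProduct.dualDistrib F K K (β ⊗ₜ α) (comul k) =
        TensorProduct.dualDistrib F K K (α ⊗ₜ β) (flip (comul k) * 1)
      rw [mul_one]
      generalize comul (R := F) k = w
      induction w using TensorProduct.induction_on with
      | zero => simp
      | add a b ha hb => simp only [map_add, ha, hb]
      | tmul k l => simp [mul_comm]
    · have e : (endTwist R true) = R := rfl
      rw [e, coprOp_mul_scal hR, ev₂_scal_mul_copr, ev_univ, endMul_true hR]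
      rfl
  -- The unstraightened matrix of an outgoing end satisfies the relation with Δ in place of Δᵒᵖ;
  -- straightening is the reversal by g S, which exchanges the two.
  · have e : univ (ι.toLinearMap ∘ₗ straightMul (R : K ⊗[F] K) g true sel)
      = rev g (univ (ι.toLinearMap ∘ₗ endLeft (R : K ⊗[F] K) true sel)) := by
      rw [rev_univ, LinearMap.comp_assoc, straightMul, straighten, if_pos rfl]
    rw [e]
    refine rev_same' (endTwist_map_antipode hR sel) hg.comul ?_
    refine ev₂_ext fun α β => ?_
    rw [ev₂_leg₂_mul_leg₁, ev_univ, ev_univ, ev₂_scal_mul_copr, ev_univ]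
    refine (hmul β α).trans ?_
    cases sel
    · rw [LinearMap.comp_apply, AlgHom.toLinearMap_apply]
      congr 2
      refine LinearMap.ext fun k => ?_
      change TensorProduct.dualDistrib F K K (α ⊗ₜ β) (comul k) =
        TensorProduct.dualDistrib F K K (α ⊗ₜ β) (1 * (comul k))
      rw [one_mul]
    · rw [endMul_true hR]; rfl

end EdgeEnds

end HopfGauge

end

noncomputable section

namespace HopfGauge

open Coalgebra HopfAlgebra

/-! ### Convolution -/

section Convolution

variable {F K B B' : Type*} [Field F] [Ring K] [HopfAlgebra F K] [Semiring B] [Algebra F B]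
  [Semiring B'] [Algebra F B']

theorem conv_apply_repr {ι : Type*} {h : K} (r : Coalgebra.Repr F h ι) (a c : K →ₗ[F] B) :
    conv a c h = ∑ i ∈ r.index, a (r.left i) * c (r.right i) := by
  rw [conv, LinearMap.comp_apply, LinearMap.comp_apply, ← r.eq]
  simp

theorem conv_assoc (a c d : K →ₗ[F] B) : conv (conv a c) d = conv a (conv c d) :=
  congrArg WithConv.ofConv
    (mul_assoc (WithConv.toConv a) (WithConv.toConv c) (WithConv.toConv d))

theorem counit_conv (a : K →ₗ[F] B) : conv ((counit : K →ₗ[F] F).smulRight 1) a = a := by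
  ext h
  have := congrArg a (Coalgebra.sum_counit_smul (ℛ F h))
  rw [conv_apply_repr (ℛ F h)]
  simpa using this

theorem AlgHom.comp_conv (ι : B →ₐ[F] B') (a c : K →ₗ[F] B) :
    ι.toLinearMap ∘ₗ conv a c = conv (ι.toLinearMap ∘ₗ a) (ι.toLinearMap ∘ₗ c) := by
  ext h
  rw [conv_apply_repr (ℛ F h), LinearMap.comp_apply, conv_apply_repr (ℛ F h)]
  simp

theorem conv_commute {a c : K →ₗ[F] B} {T : B} (ha : ∀ h, T * a h = a h * T)
    (hc : ∀ h, T * c h = c h * T) (h : K) : T * conv a c h = conv a c h * T := by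
  rw [conv_apply_repr (ℛ F h), Finset.mul_sum, Finset.sum_mul]
  refine Finset.sum_congr rfl fun i _ => ?_
  rw [← mul_assoc, ha, mul_assoc, hc, mul_assoc]

theorem IsRightAct.conv {a c : K →ₗ[F] B} (ha : IsRightAct a) (hc : IsRightAct c)
    (hac : ∀ h k, a h * c k = c k * a h) : IsRightAct (conv a c) := by
  refine ⟨?_, fun h k => ?_⟩
  · simp [HopfGauge.conv, Algebra.TensorProduct.one_def, ha.one, hc.one]
  · have e : comul (R := F) (h * k) = ∑ i ∈ (ℛ F h).index, ∑ j ∈ (ℛ F k).index,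
        ((ℛ F h).left i * (ℛ F k).left j) ⊗ₜ[F] ((ℛ F h).right i * (ℛ F k).right j) := by
      rw [Bialgebra.comul_mul, ← (ℛ F h).eq, ← (ℛ F k).eq, Finset.sum_mul_sum]
      simp
    rw [conv_apply_repr (ℛ F h), conv_apply_repr (ℛ F k), HopfGauge.conv, LinearMap.comp_apply,
      LinearMap.comp_apply, e, Finset.sum_mul_sum, Finset.sum_comm]
    simp only [map_sum, TensorProduct.map_tmul, LinearMap.mul'_apply, ha.mul, hc.mul]
    refine Finset.sum_congr rfl fun i _ => Finset.sum_congr rfl fun j _ => ?_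
    rw [mul_assoc, ← mul_assoc (a _) (c _), hac, mul_assoc, mul_assoc]

theorem IsRightAct.map (ι : B →ₐ[F] B') {a : K →ₗ[F] B} (ha : IsRightAct a) :
    IsRightAct (ι.toLinearMap ∘ₗ a) :=
  ⟨by simp [ha.one], fun h k => by simp [ha.mul]⟩

/-- The trilinear map `(p, q, r) ↦ φ(p ⊗ q) M (1 ⊗ e(r))`. -/
def triple (φ : K ⊗[F] K →ₗ[F] K ⊗[F] B) (M : K ⊗[F] B) (e : K →ₗ[F] B) :
    K →ₗ[F] K →ₗ[F] K →ₗ[F] K ⊗[F] B :=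
  (TensorProduct.mk F K K).compr₂ (((LinearMap.mul F (K ⊗[F] B)).compl₂
    ((Algebra.TensorProduct.includeRight : B →ₐ[F] K ⊗[F] B).toLinearMap ∘ₗ e)) ∘ₗ
      LinearMap.mulRight F M ∘ₗ φ)

theorem triple_apply (φ : K ⊗[F] K →ₗ[F] K ⊗[F] B) (M : K ⊗[F] B) (e : K →ₗ[F] B) (p q r : K) :
    triple φ M e p q r = φ (p ⊗ₜ q) * M * ((1 : K) ⊗ₜ[F] e r) := rfl

theorem lift_triple (φ : K ⊗[F] K →ₗ[F] K ⊗[F] B) (M : K ⊗[F] B) (e : K →ₗ[F] B)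
    (w : K ⊗[F] K) (r : K) :
    TensorProduct.lift (triple φ M e) w r = φ w * M * ((1 : K) ⊗ₜ[F] e r) := by
  induction w using TensorProduct.induction_on with
  | zero => simp
  | add a b ha hb => simp only [map_add, LinearMap.add_apply, add_mul, ha, hb]
  | tmul k l => simp [triple_apply]

/-- Edge ends whose action commutes with M may be appended to the acting ones; this is
coassociativity. -/
theorem Transforms.conv_right {c d : K →ₗ[F] B} {M : K ⊗[F] B} (hc : Transforms c M)
    (hd : ∀ h, ((1 : K) ⊗ₜ[F] d h) * M = M * ((1 : K) ⊗ₜ[F] d h)) : Transforms (conv c d) M := by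
  intro h
  let f := triple (smash M c) 1 d
  have hf : ∀ p q r, f p q r = (p ⊗ₜ[F] (1 : B)) * M * ((1 : K) ⊗ₜ[F] c q) * ((1 : K) ⊗ₜ[F] d r) := by
    intro p q r
    rw [triple_apply, smash_tmul, mul_one]
  have h1 := sum_comul_comul (ℛ F h) f
  have e1 : ∀ k r, TensorProduct.lift f (comul k) r
      = ((1 : K) ⊗ₜ[F] c k) * M * ((1 : K) ⊗ₜ[F] d r) := by
    intro k r
    rw [hc k, lift_triple, mul_one]
  have e2 : ∀ p k, TensorProduct.lift (f p) (comul k)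
      = (p ⊗ₜ[F] (1 : B)) * M * ((1 : K) ⊗ₜ[F] conv c d k) := by
    intro p k
    rw [conv, LinearMap.comp_apply, LinearMap.comp_apply]
    generalize comul (R := F) k = w
    induction w using TensorProduct.induction_on with
    | zero => simp
    | add a b ha hb => simp only [map_add, TensorProduct.tmul_add, mul_add, ha, hb]
    | tmul k l => simp [hf, mul_assoc]
  simp only [e1, e2] at h1
  conv_rhs => rw [← (ℛ F h).eq, map_sum]
  simp only [smash_tmul, ← h1]
  rw [conv_apply_repr (ℛ F h), TensorProduct.tmul_sum, Finset.sum_mul]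
  refine Finset.sum_congr rfl fun i _ => ?_
  rw [mul_assoc _ M, ← hd, ← mul_assoc]
  simp

/-- The gauge transformations of the holonomy of an incoming edge end at a vertex. -/
theorem Transforms.twist_braided {R : (K ⊗[F] K)ˣ} (hR : IsRMatrix R) {a e : K →ₗ[F] B}
    {M : K ⊗[F] B} (ha : IsRightAct a) (he : Transforms e M)
    (hae : ∀ h k, a h * e k = e k * a h)
    (haM : ∀ h, ((1 : K) ⊗ₜ[F] a h) * M = M * ((1 : K) ⊗ₜ[F] a h)) :
    Transforms (conv a e) (twist (R : K ⊗[F] K) a * M) := by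
  intro h
  set T := twist (R : K ⊗[F] K) a with hT
  have heT : ∀ k, ((1 : K) ⊗ₜ[F] e k) * T = T * ((1 : K) ⊗ₜ[F] e k) := by
    intro k
    rw [hT, twist]
    generalize flip (R : K ⊗[F] K) = w
    induction w using TensorProduct.induction_on with
    | zero => simp
    | add a b ha hb => simp only [map_add, mul_add, add_mul, ha, hb]
    | tmul k l => simp [hae]
  let φ : K ⊗[F] K →ₗ[F] K ⊗[F] B := a.lTensor K ∘ₗ
    (flip : K ⊗[F] K ≃ₐ[F] K ⊗[F] K).toLinearMap ∘ₗ LinearMap.mulLeft F (R : K ⊗[F] K)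
  let φ' : K ⊗[F] K →ₗ[F] K ⊗[F] B := a.lTensor K ∘ₗ
    (flip : K ⊗[F] K ≃ₐ[F] K ⊗[F] K).toLinearMap ∘ₗ LinearMap.mulRight F (R : K ⊗[F] K) ∘ₗ
    (flip : K ⊗[F] K ≃ₐ[F] K ⊗[F] K).toLinearMap
  have hφ : ∀ p q, φ (p ⊗ₜ q) = ((1 : K) ⊗ₜ[F] a p) * T * (q ⊗ₜ[F] (1 : B)) := by
    intro p q
    change a.lTensor K (flip ((R : K ⊗[F] K) * (p ⊗ₜ q))) = _ * a.lTensor K (flip (R : K ⊗[F] K)) * _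
    generalize (R : K ⊗[F] K) = w
    induction w using TensorProduct.induction_on with
    | zero => simp
    | add a b ha hb => simp only [map_add, mul_add, add_mul, ha, hb]
    | tmul k l => simp [ha.mul]
  have hφ' : ∀ p q, φ' (p ⊗ₜ q) = (p ⊗ₜ[F] (1 : B)) * T * ((1 : K) ⊗ₜ[F] a q) := by
    intro p q
    change a.lTensor K (flip ((q ⊗ₜ p) * (R : K ⊗[F] K))) = _ * a.lTensor K (flip (R : K ⊗[F] K)) * _
    generalize (R : K ⊗[F] K) = w
    induction w using TensorProduct.induction_on with
    | zero => simp
    | add a b ha hb => simp only [map_add, mul_add, add_mul, ha, hb]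
    | tmul k l => simp [ha.mul]
  -- With T the twist, R Δ = Δᵒᵖ R becomes Σ (1 ⊗ a(h₍₁₎)) T (h₍₂₎ ⊗ 1) = Σ (h₍₁₎ ⊗ 1) T (1 ⊗
  -- a(h₍₂₎)). This carries the matrix part of the transformation of M from the right of T to its
  -- left.
  have hφφ' : ∀ k, φ (comul k) = φ' (comul k) := by
    intro k
    change a.lTensor K (flip ((R : K ⊗[F] K) * comul k)) = a.lTensor K (flip (flip (comul k) * _))
    rw [hR.mul_comul]
  let f := fun φ => triple φ M e
  have hf : ∀ φ p q r, f φ p q r = φ (p ⊗ₜ q) * M * ((1 : K) ⊗ₜ[F] e r) := fun φ p q r => rfl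
  have hf' : ∀ φ w r, TensorProduct.lift (f φ) w r = φ w * M * ((1 : K) ⊗ₜ[F] e r) :=
    fun φ w r => lift_triple φ M e w r
  have h1 := sum_comul_comul (ℛ F h) (f φ)
  have h2 := sum_comul_comul (ℛ F h) (f φ')
  have h3 : TensorProduct.lift (f φ) ∘ₗ comul = TensorProduct.lift (f φ') ∘ₗ comul := by
    ext k r
    simp only [LinearMap.comp_apply, hf', hφφ']
  have h4 := fun k => LinearMap.congr_fun h3 k
  simp only [LinearMap.comp_apply] at h4
  simp only [h4] at h1
  have e2 : ∀ p k, TensorProduct.lift (f φ' p) (comul k)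
      = (p ⊗ₜ[F] (1 : B)) * (T * M) * ((1 : K) ⊗ₜ[F] conv a e k) := by
    intro p k
    rw [conv, LinearMap.comp_apply, LinearMap.comp_apply]
    generalize comul (R := F) k = w
    induction w using TensorProduct.induction_on with
    | zero => simp
    | add a b ha hb => simp only [map_add, TensorProduct.tmul_add, mul_add, ha, hb]
    | tmul k l =>
      have : ((1 : K) ⊗ₜ[F] (a k * e l)) = ((1 : K) ⊗ₜ[F] a k) * ((1 : K) ⊗ₜ[F] e l) := by simp
      rw [TensorProduct.lift.tmul, hf, hφ', TensorProduct.map_tmul, LinearMap.mul'_apply, this]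
      simp only [mul_assoc]
      rw [← mul_assoc (1 ⊗ₜ[F] a k) M, haM, mul_assoc]
  have e1 : ∀ p k, TensorProduct.lift (f φ p) (comul k)
      = ((1 : K) ⊗ₜ[F] a p) * T * smash M e (comul k) := by
    intro p k
    generalize comul (R := F) k = w
    induction w using TensorProduct.induction_on with
    | zero => simp
    | add a b ha hb => simp only [map_add, mul_add, ha, hb]
    | tmul k l => 
      rw [TensorProduct.lift.tmul, hf, hφ, smash_tmul]
      simp only [mul_assoc]
  rw [h2] at h1
  simp only [e1, e2, ← he _] at h1
  conv_rhs => rw [← (ℛ F h).eq, map_sum]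
  simp only [smash_tmul, h1]
  rw [conv_apply_repr (ℛ F h), TensorProduct.tmul_sum, Finset.sum_mul]
  refine Finset.sum_congr rfl fun i _ => ?_
  have : ((1 : K) ⊗ₜ[F] (a ((ℛ F h).left i) * e ((ℛ F h).right i)))
    = ((1 : K) ⊗ₜ[F] a ((ℛ F h).left i)) * ((1 : K) ⊗ₜ[F] e ((ℛ F h).right i)) := by simp
  rw [this]
  simp only [mul_assoc]
  rw [← mul_assoc (1 ⊗ₜ[F] e _) T, heT, mul_assoc]

variable [FiniteDimensional F K]

theorem transforms_univ_iff (c : K →ₗ[F] B) (f : Module.Dual F K →ₗ[F] B) :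
    Transforms c (univ f) ↔ ∀ h α, c h * f α
      = ∑ i ∈ (ℛ F h).index, f (α ∘ₗ LinearMap.mulLeft F ((ℛ F h).left i)) * c ((ℛ F h).right i) := by
  have key : ∀ h α, ev α (smash (univ f) c (comul h))
      = ∑ i ∈ (ℛ F h).index, f (α ∘ₗ LinearMap.mulLeft F ((ℛ F h).left i)) * c ((ℛ F h).right i) := by
    intro h α
    conv_lhs => rw [← (ℛ F h).eq]
    simp only [map_sum, smash_tmul, ev_mul_one_tmul, ev_mul_left, ev_univ]
  constructor
  · intro H h α
    have := congrArg (ev α) (H h)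
    rwa [ev_one_tmul_mul, ev_univ, key] at this
  · intro H h
    refine ev_ext fun α => ?_
    rw [ev_one_tmul_mul, ev_univ, key, H]

theorem univ_commute {f : Module.Dual F K →ₗ[F] B} {T : B} (h : ∀ α, T * f α = f α * T) :
    ((1 : K) ⊗ₜ[F] T) * univ f = univ f * ((1 : K) ⊗ₜ[F] T) :=
  ev_ext fun α => by rw [ev_one_tmul_mul, ev_mul_one_tmul, ev_univ, h]

end Convolution

/-! ### Endomorphisms of one factor of a tensor product -/

section Factor

variable {F : Type*} [Field F] {ι : Type*} [DecidableEq ι] {M : ι → Type*}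
  [∀ i, AddCommMonoid (M i)] [∀ i, Module F (M i)]

/-- An endomorphism of the `i`-th factor as an endomorphism of the tensor product. -/
def atFactor (i : ι) : Module.End F (M i) →ₐ[F] Module.End F (⨂[F] i, M i) :=
  AlgHom.ofLinearMap ((PiTensorProduct.mapMultilinear F M M).toLinearMap (fun _ => LinearMap.id) i)
    (by
      change PiTensorProduct.map (Function.update (fun _ => LinearMap.id) i LinearMap.id) = 1
      rw [Function.update_eq_self]
      exact PiTensorProduct.map_one)
    (fun f f' => by
      change PiTensorProduct.map (Function.update (fun _ => LinearMap.id) i (f * f'))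
        = PiTensorProduct.map (Function.update (fun _ => LinearMap.id) i f) *
          PiTensorProduct.map (Function.update (fun _ => LinearMap.id) i f')
      rw [← PiTensorProduct.map_mul]
      congr 1
      funext j
      by_cases h : j = i
      · subst h; simp
      · simp [h, ← Module.End.one_eq_id])

theorem atFactor_tprod (i : ι) (f : Module.End F (M i)) (x : ∀ i, M i) :
    atFactor i f (PiTensorProduct.tprod F x)
      = PiTensorProduct.tprod F (Function.update x i (f (x i))) := by
  change PiTensorProduct.map (Function.update (fun _ => LinearMap.id) i f) _ = _
  rw [PiTensorProduct.map_tprod]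
  congr 1
  funext j
  by_cases h : j = i
  · subst h; simp
  · simp [h]

theorem atFactor_commute {i j : ι} (hij : i ≠ j) (f : Module.End F (M i))
    (f' : Module.End F (M j)) : atFactor i f * atFactor j f' = atFactor j f' * atFactor i f := by
  refine PiTensorProduct.ext (MultilinearMap.ext fun x => ?_)
  simp only [LinearMap.compMultilinearMap_apply, Module.End.mul_apply, atFactor_tprod]
  rw [Function.update_of_ne hij, Function.update_of_ne hij.symm, Function.update_comm hij]

end Factor

/-! ### Lists -/

section Lists

theorem List.eq_filter_append {n : ℕ} {l : List (Fin n)} (hl : l.Pairwise (· < ·)) {i : Fin n}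
    (hi : i ∈ l) : l = l.filter (· < i) ++ i :: l.filter (i < ·) := by
  induction l with
  | nil => simp at hi
  | cons j l ih =>
    rw [List.pairwise_cons] at hl
    by_cases hij : i = j
    · subst hij
      have h1 : l.filter (· < i) = [] := by
        rw [List.filter_eq_nil_iff]
        intro k hk
        simpa using (hl.1 k hk).le
      have h2 : l.filter (i < ·) = l := by
        rw [List.filter_eq_self]
        intro k hk
        simpa using hl.1 k hk
      simp [h1, h2]
    · have hi' : i ∈ l := by simpa [hij] using hi
      have hji := hl.1 i hi'
      rw [List.filter_cons_of_pos (by simpa using hji),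
        List.filter_cons_of_neg (by simpa using hji.le), List.cons_append, ← ih hl.2 hi']

variable {F A : Type*} [Field F] [Semiring A] [Algebra F A]

/-- Straightening: the new factor is moved past the preceding ones to the place of its own index and
absorbed there. It serves both for the edge ends at a vertex and for the edges of the graph. -/
theorem mul_list_prod_le {ι : Type*} {C : ι → Submodule F A} {l : List ι}
    (hl : l.Pairwise fun j i => C i * C j ≤ C j * C i) {i : ι} (hi : i ∈ l)
    (hii : C i * C i ≤ C i) : C i * (l.map C).prod ≤ (l.map C).prod := by
  induction l with
  | nil => simp at hi
  | cons j l ih =>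
    rw [List.pairwise_cons] at hl
    rw [List.map_cons, List.prod_cons, ← mul_assoc]
    rcases List.mem_cons.1 hi with rfl | hi
    · exact mul_le_mul' hii le_rfl
    · refine (mul_le_mul' (hl.1 i hi) le_rfl).trans ?_
      rw [mul_assoc]
      exact mul_le_mul' le_rfl (ih hl.2 hi)

/-- Since no index repeats in the list, the factors of a product can be prescribed independently by
a single family x. -/
theorem list_prod_range_le {ι : Type*} [DecidableEq ι] {N : ι → Type*}
    [∀ i, AddCommMonoid (N i)] [∀ i, Module F (N i)] (f : ∀ i, N i →ₗ[F] A) {l : List ι}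
    (hl : l.Nodup) : (l.map fun i => LinearMap.range (f i)).prod
      ≤ Submodule.span F (Set.range fun x : ∀ i, N i => (l.map fun i => f i (x i)).prod) := by
  induction l with
  | nil =>
    simp only [List.map_nil, List.prod_nil]
    rw [Submodule.one_le]
    exact Submodule.subset_span ⟨0, rfl⟩
  | cons i l ih =>
    rw [List.nodup_cons] at hl
    rw [List.map_cons, List.prod_cons]
    refine (mul_le_mul' le_rfl (ih hl.2)).trans ?_
    rw [Submodule.mul_le]
    rintro _ ⟨y, rfl⟩ b hb
    induction hb using Submodule.span_induction with
    | zero => simp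
    | add a b _ _ ha hb => rw [mul_add]; exact Submodule.add_mem _ ha hb
    | smul c a _ ha => rw [mul_smul_comm]; exact Submodule.smul_mem _ _ ha
    | mem b hb =>
      obtain ⟨x, rfl⟩ := hb
      refine Submodule.subset_span ⟨Function.update x i y, ?_⟩
      simp only [List.map_cons, List.prod_cons, Function.update_self]
      congr 2
      refine List.map_congr_left fun j hj => ?_
      rw [Function.update_of_ne (by rintro rfl; exact hl.1 hj)]

theorem list_prod_mem {ι : Type*} {C : ι → Submodule F A} (l : List ι) (x : ι → A)
    (hx : ∀ i ∈ l, x i ∈ C i) : (l.map x).prod ∈ (l.map C).prod := by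
  induction l with
  | nil => exact ⟨1, by simp⟩
  | cons i l ih =>
    simp only [List.map_cons, List.prod_cons]
    exact Submodule.mul_mem_mul (hx i (by simp)) (ih fun j hj => hx j (by simp [hj]))

end Lists

end HopfGauge

end

noncomputable section

namespace HopfGauge

open Coalgebra HopfAlgebra

/-! ### The algebra of a vertex neighbourhood -/

section VertexAlgebra

variable {F K : Type*} [Field F] [Ring K] [HopfAlgebra F K] {n : ℕ}

variable (F K n) in
/-- The endomorphisms of `(K*)^{⊗ n}`. -/
abbrev DualPowEnd : Type _ := Module.End F (DualPow F K n)

theorem slot_tprod (i : Fin n) (f : Module.End F (Module.Dual F K))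
    (x : Fin n → Module.Dual F K) : slot i f (PiTensorProduct.tprod F x)
      = PiTensorProduct.tprod F (Function.update x i (f (x i))) :=
  atFactor_tprod (M := fun _ : Fin n => Module.Dual F K) i f x

theorem slot_mul (i : Fin n) (f f' : Module.End F (Module.Dual F K)) :
    slot i (f * f') = slot i f * slot i f' :=
  map_mul (atFactor (M := fun _ : Fin n => Module.Dual F K) i) f f'

theorem slot_one (i : Fin n) : slot i (1 : Module.End F (Module.Dual F K)) = 1 :=
  map_one (atFactor (M := fun _ : Fin n => Module.Dual F K) i)

theorem slot_commute {i j : Fin n} (hij : i ≠ j) (f f' : Module.End F (Module.Dual F K)) :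
    slot i f * slot j f' = slot j f' * slot i f :=
  atFactor_commute (M := fun _ : Fin n => Module.Dual F K) hij f f'

variable (out : Fin n → Bool)

/-- The action of gauge transformations on the functions of one edge end. -/
def slotAct (i : Fin n) : K →ₗ[F] DualPowEnd F K n := slot i ∘ₗ endAct (out i)

theorem slotAct_apply (i : Fin n) (h : K) :
    slotAct (F := F) out i h = slot i (endAct (out i) h) := rfl

theorem isRightAct_slotAct (i : Fin n) :
    IsRightAct (F := F) (K := K) (B := DualPowEnd F K n) (slotAct out i) := by
  have h := isRightAct_endAct (F := F) (K := K) (out i)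
  refine ⟨?_, fun h' k => ?_⟩
  · rw [slotAct_apply, h.one, slot_one]
  · rw [slotAct_apply, slotAct_apply, slotAct_apply, h.mul, slot_mul]

theorem jointAct_cons (i : Fin n) (l : List (Fin n)) :
    jointAct (F := F) (K := K) out (i :: l)
      = conv (B := DualPowEnd F K n) (slotAct out i) (jointAct out l) := rfl

theorem jointAct_append (l l' : List (Fin n)) :
    jointAct (F := F) (K := K) out (l ++ l')
      = conv (B := DualPowEnd F K n) (jointAct out l) (jointAct out l') := by
  induction l with
  | nil => exact (counit_conv (B := DualPowEnd F K n) _).symm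
  | cons i l ih => rw [List.cons_append, jointAct_cons, ih, jointAct_cons, conv_assoc]

theorem jointAct_commute {T : DualPowEnd F K n} {l : List (Fin n)}
    (hT : ∀ i ∈ l, ∀ f, T * slot i f = slot i f * T) (h : K) :
    T * jointAct out l h = jointAct out l h * T := by
  induction l generalizing h with
  | nil => simp [jointAct]
  | cons i l ih =>
    rw [jointAct_cons]
    exact conv_commute (B := DualPowEnd F K n) (fun h => hT i (by simp) _)
      (fun h => ih (fun j hj => hT j (by simp [hj])) h) h

theorem jointAct_commute_slot {i : Fin n} {l : List (Fin n)} (hi : i ∉ l) (h : K)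
    (f : Module.End F (Module.Dual F K)) :
    jointAct out l h * slot i f = slot i f * jointAct out l h :=
  (jointAct_commute out (fun j hj f' => slot_commute (by rintro rfl; exact hi hj) f f') h).symm

theorem jointAct_commute_jointAct {l l' : List (Fin n)} (hl : l.Disjoint l') (h k : K) :
    jointAct (F := F) out l h * jointAct out l' k = jointAct out l' k * jointAct out l h :=
  jointAct_commute out (fun _ hj f => jointAct_commute_slot out (fun hj' => hl hj' hj) h f) k

theorem isRightAct_jointAct {l : List (Fin n)} (hl : l.Nodup) :
    IsRightAct (F := F) (K := K) (B := DualPowEnd F K n) (jointAct out l) := by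
  induction l with
  | nil => exact ⟨by simp [jointAct], fun h k => by simp [jointAct, mul_smul]⟩
  | cons i l ih =>
    rw [List.nodup_cons] at hl
    rw [jointAct_cons]
    exact (isRightAct_slotAct out i).conv (ih hl.2) fun h k =>
      (jointAct_commute_slot out hl.1 k _).symm

theorem jointAct_counit {l : List (Fin n)} {x : Fin n → Module.Dual F K}
    (hx : ∀ i ∈ l, x i = (counit : K →ₗ[F] F)) (h : K) :
    jointAct out l h (PiTensorProduct.tprod F x)
      = counit (R := F) h • PiTensorProduct.tprod F x := by
  induction l generalizing h with
  | nil => rfl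
  | cons i l ih =>
    have h1 : ∀ k, slotAct out i k (PiTensorProduct.tprod F x)
        = counit (R := F) k • PiTensorProduct.tprod F x := by
      intro k
      rw [slotAct_apply, slot_tprod, hx i (by simp), endAct_counit, MultilinearMap.map_update_smul,
        ← hx i (by simp), Function.update_eq_self]
    rw [jointAct_cons, conv_apply_repr (B := DualPowEnd F K n) (ℛ F h), LinearMap.sum_apply]
    simp only [Module.End.mul_apply, ih (fun j hj => hx j (by simp [hj])), map_smul, h1, smul_smul]
    rw [← Finset.sum_smul]
    congr 1
    have := congrArg (counit (R := F)) (Coalgebra.sum_counit_smul (ℛ F h))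
    simpa [mul_comm] using this

/-- The positions before the `i`-th edge end. -/
abbrev below (i : Fin n) : List (Fin n) := (List.finRange n).filter (· < i)

/-- The positions after the `i`-th edge end. -/
abbrev above (i : Fin n) : List (Fin n) := (List.finRange n).filter (i < ·)

/-- The positions between the `j`-th and the `i`-th edge end. -/
abbrev between (j i : Fin n) : List (Fin n) := (below i).filter (j < ·)

theorem pairwise_finRange (n : ℕ) : (List.finRange n).Pairwise (· < ·) :=
  (List.sortedLT_finRange n).pairwise

theorem finRange_eq (i : Fin n) : List.finRange n = below i ++ i :: above i :=
  List.eq_filter_append (pairwise_finRange n) (List.mem_finRange i)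

theorem below_eq {i j : Fin n} (hji : j < i) : below i = below j ++ j :: between j i := by
  have h := List.eq_filter_append ((pairwise_finRange n).filter (· < i)) (i := j) (by simpa using hji)
  rw [List.filter_filter] at h
  have e : (List.finRange n).filter (fun k => decide (k < j) && decide (k < i)) = below j := by
    refine List.filter_congr fun k _ => ?_
    by_cases hk : k < j
    · simp [hk, hk.trans hji]
    · simp [hk]
  rw [e] at h
  exact h

theorem nodup_below (i : Fin n) : (below i).Nodup := (List.nodup_finRange n).filter _

variable (sel : Fin n → Bool)

theorem leftMul_apply (R : K ⊗[F] K) (i : Fin n) (α : Module.Dual F K) :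
    leftMul R out sel i α = LinearMap.mul' F (DualPowEnd F K n)
      (TensorProduct.map (jointAct out (below i))
        (slot i ∘ₗ endMul R (out i) (sel i) ∘ₗ (endAct (out i)).flip α) R) := rfl

theorem leftMul_sum {R : K ⊗[F] K} {m : ℕ} {x y : Fin m → K} (hxy : R = ∑ p, x p ⊗ₜ[F] y p)
    (i : Fin n) (α : Module.Dual F K) : leftMul R out sel i α
      = ∑ p, jointAct out (below i) (x p) * slot i (endMul R (out i) (sel i)
          (endAct (out i) (y p) α)) := by
  rw [leftMul_apply]
  conv_lhs => enter [2, 2]; rw [hxy]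
  simp

variable {B : Type*} [Semiring B] [Algebra F B]
  (ι : DualPowEnd F K n →ₐ[F] B) {R : (K ⊗[F] K)ˣ} (g : K)

/-- The matrix of functions of the `i`-th edge end, before braiding. -/
def slotMat (R : K ⊗[F] K) (i : Fin n) : Module.Dual F K →ₗ[F] B :=
  ι.toLinearMap ∘ₗ slot i ∘ₗ straightMul R g (out i) (sel i)

theorem slotMat_apply (R : K ⊗[F] K) (i : Fin n) (α : Module.Dual F K) :
    slotMat out sel ι g R i α = ι (slot i (straightMul R g (out i) (sel i) α)) := rfl

/-- The action of gauge transformations on the edge ends in `l`. -/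
def listAct (l : List (Fin n)) : K →ₗ[F] B := ι.toLinearMap ∘ₗ jointAct out l

theorem listAct_apply (l : List (Fin n)) (h : K) : listAct out ι l h = ι (jointAct out l h) := rfl

theorem listAct_append (l l' : List (Fin n)) :
    listAct out ι (l ++ l') = conv (listAct out ι l) (listAct out ι l') := by
  rw [listAct, jointAct_append, AlgHom.comp_conv]; rfl

theorem listAct_cons (i : Fin n) (l : List (Fin n)) :
    listAct out ι (i :: l) = conv (ι.toLinearMap ∘ₗ slotAct out i) (listAct out ι l) := by
  rw [listAct, jointAct_cons, AlgHom.comp_conv]; rfl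

/-- Left multiplication by the functions of the `i`-th edge end, composed with `κ`. -/
def leftMat (R : K ⊗[F] K) (i : Fin n) : Module.Dual F K →ₗ[F] B :=
  ι.toLinearMap ∘ₗ leftMul R out sel i ∘ₗ straighten g (out i)

variable {i j : Fin n}

theorem listAct_commute_slotMat {l : List (Fin n)} (hi : i ∉ l) (h : K) (α : Module.Dual F K) :
    listAct out ι l h * slotMat out sel ι g (R : K ⊗[F] K) i α
      = slotMat out sel ι g (R : K ⊗[F] K) i α * listAct out ι l h := by
  rw [listAct_apply, slotMat_apply, ← map_mul, ← map_mul, jointAct_commute_slot out hi]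

variable [FiniteDimensional F K]

/-- In K ⊗ B the braided left multiplication factorises. R₍₂₎ acts on a straightened function by
left multiplication, hence moves to the first leg of the matrix; R₍₁₎ acts on the earlier ends. -/
theorem univ_leftMat {g : K} (hg : IsPivotal F g) (i : Fin n) :
    univ (leftMat out sel ι g (R : K ⊗[F] K) i)
      = twist (R : K ⊗[F] K) (listAct out ι (below i))
        * (slotMat out sel ι g (R : K ⊗[F] K) i).lTensor K (canon F K) := by
  refine ev_ext fun α => ?_
  obtain ⟨m, x, y, hxy⟩ := exists_sum_tmul (R : K ⊗[F] K)
  have e : ∀ p, ev α ((y p ⊗ₜ[F] listAct out ι (below i) (x p))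
      * univ (slotMat out sel ι g (R : K ⊗[F] K) i))
      = listAct out ι (below i) (x p) *
        slotMat out sel ι g (R : K ⊗[F] K) i (α ∘ₗ LinearMap.mulLeft F (y p)) := by
    intro p
    have : (y p ⊗ₜ[F] listAct out ι (below i) (x p))
      = ((1 : K) ⊗ₜ[F] listAct out ι (below i) (x p)) * (y p ⊗ₜ[F] (1 : B)) := by simp
    rw [this, mul_assoc, ev_one_tmul_mul, ev_mul_left, ev_univ]
  rw [ev_univ, twist_sum hxy, Finset.sum_mul, map_sum]
  refine Eq.trans ?_ (Finset.sum_congr rfl fun p _ => (e p).symm)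
  rw [leftMat, LinearMap.comp_apply, LinearMap.comp_apply, leftMul_sum out sel hxy]
  simp only [map_sum, AlgHom.toLinearMap_apply, map_mul]
  refine Finset.sum_congr rfl fun p _ => ?_
  rw [endAct_straighten hg]
  rfl

/-- The module algebra property of one edge end, rewritten with `transforms_univ_iff`. -/
theorem transforms_slotMat {g : K} (hg : IsPivotal F g) (hR : IsRMatrix R) (i : Fin n) :
    Transforms (ι.toLinearMap ∘ₗ slotAct out i) (univ (slotMat out sel ι g (R : K ⊗[F] K) i)) := by
  rw [transforms_univ_iff]
  intro h α
  have := endAct_mul_endMul hR (out i) (sel i) h (straighten g (out i) α)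
  rw [conv_apply_repr (B := Module.End F (Module.Dual F K)) (ℛ F h)] at this
  have h1 := congrArg (fun f => ι (slot i f)) this
  simp only [slot_mul, map_mul, map_sum] at h1
  refine Eq.trans h1 (Finset.sum_congr rfl fun p _ => ?_)
  rw [LinearMap.comp_apply, LinearMap.flip_apply, endAct_straighten hg]
  rfl

/-- The braiding of two edge ends at a vertex. -/
theorem leftMat_exchange {g : K} (hg : IsPivotal F g) (hR : IsRMatrix R) (hji : j < i) :
    leg₂ (univ (leftMat out sel ι g (R : K ⊗[F] K) i))
        * leg₁ (univ (leftMat out sel ι g (R : K ⊗[F] K) j))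
      = scal (R : K ⊗[F] K) * (leg₁ (univ (leftMat out sel ι g (R : K ⊗[F] K) j))
        * leg₂ (univ (leftMat out sel ι g (R : K ⊗[F] K) i))) := by
  rw [univ_leftMat out sel ι hg, univ_leftMat out sel ι hg, below_eq hji, listAct_append,
    listAct_cons]
  have hj : j ∉ below j := by simp
  have hi : i ∉ below j := by simpa using hji.le
  have hm : j ∉ between j i := by simp
  refine braided_exchange hR _ _ _ _ ((isRightAct_jointAct out (nodup_below j)).map ι) ?_ ?_ ?_ ?_
    ?_ ?_ (transforms_slotMat out sel ι hg hR j)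
  · intro h k
    change ι _ * ι _ = ι _ * ι _
    rw [← map_mul, ← map_mul, slotAct_apply, jointAct_commute_slot out hj]
  · intro h k
    change ι _ * ι _ = ι _ * ι _
    rw [← map_mul, ← map_mul, jointAct_commute_jointAct]
    intro k hk hk'
    simp only [List.mem_filter, decide_eq_true_eq] at hk hk'
    exact lt_asymm hk.2 hk'.2
  · exact fun h α => listAct_commute_slotMat out sel ι g hj h α
  · exact fun h α => listAct_commute_slotMat out sel ι g hi h α
  · exact fun h α => listAct_commute_slotMat out sel ι g hm h α
  · intro α β
    rw [slotMat_apply, slotMat_apply, ← map_mul, ← map_mul, slot_commute hji.ne]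

/-- The product of the functions of one edge end. -/
theorem leftMat_same {g : K} (hg : IsPivotal F g) (hR : IsRMatrix R) (i : Fin n) :
    leg₂ (univ (leftMat out sel ι g (R : K ⊗[F] K) i))
        * leg₁ (univ (leftMat out sel ι g (R : K ⊗[F] K) i))
      = coprOp (univ (leftMat out sel ι g (R : K ⊗[F] K) i))
        * scal (endTwist R (sel i) : K ⊗[F] K) := by
  rw [univ_leftMat out sel ι hg]
  have hi : i ∉ below i := by simp
  exact braided_same hR _ _ ((isRightAct_jointAct out (nodup_below i)).map ι)
    (fun h α => listAct_commute_slotMat out sel ι g hi h α) _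
    (univ_straightMul_same hg hR (out i) (sel i)
      (ι.comp (atFactor (M := fun _ : Fin n => Module.Dual F K) i)))

/-- The gauge transformations of the functions of one edge end. -/
theorem transforms_leftMat {g : K} (hg : IsPivotal F g) (hR : IsRMatrix R) (i : Fin n) :
    Transforms (ι.toLinearMap ∘ₗ vertexAct out) (univ (leftMat out sel ι g (R : K ⊗[F] K) i)) := by
  have hi : i ∉ below i := by simp
  have hi' : i ∉ above i := by simp
  -- The vertex action is that of the ends before i, of i, and of the ends after i. The first meets
  -- the twist, the second the matrix, and the third commutes with both.
  have e : ι.toLinearMap ∘ₗ vertexAct out = conv (listAct out ι (below i))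
      (conv (ι.toLinearMap ∘ₗ slotAct out i) (listAct out ι (above i))) := by
    rw [← listAct_cons, ← listAct_append, ← finRange_eq]
    rfl
  rw [e, univ_leftMat out sel ι hg]
  refine Transforms.twist_braided hR ((isRightAct_jointAct out (nodup_below i)).map ι) ?_ ?_ ?_
  · refine (transforms_slotMat out sel ι hg hR i).conv_right fun h => ?_
    exact univ_commute fun α => listAct_commute_slotMat out sel ι g hi' h α
  · intro h k
    refine conv_commute (fun k => ?_) (fun k => ?_) k
    · change ι _ * ι _ = ι _ * ι _
      rw [← map_mul, ← map_mul, slotAct_apply, jointAct_commute_slot out hi]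
    · change ι _ * ι _ = ι _ * ι _
      rw [← map_mul, ← map_mul, jointAct_commute_jointAct]
      intro k hk hk'
      simp only [List.mem_filter, decide_eq_true_eq] at hk hk'
      exact lt_asymm hk.2 hk'.2
  · exact fun h => univ_commute fun α => listAct_commute_slotMat out sel ι g hi h α

end VertexAlgebra

end HopfGauge

end

noncomputable section

namespace HopfGauge

open Coalgebra HopfAlgebra

theorem ev₂_scal_mul_sum {F K B : Type*} [Field F] [Ring K] [HopfAlgebra F K] [Semiring B]
    [Algebra F B] {w : K ⊗[F] K} {m : ℕ} {x y : Fin m → K} (hw : w = ∑ p, x p ⊗ₜ[F] y p)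
    (α β : Module.Dual F K) (z : (K ⊗[F] K) ⊗[F] B) : ev₂ α β (scal w * z)
      = ∑ p, ev₂ (α ∘ₗ LinearMap.mulLeft F (x p)) (β ∘ₗ LinearMap.mulLeft F (y p)) z := by
  rw [hw]
  simp only [map_sum, Finset.sum_mul, ev₂_scal_mul]

/-! ### The product of the functions of a vertex neighbourhood -/

section VertexProduct

variable {F K : Type*} [Field F] [Ring K] [HopfAlgebra F K] {n : ℕ}
variable (out sel : Fin n → Bool) {R : (K ⊗[F] K)ˣ}

theorem vertexMul_tprod (R : K ⊗[F] K) (α : Fin n → Module.Dual F K) :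
    vertexMul R out sel (PiTensorProduct.tprod F α)
      = ((List.finRange n).map fun i => leftMul R out sel i (α i)).prod := by
  rw [vertexMul, PiTensorProduct.lift.tprod, MultilinearMap.compLinearMap_apply,
    MultilinearMap.mkPiAlgebraFin_apply, List.ofFn_eq_map]

theorem leftMul_counit (hR : IsRMatrix R) (i : Fin n) :
    leftMul (R : K ⊗[F] K) out sel i (counit : K →ₗ[F] F) = 1 := by
  obtain ⟨m, x, y, hxy⟩ := exists_sum_tmul (R : K ⊗[F] K)
  rw [leftMul_sum out sel hxy]
  simp only [endAct_counit, map_smul, endMul_counit hR]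
  have h1 := congrArg (fun k => jointAct (F := F) out (below i) k * slot i 1)
    (hR.sum_counit_right hxy)
  simp only [map_sum, map_smul, Finset.sum_mul, smul_mul_assoc] at h1
  simp only [mul_smul_comm]
  refine h1.trans ?_
  rw [(isRightAct_jointAct out (nodup_below i)).one, one_mul, slot_one]

/-- If the ends before i carry ε, then R₍₁₎ acts on them by the counit and the braiding disappears.
-/
theorem leftMul_tprod (hR : IsRMatrix R) (i : Fin n) (α : Module.Dual F K)
    (x : Fin n → Module.Dual F K) (hx : ∀ j ≤ i, x j = (counit : K →ₗ[F] F)) :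
    leftMul (R : K ⊗[F] K) out sel i α (PiTensorProduct.tprod F x)
      = PiTensorProduct.tprod F (Function.update x i α) := by
  obtain ⟨m, u, v, huv⟩ := exists_sum_tmul (R : K ⊗[F] K)
  rw [leftMul_sum out sel huv, LinearMap.sum_apply]
  have h1 : ∀ p, (jointAct out (below i) (u p) * slot i (endMul (R : K ⊗[F] K) (out i) (sel i)
      (endAct (out i) (v p) α)) : DualPowEnd F K n) (PiTensorProduct.tprod F x)
      = counit (R := F) (u p) • PiTensorProduct.tprod F
        (Function.update x i (endAct (out i) (v p) α)) := by
    intro p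
    rw [Module.End.mul_apply, slot_tprod, hx i le_rfl, endMul_counit_right hR]
    refine jointAct_counit out (fun j hj => ?_) _
    simp only [List.mem_filter, decide_eq_true_eq] at hj
    rw [Function.update_of_ne hj.2.ne, hx j hj.2.le]
  simp only [h1]
  have h2 := congrArg (fun k => (PiTensorProduct.tprod F).toLinearMap x i (endAct (out i) k α))
    (hR.sum_counit_left huv)
  simp only [map_sum, map_smul, LinearMap.sum_apply, LinearMap.smul_apply,
    MultilinearMap.toLinearMap_apply, (isRightAct_endAct (F := F) (K := K) (out i)).one,
    Module.End.one_apply] at h2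
  exact h2

theorem list_prod_leftMul_apply (hR : IsRMatrix R) (α : Fin n → Module.Dual F K)
    {l : List (Fin n)} (hl : l.Pairwise (· < ·)) :
    (l.map fun i => leftMul (R : K ⊗[F] K) out sel i (α i)).prod
        (PiTensorProduct.tprod F fun _ => (counit : K →ₗ[F] F))
      = PiTensorProduct.tprod F fun i => if i ∈ l then α i else (counit : K →ₗ[F] F) := by
  induction l with
  | nil => simp
  | cons i l ih =>
    rw [List.pairwise_cons] at hl
    rw [List.map_cons, List.prod_cons, Module.End.mul_apply, ih hl.2, leftMul_tprod out sel hR]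
    · congr 1
      funext j
      by_cases hj : j = i
      · subst hj; simp
      · simp [hj]
    · intro j hj
      rw [if_neg]
      exact fun h => absurd (hl.1 j h) (not_lt.2 hj)

/-- Applied to the unit, the ordered product fills in the factors from the last to the first, so no
braiding ever occurs. It follows that an element can be read off from its left multiplication
operator. -/
theorem vertexMul_one (hR : IsRMatrix R) (x : DualPow F K n) :
    vertexMul (R : K ⊗[F] K) out sel x
      (PiTensorProduct.tprod F fun _ => (counit : K →ₗ[F] F)) = x := by
  suffices h : (vertexMul (R : K ⊗[F] K) out sel).flip
      (PiTensorProduct.tprod F fun _ => (counit : K →ₗ[F] F)) = LinearMap.id from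
    LinearMap.congr_fun h x
  refine PiTensorProduct.ext (MultilinearMap.ext fun α => ?_)
  rw [LinearMap.compMultilinearMap_apply, LinearMap.flip_apply, vertexMul_tprod,
    list_prod_leftMul_apply out sel hR α (pairwise_finRange n)]
  simp

theorem one_vertexMul (hR : IsRMatrix R) :
    vertexMul (R : K ⊗[F] K) out sel (PiTensorProduct.tprod F fun _ => (counit : K →ₗ[F] F))
      = 1 := by
  rw [vertexMul_tprod]
  refine List.prod_eq_one ?_
  simp [leftMul_counit out sel hR]

variable [FiniteDimensional F K] {g : K} (hg : IsPivotal F g) (hR : IsRMatrix R)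
include hg hR

theorem leftMul_mul_self (i : Fin n) :
    LinearMap.range (leftMul (R : K ⊗[F] K) out sel i)
        * LinearMap.range (leftMul (R : K ⊗[F] K) out sel i)
      ≤ LinearMap.range (leftMul (R : K ⊗[F] K) out sel i) := by
  rw [Submodule.mul_le]
  rintro _ ⟨α, rfl⟩ _ ⟨β, rfl⟩
  have h := congrArg (ev₂ (straighten g (out i) β) (straighten g (out i) α))
    (leftMat_same out sel (AlgHom.id F (DualPowEnd F K n)) hg hR i)
  rw [ev₂_leg₂_mul_leg₁, ev₂_coprOp_mul_scal, ev_univ, ev_univ, ev_univ] at h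
  simp only [leftMat, LinearMap.comp_apply, straighten_straighten hg] at h
  exact ⟨_, h.symm⟩

/-- The exchange relation, evaluated on a pair of functionals, rewrites a product in the wrong order
as a sum of products in the right order. -/
theorem leftMul_mul_le {i j : Fin n} (hji : j < i) :
    LinearMap.range (leftMul (R : K ⊗[F] K) out sel i)
        * LinearMap.range (leftMul (R : K ⊗[F] K) out sel j)
      ≤ LinearMap.range (leftMul (R : K ⊗[F] K) out sel j)
        * LinearMap.range (leftMul (R : K ⊗[F] K) out sel i) := by
  rw [Submodule.mul_le]
  rintro _ ⟨α, rfl⟩ _ ⟨β, rfl⟩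
  have h := congrArg (ev₂ (straighten g (out j) β) (straighten g (out i) α))
    (leftMat_exchange out sel (AlgHom.id F (DualPowEnd F K n)) hg hR hji)
  obtain ⟨m, u, v, huv⟩ := exists_sum_tmul (R : K ⊗[F] K)
  simp only [ev₂_scal_mul_sum huv, ev₂_leg₂_mul_leg₁, ev₂_leg₁_mul_leg₂, ev_univ] at h
  simp only [leftMat, LinearMap.comp_apply, straighten_straighten hg, AlgHom.toLinearMap_apply,
    AlgHom.id_apply] at h
  rw [h]
  refine Submodule.sum_mem _ fun p _ => Submodule.mul_mem_mul ?_ ?_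
  · exact LinearMap.mem_range_self _ _
  · exact LinearMap.mem_range_self _ _

/-- The reordering relations show that the composite is again left multiplication by some element w.
Evaluating both operators at the unit identifies w, so associativity needs no computation with
iterated braidings. -/
theorem leftMul_mul_vertexMul (i : Fin n) (α : Module.Dual F K) (x : DualPow F K n) :
    leftMul (R : K ⊗[F] K) out sel i α * vertexMul (R : K ⊗[F] K) out sel x
      = vertexMul (R : K ⊗[F] K) out sel (leftMul (R : K ⊗[F] K) out sel i α x) := by
  set C := fun i => LinearMap.range (leftMul (R : K ⊗[F] K) out sel i) with hC
  have hle : ((List.finRange n).map C).prod ≤ LinearMap.range (vertexMul (R : K ⊗[F] K) out sel) := by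
    refine (list_prod_range_le (leftMul (R : K ⊗[F] K) out sel) (List.nodup_finRange n)).trans ?_
    rw [Submodule.span_le]
    rintro _ ⟨α, rfl⟩
    exact ⟨PiTensorProduct.tprod F α, vertexMul_tprod out sel _ α⟩
  have hmem : vertexMul (R : K ⊗[F] K) out sel x ∈ ((List.finRange n).map C).prod := by
    induction x using PiTensorProduct.induction_on with
    | smul_tprod r α =>
      rw [map_smul, vertexMul_tprod]
      exact Submodule.smul_mem _ _ (list_prod_mem _ _ fun i _ => ⟨_, rfl⟩)
    | add x y hx hy => rw [map_add]; exact Submodule.add_mem _ hx hy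
  have h1 : leftMul (R : K ⊗[F] K) out sel i α * vertexMul (R : K ⊗[F] K) out sel x
      ∈ LinearMap.range (vertexMul (R : K ⊗[F] K) out sel) := by
    refine hle (mul_list_prod_le (C := C) ?_ (List.mem_finRange i)
      (leftMul_mul_self out sel hg hR i) (Submodule.mul_mem_mul ⟨α, rfl⟩ hmem))
    exact (pairwise_finRange n).imp fun hji => leftMul_mul_le out sel hg hR hji
  obtain ⟨w, hw⟩ := h1
  have h2 := LinearMap.congr_fun hw (PiTensorProduct.tprod F fun _ => (counit : K →ₗ[F] F))
  rw [vertexMul_one out sel hR, Module.End.mul_apply, vertexMul_one out sel hR] at h2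
  rw [← hw, h2]

theorem vertexMul_vertexMul (x y : DualPow F K n) :
    vertexMul (R : K ⊗[F] K) out sel (vertexMul (R : K ⊗[F] K) out sel x y)
      = vertexMul (R : K ⊗[F] K) out sel x * vertexMul (R : K ⊗[F] K) out sel y := by
  induction x using PiTensorProduct.induction_on with
  | smul_tprod r α =>
    simp only [map_smul, LinearMap.smul_apply, smul_mul_assoc]
    congr 1
    rw [vertexMul_tprod]
    generalize List.finRange n = l
    induction l with
    | nil => simp
    | cons i l ih =>
      rw [List.map_cons, List.prod_cons, Module.End.mul_apply, ← leftMul_mul_vertexMul out sel hg hR,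
        ih, mul_assoc]
  | add x x' hx hx' => simp only [map_add, LinearMap.add_apply, add_mul, hx, hx']

end VertexProduct

end HopfGauge

end

noncomputable section

namespace HopfGauge

open Coalgebra HopfAlgebra

/-! ### Exchanging the two legs -/

section SwapLegs

variable {F K B : Type*} [Field F] [Ring K] [HopfAlgebra F K] [Semiring B] [Algebra F B]

/-- The flip of the first two factors of `K ⊗ K ⊗ B`. -/
def swapLegs : (K ⊗[F] K) ⊗[F] B →ₐ[F] (K ⊗[F] K) ⊗[F] B :=
  Algebra.TensorProduct.map (flip : K ⊗[F] K ≃ₐ[F] K ⊗[F] K).toAlgHom (AlgHom.id F B)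

theorem swapLegs_leg₁ (z : K ⊗[F] B) : swapLegs (leg₁ z) = leg₂ z := by
  induction z using TensorProduct.induction_on with
  | zero => simp
  | add a b ha hb => simp only [map_add, ha, hb]
  | tmul k b => rfl

theorem swapLegs_leg₂ (z : K ⊗[F] B) : swapLegs (leg₂ z) = leg₁ z := by
  induction z using TensorProduct.induction_on with
  | zero => simp
  | add a b ha hb => simp only [map_add, ha, hb]
  | tmul k b => rfl

theorem swapLegs_copr (z : K ⊗[F] B) : swapLegs (copr z) = coprOp z := by
  induction z using TensorProduct.induction_on with
  | zero => simp
  | add a b ha hb => simp only [map_add, ha, hb]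
  | tmul k b => rfl

theorem swapLegs_scal (w : K ⊗[F] K) : swapLegs (scal w : (K ⊗[F] K) ⊗[F] B) = scal (flip w) := rfl

theorem scal_mul_scal_inv (W : (K ⊗[F] K)ˣ) :
    (scal (W : K ⊗[F] K) * scal ((W⁻¹ : (K ⊗[F] K)ˣ) : K ⊗[F] K) : (K ⊗[F] K) ⊗[F] B) = 1 := by
  rw [← map_mul, Units.mul_inv, map_one]

theorem scal_inv_mul_scal (W : (K ⊗[F] K)ˣ) :
    (scal ((W⁻¹ : (K ⊗[F] K)ˣ) : K ⊗[F] K) * scal (W : K ⊗[F] K) : (K ⊗[F] K) ⊗[F] B) = 1 := by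
  rw [← map_mul, Units.inv_mul, map_one]

theorem flipUnit_val (R : (K ⊗[F] K)ˣ) : (flipUnit R : K ⊗[F] K) = flip (R : K ⊗[F] K) := rfl

/-- Exchanging the two legs replaces W by W₂₁⁻¹. This accounts for R₂₁⁻¹ as the braiding of ends in
the opposite order. -/
theorem swap_exchange {W : (K ⊗[F] K)ˣ} {M N : K ⊗[F] B}
    (h : leg₂ N * leg₁ M = scal (W : K ⊗[F] K) * (leg₁ M * leg₂ N)) :
    leg₂ M * leg₁ N = scal (((flipUnit W)⁻¹ : (K ⊗[F] K)ˣ) : K ⊗[F] K) * (leg₁ N * leg₂ M) := by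
  have h' := congrArg swapLegs h
  simp only [map_mul, swapLegs_leg₁, swapLegs_leg₂, swapLegs_scal] at h'
  rw [h', ← flipUnit_val, ← mul_assoc, scal_inv_mul_scal, one_mul]

end SwapLegs

/-! ### The tensor product of the algebras of the vertex neighbourhoods -/

section Total

variable {F K : Type*} [Field F] [Ring K] [HopfAlgebra F K] {V E : Type*} [DecidableEq V]
variable (Γ : CiliatedRibbonGraph V E)

variable (F K) in
/-- The endomorphisms of `⨂ᵥ (K*)^{⊗ |v|}`. -/
abbrev TotalEnd : Type _ := Module.End F (VertexFun F K Γ)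

variable (F K) in
/-- The endomorphisms of the functions of one vertex neighbourhood. -/
def atVertex (v : V) : DualPowEnd F K (Γ.valence v) →ₐ[F] TotalEnd F K Γ :=
  atFactor (M := fun v => DualPow F K (Γ.valence v)) v

theorem atVertex_tprod (v : V) (f : DualPowEnd F K (Γ.valence v))
    (x : ∀ v, DualPow F K (Γ.valence v)) :
    atVertex F K Γ v f (PiTensorProduct.tprod F x)
      = PiTensorProduct.tprod F (Function.update x v (f (x v))) :=
  atFactor_tprod (M := fun v => DualPow F K (Γ.valence v)) v f x

theorem atVertex_commute {v w : V} (h : v ≠ w) (f : DualPowEnd F K (Γ.valence v))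
    (f' : DualPowEnd F K (Γ.valence w)) :
    atVertex F K Γ v f * atVertex F K Γ w f' = atVertex F K Γ w f' * atVertex F K Γ v f :=
  atFactor_commute (M := fun v => DualPow F K (Γ.valence v)) h f f'

/-- The product `⨂ᵥ ⨂ᵢ x(v, i)`. -/
def flat (x : E ⊕ E → Module.Dual F K) : VertexFun F K Γ :=
  PiTensorProduct.tprod F fun v => PiTensorProduct.tprod F fun i => x (Γ.ends ⟨v, i⟩)

variable (F K) in
/-- The unit of `⨂ᵥ A*ᵥ`. -/
def totalOne : VertexFun F K Γ := flat Γ fun _ => (counit : K →ₗ[F] F)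

/-- An endomorphism of the functions of the `i`-th edge end at `v`. -/
def atSite (p : Σ v, Fin (Γ.valence v)) :
    Module.End F (Module.Dual F K) →ₐ[F] TotalEnd F K Γ :=
  (atVertex F K Γ p.1).comp
    (atFactor (M := fun _ : Fin (Γ.valence p.1) => Module.Dual F K) p.2)

/-- An endomorphism of the functions of one edge end. -/
def atEnd (y : E ⊕ E) : Module.End F (Module.Dual F K) →ₐ[F] TotalEnd F K Γ :=
  atSite Γ (Γ.ends.symm y)

theorem flat_update [DecidableEq E] {v : V} {i : Fin (Γ.valence v)} (x : E ⊕ E → Module.Dual F K)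
    (a : Module.Dual F K) : flat Γ (Function.update x (Γ.ends ⟨v, i⟩) a)
      = PiTensorProduct.tprod F (Function.update
        (fun w => PiTensorProduct.tprod F fun j => x (Γ.ends ⟨w, j⟩)) v
        (PiTensorProduct.tprod F (Function.update (fun j => x (Γ.ends ⟨v, j⟩)) i a))) := by
  have h := nest_aux (F := F) (fun p => x (Γ.ends p)) ⟨v, i⟩ a
  rw [← h, flat]
  congr 1
  funext w
  congr 1
  funext j
  by_cases hp : (⟨w, j⟩ : Σ v, Fin (Γ.valence v)) = ⟨v, i⟩
  · rw [hp]; simp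
  · rw [Function.update_of_ne hp, Function.update_of_ne (fun H => hp (Γ.ends.injective H))]

theorem atEnd_flat [DecidableEq E] (y : E ⊕ E) (f : Module.End F (Module.Dual F K))
    (x : E ⊕ E → Module.Dual F K) :
    atEnd Γ y f (flat Γ x) = flat Γ (Function.update x y (f (x y))) := by
  obtain ⟨⟨v, i⟩, rfl⟩ := Γ.ends.surjective y
  have e : atEnd (F := F) (K := K) Γ (Γ.ends ⟨v, i⟩) f = atVertex F K Γ v (slot i f) := by
    rw [atEnd, Equiv.symm_apply_apply]
    rfl
  rw [flat_update, e, flat, atVertex_tprod, slot_tprod]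

variable (ρ : E → Bool) (R : (K ⊗[F] K)ˣ) (g : K)

/-- The matrix of the functions of the `i`-th edge end at `v`, straightened to an incoming one. -/
def siteMat (p : Σ v, Fin (Γ.valence v)) : Module.Dual F K →ₗ[F] TotalEnd F K Γ :=
  leftMat (Γ.outgoing p.1) (Γ.selected ρ p.1) (atVertex F K Γ p.1) g (R : K ⊗[F] K) p.2

/-- Left multiplication by the functions of the `i`-th edge end at `v`. -/
def siteOp (p : Σ v, Fin (Γ.valence v)) : Module.Dual F K →ₗ[F] TotalEnd F K Γ :=
  (atVertex F K Γ p.1).toLinearMap ∘ₗ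
    leftMul (R : K ⊗[F] K) (Γ.outgoing p.1) (Γ.selected ρ p.1) p.2

/-- The matrix of the functions of an edge end, straightened to an incoming one. -/
def endMat (y : E ⊕ E) : Module.Dual F K →ₗ[F] TotalEnd F K Γ := siteMat Γ ρ R g (Γ.ends.symm y)

/-- Left multiplication by the functions of an edge end. -/
def endOp (y : E ⊕ E) : Module.Dual F K →ₗ[F] TotalEnd F K Γ := siteOp Γ ρ R (Γ.ends.symm y)

omit [DecidableEq V] in
theorem outgoing_symm (y : E ⊕ E) :
    Γ.outgoing (Γ.ends.symm y).1 (Γ.ends.symm y).2 = y.isRight := by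
  simp [CiliatedRibbonGraph.outgoing]

/-- Whether an edge end is selected. -/
def selectedEnd (y : E ⊕ E) : Bool := Γ.selected ρ (Γ.ends.symm y).1 (Γ.ends.symm y).2

omit [DecidableEq V] in
theorem selectedEnd_inl (e : E) : selectedEnd Γ ρ (Sum.inl e) = ρ e := by
  simp [selectedEnd, CiliatedRibbonGraph.selected]

omit [DecidableEq V] in
theorem selectedEnd_inr (e : E) : selectedEnd Γ ρ (Sum.inr e) = !(ρ e) := by
  simp [selectedEnd, CiliatedRibbonGraph.selected]

theorem endMat_eq (y : E ⊕ E) :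
    endMat Γ ρ R g y = endOp Γ ρ R y ∘ₗ straighten g y.isRight := by
  rw [← outgoing_symm Γ y]; rfl

theorem endOp_eq {g : K} (hg : IsPivotal F g) (y : E ⊕ E) :
    endOp Γ ρ R y = endMat Γ ρ R g y ∘ₗ straighten g y.isRight := by
  rw [endMat_eq]
  ext1 α
  simp [straighten_straighten hg]

/-- The action of a gauge transformation at a vertex. -/
def gaugeAct (v : V) : K →ₗ[F] TotalEnd F K Γ :=
  (atVertex F K Γ v).toLinearMap ∘ₗ vertexAct (Γ.outgoing v)

theorem isBraiding_braid {R : (K ⊗[F] K)ˣ} (hR : IsRMatrix R) (y z : E ⊕ E) :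
    IsBraiding (Γ.braid R y z) := by
  unfold CiliatedRibbonGraph.braid
  split_ifs
  · exact hR.isBraiding
  · exact hR.flipUnit_inv.isBraiding
  · exact isBraiding_one

/-! ### Relations of edge ends in the tensor product over all vertices. -/

section Relations

variable [FiniteDimensional F K] {R : (K ⊗[F] K)ˣ} {g : K} (hg : IsPivotal F g)
  (hR : IsRMatrix R)
include hg hR

/-- The exchange relation of two edge ends. -/
theorem endMat_exchange {y z : E ⊕ E} (hyz : y ≠ z) :
    leg₂ (univ (endMat Γ ρ R g z)) * leg₁ (univ (endMat Γ ρ R g y))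
      = scal (Γ.braid R y z : K ⊗[F] K) *
        (leg₁ (univ (endMat Γ ρ R g y)) * leg₂ (univ (endMat Γ ρ R g z))) := by
  have hpq : Γ.ends.symm y ≠ Γ.ends.symm z := fun h => hyz (Γ.ends.symm.injective h)
  unfold CiliatedRibbonGraph.braid CiliatedRibbonGraph.vertexOf CiliatedRibbonGraph.position endMat
  generalize Γ.ends.symm y = p at *
  generalize Γ.ends.symm z = q at *
  obtain ⟨v, i⟩ := p
  obtain ⟨w, j⟩ := q
  by_cases hvw : v = w
  · subst hvw
    have hij : i ≠ j := fun h => hpq (by rw [h])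
    rw [if_pos rfl]
    rcases lt_or_gt_of_ne hij with h | h
    · rw [if_pos (by simpa using h)]
      exact leftMat_exchange _ _ _ hg hR h
    · rw [if_neg (by simpa using h.le)]
      exact swap_exchange (leftMat_exchange _ _ _ hg hR h)
  · rw [if_neg (by simpa using hvw), Units.val_one, map_one, one_mul]
    refine (legs_commute _ _ (fun α β => ?_) _ _).symm
    exact atVertex_commute Γ hvw _ _

theorem endMat_same (y : E ⊕ E) :
    leg₂ (univ (endMat Γ ρ R g y)) * leg₁ (univ (endMat Γ ρ R g y))
      = coprOp (univ (endMat Γ ρ R g y)) *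
        scal (endTwist R (selectedEnd Γ ρ y) : K ⊗[F] K) :=
  leftMat_same _ _ _ hg hR _

theorem endMat_same_rev {γ : K} (hγ : comul (R := F) γ = γ ⊗ₜ[F] γ)
    (hγR : (γ ⊗ₜ[F] γ) * (R : K ⊗[F] K) = (R : K ⊗[F] K) * (γ ⊗ₜ[F] γ)) (y : E ⊕ E) :
    leg₂ (rev γ (univ (endMat Γ ρ R g y))) * leg₁ (rev γ (univ (endMat Γ ρ R g y)))
      = scal (endTwist R (selectedEnd Γ ρ y) : K ⊗[F] K) *
        copr (rev γ (univ (endMat Γ ρ R g y))) := by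
  refine rev_same (endTwist_map_antipode hR _) hγ ?_ (endMat_same Γ ρ hg hR y)
  cases selectedEnd Γ ρ y
  · simp [endTwist]
  · exact hγR

theorem transforms_endMat (y : E ⊕ E) :
    Transforms (gaugeAct Γ (Γ.vertexOf y)) (univ (endMat Γ ρ R g y)) :=
  transforms_leftMat _ _ _ hg hR _

end Relations

theorem gaugeAct_commute {v : V} {y : E ⊕ E} (hv : Γ.vertexOf y ≠ v) (h : K)
    (α : Module.Dual F K) :
    gaugeAct Γ v h * endMat Γ ρ R g y α = endMat Γ ρ R g y α * gaugeAct Γ v h :=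
  (atVertex_commute Γ hv _ _).symm

/-! #### The product -/

omit [DecidableEq V] in
theorem totalMul_tprod (x : ∀ v, DualPow F K (Γ.valence v)) :
    totalMul Γ (R : K ⊗[F] K) ρ (PiTensorProduct.tprod F x) = PiTensorProduct.map fun v =>
      vertexMul (R : K ⊗[F] K) (Γ.outgoing v) (Γ.selected ρ v) (x v) := by
  rw [totalMul, PiTensorProduct.map₂, PiTensorProduct.lift.tprod]
  exact PiTensorProduct.piTensorHomMap_tprod_eq_map _

variable {R}

omit [DecidableEq V] in
theorem totalMul_one (hR : IsRMatrix R) (x : VertexFun F K Γ) :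
    totalMul Γ (R : K ⊗[F] K) ρ x (totalOne F K Γ) = x := by
  suffices h : (totalMul Γ (R : K ⊗[F] K) ρ).flip (totalOne F K Γ) = LinearMap.id from
    LinearMap.congr_fun h x
  refine PiTensorProduct.ext (MultilinearMap.ext fun x => ?_)
  rw [LinearMap.compMultilinearMap_apply, LinearMap.flip_apply, totalMul_tprod, totalOne, flat,
    PiTensorProduct.map_tprod]
  simp only [vertexMul_one _ _ hR]
  rfl

omit [DecidableEq V] in
theorem one_totalMul (hR : IsRMatrix R) :
    totalMul Γ (R : K ⊗[F] K) ρ (totalOne F K Γ) = 1 := by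
  rw [totalOne, flat, totalMul_tprod]
  simp only [one_vertexMul _ _ hR]
  exact PiTensorProduct.map_one

section

variable [FiniteDimensional F K] {g : K} (hg : IsPivotal F g) (hR : IsRMatrix R)
include hg hR

omit [DecidableEq V] in
theorem totalMul_totalMul (x y : VertexFun F K Γ) :
    totalMul Γ (R : K ⊗[F] K) ρ (totalMul Γ (R : K ⊗[F] K) ρ x y)
      = totalMul Γ (R : K ⊗[F] K) ρ x * totalMul Γ (R : K ⊗[F] K) ρ y := by
  induction x using PiTensorProduct.induction_on with
  | add x x' hx hx' => simp only [map_add, LinearMap.add_apply, add_mul, hx, hx']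
  | smul_tprod r x =>
    induction y using PiTensorProduct.induction_on with
    | add y y' hy hy' => simp only [map_add, mul_add, hy, hy']
    | smul_tprod s y =>
      simp only [map_smul, LinearMap.smul_apply, smul_mul_assoc, mul_smul_comm]
      congr 2
      rw [totalMul_tprod, PiTensorProduct.map_tprod, totalMul_tprod, totalMul_tprod,
        ← PiTensorProduct.map_mul]
      simp only [vertexMul_vertexMul _ _ hg hR]

/-- The operator attached to functions of an edge end is left multiplication by its own value at the
unit. -/
theorem totalMul_endOp_one (y : E ⊕ E) (α : Module.Dual F K) :
    totalMul Γ (R : K ⊗[F] K) ρ (endOp Γ ρ R y α (totalOne F K Γ)) = endOp Γ ρ R y α := by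
  unfold endOp
  generalize Γ.ends.symm y = p
  obtain ⟨v, i⟩ := p
  rw [siteOp, LinearMap.comp_apply, AlgHom.toLinearMap_apply, totalOne, flat, atVertex_tprod,
    totalMul_tprod]
  change PiTensorProduct.map _ = PiTensorProduct.map (Function.update (fun _ => LinearMap.id) v _)
  congr 1
  funext w
  by_cases hw : w = v
  · subst hw
    rw [Function.update_self, Function.update_self, ← leftMul_mul_vertexMul _ _ hg hR,
      one_vertexMul _ _ hR, mul_one]
  · rw [Function.update_of_ne hw, Function.update_of_ne hw, one_vertexMul _ _ hR]
    rfl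

theorem totalMul_endOp (y : E ⊕ E) (α : Module.Dual F K) (x : VertexFun F K Γ) :
    totalMul Γ (R : K ⊗[F] K) ρ (endOp Γ ρ R y α x)
      = endOp Γ ρ R y α * totalMul Γ (R : K ⊗[F] K) ρ x := by
  have h := totalMul_totalMul Γ ρ hg hR (endOp Γ ρ R y α (totalOne F K Γ)) x
  rwa [totalMul_endOp_one Γ ρ hg hR] at h

end

theorem endOp_flat [DecidableEq E] (hR : IsRMatrix R) (y : E ⊕ E) (α : Module.Dual F K)
    (x : E ⊕ E → Module.Dual F K)
    (hx : ∀ z, Γ.vertexOf z = Γ.vertexOf y → Γ.position z ≤ Γ.position y →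
      x z = (counit : K →ₗ[F] F)) :
    endOp Γ ρ R y α (flat Γ x) = flat Γ (Function.update x y α) := by
  obtain ⟨⟨v, i⟩, rfl⟩ := Γ.ends.surjective y
  have e : endOp Γ ρ R (Γ.ends ⟨v, i⟩) α = atVertex F K Γ v
      (leftMul (R : K ⊗[F] K) (Γ.outgoing v) (Γ.selected ρ v) i α) := by
    rw [endOp, Equiv.symm_apply_apply]
    rfl
  rw [flat_update, e, flat, atVertex_tprod, leftMul_tprod _ _ hR]
  intro j hj
  refine hx _ ?_ ?_
  · simp [CiliatedRibbonGraph.vertexOf]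
  · simp only [CiliatedRibbonGraph.position]
    rw [Equiv.symm_apply_apply, Equiv.symm_apply_apply]
    exact hj

end Total

end HopfGauge

end

noncomputable section

namespace HopfGauge

open Coalgebra HopfAlgebra

/-! ### The comultiplication of the dual -/

section ComulDual

variable {F K : Type*} [Field F] [Ring K] [HopfAlgebra F K] [FiniteDimensional F K]

theorem dualDistrib_injective :
    Function.Injective (TensorProduct.dualDistrib F K K) :=
  (TensorProduct.dualDistribEquiv F K K).injective

omit [FiniteDimensional F K] in
theorem dualDistrib_map (f f' : K →ₗ[F] K) (z : Module.Dual F K ⊗[F] Module.Dual F K) :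
    TensorProduct.dualDistrib F K K (TensorProduct.map f.dualMap f'.dualMap z)
      = TensorProduct.dualDistrib F K K z ∘ₗ TensorProduct.map f f' := by
  induction z using TensorProduct.induction_on with
  | zero => simp
  | add a b ha hb => simp only [map_add, LinearMap.add_comp, ha, hb]
  | tmul a b => ext k l; simp

theorem comulDual_counit :
    comulDual (counit : K →ₗ[F] F) = (counit : K →ₗ[F] F) ⊗ₜ[F] (counit : K →ₗ[F] F) := by
  refine dualDistrib_injective ?_
  rw [dualDistrib_comulDual]
  ext k l
  simp

/-- Left translation acts on the first factor of the coproduct of K* and right translation on the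
second. This is why gauge transformations at the two ends of an edge descend from ⨂ᵥ A*ᵥ to
functions of the edge. -/
theorem comulDual_map (h k : K) (α : Module.Dual F K) :
    TensorProduct.map (endAct false h) (endAct true k) (comulDual α)
      = comulDual (endAct false h (endAct true k α)) := by
  refine dualDistrib_injective ?_
  have e : TensorProduct.dualDistrib F K K
      (TensorProduct.map (endAct false h) (endAct true k) (comulDual α)) = _ :=
    dualDistrib_map (LinearMap.mulLeft F h) (LinearMap.mulRight F (antipode F k)) (comulDual α)
  rw [e, dualDistrib_comulDual, dualDistrib_comulDual]
  ext a b
  simp [endAct_false_apply, endAct_true_apply, mul_assoc]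

omit [FiniteDimensional F K] in
theorem endAct_endAct_comm (h k : K) (α : Module.Dual F K) :
    endAct true k (endAct false h α) = endAct false h (endAct true k α) := by
  ext a
  simp [endAct_false_apply, endAct_true_apply, mul_assoc]

theorem comulDual_act_left (h : K) (α : Module.Dual F K) :
    TensorProduct.map (endAct false h) LinearMap.id (comulDual α)
      = comulDual (endAct false h α) := by
  have := comulDual_map h 1 α
  rw [(isRightAct_endAct true).one] at this
  exact this

theorem comulDual_act_right (k : K) (α : Module.Dual F K) :
    TensorProduct.map LinearMap.id (endAct true k) (comulDual α)
      = comulDual (endAct true k α) := by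
  have := comulDual_map 1 k α
  rw [(isRightAct_endAct false).one] at this
  exact this

/-- Evaluation at 1 is the counit of K*. -/
theorem comulDual_leftInverse :
    Function.LeftInverse (fun z => TensorProduct.dualDistrib F K K z ∘ₗ
      (TensorProduct.mk F K K).flip 1) (comulDual (F := F) (K := K)) := by
  intro α
  simp only [dualDistrib_comulDual]
  ext k
  simp

theorem map_comulDual_injective (E : Type*) :
    Function.Injective (PiTensorProduct.map (R := F) fun _ : E => comulDual (F := F) (K := K)) := by
  let r : Module.Dual F K ⊗[F] Module.Dual F K →ₗ[F] Module.Dual F K :=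
    ((TensorProduct.mk F K K).flip 1).dualMap ∘ₗ TensorProduct.dualDistrib F K K
  have hr : r ∘ₗ comulDual = LinearMap.id :=
    LinearMap.ext fun α => comulDual_leftInverse α
  have h : PiTensorProduct.map (fun _ : E => r) ∘ₗ PiTensorProduct.map (fun _ : E => comulDual)
      = LinearMap.id := by
    rw [← PiTensorProduct.map_comp, hr, PiTensorProduct.map_id]
  exact Function.LeftInverse.injective (g := PiTensorProduct.map (fun _ : E => r))
    fun x => LinearMap.congr_fun h x

/-- The comultiplication of `K*` or its opposite, according to the orientation of an edge. -/
def comulOr (b : Bool) : Module.Dual F K →ₗ[F] Module.Dual F K ⊗[F] Module.Dual F K :=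
  match b with
  | true => comulDual
  | false => (TensorProduct.comm F _ _).toLinearMap ∘ₗ comulDual

theorem comulOr_act {E : Type*} (x : E × Bool) (h k : K) (α : Module.Dual F K) :
    TensorProduct.map (endAct (tEnd x).isRight h) (endAct (sEnd x).isRight k) (comulOr x.2 α)
      = comulOr x.2 (endAct (tEnd x).isRight h (endAct (sEnd x).isRight k α)) := by
  obtain ⟨e, _ | _⟩ := x
  · change TensorProduct.map _ _ (TensorProduct.comm F _ _ (comulDual α))
      = TensorProduct.comm F _ _ (comulDual _)
    rw [TensorProduct.map_comm]
    congr 1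
    change TensorProduct.map (endAct false k) (endAct true h) (comulDual α)
      = comulDual (endAct true h (endAct false k α))
    rw [endAct_endAct_comm, comulDual_map]
  · exact comulDual_map h k α

end ComulDual

/-! ### The embedding `G*` -/

section Gstar

variable {F K : Type*} [Field F] [Ring K] [HopfAlgebra F K] [FiniteDimensional F K]
variable {V E : Type*} [Fintype V] [DecidableEq V] [Fintype E] [DecidableEq E]

omit [Fintype E] [DecidableEq E] [DecidableEq V] in
-- The map sends a basis of pure tensors bijectively to a basis, by currying of index functions.
theorem nest_injective {M : Type*} [AddCommGroup M] [Module F M] [FiniteDimensional F M]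
    (n : V → ℕ) : Function.Injective (nest F M n) := by
  let b := Module.finBasis F M
  let B₁ := Basis.piTensorProduct fun _ : Σ v, Fin (n v) => b
  let B₂ := Basis.piTensorProduct fun v => Basis.piTensorProduct fun _ : Fin (n v) => b
  let e := B₁.equiv B₂ (Equiv.piCurry fun _ _ => _)
  have h : nest F M n = e.toLinearMap := by
    refine B₁.ext fun p => ?_
    rw [LinearEquiv.coe_coe, Module.Basis.equiv_apply, Basis.piTensorProduct_apply, nest_tprod,
      Basis.piTensorProduct_apply]
    simp only [Basis.piTensorProduct_apply]
    rfl
  rw [h]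
  exact e.injective

variable (F K) in
/-- The linear map `⨂ₑ (aₑ ⊗ bₑ) ↦ ⨂ᵥ ⨂ᵢ x(v, i)` with `x(t(e)) = aₑ` and `x(s(e)) = bₑ`. -/
def edgeEmb (Γ : CiliatedRibbonGraph V E) :
    (⨂[F] _ : E, Module.Dual F K ⊗[F] Module.Dual F K) →ₗ[F] VertexFun F K Γ :=
  nest F (Module.Dual F K) Γ.valence ∘ₗ
    (PiTensorProduct.reindex F (fun _ : E ⊕ E => Module.Dual F K) Γ.ends.symm).toLinearMap ∘ₗ
    (PiTensorProduct.tmulEquiv F (Module.Dual F K)).toLinearMap ∘ₗ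
    (unshuffle F E (Module.Dual F K)).toLinearMap

variable (Γ : CiliatedRibbonGraph V E)

omit [Fintype V] [DecidableEq V] [DecidableEq E] in
theorem Gstar_eq : Gstar (F := F) (K := K) Γ
    = edgeEmb F K Γ ∘ₗ PiTensorProduct.map (fun _ => comulDual) := rfl

omit [Fintype V] [DecidableEq V] [DecidableEq E] in
theorem edgeEmb_tprod (a b : E → Module.Dual F K) :
    edgeEmb F K Γ (PiTensorProduct.tprod F fun e => a e ⊗ₜ[F] b e) = flat Γ (Sum.elim a b) := by
  simp only [edgeEmb, LinearMap.comp_apply, LinearEquiv.coe_coe, unshuffle_tprod,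
    PiTensorProduct.tmulEquiv_apply, PiTensorProduct.reindex_tprod, nest_tprod]
  rfl

omit [DecidableEq V] [DecidableEq E] in
theorem Gstar_injective : Function.Injective (Gstar (F := F) (K := K) Γ) := by
  rw [Gstar_eq, LinearMap.coe_comp]
  refine Function.Injective.comp ?_ (map_comulDual_injective E)
  refine (nest_injective (M := Module.Dual F K) Γ.valence).comp ?_
  exact (PiTensorProduct.reindex F (fun _ : E ⊕ E => Module.Dual F K) Γ.ends.symm).injective.comp
    ((PiTensorProduct.tmulEquiv F (Module.Dual F K)).injective.comp
      (unshuffle F E (Module.Dual F K)).injective)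

omit [Fintype V] [DecidableEq V] [DecidableEq E] in
theorem Gstar_one : Gstar (F := F) (K := K) Γ
    (PiTensorProduct.tprod F fun _ => (counit : K →ₗ[F] F)) = totalOne F K Γ := by
  rw [Gstar_eq, LinearMap.comp_apply, PiTensorProduct.map_tprod]
  simp only [comulDual_counit]
  rw [edgeEmb_tprod, totalOne]
  congr 1
  funext y
  cases y <;> rfl

omit [Fintype V] in
theorem edgeEmb_atFactor (e : E) (f f' : Module.End F (Module.Dual F K))
    (z : ⨂[F] _ : E, Module.Dual F K ⊗[F] Module.Dual F K) :
    edgeEmb F K Γ (atFactor (M := fun _ : E => Module.Dual F K ⊗[F] Module.Dual F K) e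
        (TensorProduct.map f f') z)
      = atEnd Γ (Sum.inl e) f (atEnd Γ (Sum.inr e) f' (edgeEmb F K Γ z)) := by
  let b := Module.finBasis F (Module.Dual F K)
  suffices h : edgeEmb F K Γ ∘ₗ atFactor (M := fun _ : E => Module.Dual F K ⊗[F] Module.Dual F K) e
        (TensorProduct.map f f')
      = atEnd Γ (Sum.inl e) f ∘ₗ atEnd Γ (Sum.inr e) f' ∘ₗ edgeEmb F K Γ from
    LinearMap.congr_fun h z
  refine (Basis.piTensorProduct fun _ : E => b.tensorProduct b).ext fun p => ?_
  rw [Basis.piTensorProduct_apply]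
  simp only [LinearMap.comp_apply, Module.Basis.tensorProduct_apply', edgeEmb_tprod, atEnd_flat]
  rw [atFactor_tprod]
  have e1 : Function.update (fun i => b (p i).1 ⊗ₜ[F] b (p i).2) e
      (TensorProduct.map f f' (b (p e).1 ⊗ₜ[F] b (p e).2))
      = fun i => (Function.update (fun i => b (p i).1) e (f (b (p e).1)) i) ⊗ₜ[F]
        (Function.update (fun i => b (p i).2) e (f' (b (p e).2)) i) := by
    funext i
    by_cases hi : i = e
    · subst hi; simp
    · simp [hi]
  rw [e1, edgeEmb_tprod, Sum.update_elim_inr, Sum.update_elim_inl]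
  rfl

omit [Fintype V] in
-- Acting at a single edge end preserves the image of G*. The actions at a vertex and those used in
-- the braiding are built from these.
theorem Gstar_act (y : E ⊕ E) (h : K) (z : EdgeFun F K E) :
    atEnd Γ y (endAct y.isRight h) (Gstar Γ z) = Gstar Γ
      (atFactor (M := fun _ : E => Module.Dual F K) (y.elim id id) (endAct y.isRight h) z) := by
  suffices H : atEnd Γ y (endAct y.isRight h) ∘ₗ Gstar Γ = Gstar Γ ∘ₗ
      atFactor (M := fun _ : E => Module.Dual F K) (y.elim id id) (endAct y.isRight h) from
    LinearMap.congr_fun H z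
  refine PiTensorProduct.ext (MultilinearMap.ext fun z => ?_)
  simp only [LinearMap.compMultilinearMap_apply, LinearMap.comp_apply, Gstar_eq,
    PiTensorProduct.map_tprod]
  have key : ∀ (e : E) (f f' f'' : Module.End F (Module.Dual F K)),
      (∀ α, TensorProduct.map f f' (comulDual α) = comulDual (f'' α)) →
      atEnd Γ (Sum.inl e) f (atEnd Γ (Sum.inr e) f'
        (edgeEmb F K Γ (PiTensorProduct.tprod F fun i => comulDual (z i))))
      = edgeEmb F K Γ (PiTensorProduct.map (fun _ => comulDual)
        (atFactor (M := fun _ : E => Module.Dual F K) e f'' (PiTensorProduct.tprod F z))) := by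
    intro e f f' f'' hf
    rw [← edgeEmb_atFactor, atFactor_tprod, atFactor_tprod, PiTensorProduct.map_tprod, hf]
    congr 2
    funext i
    by_cases hi : i = e
    · subst hi; simp
    · simp [hi]
  cases y with
  | inl e =>
    have := key e (endAct false h) 1 (endAct false h) (comulDual_act_left h)
    rw [map_one] at this
    exact this
  | inr e =>
    have := key e 1 (endAct true h) (endAct true h) (comulDual_act_right h)
    rw [map_one] at this
    exact this

omit [Fintype V] in
-- The function α at e is created from ε by operators at the two ends of e. Any `f`, `f'` that
-- reproduce β when applied to ε will do; below they are the unbraided left multiplications.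
theorem Gstar_update (e : E) (x : E → Module.Dual F K) (α : Module.Dual F K)
    {f f' : Module.Dual F K →ₗ[F] Module.End F (Module.Dual F K)}
    (hf : ∀ β, f β (counit : K →ₗ[F] F) = β) (hf' : ∀ β, f' β (counit : K →ₗ[F] F) = β) :
    Gstar Γ (PiTensorProduct.tprod F (Function.update x e α))
      = LinearMap.mul' F (TotalEnd F K Γ)
          (TensorProduct.map ((atEnd Γ (Sum.inl e)).toLinearMap ∘ₗ f)
            ((atEnd Γ (Sum.inr e)).toLinearMap ∘ₗ f') (comulDual α))
        (Gstar Γ (PiTensorProduct.tprod F (Function.update x e (counit : K →ₗ[F] F)))) := by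
  have h1 : ∀ β : Module.Dual F K, (fun i => comulDual (Function.update x e β i))
      = Function.update (fun i => comulDual (x i)) e (comulDual β) := by
    intro β
    funext i
    by_cases hi : i = e
    · subst hi; simp
    · simp [hi]
  simp only [Gstar_eq, LinearMap.comp_apply, PiTensorProduct.map_tprod, h1]
  rw [comulDual_counit]
  generalize comulDual α = w
  induction w using TensorProduct.induction_on with
  | zero =>
    rw [MultilinearMap.map_update_zero]
    simp
  | add a b ha hb => 
    rw [MultilinearMap.map_update_add, map_add, ha, hb]
    simp only [map_add, LinearMap.add_apply]
  | tmul a b =>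
    rw [TensorProduct.map_tmul, LinearMap.mul'_apply, Module.End.mul_apply]
    refine Eq.trans ?_ (edgeEmb_atFactor Γ e (f a) (f' b) _)
    rw [atFactor_tprod, Function.update_self, TensorProduct.map_tmul, hf, hf',
      Function.update_idem]

end Gstar

end HopfGauge

end

noncomputable section

namespace HopfGauge

open Coalgebra HopfAlgebra

/-! ### Inverting the braiding at a vertex -/

section Unbraid

variable {F K : Type*} [Field F] [Ring K] [HopfAlgebra F K] {n : ℕ}
variable (out sel : Fin n → Bool) {R : (K ⊗[F] K)ˣ}

/-- In `leftMul` the two legs of R enter through right actions, on the earlier ends and on α. Acting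
with R⁻¹ as well composes to the action of R⁻¹R = 1, which removes the braiding. -/
theorem sum_leftMul_mul_jointAct {m : ℕ} {x y : Fin m → K}
    (hxy : ((R⁻¹ : (K ⊗[F] K)ˣ) : K ⊗[F] K) = ∑ p, x p ⊗ₜ[F] y p) (i : Fin n)
    (α : Module.Dual F K) :
    ∑ p, leftMul (R : K ⊗[F] K) out sel i (endAct (out i) (y p) α) * jointAct out (below i) (x p)
      = slot i (endMul (R : K ⊗[F] K) (out i) (sel i) α) := by
  obtain ⟨k, u, v, huv⟩ := exists_sum_tmul (R : K ⊗[F] K)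
  let T : K ⊗[F] K →ₗ[F] DualPowEnd F K n := LinearMap.mul' F (DualPowEnd F K n) ∘ₗ
      (TensorProduct.map (jointAct out (below i))
        (slot i ∘ₗ endMul (R : K ⊗[F] K) (out i) (sel i) ∘ₗ (endAct (out i)).flip α))
  have hT : ∀ a b, T (a ⊗ₜ b) = jointAct out (below i) a *
      slot i (endMul (R : K ⊗[F] K) (out i) (sel i) (endAct (out i) b α)) := fun a b => rfl
  have hA := isRightAct_jointAct (F := F) (K := K) out (nodup_below i)
  have h1 : T (((R⁻¹ : (K ⊗[F] K)ˣ) : K ⊗[F] K) * (R : K ⊗[F] K))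
      = ∑ p, leftMul (R : K ⊗[F] K) out sel i (endAct (out i) (y p) α) *
        jointAct out (below i) (x p) := by
    have e : ((R⁻¹ : (K ⊗[F] K)ˣ) : K ⊗[F] K) * (R : K ⊗[F] K)
        = ∑ p, ∑ q, (x p * u q) ⊗ₜ[F] (y p * v q) := by
      conv_lhs => rw [hxy, huv]
      simp [Finset.sum_mul_sum]
    rw [e, map_sum]
    refine Finset.sum_congr rfl fun p _ => ?_
    rw [map_sum, leftMul_sum out sel huv, Finset.sum_mul]
    refine Finset.sum_congr rfl fun q _ => ?_
    rw [hT, hA.mul, (isRightAct_endAct (out i)).mul, Module.End.mul_apply, mul_assoc,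
      jointAct_commute_slot out (by simp), mul_assoc]
  rw [← h1, Units.inv_mul, Algebra.TensorProduct.one_def, hT, hA.one, one_mul,
    (isRightAct_endAct (out i)).one, Module.End.one_apply]

end Unbraid

/-! ### Left multiplication by the functions of an edge -/

section Edge

variable {F K : Type*} [Field F] [Ring K] [HopfAlgebra F K]
variable {V E : Type*} [DecidableEq V] (Γ : CiliatedRibbonGraph V E)

/-- The joint action of gauge transformations on the edge ends at `p.1` before the `p.2`-th. -/
def siteBelow (p : Σ v, Fin (Γ.valence v)) : K →ₗ[F] TotalEnd F K Γ :=
  (atVertex F K Γ p.1).toLinearMap ∘ₗ jointAct (Γ.outgoing p.1) (below p.2)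

/-- The joint action of gauge transformations on the edge ends before `y`. -/
def belowAct (y : E ⊕ E) : K →ₗ[F] TotalEnd F K Γ := siteBelow Γ (Γ.ends.symm y)

theorem atVertex_slot {v : V} (i : Fin (Γ.valence v)) (f : Module.End F (Module.Dual F K)) :
    atVertex F K Γ v (slot i f) = atEnd Γ (Γ.ends ⟨v, i⟩) f := by
  rw [atEnd, Equiv.symm_apply_apply]
  rfl

variable (ρ : E → Bool) {R : (K ⊗[F] K)ˣ}

theorem sum_endOp_mul_belowAct {m : ℕ} {x y : Fin m → K}
    (hxy : ((R⁻¹ : (K ⊗[F] K)ˣ) : K ⊗[F] K) = ∑ p, x p ⊗ₜ[F] y p) (z : E ⊕ E)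
    (α : Module.Dual F K) :
    ∑ p, endOp Γ ρ R z (endAct z.isRight (y p) α) * belowAct Γ z (x p)
      = atEnd Γ z (endMul (R : K ⊗[F] K) z.isRight (selectedEnd Γ ρ z) α) := by
  have h := congrArg (atVertex F K Γ (Γ.ends.symm z).1) (sum_leftMul_mul_jointAct
    (Γ.outgoing (Γ.ends.symm z).1) (Γ.selected ρ (Γ.ends.symm z).1) hxy (Γ.ends.symm z).2 α)
  simp only [map_sum, map_mul] at h
  rw [← outgoing_symm Γ z]
  exact h

theorem atEnd_commute {y z : E ⊕ E} (hyz : y ≠ z) (f f' : Module.End F (Module.Dual F K)) :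
    atEnd Γ y f * atEnd Γ z f' = atEnd Γ z f' * atEnd Γ y f := by
  obtain ⟨⟨v, i⟩, rfl⟩ := Γ.ends.surjective y
  obtain ⟨⟨w, j⟩, rfl⟩ := Γ.ends.surjective z
  rw [← atVertex_slot, ← atVertex_slot]
  by_cases hvw : v = w
  · subst hvw
    have hij : i ≠ j := by rintro rfl; exact hyz rfl
    rw [← map_mul, ← map_mul, slot_commute hij]
  · exact atVertex_commute Γ hvw _ _

theorem belowAct_commute {y z : E ⊕ E}
    (hyz : Γ.vertexOf y = Γ.vertexOf z → Γ.position y ≤ Γ.position z) (h : K)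
    (f : Module.End F (Module.Dual F K)) :
    belowAct Γ y h * atEnd Γ z f = atEnd Γ z f * belowAct Γ y h := by
  unfold belowAct atEnd
  unfold CiliatedRibbonGraph.vertexOf CiliatedRibbonGraph.position at hyz
  generalize Γ.ends.symm y = p at *
  generalize Γ.ends.symm z = q at *
  obtain ⟨v, i⟩ := p
  obtain ⟨w, j⟩ := q
  by_cases hvw : v = w
  · subst hvw
    have hij : i ≤ j := hyz rfl
    change atVertex F K Γ v _ * atVertex F K Γ v (slot j f) = _
    rw [← map_mul, jointAct_commute_slot _ (by simpa using hij), map_mul]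
    rfl
  · exact atVertex_commute Γ hvw _ _

theorem tEnd_ne_sEnd (x : E × Bool) : tEnd x ≠ sEnd x := by
  obtain ⟨e, _ | _⟩ := x <;> simp [tEnd, sEnd]

omit [DecidableEq V] in
theorem position_ne {y z : E ⊕ E} (hyz : y ≠ z) (hv : Γ.vertexOf y = Γ.vertexOf z) :
    Γ.position y ≠ Γ.position z := by
  unfold CiliatedRibbonGraph.vertexOf at hv
  unfold CiliatedRibbonGraph.position
  have hpq : Γ.ends.symm y ≠ Γ.ends.symm z := fun h => hyz (Γ.ends.symm.injective h)
  generalize Γ.ends.symm y = p at *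
  generalize Γ.ends.symm z = q at *
  obtain ⟨v, i⟩ := p
  obtain ⟨w, j⟩ := q
  obtain rfl : v = w := hv
  intro h
  obtain rfl : i = j := Fin.ext h
  exact hpq rfl

omit [DecidableEq V] in
theorem exists_admissible (e : E) : ∃ b, Γ.Admissible (e, b) := by
  by_cases hv : Γ.vertexOf (Sum.inl e) = Γ.vertexOf (Sum.inr e)
  · rcases lt_or_gt_of_ne (position_ne Γ Sum.inl_ne_inr hv) with h | h
    · exact ⟨true, Or.inr h⟩
    · exact ⟨false, Or.inr h⟩
  · exact ⟨true, Or.inl hv⟩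

omit [DecidableEq V] in
theorem Admissible.position_lt {x : E × Bool} (hx : Γ.Admissible x)
    (hv : Γ.vertexOf (tEnd x) = Γ.vertexOf (sEnd x)) : Γ.position (tEnd x) < Γ.position (sEnd x) :=
  hx.resolve_left (not_not_intro hv)

variable [FiniteDimensional F K]

variable (R) in
/-- Left multiplication by the functions of an edge, written in terms of its ends. -/
def edgeOp (x : E × Bool) : Module.Dual F K →ₗ[F] TotalEnd F K Γ :=
  LinearMap.mul' F (TotalEnd F K Γ) ∘ₗ
    TensorProduct.map (endOp Γ ρ R (tEnd x)) (endOp Γ ρ R (sEnd x)) ∘ₗ comulOr x.2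

variable (R) in
/-- Left multiplication by the functions of an edge, before braiding. -/
def edgeSlot (x : E × Bool) : Module.Dual F K →ₗ[F] TotalEnd F K Γ :=
  LinearMap.mul' F (TotalEnd F K Γ) ∘ₗ
    TensorProduct.map
      ((atEnd Γ (tEnd x)).toLinearMap ∘ₗ endLeft (R : K ⊗[F] K) (tEnd x).isRight
        (selectedEnd Γ ρ (tEnd x)))
      ((atEnd Γ (sEnd x)).toLinearMap ∘ₗ endLeft (R : K ⊗[F] K) (sEnd x).isRight
        (selectedEnd Γ ρ (sEnd x))) ∘ₗ comulOr x.2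

/-- The braiding is undone at both ends. For an admissible edge the target end does not come after
the starting end at a common vertex, so the action on the ends before the target commutes with the
functions of the starting end and can be collected on the right. -/
theorem edgeSlot_eq {m : ℕ} {u v : Fin m → K}
    (huv : ((R⁻¹ : (K ⊗[F] K)ˣ) : K ⊗[F] K) = ∑ p, u p ⊗ₜ[F] v p) {x : E × Bool}
    (hx : Γ.Admissible x) (α : Module.Dual F K) :
    edgeSlot Γ ρ R x α = ∑ p, ∑ q, edgeOp Γ ρ R x
        (endAct (tEnd x).isRight (v q) (endAct (sEnd x).isRight (v p) α)) *
      (belowAct Γ (sEnd x) (u p) * belowAct Γ (tEnd x) (u q)) := by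
  simp only [edgeSlot, edgeOp, LinearMap.comp_apply, ← comulOr_act]
  generalize comulOr x.2 α = w
  induction w using TensorProduct.induction_on with
  | zero => simp
  | add a b ha hb => simp only [map_add, add_mul, Finset.sum_add_distrib, ha, hb]
  | tmul a b =>
    simp only [TensorProduct.map_tmul, LinearMap.mul'_apply, LinearMap.comp_apply,
      AlgHom.toLinearMap_apply]
    have h1 := sum_endOp_mul_belowAct Γ ρ huv (tEnd x) a
    have h2 := sum_endOp_mul_belowAct Γ ρ huv (sEnd x) b
    have h3 := belowAct_commute (F := F) (K := K) Γ (y := tEnd x) (z := sEnd x)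
      fun hv => (Admissible.position_lt Γ hx hv).le
    change atEnd Γ (tEnd x) (endMul _ _ _ a) * atEnd Γ (sEnd x) (endMul _ _ _ b) = _
    rw [← h1, Finset.sum_mul]
    simp only [mul_assoc, h3]
    rw [← h2, Finset.sum_comm]
    refine Finset.sum_congr rfl fun p _ => ?_
    rw [Finset.sum_mul, Finset.mul_sum]
    refine Finset.sum_congr rfl fun q _ => ?_
    simp only [mul_assoc]

theorem edgeSlot_symm (e : E) : edgeSlot Γ ρ R (e, false) = edgeSlot Γ ρ R (e, true) := by
  ext1 α
  change LinearMap.mul' F (TotalEnd F K Γ) (TensorProduct.map _ _ (TensorProduct.comm F _ _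
    (comulDual α))) = LinearMap.mul' F (TotalEnd F K Γ) (TensorProduct.map _ _ (comulDual α))
  generalize comulDual α = w
  induction w using TensorProduct.induction_on with
  | zero => simp
  | add a b ha hb => simp only [map_add, ha, hb]
  | tmul a b =>
    simp only [TensorProduct.comm_tmul, TensorProduct.map_tmul, LinearMap.mul'_apply]
    exact (atEnd_commute Γ (tEnd_ne_sEnd (e, true)) _ _).symm

variable [Fintype E] [DecidableEq E]

variable (R) in
/-- Left multiplication by `G*((α)ₑ)`. -/
def holOp (e : E) : Module.Dual F K →ₗ[F] TotalEnd F K Γ :=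
  totalMul Γ (R : K ⊗[F] K) ρ ∘ₗ Gstar Γ ∘ₗ
    (PiTensorProduct.tprod F).toLinearMap (fun _ : E => (counit : K →ₗ[F] F)) e

omit [DecidableEq V] in
theorem holOp_apply (e : E) (α : Module.Dual F K) :
    holOp Γ ρ R e α = totalMul Γ (R : K ⊗[F] K) ρ (Gstar Γ (single e α)) := rfl

/-- For an admissible orientation the factor of the starting end is applied to the unit first and
the factor of the earlier target end afterwards, so no braiding arises: G*((α)ₑ) is the plain
product of its two halves, also for e⁻¹ with the opposite coproduct. -/
theorem holOp_eq {g : K} (hg : IsPivotal F g) (hR : IsRMatrix R) {x : E × Bool}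
    (hx : Γ.Admissible x) : holOp Γ ρ R x.1 = edgeOp Γ ρ R x := by
  have key : ∀ a b : Module.Dual F K, endOp Γ ρ R (tEnd x) a (endOp Γ ρ R (sEnd x) b
      (totalOne F K Γ)) = flat Γ (Function.update (Function.update
        (fun _ => (counit : K →ₗ[F] F)) (sEnd x) b) (tEnd x) a) := by
    intro a b
    rw [totalOne, endOp_flat Γ ρ hR _ _ _ fun _ _ _ => rfl, endOp_flat Γ ρ hR]
    intro z hv hz
    rw [Function.update_of_ne]
    rintro rfl
    exact absurd (Admissible.position_lt Γ hx hv.symm) (not_lt.2 hz)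
  have key2 : ∀ w : Module.Dual F K ⊗[F] Module.Dual F K,
      totalMul Γ (R : K ⊗[F] K) ρ (LinearMap.mul' F (TotalEnd F K Γ)
        (TensorProduct.map (endOp Γ ρ R (tEnd x)) (endOp Γ ρ R (sEnd x)) w) (totalOne F K Γ))
      = LinearMap.mul' F (TotalEnd F K Γ)
        (TensorProduct.map (endOp Γ ρ R (tEnd x)) (endOp Γ ρ R (sEnd x)) w) := by
    intro w
    induction w using TensorProduct.induction_on with
    | zero => simp
    | add a b ha hb => simp only [map_add, LinearMap.add_apply, ha, hb]
    | tmul a b =>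
      rw [TensorProduct.map_tmul, LinearMap.mul'_apply, Module.End.mul_apply,
        totalMul_endOp Γ ρ hg hR, totalMul_endOp_one Γ ρ hg hR]
  ext1 α
  rw [holOp_apply, edgeOp, LinearMap.comp_apply, LinearMap.comp_apply, ← key2]
  congr 1
  have e1 : (fun i => comulDual (Function.update (fun _ : E => (counit : K →ₗ[F] F)) x.1 α i))
      = Function.update (fun i => (counit : K →ₗ[F] F) ⊗ₜ[F] (counit : K →ₗ[F] F)) x.1
        (comulDual α) := by
    funext i
    by_cases hi : i = x.1
    · subst hi; simp
    · simp [hi, comulDual_counit]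
  rw [single, Gstar_eq, LinearMap.comp_apply, PiTensorProduct.map_tprod, e1]
  have e2 : ∀ a b : Module.Dual F K, edgeEmb F K Γ (PiTensorProduct.tprod F
      (Function.update (fun i => (counit : K →ₗ[F] F) ⊗ₜ[F] (counit : K →ₗ[F] F)) x.1 (a ⊗ₜ b)))
      = flat Γ (Function.update (Function.update (fun _ => (counit : K →ₗ[F] F)) (Sum.inr x.1) b)
        (Sum.inl x.1) a) := by
    intro a b
    have h1 : (Function.update (fun i => (counit : K →ₗ[F] F) ⊗ₜ[F] (counit : K →ₗ[F] F))
        x.1 (a ⊗ₜ b)) = fun i => Function.update (fun _ => (counit : K →ₗ[F] F)) x.1 a i ⊗ₜ[F]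
          Function.update (fun _ => (counit : K →ₗ[F] F)) x.1 b i := by
      funext i
      by_cases hi : i = x.1
      · subst hi; simp
      · simp [hi]
    rw [h1, edgeEmb_tprod]
    congr 1
    funext y
    cases y with
    | inl i =>
      by_cases hi : i = x.1
      · subst hi; simp
      · simp [hi]
    | inr i =>
      by_cases hi : i = x.1
      · subst hi; simp
      · simp [hi]
  obtain ⟨e, _ | _⟩ := x
  · change edgeEmb F K Γ _ = LinearMap.mul' F (TotalEnd F K Γ) (TensorProduct.map _ _
      (TensorProduct.comm F _ _ (comulDual α))) _
    generalize comulDual α = w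
    induction w using TensorProduct.induction_on with
    | zero => rw [MultilinearMap.map_update_zero]; simp
    | add a b ha hb =>
      rw [MultilinearMap.map_update_add, map_add, ha, hb]
      simp only [map_add, LinearMap.add_apply]
    | tmul a b =>
      rw [e2, TensorProduct.comm_tmul, TensorProduct.map_tmul, LinearMap.mul'_apply,
        Module.End.mul_apply, key]
      congr 1
      exact Function.update_comm Sum.inr_ne_inl _ _ _
  · change edgeEmb F K Γ _ = LinearMap.mul' F (TotalEnd F K Γ) (TensorProduct.map _ _
      (comulDual α)) _
    generalize comulDual α = w
    induction w using TensorProduct.induction_on with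
    | zero => rw [MultilinearMap.map_update_zero]; simp
    | add a b ha hb =>
      rw [MultilinearMap.map_update_add, map_add, ha, hb]
      simp only [map_add, LinearMap.add_apply]
    | tmul a b =>
      rw [e2, TensorProduct.map_tmul, LinearMap.mul'_apply, Module.End.mul_apply, key]
      rfl

end Edge

end HopfGauge

end

noncomputable section

namespace HopfGauge

open Coalgebra HopfAlgebra

/-! ### The image of `G*` is generated by the functions of the edges -/

section Stable

/-- The endomorphisms that map a submodule to itself. -/
def stabilizer {F M : Type*} [Field F] [AddCommMonoid M] [Module F M] (W : Submodule F M) :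
    Subalgebra F (Module.End F M) where
  carrier := {f | ∀ w ∈ W, f w ∈ W}
  mul_mem' hf hf' w hw := hf _ (hf' w hw)
  add_mem' hf hf' w hw := W.add_mem (hf w hw) (hf' w hw)
  algebraMap_mem' r w hw := by
    rw [Module.algebraMap_end_apply]
    exact W.smul_mem r hw

variable {F K : Type*} [Field F] [Ring K] [HopfAlgebra F K]

theorem conv_mem {B : Type*} [Semiring B] [Algebra F B] {A : Subalgebra F B} {a c : K →ₗ[F] B}
    (ha : ∀ h, a h ∈ A) (hc : ∀ h, c h ∈ A) (h : K) : conv a c h ∈ A := by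
  rw [conv_apply_repr (ℛ F h)]
  exact A.sum_mem fun i _ => A.mul_mem (ha _) (hc _)

theorem jointAct_mem {n : ℕ} (out : Fin n → Bool) {A : Subalgebra F (DualPowEnd F K n)}
    (hA : ∀ i h, slotAct out i h ∈ A) (l : List (Fin n)) (h : K) : jointAct out l h ∈ A := by
  induction l generalizing h with
  | nil =>
    rw [jointAct, LinearMap.smulRight_apply]
    exact A.smul_mem A.one_mem _
  | cons i l ih => exact conv_mem (hA i) ih h

variable {V E : Type*} [DecidableEq V] (Γ : CiliatedRibbonGraph V E)

/-! ### Subalgebras that contain the actions at single edge ends. -/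

section

variable {A : Subalgebra F (TotalEnd F K Γ)} (hA : ∀ y h, atEnd Γ y (endAct y.isRight h) ∈ A)
include hA

theorem atVertex_jointAct_mem (v : V) (l : List (Fin (Γ.valence v))) (h : K) :
    atVertex F K Γ v (jointAct (Γ.outgoing v) l h) ∈ A := by
  refine jointAct_mem (Γ.outgoing v) (A := A.comap (atVertex F K Γ v)) (fun i k => ?_) l h
  rw [Subalgebra.mem_comap, slotAct_apply, atVertex_slot]
  exact hA _ k

theorem belowAct_mem (y : E ⊕ E) (h : K) : belowAct Γ y h ∈ A :=
  atVertex_jointAct_mem Γ hA _ _ h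

theorem gaugeAct_mem (v : V) (h : K) : gaugeAct Γ v h ∈ A :=
  atVertex_jointAct_mem Γ hA _ _ h

end

variable [Fintype E] [DecidableEq E] [FiniteDimensional F K]

theorem atEnd_range_Gstar (y : E ⊕ E) (h : K) :
    atEnd Γ y (endAct y.isRight h) ∈ stabilizer (LinearMap.range (Gstar (F := F) (K := K) Γ)) := by
  rintro _ ⟨z, rfl⟩
  exact ⟨_, (Gstar_act Γ y h z).symm⟩

/-- The span of the functions `G*(⨂ₑ αₑ)` that are trivial outside a set of edges. -/
def supported (S : Finset E) : Submodule F (VertexFun F K Γ) :=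
  Submodule.span F {w | ∃ x : E → Module.Dual F K,
    (∀ e ∉ S, x e = (counit : K →ₗ[F] F)) ∧ w = Gstar Γ (PiTensorProduct.tprod F x)}

theorem atEnd_supported (S : Finset E) (y : E ⊕ E) (h : K) :
    atEnd Γ y (endAct y.isRight h) ∈ stabilizer (supported (F := F) (K := K) Γ S) := by
  intro w hw
  refine Submodule.span_induction ?_ ?_ ?_ ?_ hw
  · rintro _ ⟨x, hx, rfl⟩
    rw [Gstar_act, atFactor_tprod]
    by_cases he : y.elim id id ∈ S
    · refine Submodule.subset_span ⟨_, fun e he' => ?_, rfl⟩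
      rw [Function.update_of_ne, hx e he']
      rintro rfl
      exact he' he
    · rw [hx _ he, endAct_counit, MultilinearMap.map_update_smul, map_smul, ← hx _ he,
        Function.update_eq_self]
      exact Submodule.smul_mem _ _ (Submodule.subset_span ⟨x, hx, rfl⟩)
  · rw [map_zero]; exact Submodule.zero_mem _
  · intro a b _ _ ha hb
    rw [map_add]; exact Submodule.add_mem _ ha hb
  · intro r a _ ha
    rw [map_smul]; exact Submodule.smul_mem _ _ ha

variable (ρ : E → Bool) {R : (K ⊗[F] K)ˣ} {g : K} (hg : IsPivotal F g) (hR : IsRMatrix R)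
include hg hR

/-- Induction on the support. A function that is nontrivial at e arises from one that is trivial
there by unbraided multiplication at the two ends of e. By `edgeSlot_eq` that is a sum of holonomy
operators applied after gauge actions on earlier ends, and those actions do not enlarge the support
because ε is invariant up to a scalar. -/
theorem supported_le {N : Submodule F (VertexFun F K Γ)} (h1 : totalOne F K Γ ∈ N)
    (hN : ∀ e α, holOp Γ ρ R e α ∈ stabilizer N) (S : Finset E) :
    supported (F := F) (K := K) Γ S ≤ N := by
  induction S using Finset.induction_on with
  | empty =>
    refine Submodule.span_le.2 ?_
    rintro _ ⟨x, hx, rfl⟩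
    obtain rfl : x = fun _ => (counit : K →ₗ[F] F) := funext fun e => hx e (by simp)
    rw [Gstar_one]
    exact h1
  | insert e S he ih =>
    refine Submodule.span_le.2 ?_
    rintro _ ⟨x, hx, rfl⟩
    -- A loop may be admissible only in its reversed orientation; the unbraided operator does not
    -- depend on the orientation.
    obtain ⟨b, hb⟩ := exists_admissible Γ e
    have hw : Gstar Γ (PiTensorProduct.tprod F (Function.update x e (counit : K →ₗ[F] F)))
        ∈ supported (F := F) (K := K) Γ S := by
      refine Submodule.subset_span ⟨_, fun e' he' => ?_, rfl⟩
      by_cases hee : e' = e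
      · subst hee; simp
      · rw [Function.update_of_ne hee, hx]
        simp [hee, he']
    have hup := Gstar_update Γ e x (x e)
      (f := endLeft (R : K ⊗[F] K) false (selectedEnd Γ ρ (Sum.inl e)))
      (f' := endLeft (R : K ⊗[F] K) true (selectedEnd Γ ρ (Sum.inr e)))
      (endMul_counit_right hR _ _) (endMul_counit_right hR _ _)
    rw [Function.update_eq_self] at hup
    have hslot : Gstar Γ (PiTensorProduct.tprod F x) = edgeSlot Γ ρ R (e, b) (x e)
        (Gstar Γ (PiTensorProduct.tprod F (Function.update x e (counit : K →ₗ[F] F)))) := by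
      rw [hup]
      cases b
      · rw [edgeSlot_symm]; rfl
      · rfl
    obtain ⟨n, u, v, huv⟩ := exists_sum_tmul ((R⁻¹ : (K ⊗[F] K)ˣ) : K ⊗[F] K)
    rw [hslot, edgeSlot_eq Γ ρ huv hb, ← holOp_eq Γ ρ hg hR hb]
    simp only [LinearMap.sum_apply]
    refine N.sum_mem fun p _ => N.sum_mem fun q _ => hN _ _ _ (ih ?_)
    have hA := atEnd_supported (F := F) (K := K) Γ S
    exact (stabilizer (supported Γ S)).mul_mem (belowAct_mem Γ hA _ _) (belowAct_mem Γ hA _ _) _ hw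

theorem range_Gstar_le {N : Submodule F (VertexFun F K Γ)} (h1 : totalOne F K Γ ∈ N)
    (hN : ∀ e α, holOp Γ ρ R e α ∈ stabilizer N) :
    LinearMap.range (Gstar (F := F) (K := K) Γ) ≤ N := by
  rintro _ ⟨z, rfl⟩
  induction z using PiTensorProduct.induction_on with
  | smul_tprod r x =>
    rw [map_smul]
    refine N.smul_mem r (supported_le Γ ρ hg hR h1 hN Finset.univ ?_)
    exact Submodule.subset_span ⟨x, fun e he => absurd (Finset.mem_univ e) he, rfl⟩
  | add a b ha hb => rw [map_add]; exact N.add_mem ha hb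

end Stable

end HopfGauge

end

noncomputable section

namespace HopfGauge

open Coalgebra HopfAlgebra

/-! ### The relations of the holonomies -/

/-- The relation of two edges from those of their ends: t and s stand for the matrices of the target
and the reversed starting end, with index 1 for x and 2 for y. -/
theorem exchange_four {A : Type*} [Monoid A] {t₁ s₁ t₂ s₂ a a' b c d : A}
    (hb : s₂ * b * t₁ = t₁ * s₂) (ha : t₂ * t₁ = a * (t₁ * t₂)) (hd : s₂ * s₁ = s₁ * s₂ * d)
    (hc : t₂ * s₁ = s₁ * c * t₂) (h : a' * a = 1) :
    a' * (t₂ * s₂) * b * (t₁ * s₁) = t₁ * s₁ * c * (t₂ * s₂) * d := by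
  calc a' * (t₂ * s₂) * b * (t₁ * s₁) = a' * t₂ * (s₂ * b * t₁) * s₁ := by simp only [mul_assoc]
    _ = a' * (t₂ * t₁) * s₂ * s₁ := by rw [hb]; simp only [mul_assoc]
    _ = (a' * a) * t₁ * t₂ * (s₂ * s₁) := by rw [ha]; simp only [mul_assoc]
    _ = t₁ * (t₂ * s₁) * s₂ * d := by rw [hd, h, one_mul]; simp only [mul_assoc]
    _ = _ := by rw [hc]; simp only [mul_assoc]

section Holonomy

variable {F K : Type*} [Field F] [Ring K] [HopfAlgebra F K] [FiniteDimensional F K]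
variable {V E : Type*} [DecidableEq V] (Γ : CiliatedRibbonGraph V E)

/-- The relations of the lattice algebra for linear maps on `K*` in place of matrices of
generators. -/
structure IsHolonomy {B : Type*} [Semiring B] [Algebra F B] (R : (K ⊗[F] K)ˣ) (g : K)
    (f : E × Bool → Module.Dual F K →ₗ[F] B) : Prop where
  one : ∀ x, f x (counit : K →ₗ[F] F) = 1
  reversal : ∀ x : E × Bool, f (x.1, !x.2) = f x ∘ₗ revDual g
  functorial : ∀ x, Γ.Admissible x →
    leg₂ (univ (f x)) * scal (Γ.braid R (tEnd x) (sEnd x) : K ⊗[F] K) * leg₁ (univ (f x))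
      = scal (R : K ⊗[F] K) * copr (univ (f x))
  exchange_same : ∀ x, Γ.Admissible x →
    leg₂ (univ (f x)) * scal (Γ.braid R (tEnd x) (sEnd x) : K ⊗[F] K) * leg₁ (univ (f x))
      = scal (R : K ⊗[F] K) * leg₁ (univ (f x))
        * scal (((Γ.braid R (sEnd x) (tEnd x))⁻¹ : (K ⊗[F] K)ˣ) : K ⊗[F] K)
        * leg₂ (univ (f x)) * scal (((flipUnit R)⁻¹ : (K ⊗[F] K)ˣ) : K ⊗[F] K)
  exchange : ∀ x y, Γ.Admissible x → Γ.Admissible y → x.1 ≠ y.1 →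
    scal (((Γ.braid R (tEnd x) (tEnd y))⁻¹ : (K ⊗[F] K)ˣ) : K ⊗[F] K) * leg₂ (univ (f y))
        * scal (Γ.braid R (tEnd x) (sEnd y) : K ⊗[F] K) * leg₁ (univ (f x))
      = leg₁ (univ (f x)) * scal (((Γ.braid R (sEnd x) (tEnd y))⁻¹ : (K ⊗[F] K)ˣ) : K ⊗[F] K)
        * leg₂ (univ (f y)) * scal (Γ.braid R (sEnd x) (sEnd y) : K ⊗[F] K)

omit [FiniteDimensional F K] in
theorem flipUnit_flipUnit (W : (K ⊗[F] K)ˣ) : flipUnit (flipUnit W) = W := by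
  ext
  rw [flipUnit_val, flipUnit_val]
  induction (W : K ⊗[F] K) using TensorProduct.induction_on with
  | zero => simp
  | add a b ha hb => simp only [map_add, ha, hb]
  | tmul k l => rfl

omit [FiniteDimensional F K] in
theorem flipUnit_braid (R : (K ⊗[F] K)ˣ) {y z : E ⊕ E} (hyz : y ≠ z) :
    flipUnit (Γ.braid R y z) = (Γ.braid R z y)⁻¹ := by
  unfold CiliatedRibbonGraph.braid
  by_cases hv : Γ.vertexOf y = Γ.vertexOf z
  · have hne := position_ne Γ hyz hv
    rw [if_pos hv, if_pos hv.symm]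
    rcases lt_or_gt_of_ne hne with h | h
    · rw [if_pos h, if_neg h.not_gt, inv_inv]
    · rw [if_neg h.not_gt, if_pos h]
      have : flipUnit (flipUnit R)⁻¹ = (flipUnit (flipUnit R))⁻¹ := map_inv (Units.map _) _
      rw [this, flipUnit_flipUnit]
  · rw [if_neg hv, if_neg (Ne.symm hv), inv_one]
    exact map_one (Units.map _)

theorem tEnd_ne {x y : E × Bool} (hxy : x.1 ≠ y.1) : tEnd x ≠ tEnd y ∧ tEnd x ≠ sEnd y ∧
    sEnd x ≠ tEnd y ∧ sEnd x ≠ sEnd y := by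
  obtain ⟨e, _ | _⟩ := x <;> obtain ⟨e', _ | _⟩ := y <;> simpa [tEnd, sEnd] using hxy

variable (ρ : E → Bool) {R : (K ⊗[F] K)ˣ} {g : K}

omit [DecidableEq V] [FiniteDimensional F K] in
-- Exactly one end of each edge is selected. This is the point at which the choice of selected ends
-- leaves the relations.
theorem endTwist_mul (x : E × Bool) : endTwist R (selectedEnd Γ ρ (tEnd x))
    * endTwist R (selectedEnd Γ ρ (sEnd x)) = R := by
  obtain ⟨e, _ | _⟩ := x <;> cases h : ρ e <;>
    simp [tEnd, sEnd, selectedEnd_inl, selectedEnd_inr, h, endTwist]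

/-- The element `γ` for which the holonomy of `x` is the product of the matrix of its target and the
matrix of its starting end, reversed by `γ S`. -/
def edgeRev (g : K) (x : E × Bool) : K := if x.2 then g else 1

variable (hg : IsPivotal F g) (hR : IsRMatrix R)

omit [FiniteDimensional F K] in
include hg hR in
theorem edgeRev_spec (x : E × Bool) :
    comul (R := F) (edgeRev g x) = edgeRev g x ⊗ₜ[F] edgeRev g x ∧
    (edgeRev g x ⊗ₜ[F] edgeRev g x) * (R : K ⊗[F] K) = R * (edgeRev g x ⊗ₜ[F] edgeRev g x) := by
  obtain ⟨e, _ | _⟩ := x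
  · simp [edgeRev, ← Algebra.TensorProduct.one_def]
  · exact ⟨hg.comul, hg.comm hR⟩

/-- The map k ↦ g S(k) reverses products, with g staying on the left. So T* of a product distributes
as T* on one half and as the plain dual of S on the other. -/
theorem comulOr_revDual (α : Module.Dual F K) : comulOr false (revDual g α)
    = TensorProduct.map (revDual g) (revDual 1) (comulDual α) := by
  refine dualDistrib_injective ?_
  have e : TensorProduct.dualDistrib F K K
      (TensorProduct.map (revDual g) (revDual 1) (comulDual α)) = _ :=
    dualDistrib_map (LinearMap.mulLeft F g ∘ₗ antipode F) (LinearMap.mulLeft F 1 ∘ₗ antipode F) _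
  have e' : ∀ w : Module.Dual F K ⊗[F] Module.Dual F K, TensorProduct.dualDistrib F K K
      (TensorProduct.comm F _ _ w) = TensorProduct.dualDistrib F K K w ∘ₗ
        (TensorProduct.comm F K K).toLinearMap := by
    intro w
    induction w using TensorProduct.induction_on with
    | zero => simp
    | add a b ha hb => simp only [map_add, ha, hb, LinearMap.add_comp]
    | tmul a b => ext k l; simp [mul_comm]
  rw [e, dualDistrib_comulDual]
  refine (e' _).trans ?_
  rw [dualDistrib_comulDual]
  ext k l
  simp [antipode_mul_antidistrib, mul_assoc]

variable [Fintype E] [DecidableEq E]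

variable (R g) in
/-- The holonomies of the oriented edges in the gauge theory algebra. -/
def holMap (x : E × Bool) : Module.Dual F K →ₗ[F] TotalEnd F K Γ :=
  if x.2 then holOp Γ ρ R x.1 else holOp Γ ρ R x.1 ∘ₗ revDual g

include hg hR

/-- For the edge e itself the reversal by g S undoes the straightening of its outgoing starting end.
For e⁻¹ the roles of the ends are exchanged: T* distributes over the coproduct, its g straightens
the outgoing end s(e), and t(e) is reversed by S alone. This explains the two values of `edgeRev`.
-/
theorem univ_holMap {x : E × Bool} (hx : Γ.Admissible x) : univ (holMap Γ ρ R g x)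
    = univ (endMat Γ ρ R g (tEnd x)) * rev (edgeRev g x) (univ (endMat Γ ρ R g (sEnd x))) := by
  rw [rev_univ]
  refine ev_ext fun α => ?_
  rw [ev_univ, ev_univ_mul, holMap, holOp_eq Γ ρ hg hR hx, edgeOp]
  obtain ⟨e, _ | _⟩ := x
  · change LinearMap.mul' F (TotalEnd F K Γ) (TensorProduct.map (endOp Γ ρ R (Sum.inr e))
      (endOp Γ ρ R (Sum.inl e)) (comulOr false (revDual g α))) = _
    rw [comulOr_revDual, endMat_eq, endMat_eq, ← LinearMap.comp_apply (TensorProduct.map _ _),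
      ← TensorProduct.map_comp]
    rfl
  · change LinearMap.mul' F (TotalEnd F K Γ) (TensorProduct.map (endOp Γ ρ R (Sum.inl e))
      (endOp Γ ρ R (Sum.inr e)) (comulDual α)) = _
    rw [endOp_eq Γ ρ R hg, endOp_eq Γ ρ R hg]
    rfl

/-- The inserted braiding makes the starting end of the second copy commute with the target end of
the first. What remains are two relations of single ends, Δᵒᵖ with a factor on the right for the
target and Δ with a factor on the left for the starting end. The two factors multiply to R, which
passes through Δᵒᵖ. -/
theorem holMap_functorial {x : E × Bool} (hx : Γ.Admissible x) :
    leg₂ (univ (holMap Γ ρ R g x)) * scal (Γ.braid R (tEnd x) (sEnd x) : K ⊗[F] K)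
        * leg₁ (univ (holMap Γ ρ R g x))
      = scal (R : K ⊗[F] K) * copr (univ (holMap Γ ρ R g x)) := by
  rw [univ_holMap Γ ρ hg hR hx]
  have q1 := exchange_out_in (isBraiding_braid Γ hR _ _)
    (endMat_exchange Γ ρ hg hR (tEnd_ne_sEnd x)) (edgeRev g x)
  obtain ⟨hγ, hγR⟩ := edgeRev_spec hg hR x
  have q2 := endMat_same Γ ρ hg hR (tEnd x)
  have q3 := endMat_same_rev Γ ρ hg hR hγ hγR (sEnd x)
  have q4 := coprOp_mul_scal hR (univ (endMat Γ ρ R g (tEnd x)))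
  have q5 : (scal (R : K ⊗[F] K) : (K ⊗[F] K) ⊗[F] TotalEnd F K Γ)
      = scal (endTwist R (selectedEnd Γ ρ (tEnd x)) : K ⊗[F] K)
        * scal (endTwist R (selectedEnd Γ ρ (sEnd x)) : K ⊗[F] K) := by
    rw [← map_mul, ← Units.val_mul, endTwist_mul]
  simp only [map_mul]
  generalize rev (edgeRev g x) (univ (endMat Γ ρ R g (sEnd x))) = S at *
  generalize univ (endMat Γ ρ R g (tEnd x)) = T at *
  calc _ = leg₂ T * (leg₂ S * scal (Γ.braid R (tEnd x) (sEnd x) : K ⊗[F] K) * leg₁ T)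
        * leg₁ S := by simp only [mul_assoc]
    _ = (leg₂ T * leg₁ T) * (leg₂ S * leg₁ S) := by rw [q1]; simp only [mul_assoc]
    _ = coprOp T * (scal (endTwist R (selectedEnd Γ ρ (tEnd x)) : K ⊗[F] K)
        * scal (endTwist R (selectedEnd Γ ρ (sEnd x)) : K ⊗[F] K)) * copr S := by
      rw [q2, q3]; simp only [mul_assoc]
    _ = _ := by rw [← q5, q4]; simp only [mul_assoc]

theorem holMap_exchange {x y : E × Bool} (hx : Γ.Admissible x) (hy : Γ.Admissible y)
    (hxy : x.1 ≠ y.1) :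
    scal (((Γ.braid R (tEnd x) (tEnd y))⁻¹ : (K ⊗[F] K)ˣ) : K ⊗[F] K)
        * leg₂ (univ (holMap Γ ρ R g y))
        * scal (Γ.braid R (tEnd x) (sEnd y) : K ⊗[F] K) * leg₁ (univ (holMap Γ ρ R g x))
      = leg₁ (univ (holMap Γ ρ R g x))
        * scal (((Γ.braid R (sEnd x) (tEnd y))⁻¹ : (K ⊗[F] K)ˣ) : K ⊗[F] K)
        * leg₂ (univ (holMap Γ ρ R g y)) * scal (Γ.braid R (sEnd x) (sEnd y) : K ⊗[F] K) := by
  rw [univ_holMap Γ ρ hg hR hx, univ_holMap Γ ρ hg hR hy]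
  obtain ⟨htt, hts, hst, hss⟩ := tEnd_ne hxy
  have q1 := exchange_out_in (isBraiding_braid Γ hR _ _)
    (endMat_exchange Γ ρ hg hR hts) (edgeRev g y)
  have q2 := endMat_exchange Γ ρ hg hR htt
  have q3 := exchange_out_out (isBraiding_braid Γ hR _ _)
    (endMat_exchange Γ ρ hg hR hss) (edgeRev g y) (edgeRev g x)
  have q4 := exchange_in_out (isBraiding_braid Γ hR _ _)
    (endMat_exchange Γ ρ hg hR hst) (edgeRev g x)
  simp only [map_mul leg₁, map_mul leg₂]
  exact exchange_four q1 q2 q3 q4 (scal_inv_mul_scal (Γ.braid R (tEnd x) (tEnd y)))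

theorem isHolonomy_holMap : IsHolonomy Γ R g (holMap Γ ρ R g) where
  one x := by
    have h : ∀ e, holOp Γ ρ R e (counit : K →ₗ[F] F) = 1 := by
      intro e
      rw [holOp_apply, single, Function.update_eq_self_iff.2 rfl, Gstar_one, one_totalMul Γ ρ hR]
    obtain ⟨e, _ | _⟩ := x
    · change holOp Γ ρ R e (revDual g (counit : K →ₗ[F] F)) = 1
      rw [← h e]
      congr 1
      ext k
      simp [hg.counit]
    · exact h e
  reversal x := by
    obtain ⟨e, _ | _⟩ := x
    · change holOp Γ ρ R e = (holOp Γ ρ R e ∘ₗ revDual g) ∘ₗ revDual g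
      rw [LinearMap.comp_assoc, revDual_comp_revDual hg, LinearMap.comp_id]
    · rfl
  functorial x hx := holMap_functorial Γ ρ hg hR hx
  exchange_same x hx := by
    -- With its legs flipped the functoriality relation expresses the product in the opposite order
    -- through R₂₁Δᵒᵖ = Δ R₂₁. Eliminating Δ between the two forms gives the exchange relation.
    have h := holMap_functorial Γ ρ hg hR hx
    have h' := congrArg swapLegs h
    have q := congrArg swapLegs (coprOp_mul_scal hR (univ (holMap Γ ρ R g x)))
    simp only [map_mul, swapLegs_leg₁, swapLegs_leg₂, swapLegs_scal, swapLegs_copr,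
      ← flipUnit_val] at h' q
    have q' : swapLegs (coprOp (univ (holMap Γ ρ R g x))) = copr (univ (holMap Γ ρ R g x)) := by
      rw [← swapLegs_copr]
      generalize copr (univ (holMap Γ ρ R g x)) = w
      induction w using TensorProduct.induction_on with
      | zero => simp
      | add a b ha hb => simp only [map_add, ha, hb]
      | tmul k b =>
        induction k using TensorProduct.induction_on with
        | zero => simp
        | add a b ha hb => simp only [TensorProduct.add_tmul, map_add, ha, hb]
        | tmul k l => rfl
    rw [flipUnit_braid Γ R (tEnd_ne_sEnd x)] at h'
    rw [h]
    simp only [mul_assoc] at h' ⊢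
    rw [← mul_assoc (scal (((Γ.braid R (sEnd x) (tEnd x))⁻¹ : (K ⊗[F] K)ˣ) : K ⊗[F] K)),
      ← mul_assoc (leg₁ _), h', ← q, q', mul_assoc, scal_mul_scal_inv, mul_one]
  exchange x y hx hy hxy := holMap_exchange Γ ρ hg hR hx hy hxy

end Holonomy

end HopfGauge

end

noncomputable section

namespace HopfGauge

open Coalgebra HopfAlgebra

/-! ### Matrices of holonomies -/

section MatrixEvaluation

variable {F K B : Type*} [Field F] [Ring K] [HopfAlgebra F K] [Semiring B] [Algebra F B]

/-- The evaluation `A ⊗ B → Mat(B)` of the first factor in a representation of `A`. -/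
def matEv {A n : Type*} [Semiring A] [Algebra F A] [Fintype n] [DecidableEq n]
    (κ : A →ₐ[F] Matrix n n F) : A ⊗[F] B →ₐ[F] Matrix n n B :=
  Algebra.TensorProduct.lift ((Algebra.ofId F B).mapMatrix.comp κ) (Matrix.scalarAlgHom n F)
    fun a b => by
      ext i j
      simp [Matrix.mul_apply, Matrix.scalar_apply, Matrix.diagonal_apply, Algebra.ofId_apply,
        Algebra.commutes]

theorem matEv_tmul {A n : Type*} [Semiring A] [Algebra F A] [Fintype n] [DecidableEq n]
    (κ : A →ₐ[F] Matrix n n F) (a : A) (b : B) (i j : n) :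
    matEv κ (a ⊗ₜ[F] b) i j = κ a i j • b := by
  change ((κ a).map (algebraMap F B) * Matrix.scalar n b) i j = _
  simp [Matrix.scalar_apply, Algebra.smul_def]

theorem kron_tmul_eq (I J : MatRep F K) (k l : K) :
    I.kron J (k ⊗ₜ l) = I.rep k ⊗ₖ J.rep l := rfl

/-- The tensor product of two representations, as a representation of `K ⊗ K`. -/
def kronHom (I J : MatRep F K) :
    K ⊗[F] K →ₐ[F] Matrix (Fin I.dim × Fin J.dim) (Fin I.dim × Fin J.dim) F :=
  AlgHom.ofLinearMap (I.kron J) (by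
    rw [Algebra.TensorProduct.one_def, kron_tmul_eq, map_one, map_one, Matrix.one_kronecker_one]) (by
    intro x y
    induction x using TensorProduct.induction_on with
    | zero => simp
    | add a b ha hb => simp only [map_add, add_mul, ha, hb]
    | tmul k l =>
      induction y using TensorProduct.induction_on with
      | zero => simp
      | add a b ha hb => simp only [map_add, mul_add, ha, hb]
      | tmul k' l' =>
        simp only [Algebra.TensorProduct.tmul_mul_tmul, kron_tmul_eq, map_mul,
          Matrix.mul_kronecker_mul])

theorem kronHom_apply (I J : MatRep F K) (w : K ⊗[F] K) : kronHom I J w = I.kron J w := rfl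

theorem kron_tmul (I J : MatRep F K) (k l : K) (p q : Fin I.dim × Fin J.dim) :
    I.kron J (k ⊗ₜ l) p q = I.rep k p.1 q.1 * J.rep l p.2 q.2 := rfl

theorem coef_apply (I : MatRep F K) (a b : Fin I.dim) (k : K) : I.coef a b k = I.rep k a b := rfl

theorem dualDistrib_coef (I J : MatRep F K) (p q : Fin I.dim × Fin J.dim) (w : K ⊗[F] K) :
    TensorProduct.dualDistrib F K K (I.coef p.1 q.1 ⊗ₜ J.coef p.2 q.2) w = I.kron J w p q := by
  induction w using TensorProduct.induction_on with
  | zero => simp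
  | add a b ha hb => simp only [map_add, Matrix.add_apply, ha, hb]
  | tmul k l => rw [kron_tmul]; rfl

theorem matEv_apply (I : MatRep F K) (z : K ⊗[F] B) (a b : Fin I.dim) :
    matEv I.rep z a b = ev (I.coef a b) z := by
  induction z using TensorProduct.induction_on with
  | zero => simp
  | add a b ha hb => simp only [map_add, Matrix.add_apply, ha, hb]
  | tmul k l => rw [matEv_tmul, ev_tmul]; rfl

theorem matEv_kron_apply (I J : MatRep F K) (z : (K ⊗[F] K) ⊗[F] B)
    (p q : Fin I.dim × Fin J.dim) :
    matEv (kronHom I J) z p q = ev₂ (I.coef p.1 q.1) (J.coef p.2 q.2) z := by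
  induction z using TensorProduct.induction_on with
  | zero => simp
  | add a b ha hb => simp only [map_add, Matrix.add_apply, ha, hb]
  | tmul w l => rw [matEv_tmul, ev₂_tmul, dualDistrib_coef]; rfl

theorem matEv_scal (I J : MatRep F K) (w : K ⊗[F] K) :
    matEv (B := B) (kronHom I J) (scal w) = (I.kron J w).map (algebraMap F B) := by
  ext p q
  rw [scal_apply, matEv_tmul, Matrix.map_apply, Algebra.algebraMap_eq_smul_one, kronHom_apply]

theorem matEv_leg₁ (I J : MatRep F K) (z : K ⊗[F] B) :
    matEv (kronHom I J) (leg₁ z) = inFst _ (matEv I.rep z) := by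
  induction z using TensorProduct.induction_on with
  | zero => ext; simp [inFst]
  | add a b ha hb => simp only [map_add, inFst, Matrix.add_kronecker] at *; rw [ha, hb]
  | tmul k b =>
    ext p q
    rw [leg₁_tmul, matEv_tmul, kronHom_apply, kron_tmul, inFst, Matrix.kroneckerMap_apply,
      matEv_tmul, map_one]
    by_cases h : p.2 = q.2 <;> simp [Matrix.one_apply, h]

theorem matEv_leg₂ (I J : MatRep F K) (z : K ⊗[F] B) :
    matEv (kronHom I J) (leg₂ z) = inSnd _ (matEv J.rep z) := by
  induction z using TensorProduct.induction_on with
  | zero => ext; simp [inSnd]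
  | add a b ha hb => simp only [map_add, inSnd, Matrix.kronecker_add] at *; rw [ha, hb]
  | tmul k b =>
    ext p q
    rw [leg₂_tmul, matEv_tmul, kronHom_apply, kron_tmul, inSnd, Matrix.kroneckerMap_apply,
      matEv_tmul, map_one]
    by_cases h : p.1 = q.1 <;> simp [Matrix.one_apply, h]

theorem map_mul_algebraMap_apply {m n o : Type*} [Fintype n] (M : Matrix m n B) (A : Matrix n o F)
    (i : m) (j : o) : (M * A.map (algebraMap F B)) i j = ∑ k, A k j • M i k := by
  simp [Matrix.mul_apply, Algebra.smul_def, Algebra.commutes]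

theorem map_algebraMap_mul_apply {m n o : Type*} [Fintype n] (A : Matrix m n F) (M : Matrix n o B)
    (i : m) (j : o) : (A.map (algebraMap F B) * M) i j = ∑ k, A i k • M k j := by
  simp [Matrix.mul_apply, Algebra.smul_def]

theorem matEv_mul_of_intertwiner {A m n : Type*} [Semiring A] [Algebra F A] [Fintype n]
    [DecidableEq n] [Fintype m] [DecidableEq m] {κ : A →ₐ[F] Matrix n n F}
    {κ' : A →ₐ[F] Matrix m m F} {T : Matrix n m F} (hT : ∀ k, κ k * T = T * κ' k) (z : A ⊗[F] B) :
    matEv κ z * T.map (algebraMap F B) = T.map (algebraMap F B) * matEv κ' z := by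
  induction z using TensorProduct.induction_on with
  | zero => simp
  | add a b ha hb => simp only [map_add, Matrix.add_mul, Matrix.mul_add, ha, hb]
  | tmul k b =>
    ext i j
    rw [map_mul_algebraMap_apply, map_algebraMap_mul_apply]
    simp only [matEv_tmul, smul_smul, ← Finset.sum_smul]
    congr 1
    have := congrFun (congrFun (hT k) i) j
    simpa [Matrix.mul_apply, mul_comm] using this

theorem matEv_copr (I J : MatRep F K) (z : K ⊗[F] B) : matEv (kronHom I J) (copr z)
    = matEv ((kronHom I J).comp (Bialgebra.comulAlgHom F K)) z := by
  induction z using TensorProduct.induction_on with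
  | zero => simp
  | add a b ha hb => simp only [map_add, ha, hb]
  | tmul k b => ext p q; rw [copr_tmul, matEv_tmul, matEv_tmul]; rfl

/-- The intertwiners Cₖ pass through the evaluated matrix, and then Σ CₖDₖ = 1 applies. Thus the
right-hand side of the functoriality relation does not depend on the decomposition. -/
theorem sum_matEv {A n : Type*} [Semiring A] [Algebra F A] [Fintype n] [DecidableEq n]
    {κ : A →ₐ[F] Matrix n n F} {r : ℕ} {d : Fin r → ℕ}
    {κ' : ∀ k, A →ₐ[F] Matrix (Fin (d k)) (Fin (d k)) F}
    {C : ∀ k, Matrix n (Fin (d k)) F} {D : ∀ k, Matrix (Fin (d k)) n F}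
    (hC : ∀ k h, κ h * C k = C k * κ' k h) (hCD : ∑ k, C k * D k = 1) (z : A ⊗[F] B) :
    ∑ k, (C k).map (algebraMap F B) * matEv (κ' k) z * (D k).map (algebraMap F B)
      = matEv κ z := by
  have h : (∑ k, (C k).map (algebraMap F B) * (D k).map (algebraMap F B)) = 1 := by
    have := congrArg (algebraMap F B).mapMatrix hCD
    rw [map_sum, map_one] at this
    rw [← this]
    refine Finset.sum_congr rfl fun k _ => ?_
    simp [Matrix.map_mul]
  calc _ = ∑ k, matEv κ z * ((C k).map (algebraMap F B) * (D k).map (algebraMap F B)) := by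
        refine Finset.sum_congr rfl fun k _ => ?_
        rw [← Matrix.mul_assoc, matEv_mul_of_intertwiner (hC k)]
    _ = _ := by rw [← Finset.mul_sum, h, mul_one]

end MatrixEvaluation

/-! ### The universal property of the lattice algebra -/

section Lift

variable {F K : Type*} [Field F] [Ring K] [HopfAlgebra F K] [FiniteDimensional F K]
variable {V E : Type*} [DecidableEq V] {Γ : CiliatedRibbonGraph V E}
variable {R : (K ⊗[F] K)ˣ} {g : K} {B : Type*} [Semiring B] [Algebra F B]
variable {f : E × Bool → Module.Dual F K →ₗ[F] B} (P : Set (MatRep F K))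

/-- The image of a matrix of generators. -/
def freeLift (f : E × Bool → Module.Dual F K →ₗ[F] B) : FreeAlgebra F (Gen P E) →ₐ[F] B :=
  FreeAlgebra.lift F fun G => f G.edge (G.rep.1.coef G.row G.col)

variable {P}

theorem map_genMat (I : P) (x : E × Bool) :
    (genMat I x).map (freeLift P f) = matEv I.1.rep (univ (f x)) := by
  ext a b
  rw [matEv_apply, ev_univ]
  simp [freeLift, genMat]

omit [FiniteDimensional F K] in
theorem map_sc {m n : Type*} (A : Matrix m n F) :
    (sc P E A).map (freeLift P f) = A.map (algebraMap F B) := by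
  ext a b
  simp [sc]

omit [FiniteDimensional F K] in
theorem map_matMul {m n o : Type*} [Fintype n] (A : Matrix m n (FreeAlgebra F (Gen P E)))
    (A' : Matrix n o (FreeAlgebra F (Gen P E))) :
    (A * A').map (freeLift P f) = A.map (freeLift P f) * A'.map (freeLift P f) := by
  ext a b
  simp [Matrix.mul_apply]

omit [FiniteDimensional F K] in
theorem map_inFst {m n : Type*} [DecidableEq n] (A : Matrix m m (FreeAlgebra F (Gen P E))) :
    (inFst n A).map (freeLift P f) = inFst n (A.map (freeLift P f)) := by
  ext p q
  by_cases h : p.2 = q.2 <;> simp [inFst, Matrix.one_apply, h]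

omit [FiniteDimensional F K] in
theorem map_inSnd {m n : Type*} [DecidableEq m] (A : Matrix n n (FreeAlgebra F (Gen P E))) :
    (inSnd m A).map (freeLift P f) = inSnd m (A.map (freeLift P f)) := by
  ext p q
  by_cases h : p.1 = q.1 <;> simp [inSnd, Matrix.one_apply, h]

/-- Naturality holds for every element of K ⊗ B, the trivial and reversal relations are checked on
matrix elements, and the remaining relations are the identities of `IsHolonomy` evaluated in I ⊗ J.
-/
theorem map_matrixRel (hf : IsHolonomy Γ R g f) {m n : Type}
    {A A' : Matrix m n (FreeAlgebra F (Gen P E))} (h : MatrixRel Γ R g P A A') :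
    A.map (freeLift P f) = A'.map (freeLift P f) := by
  cases h with
  | natural I J x T hT =>
    simp only [map_matMul, map_sc, map_genMat]
    exact matEv_mul_of_intertwiner hT _
  | trivial I x hI =>
    rw [map_genMat]
    ext a b
    have : I.1.coef a b = (1 : Matrix (Fin I.1.dim) (Fin I.1.dim) F) a b •
        (counit : K →ₗ[F] F) := by
      ext k
      simp [coef_apply, hI, mul_comm]
    rw [matEv_apply, ev_univ, this, map_smul, hf.one]
    by_cases hab : a = b <;> simp [Matrix.one_apply, hab]
  | reversal I I' x σ hI =>
    rw [map_matMul, map_sc, map_genMat]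
    ext a b
    rw [matEv_apply, ev_univ, hf.reversal, map_algebraMap_mul_apply]
    have e : ∀ c, ((Matrix.submatrix (genMat I' x) σ σ).transpose.map (freeLift P f)) c b
        = f x (I'.1.coef (σ b) (σ c)) := by
      intro c
      have := congrFun (congrFun (map_genMat (f := f) I' x) (σ b)) (σ c)
      rw [matEv_apply, ev_univ] at this
      exact this
    simp only [e, ← map_smul, ← map_sum]
    rw [LinearMap.comp_apply]
    congr 1
    ext k
    simp [coef_apply, hI, Matrix.mul_apply]
  | functorial I J x hx r N C D hC hD hCD =>
    have h := congrArg (matEv (kronHom I.1 J.1)) (hf.functorial x hx)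
    simp only [map_mul, matEv_leg₁, matEv_leg₂, matEv_scal, matEv_copr] at h
    simp only [map_matMul, map_sc, map_genMat, map_inFst, map_inSnd]
    rw [h]
    congr 1
    rw [← sum_matEv (κ' := fun k => (N k).1.rep) hC hCD]
    ext p q
    simp only [Matrix.map_apply, Matrix.sum_apply, map_sum]
    refine Finset.sum_congr rfl fun k _ => ?_
    rw [← Matrix.map_apply (f := freeLift P f), map_matMul, map_matMul, map_sc, map_sc, map_genMat]
  | exchange_same I J x hx =>
    have h := congrArg (matEv (kronHom I.1 J.1)) (hf.exchange_same x hx)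
    simp only [map_mul, matEv_leg₁, matEv_leg₂, matEv_scal] at h
    simp only [map_matMul, map_sc, map_genMat, map_inFst, map_inSnd]
    exact h
  | exchange I J x y hx hy hxy =>
    have h := congrArg (matEv (kronHom I.1 J.1)) (hf.exchange x y hx hy hxy)
    simp only [map_mul, matEv_leg₁, matEv_leg₂, matEv_scal] at h
    simp only [map_matMul, map_sc, map_genMat, map_inFst, map_inSnd]
    exact h

variable (P) in
/-- The algebra homomorphism from the lattice algebra that is defined by a family of holonomies. -/
def latticeLift (hf : IsHolonomy Γ R g f) : LatticeAlgebra Γ R g P →ₐ[F] B :=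
  RingQuot.liftAlgHom F ⟨freeLift P f, by
    rintro _ _ ⟨A, A', h, i, j⟩
    exact congrFun (congrFun (map_matrixRel hf h) i) j⟩

theorem latticeLift_holonomy (hf : IsHolonomy Γ R g f) (I : P) (x : E × Bool)
    (a b : Fin I.1.dim) : latticeLift P hf (holonomy Γ R g I x a b) = f x (I.1.coef a b) := by
  rw [holonomy, latticeLift, RingQuot.liftAlgHom_mkAlgHom_apply]
  simp [freeLift, genMat]

omit [FiniteDimensional F K] in
theorem adjoin_holonomy : Algebra.adjoin F {l | ∃ (I : P) (x : E × Bool) (a b : Fin I.1.dim),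
    l = holonomy Γ R g I x a b} = ⊤ := by
  have h1 := FreeAlgebra.adjoin_range_ι F (Gen P E)
  have h2 := congrArg (Subalgebra.map (RingQuot.mkAlgHom F (LatticeRel Γ R g P))) h1
  rw [Algebra.map_top, (AlgHom.range_eq_top _).2 (RingQuot.mkAlgHom_surjective F _),
    AlgHom.map_adjoin] at h2
  rw [← h2]
  congr 1
  ext l
  constructor
  · rintro ⟨I, x, a, b, rfl⟩
    exact ⟨_, ⟨⟨I, x, a, b⟩, rfl⟩, rfl⟩
  · rintro ⟨_, ⟨G, rfl⟩, rfl⟩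
    exact ⟨G.rep, G.edge, G.row, G.col, rfl⟩

end Lift

end HopfGauge

end

noncomputable section

namespace HopfGauge

open Coalgebra HopfAlgebra

/-! ### Classes of representations -/

section Classes

variable {F K : Type*} [Field F] [Ring K] [HopfAlgebra F K]

/-- The representation `κ` is a direct sum of retracts that are in the class `P`. -/
def Decomposes (P : Set (MatRep F K)) {n : Type*} [Fintype n] [DecidableEq n]
    (κ : K →ₐ[F] Matrix n n F) : Prop :=
  ∃ (r : ℕ) (N : Fin r → P) (C : ∀ k, Matrix n (Fin (N k).1.dim) F)
    (D : ∀ k, Matrix (Fin (N k).1.dim) n F),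
    (∀ k h, κ h * C k = C k * (N k).1.rep h) ∧ (∀ k h, D k * κ h = (N k).1.rep h * D k) ∧
    ∑ k, C k * D k = 1

/-- The class `P` contains the trivial representation and dual representations, and every
representation is a direct sum of retracts in `P`. -/
structure IsComplete (P : Set (MatRep F K)) : Prop where
  decomposes : ∀ I : MatRep F K, Decomposes P I.rep
  trivial : ∃ I ∈ P, 0 < I.dim ∧ ∀ k, I.rep k = counit (R := F) k • (1 : Matrix _ _ F)
  dual : ∀ I ∈ P, ∃ I' ∈ P, ∃ σ : Fin I.dim ≃ Fin I'.dim,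
    ∀ k a b, I'.rep k (σ a) (σ b) = I.rep (antipode F k) b a

variable {P : Set (MatRep F K)} (hP : IsComplete P)
include hP

theorem IsComplete.decomposes_fintype {n : Type*} [Fintype n] [DecidableEq n]
    (κ : K →ₐ[F] Matrix n n F) : Decomposes P κ := by
  let e := Fintype.equivFin n
  obtain ⟨r, N, C, D, hC, hD, hCD⟩ := hP.decomposes
    ⟨Fintype.card n, (Matrix.reindexAlgEquiv F F e).toAlgHom.comp κ⟩
  have hκ : ∀ h, κ h = ((Matrix.reindexAlgEquiv F F e).toAlgHom.comp κ h).submatrix e e := by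
    intro h
    ext i j
    simp
  refine ⟨r, N, fun k => (C k).submatrix e id, fun k => (D k).submatrix id e, fun k h => ?_,
    fun k h => ?_, ?_⟩
  · rw [hκ, Matrix.submatrix_mul_equiv, hC]
    rfl
  · rw [hκ, Matrix.submatrix_mul_equiv, hD]
    rfl
  · ext i j
    have := congrFun (congrFun hCD (e i)) (e j)
    simpa [Matrix.sum_apply, Matrix.mul_apply, Matrix.one_apply] using this

variable [FiniteDimensional F K]

/-- Every functional is a combination of matrix elements of the regular representation, and these
are combinations of matrix elements of its summands in P. -/
theorem IsComplete.span_coef : Submodule.span F {α : Module.Dual F K |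
    ∃ (I : P) (a b : Fin I.1.dim), α = I.1.coef a b} = ⊤ := by
  refine Submodule.eq_top_iff'.2 fun α => ?_
  let b := Module.finBasis F K
  obtain ⟨r, N, C, D, hC, hD, hCD⟩ := hP.decomposes_fintype (Algebra.leftMulMatrix b)
  have h1 : ∀ k, Algebra.leftMulMatrix b k = ∑ s, C s * (N s).1.rep k * D s := by
    intro k
    rw [← mul_one (Algebra.leftMulMatrix b k), ← hCD, Finset.mul_sum]
    exact Finset.sum_congr rfl fun s _ => by rw [← hC, Matrix.mul_assoc]
  have h2 : ∀ k, α k = ∑ i, ∑ j, (α (b i) * b.repr 1 j) * Algebra.leftMulMatrix b k i j := by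
    intro k
    simp only [Algebra.leftMulMatrix_eq_repr_mul, mul_assoc, ← Finset.mul_sum]
    have e : ∀ i, ∑ j, b.repr 1 j * b.repr (k * b j) i = b.repr k i := by
      intro i
      conv_rhs => rw [← mul_one k, ← b.sum_repr 1, Finset.mul_sum]
      simp
    simp only [e]
    calc α k = α (∑ i, b.repr k i • b i) := by rw [b.sum_repr]
      _ = _ := by simp only [map_sum, map_smul, smul_eq_mul, mul_comm]
  have h3 : α = ∑ i, ∑ j, (α (b i) * b.repr 1 j) • ∑ s, ∑ q, ∑ p, (C s i p * D s q j) •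
      (N s).1.coef p q := by
    ext k
    rw [h2 k]
    simp only [LinearMap.sum_apply, LinearMap.smul_apply, h1, Matrix.sum_apply, Matrix.mul_apply,
      smul_eq_mul, coef_apply]
    refine Finset.sum_congr rfl fun i _ => Finset.sum_congr rfl fun j _ => ?_
    congr 1
    refine Finset.sum_congr rfl fun s _ => Finset.sum_congr rfl fun q _ => ?_
    rw [Finset.sum_mul]
    exact Finset.sum_congr rfl fun p _ => by ring
  rw [h3]
  exact Submodule.sum_mem _ fun i _ => Submodule.sum_mem _ fun j _ => Submodule.smul_mem _ _ <|
    Submodule.sum_mem _ fun s _ => Submodule.sum_mem _ fun q _ => Submodule.sum_mem _ fun p _ =>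
    Submodule.smul_mem _ _ <| Submodule.subset_span ⟨N s, p, q, rfl⟩

/-- Since matrix elements from P span K*, relations between matrices for all I and J in P imply the
representation-free identity. -/
theorem IsComplete.ev₂_ext {B : Type*} [Semiring B] [Algebra F B] {z z' : (K ⊗[F] K) ⊗[F] B}
    (h : ∀ I J : P, matEv (kronHom I.1 J.1) z = matEv (kronHom I.1 J.1) z') : z = z' := by
  have hadd : ∀ (α α' β : Module.Dual F K) (z : (K ⊗[F] K) ⊗[F] B),
      ev₂ (α + α') β z = ev₂ α β z + ev₂ α' β z := by
    intro α α' β z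
    simp [ev₂, TensorProduct.add_tmul, LinearMap.rTensor_add]
  have hadd' : ∀ (α β β' : Module.Dual F K) (z : (K ⊗[F] K) ⊗[F] B),
      ev₂ α (β + β') z = ev₂ α β z + ev₂ α β' z := by
    intro α β β' z
    simp [ev₂, TensorProduct.tmul_add, LinearMap.rTensor_add]
  have hsmul : ∀ (r : F) (α β : Module.Dual F K) (z : (K ⊗[F] K) ⊗[F] B),
      ev₂ (r • α) β z = r • ev₂ α β z := by
    intro r α β z
    simp [ev₂, ← TensorProduct.smul_tmul', LinearMap.rTensor_smul]
  have hsmul' : ∀ (r : F) (α β : Module.Dual F K) (z : (K ⊗[F] K) ⊗[F] B),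
      ev₂ α (r • β) z = r • ev₂ α β z := by
    intro r α β z
    simp [ev₂, LinearMap.rTensor_smul]
  have hzero : ∀ (β : Module.Dual F K) (z : (K ⊗[F] K) ⊗[F] B), ev₂ 0 β z = 0 := by
    intro β z
    simpa using hsmul 0 0 β z
  have hzero' : ∀ (α : Module.Dual F K) (z : (K ⊗[F] K) ⊗[F] B), ev₂ α 0 z = 0 := by
    intro α z
    simpa using hsmul' 0 α 0 z
  refine HopfGauge.ev₂_ext fun α β => ?_
  have hα : α ∈ Submodule.span F _ := hP.span_coef ▸ Submodule.mem_top
  have hβ : β ∈ Submodule.span F _ := hP.span_coef ▸ Submodule.mem_top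
  induction hα using Submodule.span_induction with
  | zero => rw [hzero, hzero]
  | add a a' _ _ ha ha' => rw [hadd, hadd, ha, ha']
  | smul r a _ ha => rw [hsmul, hsmul, ha]
  | mem a ha =>
    obtain ⟨I, a, b, rfl⟩ := ha
    induction hβ using Submodule.span_induction with
    | zero => rw [hzero', hzero']
    | add a a' _ _ ha ha' => rw [hadd', hadd', ha, ha']
    | smul r a _ ha => rw [hsmul', hsmul', ha]
    | mem c hc =>
      obtain ⟨J, c, d, rfl⟩ := hc
      have := congrFun (congrFun (h I J) (a, c)) (b, d)
      rwa [matEv_kron_apply, matEv_kron_apply] at this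

end Classes

/-! ### The holonomies of the lattice algebra -/

section LatticeHolonomies

variable {F K : Type*} [Field F] [Ring K] [HopfAlgebra F K] [FiniteDimensional F K]
variable {V E : Type*} [DecidableEq V] (Γ : CiliatedRibbonGraph V E)
variable (R : (K ⊗[F] K)ˣ) (g : K) {P : Set (MatRep F K)}

/-- The matrix of holonomies. -/
def holMat (I : P) (x : E × Bool) :
    Matrix (Fin I.1.dim) (Fin I.1.dim) (LatticeAlgebra Γ R g P) :=
  Matrix.of (holonomy Γ R g I x)

variable {Γ R g} in
omit [FiniteDimensional F K] in
theorem mk_matrixRel {m n : Type} {A A' : Matrix m n (FreeAlgebra F (Gen P E))}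
    (h : MatrixRel Γ R g P A A') : A.map (RingQuot.mkAlgHom F (LatticeRel Γ R g P))
      = A'.map (RingQuot.mkAlgHom F (LatticeRel Γ R g P)) := by
  ext i j
  exact RingQuot.mkAlgHom_rel F (LatticeRel.entry A A' h i j)

omit [FiniteDimensional F K] in
theorem holMat_natural (I J : P) (x : E × Bool) (T : Matrix (Fin I.1.dim) (Fin J.1.dim) F)
    (hT : ∀ k, I.1.rep k * T = T * J.1.rep k) :
    holMat Γ R g I x * T.map (algebraMap F (LatticeAlgebra Γ R g P))
      = T.map (algebraMap F (LatticeAlgebra Γ R g P)) * holMat Γ R g J x := by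
  have h := mk_matrixRel (Γ := Γ) (R := R) (g := g) (MatrixRel.natural I J x T hT)
  ext i j
  have h' := congrFun (congrFun h i) j
  simpa [Matrix.mul_apply, sc, holMat, holonomy] using h'

variable (hP : IsComplete P)
include hP

omit [FiniteDimensional F K] in
-- Matrix elements of different representations are linearly dependent, so well-definedness is the
-- issue. The map is defined through the holonomy `Q` of the regular representation, assembled from
-- summands in P whether or not the regular representation itself lies in P; naturality then forces
-- the right value on every matrix element.
theorem exists_latticeHol [FiniteDimensional F K] (x : E × Bool) :
    ∃ φ : Module.Dual F K →ₗ[F] LatticeAlgebra Γ R g P,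
      ∀ (I : P) a b, φ (I.1.coef a b) = holonomy Γ R g I x a b := by
  let b := Module.finBasis F K
  obtain ⟨r, N, C, D, hC, hD, hCD⟩ := hP.decomposes_fintype (Algebra.leftMulMatrix b)
  let Q : Matrix (Fin (Module.finrank F K)) (Fin (Module.finrank F K)) (LatticeAlgebra Γ R g P) :=
    ∑ s, (C s).map (algebraMap F (LatticeAlgebra Γ R g P)) * holMat Γ R g (N s) x * (D s).map (algebraMap F (LatticeAlgebra Γ R g P))
  refine ⟨∑ i, ∑ j, (Module.Dual.eval F K (b i)).smulRight (b.repr 1 j • Q i j), fun I a c => ?_⟩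
  -- The intertwiner k ↦ I(k)e_c from the regular representation to I. It takes 1 to the basis
  -- vector e_c, and its row a lists the values of the matrix element I_{ac} on the basis of K.
  let T : Matrix (Fin I.1.dim) (Fin (Module.finrank F K)) F := Matrix.of fun p i =>
    I.1.rep (b i) p c
  have hT : ∀ k, I.1.rep k * T = T * Algebra.leftMulMatrix b k := by
    intro k
    ext p j
    have e1 : (I.1.rep k * T) p j = I.1.rep (k * b j) p c := by
      rw [map_mul]
      simp [T, Matrix.mul_apply]
    rw [e1]
    rw [← b.sum_repr (k * b j), map_sum]
    simp only [map_smul]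
    simp [T, Matrix.mul_apply, Algebra.leftMulMatrix_eq_repr_mul, Matrix.sum_apply, mul_comm]
  have hTQ : T.map (algebraMap F (LatticeAlgebra Γ R g P)) * Q = holMat Γ R g I x * T.map (algebraMap F (LatticeAlgebra Γ R g P)) := by
    have h1 : (∑ s, (C s).map (algebraMap F (LatticeAlgebra Γ R g P)) *
        (D s).map (algebraMap F (LatticeAlgebra Γ R g P))) = 1 := by
      have := congrArg (algebraMap F (LatticeAlgebra Γ R g P)).mapMatrix hCD
      rw [map_sum, map_one] at this
      rw [← this]
      exact Finset.sum_congr rfl fun k _ => by simp [Matrix.map_mul]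
    rw [← Matrix.mul_one (holMat Γ R g I x * _), ← h1, Matrix.mul_sum, Matrix.mul_sum]
    refine Finset.sum_congr rfl fun s _ => ?_
    have h2 := holMat_natural Γ R g I (N s) x (T * C s) fun k => by
      rw [← Matrix.mul_assoc, hT, Matrix.mul_assoc, hC, Matrix.mul_assoc]
    rw [Matrix.map_mul] at h2
    rw [← Matrix.mul_assoc, ← Matrix.mul_assoc, ← h2]
    simp only [Matrix.mul_assoc]
  have h4 : ∀ p, ∑ j, b.repr 1 j * T p j = (1 : Matrix (Fin I.1.dim) (Fin I.1.dim) F) p c := by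
    intro p
    rw [← map_one I.1.rep]
    conv_rhs => rw [← b.sum_repr 1, map_sum]
    simp only [map_smul]
    simp [T, Matrix.sum_apply]
  calc _ = ∑ i, ∑ j, (T a i) • (b.repr 1 j • Q i j) := by
        simp [LinearMap.sum_apply, T, coef_apply]
    _ = ∑ j, b.repr 1 j • ∑ i, T a i • Q i j := by
        rw [Finset.sum_comm]
        refine Finset.sum_congr rfl fun j _ => ?_
        rw [Finset.smul_sum]
        exact Finset.sum_congr rfl fun i _ => smul_comm _ _ _
    _ = ∑ j, b.repr 1 j • ∑ p, T p j • holMat Γ R g I x a p := by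
        refine Finset.sum_congr rfl fun j _ => ?_
        rw [← map_algebraMap_mul_apply, hTQ, map_mul_algebraMap_apply]
    _ = ∑ p, (∑ j, b.repr 1 j * T p j) • holMat Γ R g I x a p := by
        simp only [Finset.smul_sum, Finset.sum_smul, mul_smul]
        rw [Finset.sum_comm]
    _ = _ := by
        simp only [h4]
        simp [Matrix.one_apply, ite_smul, holMat]

/-- The holonomies of the lattice algebra, as linear maps on `K*`. -/
def latticeHol (x : E × Bool) : Module.Dual F K →ₗ[F] LatticeAlgebra Γ R g P :=
  (exists_latticeHol Γ R g hP x).choose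

theorem latticeHol_coef (x : E × Bool) (I : P) (a b : Fin I.1.dim) :
    latticeHol Γ R g hP x (I.1.coef a b) = holonomy Γ R g I x a b :=
  (exists_latticeHol Γ R g hP x).choose_spec I a b

/-- The quotient map is itself the lift of the universal holonomies, so the formulas for images of
generator matrices apply to it. -/
theorem mk_eq_freeLift :
    RingQuot.mkAlgHom F (LatticeRel Γ R g P) = freeLift P (latticeHol Γ R g hP) := by
  refine FreeAlgebra.hom_ext (funext fun G => ?_)
  simp only [Function.comp_apply, freeLift, FreeAlgebra.lift_ι_apply, latticeHol_coef]
  rfl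

/-- The converse of `map_matrixRel`: completeness of P supplies a trivial representation, duals and
decompositions for which the relations can be invoked, and lets the results be reassembled. -/
theorem isHolonomy_latticeHol : IsHolonomy Γ R g (latticeHol Γ R g hP) where
  one x := by
    obtain ⟨I, hI, hd, h⟩ := hP.trivial
    have h1 : I.coef ⟨0, hd⟩ ⟨0, hd⟩ = (counit : K →ₗ[F] F) := by
      ext k; simp [coef_apply, h]
    have h2 := mk_matrixRel (Γ := Γ) (R := R) (g := g) (MatrixRel.trivial ⟨I, hI⟩ x h)
    have h3 := congrFun (congrFun h2 ⟨0, hd⟩) ⟨0, hd⟩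
    rw [← h1]
    refine (latticeHol_coef Γ R g hP x ⟨I, hI⟩ _ _).trans (h3.trans ?_)
    simp
  reversal x := by
    refine LinearMap.ext_on hP.span_coef ?_
    rintro _ ⟨I, a, b, rfl⟩
    obtain ⟨I', hI', σ, hσ⟩ := hP.dual I.1 I.2
    have h2 := mk_matrixRel (Γ := Γ) (R := R) (g := g) (MatrixRel.reversal I ⟨I', hI'⟩ x σ hσ)
    rw [mk_eq_freeLift Γ R g hP, map_matMul, map_sc, map_genMat] at h2
    have h3 := congrFun (congrFun h2 a) b
    rw [matEv_apply, ev_univ, map_algebraMap_mul_apply] at h3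
    rw [h3]
    have e : ∀ c, ((Matrix.submatrix (genMat (⟨I', hI'⟩ : P) x) σ σ).transpose.map
        (freeLift P (latticeHol Γ R g hP))) c b
        = latticeHol Γ R g hP x (I'.coef (σ b) (σ c)) := by
      intro c
      have := congrFun (congrFun (map_genMat (f := latticeHol Γ R g hP)
        (⟨I', hI'⟩ : P) x) (σ b)) (σ c)
      rw [matEv_apply, ev_univ] at this
      exact this
    simp only [e, ← map_smul, ← map_sum]
    rw [LinearMap.comp_apply]
    congr 1
    ext k
    simp [coef_apply, hσ, Matrix.mul_apply]
  functorial x hx := by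
    refine hP.ev₂_ext fun I J => ?_
    obtain ⟨r, N, C, D, hC, hD, hCD⟩ := hP.decomposes_fintype
      ((kronHom I.1 J.1).comp (Bialgebra.comulAlgHom F K))
    have h := mk_matrixRel (Γ := Γ) (R := R) (g := g)
      (MatrixRel.functorial I J x hx r N C D hC hD hCD)
    rw [mk_eq_freeLift Γ R g hP] at h
    simp only [map_matMul, map_sc, map_genMat, map_inFst, map_inSnd] at h
    simp only [map_mul, matEv_leg₁, matEv_leg₂, matEv_scal, matEv_copr]
    rw [h, ← sum_matEv (κ' := fun k => (N k).1.rep) hC hCD]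
    congr 1
    ext p q
    simp only [Matrix.map_apply, Matrix.sum_apply, map_sum]
    refine Finset.sum_congr rfl fun k _ => ?_
    rw [← Matrix.map_apply (f := freeLift P (latticeHol Γ R g hP)), map_matMul, map_matMul, map_sc,
      map_sc, map_genMat]
  exchange_same x hx := by
    refine hP.ev₂_ext fun I J => ?_
    have h := mk_matrixRel (g := g) (MatrixRel.exchange_same (R := R) I J x hx)
    rw [mk_eq_freeLift Γ R g hP] at h
    simp only [map_matMul, map_sc, map_genMat, map_inFst, map_inSnd] at h
    simp only [map_mul, matEv_leg₁, matEv_leg₂, matEv_scal]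
    exact h
  exchange x y hx hy hxy := by
    refine hP.ev₂_ext fun I J => ?_
    have h := mk_matrixRel (g := g) (MatrixRel.exchange (R := R) I J x y hx hy hxy)
    rw [mk_eq_freeLift Γ R g hP] at h
    simp only [map_matMul, map_sc, map_genMat, map_inFst, map_inSnd] at h
    simp only [map_mul, matEv_leg₁, matEv_leg₂, matEv_scal]
    exact h

end LatticeHolonomies

end HopfGauge

end

noncomputable section

namespace HopfGauge

open Coalgebra HopfAlgebra

/-! ### The dimension of an algebra that is generated by holonomies -/

section Dimension

variable {F K B : Type*} [Field F] [Ring K] [HopfAlgebra F K] [Semiring B] [Algebra F B]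

theorem ev₂_mul_scal (α β : Module.Dual F K) (x y : K) (z : (K ⊗[F] K) ⊗[F] B) :
    ev₂ α β (z * scal (x ⊗ₜ y))
      = ev₂ (α ∘ₗ LinearMap.mulRight F x) (β ∘ₗ LinearMap.mulRight F y) z := by
  induction z using TensorProduct.induction_on with
  | zero => simp
  | add a b ha hb => simp only [map_add, add_mul, ha, hb]
  | tmul w b =>
    induction w using TensorProduct.induction_on with
    | zero => simp
    | add a b ha hb => simp only [TensorProduct.add_tmul, map_add, add_mul, ha, hb]
    | tmul k l => simp [scal_apply]

theorem ev₂_scal_mul_mem {D : Submodule F B} {z : (K ⊗[F] K) ⊗[F] B}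
    (hz : ∀ α β, ev₂ α β z ∈ D) (w : K ⊗[F] K) (α β : Module.Dual F K) :
    ev₂ α β (scal w * z) ∈ D := by
  induction w using TensorProduct.induction_on with
  | zero => simp
  | add a b ha hb => rw [map_add, add_mul, map_add]; exact D.add_mem ha hb
  | tmul k l => rw [ev₂_scal_mul]; exact hz _ _

theorem ev₂_mul_scal_mem {D : Submodule F B} {z : (K ⊗[F] K) ⊗[F] B}
    (hz : ∀ α β, ev₂ α β z ∈ D) (w : K ⊗[F] K) (α β : Module.Dual F K) :
    ev₂ α β (z * scal w) ∈ D := by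
  induction w using TensorProduct.induction_on with
  | zero => simp
  | add a b ha hb => rw [map_add, mul_add, map_add]; exact D.add_mem ha hb
  | tmul k l => rw [ev₂_mul_scal]; exact hz _ _

theorem leg₁_mul_scal_mul_leg₂ (M N : K ⊗[F] B) (p q : K) :
    leg₁ M * scal (p ⊗ₜ[F] q) * leg₂ N
      = scal ((1 : K) ⊗ₜ[F] q) * (leg₁ M * leg₂ N) * scal (p ⊗ₜ[F] (1 : K)) := by
  have h : p ⊗ₜ[F] q = ((1 : K) ⊗ₜ[F] q) * (p ⊗ₜ[F] (1 : K)) := by simp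
  rw [h, map_mul, mul_assoc, mul_assoc, scal_left_mul_leg₂, ← mul_assoc, ← scal_right_mul_leg₁]
  simp only [mul_assoc]

variable [FiniteDimensional F K] (f f' : Module.Dual F K →ₗ[F] B)

theorem ev₂_leg₁_scal_leg₂_mem (w : K ⊗[F] K) (α β : Module.Dual F K) :
    ev₂ α β (leg₁ (univ f) * scal w * leg₂ (univ f'))
      ∈ LinearMap.range f * LinearMap.range f' := by
  induction w using TensorProduct.induction_on with
  | zero => simp
  | add a b ha hb =>
    rw [map_add, mul_add, add_mul, map_add]
    exact Submodule.add_mem _ ha hb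
  | tmul k l =>
    rw [leg₁_mul_scal_mul_leg₂]
    refine ev₂_mul_scal_mem (ev₂_scal_mul_mem (fun α β => ?_) _) _ _ _
    rw [ev₂_leg₁_mul_leg₂, ev_univ, ev_univ]
    exact Submodule.mul_mem_mul ⟨_, rfl⟩ ⟨_, rfl⟩

/-- The inverse of W in K ⊗ Kᵒᵖ recovers a plain product from products with W inserted. Hence the
lattice relations, which always contain a braiding, control plain products of holonomies. -/
theorem mul_eq_sum_ev₂ {W : (K ⊗[F] K)ˣ} (hW : IsBraiding W) {n : ℕ} {x y : Fin n → K}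
    (hxy : (W : K ⊗[F] K) = ∑ i, x i ⊗ₜ[F] y i) (α β : Module.Dual F K) :
    f' β * f α = ∑ i, ev₂ (α ∘ₗ LinearMap.mulLeft F (x i))
      (β ∘ₗ LinearMap.mulRight F (antipode F (y i)))
      (leg₂ (univ f') * scal (W : K ⊗[F] K) * leg₁ (univ f)) := by
  have e1 : ∀ (p q : K) (α β : Module.Dual F K),
      ev₂ α β (leg₂ (univ f') * scal (p ⊗ₜ[F] q) * leg₁ (univ f))
        = f' (β ∘ₗ LinearMap.mulRight F q) * f (α ∘ₗ LinearMap.mulLeft F p) := by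
    intro p q α β
    have h : p ⊗ₜ[F] q = (p ⊗ₜ[F] (1 : K)) * ((1 : K) ⊗ₜ[F] q) := by simp
    rw [h, map_mul scal, ← mul_assoc, ← scal_left_mul_leg₂, mul_assoc, mul_assoc, scal_right_mul_leg₁,
      ← mul_assoc (leg₂ _), ev₂_scal_mul, ev₂_mul_scal, ev₂_leg₂_mul_leg₁, ev_univ,
      ev_univ]
    congr 2 <;> ext k <;> simp
  let T : K ⊗[F] K →ₗ[F] B := TensorProduct.lift ((LinearMap.mul F B).flip.compl₁₂
    (f ∘ₗ (endAct false).flip α)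
    (f' ∘ₗ (Module.Dual.transpose ∘ₗ (LinearMap.mul F K).flip).flip β))
  have hT : ∀ p q, T (p ⊗ₜ q)
      = f' (β ∘ₗ LinearMap.mulRight F q) * f (α ∘ₗ LinearMap.mulLeft F p) := fun p q => rfl
  have h1 : T 1 = f' β * f α := by
    rw [Algebra.TensorProduct.one_def, hT]
    congr 2 <;> ext k <;> simp
  rw [← h1, ← hW.sum_mul_mul_antipode hxy, map_sum]
  refine Finset.sum_congr rfl fun i _ => ?_
  rw [hxy, map_sum, map_sum, Finset.mul_sum, Finset.sum_mul, map_sum]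
  refine Finset.sum_congr rfl fun j _ => ?_
  rw [e1, hT]
  congr 2 <;> ext k <;> simp [mul_assoc]

/-! ### Reordering products of holonomies. -/

variable {V E : Type*} [DecidableEq V] {Γ : CiliatedRibbonGraph V E} {R : (K ⊗[F] K)ˣ} {g : K}
  {f : E × Bool → Module.Dual F K →ₗ[F] B}

section

variable (hR : IsRMatrix R) (hf : IsHolonomy Γ R g f)
include hR hf

/-- Functoriality: two holonomies of one edge multiply to a holonomy of that edge. -/
theorem IsHolonomy.range_mul_self {x : E × Bool} (hx : Γ.Admissible x) :
    LinearMap.range (f x) * LinearMap.range (f x) ≤ LinearMap.range (f x) := by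
  rw [Submodule.mul_le]
  rintro _ ⟨β, rfl⟩ _ ⟨α, rfl⟩
  obtain ⟨n, u, v, huv⟩ := exists_sum_tmul (Γ.braid R (tEnd x) (sEnd x) : K ⊗[F] K)
  rw [mul_eq_sum_ev₂ _ _ (isBraiding_braid Γ hR _ _) huv, hf.functorial x hx]
  refine Submodule.sum_mem _ fun i _ => ?_
  rw [ev₂_scal_mul_copr, ev_univ]
  exact ⟨_, rfl⟩

theorem IsHolonomy.range_mul_range {x y : E × Bool} (hx : Γ.Admissible x)
    (hy : Γ.Admissible y) (hxy : x.1 ≠ y.1) :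
    LinearMap.range (f y) * LinearMap.range (f x)
      ≤ LinearMap.range (f x) * LinearMap.range (f y) := by
  rw [Submodule.mul_le]
  rintro _ ⟨β, rfl⟩ _ ⟨α, rfl⟩
  obtain ⟨n, u, v, huv⟩ := exists_sum_tmul (Γ.braid R (tEnd x) (sEnd y) : K ⊗[F] K)
  have h := congrArg (scal (Γ.braid R (tEnd x) (tEnd y) : K ⊗[F] K) * ·)
    (hf.exchange x y hx hy hxy)
  simp only [mul_assoc] at h
  rw [← mul_assoc (scal _) (scal _), scal_mul_scal_inv, one_mul] at h
  rw [mul_eq_sum_ev₂ _ _ (isBraiding_braid Γ hR _ _) huv, mul_assoc, h]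
  refine Submodule.sum_mem _ fun i _ => ev₂_scal_mul_mem (fun α β => ?_) _ _ _
  rw [← mul_assoc, ← mul_assoc]
  exact ev₂_mul_scal_mem (fun α β => ev₂_leg₁_scal_leg₂_mem _ _ _ _ _) _ _ _

end

theorem IsHolonomy.range_reversal (hf : IsHolonomy Γ R g f) (e : E) (b b' : Bool) :
    LinearMap.range (f (e, b')) ≤ LinearMap.range (f (e, b)) := by
  by_cases h : b' = b
  · rw [h]
  · obtain rfl : b' = !b := by cases b <;> cases b' <;> simp_all
    rw [hf.reversal (e, b)]
    exact LinearMap.range_comp_le_range _ _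

/-- Choose an order of the edges and an admissible orientation of each. The span of the products
with one holonomy per edge contains 1 and absorbs left multiplication by every holonomy, by
straightening. So it is everything, and dim B is at most that of (K*)^{⊗E}. -/
theorem exists_surjective_of_isHolonomy [Fintype E] (hR : IsRMatrix R) (hf : IsHolonomy Γ R g f)
    (hB : Algebra.adjoin F {l | ∃ x α, l = f x α} = ⊤) :
    ∃ μ : EdgeFun F K E →ₗ[F] B, Function.Surjective μ := by
  classical
  choose b hb using exists_admissible Γ
  let n := Fintype.card E
  let e : Fin n → E := (Fintype.equivFin E).symm
  have he : Function.Injective e := (Fintype.equivFin E).symm.injective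
  let f' : Fin n → Module.Dual F K →ₗ[F] B := fun i => f (e i, b (e i))
  let C : Fin n → Submodule F B := fun i => LinearMap.range (f' i)
  let Pr := ((List.finRange n).map C).prod
  have hpair : (List.finRange n).Pairwise fun j i => C i * C j ≤ C j * C i := by
    refine (List.nodup_finRange n).imp fun {i j} hij => ?_
    exact hf.range_mul_range hR (hb _) (hb _) fun h => hij (he h)
  have h1 : (1 : B) ∈ Pr := by
    have := list_prod_mem (C := C) (List.finRange n) (fun _ => 1) fun i _ => ⟨counit, hf.one _⟩
    simpa using this
  have hmul : ∀ x α, ∀ w ∈ Pr, f x α * w ∈ Pr := by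
    intro x α w hw
    obtain ⟨i, hi⟩ : ∃ i, e i = x.1 := (Fintype.equivFin E).symm.surjective x.1
    refine mul_list_prod_le hpair (List.mem_finRange i) (hf.range_mul_self hR (hb _))
      (Submodule.mul_mem_mul ?_ hw)
    refine hf.range_reversal (e i) (b (e i)) x.2 ?_
    rw [hi]
    exact ⟨α, rfl⟩
  have htop : Pr = ⊤ := by
    refine Submodule.eq_top_iff'.2 fun z => ?_
    suffices H : ∀ w ∈ Pr, z * w ∈ Pr by simpa using H 1 h1
    have hz : z ∈ Algebra.adjoin F {l | ∃ x α, l = f x α} := hB ▸ Algebra.mem_top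
    induction hz using Algebra.adjoin_induction with
    | mem z hz =>
      obtain ⟨x, α, rfl⟩ := hz
      exact hmul x α
    | algebraMap r =>
      intro w hw
      rw [← Algebra.smul_def]
      exact Submodule.smul_mem _ _ hw
    | add a c _ _ ha hc =>
      intro w hw
      rw [add_mul]
      exact Submodule.add_mem _ (ha w hw) (hc w hw)
    | mul a c _ _ ha hc =>
      intro w hw
      rw [mul_assoc]
      exact ha _ (hc w hw)
  let μ : DualPow F K n →ₗ[F] B := PiTensorProduct.lift
    ((MultilinearMap.mkPiAlgebraFin F n B).compLinearMap f')
  have hμ : Function.Surjective μ := by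
    rw [← LinearMap.range_eq_top, ← top_le_iff, ← htop]
    refine (list_prod_range_le f' (List.nodup_finRange n)).trans (Submodule.span_le.2 ?_)
    rintro _ ⟨x, rfl⟩
    refine ⟨PiTensorProduct.tprod F x, ?_⟩
    simp only [μ, PiTensorProduct.lift.tprod, MultilinearMap.compLinearMap_apply,
      MultilinearMap.mkPiAlgebraFin_apply]
    rw [List.ofFn_eq_map]
  exact ⟨μ ∘ₗ (PiTensorProduct.reindex F (fun _ : E => Module.Dual F K)
    (Fintype.equivFin E)).toLinearMap, hμ.comp (LinearEquiv.surjective _)⟩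

end Dimension

end HopfGauge

end

noncomputable section

namespace HopfGauge

open Coalgebra HopfAlgebra

/-! ### The isomorphism of the lattice algebra and the gauge theory algebra -/

/-- A dimension count: dim M = rank f ≤ rank o = rank (o ∘ μ) ≤ dim M. Equality makes o ∘ μ
injective, hence o as well, with the same range as f. -/
theorem exists_equiv_of_range_le {F M L W : Type*} [Field F] [AddCommMonoid M] [Module F M]
    [Module.Finite F M] [AddCommMonoid L] [Module F L] [AddCommMonoid W] [Module F W]
    {f : M →ₗ[F] W} (hf : Function.Injective f) {o : L →ₗ[F] W} {μ : M →ₗ[F] L}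
    (hμ : Function.Surjective μ) (h : LinearMap.range f ≤ LinearMap.range o) :
    ∃ Φ : L ≃ₗ[F] M, ∀ l, f (Φ l) = o l := by
  -- Rank and nullity require additive groups; over a field negation is scalar multiplication by −1.
  let _ := Module.addCommMonoidToAddCommGroup F (M := M)
  let _ := Module.addCommMonoidToAddCommGroup F (M := W)
  have hr : LinearMap.range (o ∘ₗ μ) = LinearMap.range o :=
    LinearMap.range_comp_of_range_eq_top o (LinearMap.range_eq_top.2 hμ)
  have h1 := LinearMap.finrank_range_of_inj hf
  have h2 := Submodule.finrank_mono (h.trans hr.ge)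
  have h3 := LinearMap.finrank_range_add_finrank_ker (o ∘ₗ μ)
  have h4 : Function.Injective (o ∘ₗ μ) := by
    rw [← LinearMap.ker_eq_bot, ← Submodule.finrank_eq_zero]
    omega
  have h5 : Function.Injective o := by
    intro l l' hl
    obtain ⟨a, rfl⟩ := hμ l
    obtain ⟨b, rfl⟩ := hμ l'
    rw [h4 hl]
  have h6 : LinearMap.range f = LinearMap.range o := by
    rw [← hr]
    exact Submodule.eq_of_le_of_finrank_le (h.trans hr.ge) (by omega)
  refine ⟨(LinearEquiv.ofInjective o h5).trans ((LinearEquiv.ofEq _ _ h6.symm).trans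
    (LinearEquiv.ofInjective f hf).symm), fun l => ?_⟩
  have h7 := LinearEquiv.apply_symm_apply (LinearEquiv.ofInjective f hf)
    (LinearEquiv.ofEq _ _ h6.symm (LinearEquiv.ofInjective o h5 l))
  exact congrArg Subtype.val h7

section Realization

variable {F K : Type*} [Field F] [Ring K] [HopfAlgebra F K] [FiniteDimensional F K]
variable {V E : Type*} [Fintype V] [DecidableEq V] [Fintype E] [DecidableEq E]
variable (Γ : CiliatedRibbonGraph V E) (ρ : E → Bool) {R : (K ⊗[F] K)ˣ} {g : K}
variable (hg : IsPivotal F g) (hR : IsRMatrix R) {P : Set (MatRep F K)}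

variable (P) in
/-- The representation of the lattice algebra by left multiplication in `⨂ᵥ A*ᵥ`. -/
def realize : LatticeAlgebra Γ R g P →ₐ[F] TotalEnd F K Γ :=
  latticeLift P (isHolonomy_holMap Γ ρ hg hR)

omit [Fintype V] in
theorem realize_holonomy (I : P) (x : E × Bool) (a b : Fin I.1.dim) :
    realize Γ ρ hg hR P (holonomy Γ R g I x a b) = holMap Γ ρ R g x (I.1.coef a b) :=
  latticeLift_holonomy _ _ _ _ _

variable (P) in
/-- The action of the lattice algebra on the unit of `⨂ᵥ A*ᵥ`. -/
def orbit : LatticeAlgebra Γ R g P →ₗ[F] VertexFun F K Γ :=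
  LinearMap.applyₗ (totalOne F K Γ) ∘ₗ (realize Γ ρ hg hR P).toLinearMap

omit [Fintype V] in
theorem orbit_apply (l : LatticeAlgebra Γ R g P) :
    orbit Γ ρ hg hR P l = realize Γ ρ hg hR P l (totalOne F K Γ) := rfl

omit [Fintype V] in
theorem orbit_one : orbit Γ ρ hg hR P 1 = totalOne F K Γ := by
  rw [orbit_apply, map_one, Module.End.one_apply]

omit [Fintype V] in
theorem orbit_mul_eq (l l' : LatticeAlgebra Γ R g P) :
    orbit Γ ρ hg hR P (l * l') = realize Γ ρ hg hR P l (orbit Γ ρ hg hR P l') := by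
  rw [orbit_apply, map_mul, Module.End.mul_apply, orbit_apply]

/-- The linear map on `K*` that relates an oriented edge to the underlying edge. -/
def orient (g : K) (b : Bool) : Module.Dual F K →ₗ[F] Module.Dual F K :=
  if b then LinearMap.id else revDual g

omit [Fintype V] [DecidableEq V] [FiniteDimensional F K] in
theorem holMap_apply [FiniteDimensional F K] (x : E × Bool) (α : Module.Dual F K) :
    holMap Γ ρ R g x α
      = totalMul Γ (R : K ⊗[F] K) ρ (Gstar Γ (single x.1 (orient g x.2 α))) := by
  obtain ⟨e, _ | _⟩ := x <;> rfl

omit [Fintype V] [DecidableEq V] [FiniteDimensional F K] in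
include hR in
theorem holMap_one [FiniteDimensional F K] (x : E × Bool) (α : Module.Dual F K) :
    holMap Γ ρ R g x α (totalOne F K Γ) = Gstar Γ (single x.1 (orient g x.2 α)) := by
  rw [holMap_apply, totalMul_one Γ ρ hR]

omit [Fintype V] in
theorem orbit_holonomy (I : P) (x : E × Bool) (a b : Fin I.1.dim) :
    orbit Γ ρ hg hR P (holonomy Γ R g I x a b)
      = Gstar Γ (single x.1 (orient g x.2 (I.1.coef a b))) := by
  rw [orbit_apply, realize_holonomy, holMap_one Γ ρ hR]

omit [Fintype V] [FiniteDimensional F K] [Fintype E] [DecidableEq E] in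
/-- An induction principle for the lattice algebra. -/
theorem lattice_induction {motive : LatticeAlgebra Γ R g P → Prop}
    (holonomy : ∀ I x a b, motive (holonomy Γ R g I x a b))
    (scalar : ∀ r, motive (algebraMap F _ r)) (add : ∀ l l', motive l → motive l' → motive (l + l'))
    (mul : ∀ l l', motive l → motive l' → motive (l * l')) (l : LatticeAlgebra Γ R g P) :
    motive l := by
  have hl : l ∈ Algebra.adjoin F {l | ∃ (I : P) (x : E × Bool) (a b : Fin I.1.dim),
    l = HopfGauge.holonomy Γ R g I x a b} := by
    rw [adjoin_holonomy]; exact Algebra.mem_top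
  induction hl using Algebra.adjoin_induction with
  | mem l hl => obtain ⟨I, x, a, b, rfl⟩ := hl; exact holonomy I x a b
  | algebraMap r => exact scalar r
  | add l l' _ _ h h' => exact add l l' h h'
  | mul l l' _ _ h h' => exact mul l l' h h'

omit [Fintype V] in
-- An element of the lattice algebra acts as left multiplication by its own image. This is true for
-- holonomies and passes to products by associativity; it makes `orbit` multiplicative.
theorem totalMul_orbit (l : LatticeAlgebra Γ R g P) :
    totalMul Γ (R : K ⊗[F] K) ρ (orbit Γ ρ hg hR P l) = realize Γ ρ hg hR P l := by
  induction l using lattice_induction with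
  | holonomy I x a b => rw [orbit_holonomy, realize_holonomy, holMap_apply]
  | scalar r =>
    rw [Algebra.algebraMap_eq_smul_one, map_smul, orbit_one, map_smul, one_totalMul Γ ρ hR,
      map_smul, map_one]
  | add l l' h h' => rw [map_add, map_add, h, h', map_add]
  | mul l l' h h' => rw [orbit_mul_eq, ← h, totalMul_totalMul Γ ρ hg hR, h, h', map_mul]

omit [Fintype V] in
theorem orbit_mul (l l' : LatticeAlgebra Γ R g P) : orbit Γ ρ hg hR P (l * l')
    = totalMul Γ (R : K ⊗[F] K) ρ (orbit Γ ρ hg hR P l) (orbit Γ ρ hg hR P l') := by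
  rw [orbit_mul_eq, totalMul_orbit]

variable (hP : IsComplete P)
include hP

omit [Fintype V] in
theorem realize_latticeHol (x : E × Bool) (α : Module.Dual F K) :
    realize Γ ρ hg hR P (latticeHol Γ R g hP x α) = holMap Γ ρ R g x α := by
  suffices h : (realize Γ ρ hg hR P).toLinearMap ∘ₗ latticeHol Γ R g hP x = holMap Γ ρ R g x from
    LinearMap.congr_fun h α
  refine LinearMap.ext_on hP.span_coef ?_
  rintro _ ⟨I, a, b, rfl⟩
  rw [LinearMap.comp_apply, latticeHol_coef]
  exact realize_holonomy Γ ρ hg hR I x a b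

omit [Fintype V] in
-- The image of `orbit` contains the unit and is stable under left multiplication by the holonomy of
-- every edge, so `range_Gstar_le` applies.
theorem range_Gstar_le_range_orbit :
    LinearMap.range (Gstar (F := F) (K := K) Γ) ≤ LinearMap.range (orbit Γ ρ hg hR P) := by
  refine range_Gstar_le Γ ρ hg hR ⟨1, orbit_one Γ ρ hg hR⟩ ?_
  rintro e α _ ⟨l, rfl⟩
  refine ⟨latticeHol Γ R g hP (e, true) α * l, ?_⟩
  rw [orbit_mul_eq, realize_latticeHol]
  rfl

omit [Fintype V] [DecidableEq E] in
include hR in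
theorem exists_surjective_lattice :
    ∃ μ : EdgeFun F K E →ₗ[F] LatticeAlgebra Γ R g P, Function.Surjective μ := by
  refine exists_surjective_of_isHolonomy hR (isHolonomy_latticeHol Γ R g hP) ?_
  rw [← top_le_iff, ← adjoin_holonomy]
  refine Algebra.adjoin_mono ?_
  rintro _ ⟨I, x, a, b, rfl⟩
  exact ⟨x, _, (latticeHol_coef Γ R g hP x I a b).symm⟩

/-- The lower bound from `range_Gstar_le_range_orbit` and the upper bound from
`exists_surjective_lattice` meet because G* is injective. -/
theorem exists_latticeEquiv : ∃ Φ : LatticeAlgebra Γ R g P ≃ₗ[F] EdgeFun F K E,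
    ∀ l, Gstar Γ (Φ l) = orbit Γ ρ hg hR P l := by
  obtain ⟨μ, hμ⟩ := exists_surjective_lattice Γ hR hP (g := g)
  exact exists_equiv_of_range_le (Gstar_injective Γ) hμ (range_Gstar_le_range_orbit Γ ρ hg hR hP)

end Realization

end HopfGauge

end

noncomputable section

namespace HopfGauge

open Coalgebra HopfAlgebra

/-! ### Gauge transformations of products -/

section Covariant

variable {F K : Type*} [Field F] [Ring K] [HopfAlgebra F K]

theorem sum_counit_right_smul {ι : Type*} {h : K} (r : Coalgebra.Repr F h ι) :
    ∑ i ∈ r.index, counit (R := F) (r.right i) • r.left i = h := by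
  have := congrArg (TensorProduct.rid F K) (Coalgebra.sum_tmul_counit_eq r)
  rw [map_sum] at this
  simpa only [TensorProduct.rid_tmul, one_smul] using this

theorem conv_mulLeft {B : Type*} [Semiring B] [Algebra F B] (T : B) (a c : K →ₗ[F] B) (h : K) :
    conv (LinearMap.mulLeft F T ∘ₗ a) c h = T * conv a c h := by
  rw [conv_apply_repr (ℛ F h), conv_apply_repr (ℛ F h), Finset.mul_sum]
  exact Finset.sum_congr rfl fun i _ => mul_assoc _ _ _

variable {W : Type*} [AddCommMonoid W] [Module F W]

theorem conv_apply_of_counit {a c : K →ₗ[F] Module.End F W} {w : W}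
    (hc : ∀ k, c k w = counit (R := F) k • w) (h : K) : conv a c h w = a h w := by
  rw [conv_apply_repr (ℛ F h), LinearMap.sum_apply]
  simp only [Module.End.mul_apply, hc, map_smul]
  conv_rhs => rw [← sum_counit_right_smul (ℛ F h)]
  simp

/-- Multiplication by `z` is compatible with the action `c`. -/
def Covariant (c : K →ₗ[F] Module.End F W) (μ : W →ₗ[F] Module.End F W) (z : W) : Prop :=
  ∀ h, c h * μ z = conv (μ ∘ₗ c.flip z) c h

variable {c : K →ₗ[F] Module.End F W} {μ : W →ₗ[F] Module.End F W}

theorem Covariant.apply {z : W} (hz : Covariant c μ z) {ι : Type*} {h : K}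
    (r : Coalgebra.Repr F h ι) (w : W) :
    c h (μ z w) = ∑ i ∈ r.index, μ (c (r.left i) z) (c (r.right i) w) := by
  have := LinearMap.congr_fun (hz h) w
  rw [conv_apply_repr r, LinearMap.sum_apply] at this
  exact this

/-- The action on a product of three factors can be bracketed in two ways; associativity of
convolution and of `μ` identifies them. Covariance therefore has to be verified only on generators.
-/
theorem Covariant.mul (hμ : ∀ z w, μ (μ z w) = μ z * μ w) {z w : W} (hz : Covariant c μ z)
    (hw : Covariant c μ w) : Covariant c μ (μ z w) := by
  intro h
  have e : μ ∘ₗ c.flip (μ z w) = conv (μ ∘ₗ c.flip z) (μ ∘ₗ c.flip w) := by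
    ext1 k
    rw [LinearMap.comp_apply, LinearMap.flip_apply, hz.apply (ℛ F k), map_sum,
      conv_apply_repr (ℛ F k)]
    simp only [hμ]
    rfl
  rw [hμ, ← mul_assoc, hz h, e, conv_assoc, conv_apply_repr (ℛ F h), conv_apply_repr (ℛ F h),
    Finset.sum_mul]
  refine Finset.sum_congr rfl fun i _ => ?_
  rw [mul_assoc, hw]

theorem Covariant.add {z w : W} (hz : Covariant c μ z) (hw : Covariant c μ w) :
    Covariant c μ (z + w) := by
  intro h
  rw [map_add, mul_add, hz, hw, conv_apply_repr (ℛ F h), conv_apply_repr (ℛ F h),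
    conv_apply_repr (ℛ F h), ← Finset.sum_add_distrib]
  refine Finset.sum_congr rfl fun i _ => ?_
  simp [add_mul]

theorem Covariant.smul (r : F) {z : W} (hz : Covariant c μ z) : Covariant c μ (r • z) := by
  intro h
  rw [map_smul, mul_smul_comm, hz, conv_apply_repr (ℛ F h), conv_apply_repr (ℛ F h),
    Finset.smul_sum]
  refine Finset.sum_congr rfl fun i _ => ?_
  simp

end Covariant

section Gauge

variable {F K : Type*} [Field F] [Ring K] [HopfAlgebra F K]
variable {V E : Type*} [DecidableEq V] (Γ : CiliatedRibbonGraph V E)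

variable (F) in
/-- The part of a gauge transformation at `v` that acts on the functions of `y`. -/
def gaugeElt (v : V) (y : E ⊕ E) : K →ₗ[F] K :=
  if Γ.vertexOf y = v then LinearMap.id else (counit : K →ₗ[F] F).smulRight 1

/-- The cases of the definition as one formula. At a loop, admissibility puts the target end first,
so Δ appears and not Δᵒᵖ. -/
theorem gaugeTensor_eq (v : V) {x : E × Bool} (hx : Γ.Admissible x) (h : K) :
    Γ.gaugeTensor (F := F) v x h
      = TensorProduct.map (gaugeElt F Γ v (tEnd x)) (gaugeElt F Γ v (sEnd x)) (comul h) := by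
  unfold CiliatedRibbonGraph.gaugeTensor gaugeElt
  by_cases ht : Γ.vertexOf (tEnd x) = v <;> by_cases hs : Γ.vertexOf (sEnd x) = v
  · rw [if_pos ht, if_pos hs, if_pos (Admissible.position_lt Γ hx (ht.trans hs.symm)), if_pos ht,
      if_pos hs, TensorProduct.map_id]
    rfl
  · rw [if_pos ht, if_neg hs, if_pos ht, if_neg hs, ← (ℛ F h).eq, map_sum]
    conv_lhs => rw [← sum_counit_right_smul (ℛ F h)]
    simp [TensorProduct.sum_tmul, TensorProduct.smul_tmul]
  · rw [if_neg ht, if_pos hs, if_neg ht, if_pos hs, ← (ℛ F h).eq, map_sum]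
    conv_lhs => rw [← Coalgebra.sum_counit_smul (ℛ F h)]
    simp [TensorProduct.tmul_sum, TensorProduct.smul_tmul]
  · rw [if_neg ht, if_neg hs, if_neg ht, if_neg hs, ← (ℛ F h).eq, map_sum]
    conv_lhs => rw [← Coalgebra.sum_counit_smul (ℛ F h)]
    simp [TensorProduct.smul_tmul, Finset.sum_smul, mul_smul,
      Algebra.TensorProduct.one_def]
    exact Finset.sum_congr rfl fun i _ => smul_comm _ _ _

theorem flip_gaugeTensor (v : V) (e : E) (h : K) :
    flip (Γ.gaugeTensor (F := F) v (e, false) h) = Γ.gaugeTensor v (e, true) h := by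
  unfold CiliatedRibbonGraph.gaugeTensor
  by_cases ht : Γ.vertexOf (tEnd (e, true)) = v <;> by_cases hs : Γ.vertexOf (sEnd (e, true)) = v
  all_goals
    have ht' : Γ.vertexOf (sEnd (e, false)) = Γ.vertexOf (tEnd (e, true)) := rfl
    have hs' : Γ.vertexOf (tEnd (e, false)) = Γ.vertexOf (sEnd (e, true)) := rfl
    rw [← ht'] at ht
    rw [← hs'] at hs
  · have hne : Γ.position (sEnd (e, false)) ≠ Γ.position (tEnd (e, false)) :=
      position_ne Γ (tEnd_ne_sEnd (e, true)) (ht.trans hs.symm)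
    rw [if_pos hs, if_pos ht, if_pos (ht'.symm.trans ht), if_pos (hs'.symm.trans hs)]
    rcases lt_or_gt_of_ne hne with h' | h'
    · rw [if_neg h'.not_gt, IsRMatrix.flip_flip]
      exact (if_pos h').symm
    · rw [if_pos h']
      exact (if_neg h'.not_gt).symm
  · rw [if_neg hs, if_pos ht, if_pos (ht'.symm.trans ht), if_neg fun H => hs (hs'.trans H)]
    simp
  · rw [if_pos hs, if_neg ht, if_neg fun H => ht (ht'.trans H), if_pos (hs'.symm.trans hs)]
    simp
  · rw [if_neg hs, if_neg ht, if_neg fun H => ht (ht'.trans H), if_neg fun H => hs (hs'.trans H)]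
    simp

theorem gaugeAct_totalOne (v : V) (h : K) :
    gaugeAct Γ v h (totalOne F K Γ) = counit (R := F) h • totalOne F K Γ := by
  rw [gaugeAct, LinearMap.comp_apply, AlgHom.toLinearMap_apply, totalOne, flat, atVertex_tprod,
    vertexAct, jointAct_counit _ fun _ _ => rfl, MultilinearMap.map_update_smul,
    Function.update_eq_self]

variable (ρ : E → Bool) {R : (K ⊗[F] K)ˣ} {g : K}
variable [FiniteDimensional F K] (hg : IsPivotal F g) (hR : IsRMatrix R)
include hg hR

omit [FiniteDimensional F K] hg hR in
theorem conv_comp_counit {B : Type*} [Semiring B] [Algebra F B] (b : Bool)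
    (f : Module.Dual F K →ₗ[F] B) (α : Module.Dual F K) (c : K →ₗ[F] B) (h : K) :
    conv (f ∘ₗ (endAct b).flip α ∘ₗ (counit : K →ₗ[F] F).smulRight 1) c h = f α * c h := by
  have h1 : f ∘ₗ (endAct b).flip α ∘ₗ (counit : K →ₗ[F] F).smulRight 1
      = (LinearMap.mulLeft F (f α)) ∘ₗ (counit : K →ₗ[F] F).smulRight (1 : B) := by
    ext1 k
    change f (endAct b (counit (R := F) k • 1) α) = f α * (counit (R := F) k • 1)
    rw [map_smul, LinearMap.smul_apply, (isRightAct_endAct b).one,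
      Module.End.one_apply, map_smul, mul_smul_comm, mul_one]
  rw [h1, conv_mulLeft, counit_conv]

omit [FiniteDimensional F K] hR in
theorem conv_comp_straighten {B : Type*} [Semiring B] [Algebra F B] (b : Bool)
    (f : Module.Dual F K →ₗ[F] B) (α : Module.Dual F K) (c : K →ₗ[F] B) (h : K) :
    conv (f ∘ₗ (endAct b).flip α) c h = ∑ i ∈ (ℛ F h).index,
      f (straighten g b (straighten g b α ∘ₗ LinearMap.mulLeft F ((ℛ F h).left i)))
        * c ((ℛ F h).right i) := by
  rw [conv_apply_repr (ℛ F h)]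
  refine Finset.sum_congr rfl fun i _ => ?_
  have := endAct_straighten hg b ((ℛ F h).left i) (straighten g b α)
  rw [straighten_straighten hg] at this
  rw [← this]
  rfl

/-- At the vertex of y this is `transforms_endMat` with the straightening undone. At other vertices
the operators commute, and `gaugeElt` reduces to the counit. -/
theorem gaugeAct_mul_endOp (v : V) (y : E ⊕ E) (h : K) (α : Module.Dual F K) :
    gaugeAct Γ v h * endOp Γ ρ R y α = conv (B := TotalEnd F K Γ)
      (endOp Γ ρ R y ∘ₗ (endAct y.isRight).flip α ∘ₗ gaugeElt F Γ v y) (gaugeAct Γ v) h := by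
  have h5 : endMat Γ ρ R g y (straighten g y.isRight α) = endOp Γ ρ R y α := by
    rw [endOp_eq Γ ρ R hg, LinearMap.comp_apply]
  by_cases hv : Γ.vertexOf y = v
  · subst hv
    have h1 := (transforms_univ_iff (B := TotalEnd F K Γ) _ _).1
      (transforms_endMat Γ ρ hg hR y) h (straighten g y.isRight α)
    have h4 : gaugeElt F Γ (Γ.vertexOf y) y = (LinearMap.id : K →ₗ[F] K) := if_pos rfl
    rw [h5] at h1
    rw [h1, h4]
    have h6 := conv_comp_straighten (B := TotalEnd F K Γ) hg y.isRight (endOp Γ ρ R y) α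
      (gaugeAct Γ (Γ.vertexOf y)) h
    refine Eq.trans (Finset.sum_congr rfl fun i _ => ?_) h6.symm
    rw [endOp_eq Γ ρ R hg, LinearMap.comp_apply, straighten_straighten hg]
  · have h3 : gaugeAct Γ v h * endOp Γ ρ R y α = endOp Γ ρ R y α * gaugeAct Γ v h := by
      rw [← h5]
      exact gaugeAct_commute Γ ρ R g hv h _
    have h4 : gaugeElt F Γ v y = (counit : K →ₗ[F] F).smulRight (1 : K) := if_neg hv
    rw [h3, h4]
    exact (conv_comp_counit (B := TotalEnd F K Γ) y.isRight (endOp Γ ρ R y) α _ h).symm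

theorem gaugeAct_endOp_one (v : V) (y : E ⊕ E) (h : K) (α : Module.Dual F K) :
    gaugeAct Γ v h (endOp Γ ρ R y α (totalOne F K Γ))
      = endOp Γ ρ R y (endAct y.isRight (gaugeElt F Γ v y h) α) (totalOne F K Γ) := by
  have h1 := LinearMap.congr_fun (gaugeAct_mul_endOp Γ ρ hg hR v y h α) (totalOne F K Γ)
  rw [conv_apply_of_counit (gaugeAct_totalOne Γ v)] at h1
  exact h1

theorem covariant_endOp (v : V) (y : E ⊕ E) (α : Module.Dual F K) :
    Covariant (gaugeAct Γ v) (totalMul Γ (R : K ⊗[F] K) ρ)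
      (endOp Γ ρ R y α (totalOne F K Γ)) := by
  intro h
  rw [totalMul_endOp_one Γ ρ hg hR, gaugeAct_mul_endOp Γ ρ hg hR]
  have e : totalMul Γ (R : K ⊗[F] K) ρ ∘ₗ (gaugeAct Γ v).flip (endOp Γ ρ R y α (totalOne F K Γ))
      = endOp Γ ρ R y ∘ₗ (endAct y.isRight).flip α ∘ₗ gaugeElt F Γ v y := by
    ext1 k
    rw [LinearMap.comp_apply, LinearMap.flip_apply, gaugeAct_endOp_one Γ ρ hg hR,
      totalMul_endOp_one Γ ρ hg hR]
    rfl
  exact congrArg (fun a => conv (B := TotalEnd F K Γ) a (gaugeAct Γ v) h) e.symm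

theorem covariant_edgeOp (v : V) (x : E × Bool) (α : Module.Dual F K) :
    Covariant (gaugeAct Γ v) (totalMul Γ (R : K ⊗[F] K) ρ)
      (edgeOp Γ ρ R x α (totalOne F K Γ)) := by
  rw [edgeOp, LinearMap.comp_apply, LinearMap.comp_apply]
  generalize comulOr x.2 α = w
  induction w using TensorProduct.induction_on with
  | zero =>
    intro h
    simp [conv]
  | add a b ha hb => rw [map_add, map_add, LinearMap.add_apply]; exact ha.add hb
  | tmul a b =>
    rw [TensorProduct.map_tmul, LinearMap.mul'_apply, Module.End.mul_apply,
      ← totalMul_endOp_one Γ ρ hg hR (tEnd x) a]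
    exact (covariant_endOp Γ ρ hg hR v _ _).mul (totalMul_totalMul Γ ρ hg hR)
      (covariant_endOp Γ ρ hg hR v _ _)

omit [FiniteDimensional F K] [DecidableEq V] hg hR in
variable (F K) in
/-- The functional `k ↦ α(w₍₁₎ k S(w₍₂₎))`, for `w ∈ K ⊗ K`. -/
def twoSided : K ⊗[F] K →ₗ[F] Module.End F (Module.Dual F K) :=
  TensorProduct.lift ((LinearMap.mul F (Module.End F (Module.Dual F K))).compl₁₂
    (endAct false) (endAct true))

omit [FiniteDimensional F K] hg hR in
theorem twoSided_tmul (p q : K) (α : Module.Dual F K) :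
    twoSided F K (p ⊗ₜ q) α = endAct false p (endAct true q α) := rfl

/-- The two ends receive the two components of Δ(h) in the order target, start. By `comulOr_act`
these actions come from one transformation of the function of the edge. -/
theorem gaugeAct_edgeOp (v : V) (x : E × Bool) (h : K) (α : Module.Dual F K) :
    gaugeAct Γ v h (edgeOp Γ ρ R x α (totalOne F K Γ)) = edgeOp Γ ρ R x
      (LinearMap.applyₗ α (TensorProduct.lift ((LinearMap.mul F
        (Module.End F (Module.Dual F K))).compl₁₂ (endAct (tEnd x).isRight)
        (endAct (sEnd x).isRight)) (TensorProduct.map (gaugeElt F Γ v (tEnd x))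
          (gaugeElt F Γ v (sEnd x)) (comul h)))) (totalOne F K Γ) := by
  have key : ∀ w : Module.Dual F K ⊗[F] Module.Dual F K, gaugeAct Γ v h
      (LinearMap.mul' F (TotalEnd F K Γ) (TensorProduct.map (endOp Γ ρ R (tEnd x))
        (endOp Γ ρ R (sEnd x)) w) (totalOne F K Γ))
      = ∑ i ∈ (ℛ F h).index, LinearMap.mul' F (TotalEnd F K Γ) (TensorProduct.map
        (endOp Γ ρ R (tEnd x)) (endOp Γ ρ R (sEnd x)) (TensorProduct.map
          (endAct (tEnd x).isRight (gaugeElt F Γ v (tEnd x) ((ℛ F h).left i)))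
          (endAct (sEnd x).isRight (gaugeElt F Γ v (sEnd x) ((ℛ F h).right i))) w))
        (totalOne F K Γ) := by
    intro w
    induction w using TensorProduct.induction_on with
    | zero => simp
    | add a b ha hb =>
      simp only [map_add, LinearMap.add_apply, ha, hb, Finset.sum_add_distrib]
    | tmul a b =>
      simp only [TensorProduct.map_tmul, LinearMap.mul'_apply, Module.End.mul_apply]
      have h1 := LinearMap.congr_fun (gaugeAct_mul_endOp Γ ρ hg hR v (tEnd x) h a)
        (endOp Γ ρ R (sEnd x) b (totalOne F K Γ))
      rw [conv_apply_repr (B := TotalEnd F K Γ) (ℛ F h), LinearMap.sum_apply] at h1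
      refine h1.trans (Finset.sum_congr rfl fun i _ => ?_)
      rw [Module.End.mul_apply, gaugeAct_endOp_one Γ ρ hg hR]
      rfl
  rw [edgeOp, LinearMap.comp_apply, LinearMap.comp_apply, key, ← (ℛ F h).eq]
  simp only [comulOr_act, map_sum, LinearMap.sum_apply]
  rfl

end Gauge

end HopfGauge

end

noncomputable section

namespace HopfGauge

open Coalgebra HopfAlgebra

/-! ### The Hopf algebra of gauge transformations -/

section GaugeHopf

variable {F K V : Type*} [Field F] [Ring K] [HopfAlgebra F K] [Fintype V] [DecidableEq V]

/-- An induction principle for the algebra of gauge transformations. -/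
theorem gauge_induction {motive : GaugeAlg F K V → Prop}
    (single : ∀ v k, motive (PiTensorProduct.singleAlgHom (R := F) (A := fun _ : V => K) v k))
    (one : motive 1) (mul : ∀ h h', motive h → motive h' → motive (h * h'))
    (smul : ∀ (r : F) h, motive h → motive (r • h))
    (add : ∀ h h', motive h → motive h' → motive (h + h')) (h : GaugeAlg F K V) : motive h := by
  let H : Submonoid (GaugeAlg F K V) :=
    { carrier := {h | motive h}, one_mem' := one, mul_mem' := fun ha hb => mul _ _ ha hb }
  have key : ∀ k : V → K, motive (PiTensorProduct.tprod F k) := fun k =>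
    Submonoid.pi_mem_of_mulSingle_mem
      (H := H.comap (PiTensorProduct.tprodMonoidHom F (A := fun _ : V => K))) k
      fun v => single v (k v)
  induction h using PiTensorProduct.induction_on with
  | smul_tprod r k => exact smul r _ (key k)
  | add a b ha hb => exact add a b ha hb

omit [DecidableEq V] in
theorem counitPi_tprod (k : V → K) :
    counitPi (PiTensorProduct.tprod F k) = ∏ v, counit (R := F) (k v) := by
  rw [counitPi, LinearMap.comp_apply, PiTensorProduct.map_tprod]
  exact PiTensorProduct.constantBaseRingEquiv_tprod _

variable [FiniteDimensional F K]

omit [DecidableEq V] in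
theorem unshuffle_mul (s t : ⨂[F] _ : V, K ⊗[F] K) :
    unshuffle F V K (s * t) = unshuffle F V K s * unshuffle F V K t := by
  let _ : IsScalarTower F (⨂[F] _ : V, K ⊗[F] K) (⨂[F] _ : V, K ⊗[F] K) :=
    IsScalarTower.right (R := F) (A := ⨂[F] _ : V, K ⊗[F] K)
  let _ : SMulCommClass F (⨂[F] _ : V, K ⊗[F] K) (⨂[F] _ : V, K ⊗[F] K) :=
    Algebra.to_smulCommClass (R := F) (A := ⨂[F] _ : V, K ⊗[F] K)
  let b := Module.finBasis F K
  let B := Basis.piTensorProduct fun _ : V => b.tensorProduct b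
  suffices h : (LinearMap.mul F (⨂[F] _ : V, K ⊗[F] K)).compr₂ (unshuffle F V K).toLinearMap
      = (LinearMap.mul F _).compl₁₂ (unshuffle F V K).toLinearMap
        (unshuffle F V K).toLinearMap from LinearMap.congr_fun₂ h s t
  refine LinearMap.ext_basis B B fun p q => ?_
  have hB : ∀ p, B p = PiTensorProduct.tprod F fun v => b (p v).1 ⊗ₜ[F] b (p v).2 := by
    intro p
    simp [B, Basis.piTensorProduct_apply, Module.Basis.tensorProduct_apply']
  change unshuffle F V K (B p * B q) = unshuffle F V K (B p) * unshuffle F V K (B q)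
  have e : ((fun v => b (p v).1 ⊗ₜ[F] b (p v).2) * fun v => b (q v).1 ⊗ₜ[F] b (q v).2)
      = fun v => (b (p v).1 * b (q v).1) ⊗ₜ[F] (b (p v).2 * b (q v).2) :=
    funext fun v => Algebra.TensorProduct.tmul_mul_tmul _ _ _ _
  rw [hB, hB, PiTensorProduct.tprod_mul_tprod, e, unshuffle_tprod, unshuffle_tprod,
    unshuffle_tprod, Algebra.TensorProduct.tmul_mul_tmul, PiTensorProduct.tprod_mul_tprod,
    PiTensorProduct.tprod_mul_tprod]
  rfl

omit [DecidableEq V] in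
theorem comulPi_mul (h h' : GaugeAlg F K V) : comulPi (h * h') = comulPi h * comulPi h' := by
  let _ : IsScalarTower F (⨂[F] _ : V, K ⊗[F] K) (⨂[F] _ : V, K ⊗[F] K) :=
    IsScalarTower.right (R := F) (A := ⨂[F] _ : V, K ⊗[F] K)
  let _ : SMulCommClass F (⨂[F] _ : V, K ⊗[F] K) (⨂[F] _ : V, K ⊗[F] K) :=
    Algebra.to_smulCommClass (R := F) (A := ⨂[F] _ : V, K ⊗[F] K)
  rw [comulPi, LinearMap.comp_apply, LinearMap.comp_apply, LinearMap.comp_apply,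
    LinearEquiv.coe_coe, ← unshuffle_mul]
  congr 1
  induction h using PiTensorProduct.induction_on with
  | add a b ha hb => rw [add_mul, map_add, ha, hb, map_add, add_mul]
  | smul_tprod r k =>
    rw [smul_mul_assoc, map_smul, map_smul, smul_mul_assoc]
    congr 1
    induction h' using PiTensorProduct.induction_on with
    | add a b ha hb => rw [mul_add, map_add, ha, hb, map_add, mul_add]
    | smul_tprod r k' =>
      rw [mul_smul_comm, map_smul, map_smul, mul_smul_comm, PiTensorProduct.tprod_mul_tprod,
        PiTensorProduct.map_tprod, PiTensorProduct.map_tprod, PiTensorProduct.map_tprod,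
        PiTensorProduct.tprod_mul_tprod]
      simp only [Pi.mul_apply, Bialgebra.comul_mul]
      rfl

omit [DecidableEq V] in
theorem comulPi_one : comulPi (1 : GaugeAlg F K V) = 1 := by
  rw [comulPi, LinearMap.comp_apply, PiTensorProduct.one_def, PiTensorProduct.map_tprod]
  simp only [Pi.one_apply, Bialgebra.comul_one, Algebra.TensorProduct.one_def]
  exact unshuffle_tprod _ _

omit [Fintype V] [FiniteDimensional F K] in
theorem singleAlgHom_eq {A : Type*} [Ring A] [Algebra F A] (v : V) (a : A) :
    PiTensorProduct.singleAlgHom (R := F) (A := fun _ : V => A) v a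
      = PiTensorProduct.tprod F (Pi.mulSingle v a) := rfl

theorem unshuffle_single (v : V) (w : K ⊗[F] K) :
    unshuffle F V K (PiTensorProduct.singleAlgHom (R := F) (A := fun _ : V => K ⊗[F] K) v w)
      = TensorProduct.map (PiTensorProduct.singleAlgHom (A := fun _ : V => K) v).toLinearMap
        (PiTensorProduct.singleAlgHom (A := fun _ : V => K) v).toLinearMap w := by
  induction w using TensorProduct.induction_on with
  | zero => simp only [map_zero]
  | add a b ha hb => simp only [map_add, ha, hb]
  | tmul p q =>
    have e : (Pi.mulSingle v (p ⊗ₜ[F] q) : V → K ⊗[F] K)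
        = fun w => (Pi.mulSingle v p : V → K) w ⊗ₜ[F] (Pi.mulSingle v q : V → K) w := by
      funext w
      by_cases hw : w = v
      · subst hw; simp
      · simp [Pi.mulSingle_eq_of_ne hw, Algebra.TensorProduct.one_def]
    rw [singleAlgHom_eq, e, unshuffle_tprod]
    rfl

theorem comulPi_single (v : V) (k : K) :
    comulPi (PiTensorProduct.singleAlgHom (R := F) (A := fun _ : V => K) v k)
      = TensorProduct.map (PiTensorProduct.singleAlgHom (A := fun _ : V => K) v).toLinearMap
        (PiTensorProduct.singleAlgHom (A := fun _ : V => K) v).toLinearMap (comul k) := by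
  rw [← unshuffle_single, singleAlgHom_eq, singleAlgHom_eq, comulPi, LinearMap.comp_apply,
    PiTensorProduct.map_tprod, LinearEquiv.coe_coe]
  congr 2
  funext w
  by_cases hw : w = v
  · subst hw; simp
  · simp [Pi.mulSingle_eq_of_ne hw]

end GaugeHopf

/-- Compatibility with multiplication passes from h and h' to h h', with multiplied coproducts. It
extends the module algebra axiom from single vertices to all gauge transformations. -/
theorem act_mul_of_act_mul {F G L : Type*} [Field F] [Semiring G] [Algebra F G] [Semiring L]
    [Algebra F L] (act : G →ₗ[F] L →ₗ[F] L)
    (hact : ∀ h h' x, act (h * h') x = act h' (act h x)) {h h' : G} {w w' : G ⊗[F] G}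
    (H : ∀ x y, act h (x * y) = LinearMap.mul' F L (TensorProduct.map (act.flip x) (act.flip y) w))
    (H' : ∀ x y,
      act h' (x * y) = LinearMap.mul' F L (TensorProduct.map (act.flip x) (act.flip y) w'))
    (x y : L) : act (h * h') (x * y)
      = LinearMap.mul' F L (TensorProduct.map (act.flip x) (act.flip y) (w * w')) := by
  rw [hact, H]
  clear H
  induction w using TensorProduct.induction_on with
  | zero => simp
  | add a b ha hb => simp only [map_add, add_mul, ha, hb]
  | tmul p q =>
    rw [TensorProduct.map_tmul, LinearMap.mul'_apply, H']
    clear H'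
    induction w' using TensorProduct.induction_on with
    | zero => simp
    | add a b ha hb => simp only [map_add, mul_add, ha, hb]
    | tmul p' q' =>
      rw [Algebra.TensorProduct.tmul_mul_tmul, TensorProduct.map_tmul, TensorProduct.map_tmul,
        LinearMap.mul'_apply, LinearMap.mul'_apply]
      simp only [LinearMap.flip_apply, hact]

/-! ### The action of gauge transformations -/

section TotalAct

variable {F K V E : Type*} [Field F] [Ring K] [HopfAlgebra F K] [Fintype V] [DecidableEq V]
variable (Γ : CiliatedRibbonGraph V E)

omit [Fintype V] [DecidableEq V] in
theorem totalAct_tprod (k : V → K) : totalAct (F := F) Γ (PiTensorProduct.tprod F k)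
    = PiTensorProduct.map fun v => vertexAct (Γ.outgoing v) (k v) := by
  rw [totalAct, LinearMap.comp_apply, PiTensorProduct.map_tprod,
    PiTensorProduct.piTensorHomMap_tprod_eq_map]

omit [Fintype V] [DecidableEq V] in
theorem isRightAct_vertexAct (v : V) :
    IsRightAct (F := F) (K := K) (vertexAct (F := F) (Γ.outgoing v)) :=
  isRightAct_jointAct _ (List.nodup_finRange _)

omit [Fintype V] [DecidableEq V] in
theorem totalAct_one : totalAct (F := F) (K := K) Γ 1 = LinearMap.id := by
  rw [PiTensorProduct.one_def, totalAct_tprod]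
  simp only [Pi.one_apply, (isRightAct_vertexAct Γ _).one]
  exact PiTensorProduct.map_one

omit [Fintype V] [DecidableEq V] in
theorem totalAct_mul (h h' : GaugeAlg F K V) :
    totalAct Γ (h * h') = totalAct Γ h' ∘ₗ totalAct Γ h := by
  induction h using PiTensorProduct.induction_on with
  | add a b ha hb => rw [add_mul, map_add, ha, hb, map_add, LinearMap.comp_add]
  | smul_tprod r k =>
    rw [smul_mul_assoc, map_smul, map_smul, LinearMap.comp_smul]
    congr 1
    induction h' using PiTensorProduct.induction_on with
    | add a b ha hb => rw [mul_add, map_add, ha, hb, map_add, LinearMap.add_comp]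
    | smul_tprod r k' =>
      rw [mul_smul_comm, map_smul, map_smul, LinearMap.smul_comp, PiTensorProduct.tprod_mul_tprod,
        totalAct_tprod, totalAct_tprod, totalAct_tprod, ← PiTensorProduct.map_comp]
      simp only [Pi.mul_apply, (isRightAct_vertexAct Γ _).mul]
      rfl

omit [Fintype V] in
theorem totalAct_single (v : V) (k : K) :
    totalAct (F := F) Γ (PiTensorProduct.singleAlgHom v k) = gaugeAct Γ v k := by
  rw [singleAlgHom_eq, totalAct_tprod]
  refine PiTensorProduct.ext (MultilinearMap.ext fun x => ?_)
  rw [LinearMap.compMultilinearMap_apply, LinearMap.compMultilinearMap_apply,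
    PiTensorProduct.map_tprod, gaugeAct, LinearMap.comp_apply, AlgHom.toLinearMap_apply,
    atVertex_tprod]
  congr 1
  funext w
  by_cases hw : w = v
  · subst hw
    rw [Pi.mulSingle_eq_same, Function.update_self]
  · rw [Pi.mulSingle_eq_of_ne hw, Function.update_of_ne hw, (isRightAct_vertexAct Γ _).one,
      Module.End.one_apply]

omit [DecidableEq V] in
theorem totalAct_totalOne (h : GaugeAlg F K V) :
    totalAct Γ h (totalOne F K Γ) = counitPi h • totalOne F K Γ := by
  induction h using PiTensorProduct.induction_on with
  | add a b ha hb => rw [map_add, LinearMap.add_apply, ha, hb, map_add, add_smul]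
  | smul_tprod r k =>
    rw [map_smul, LinearMap.smul_apply, map_smul, smul_assoc, counitPi_tprod, totalAct_tprod,
      totalOne, flat, PiTensorProduct.map_tprod, ← MultilinearMap.map_smul_univ]
    congr 2
    funext v
    exact jointAct_counit _ (fun _ _ => rfl) _

theorem totalAct_range_Gstar [Fintype E] [DecidableEq E] [FiniteDimensional F K]
    (h : GaugeAlg F K V) :
    ∀ z ∈ LinearMap.range (Gstar (F := F) (K := K) Γ),
      totalAct Γ h z ∈ LinearMap.range (Gstar (F := F) (K := K) Γ) := by
  induction h using gauge_induction with
  | single v k =>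
    rw [totalAct_single]
    exact gaugeAct_mem Γ (atEnd_range_Gstar Γ) v k
  | one => rw [totalAct_one]; exact fun z hz => hz
  | mul h h' H H' => rw [totalAct_mul]; exact fun z hz => H' _ (H z hz)
  | smul r h H => rw [map_smul]; exact fun z hz => Submodule.smul_mem _ _ (H z hz)
  | add h h' H H' => rw [map_add]; exact fun z hz => Submodule.add_mem _ (H z hz) (H' z hz)

end TotalAct

end HopfGauge

end

noncomputable section

namespace HopfGauge

open Coalgebra HopfAlgebra

/-! ### Gauge transformations of holonomies -/

section TwoSided

variable {F K : Type*} [Field F] [Ring K] [HopfAlgebra F K]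

/-- By g S²(p) = p g the reversal T* exchanges the two sides of the transformation, which is why the
reversed holonomy transforms with the flipped tensor. -/
theorem twoSided_flip_revDual {g : K} (hg : IsPivotal F g) (w : K ⊗[F] K) (α : Module.Dual F K) :
    twoSided F K (flip w) (revDual g α) = revDual g (twoSided F K w α) := by
  induction w using TensorProduct.induction_on with
  | zero => simp
  | add a b ha hb => simp only [map_add, LinearMap.add_apply, ha, hb]
  | tmul p q =>
    ext k
    change α (g * antipode F (q * k * antipode F p)) = α (p * (g * antipode F k) * antipode F q)
    rw [antipode_mul_antidistrib, antipode_mul_antidistrib, ← mul_assoc, hg.mul_antipode_antipode,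
      mul_assoc, mul_assoc, mul_assoc]

theorem twoSided_flip (w : K ⊗[F] K) (α : Module.Dual F K) :
    LinearMap.applyₗ α (TensorProduct.lift ((LinearMap.mul F
      (Module.End F (Module.Dual F K))).compl₁₂ (endAct true) (endAct false)) w)
      = twoSided F K (flip w) α := by
  induction w using TensorProduct.induction_on with
  | zero => simp
  | add a b ha hb => simp only [map_add, LinearMap.add_apply, ha, hb]
  | tmul p q => exact endAct_endAct_comm q p α

theorem sum_dualDistrib_coef (I : MatRep F K) (a b : Fin I.dim) (w : K ⊗[F] K) :
    ∑ c, ∑ d, TensorProduct.dualDistrib F K K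
      (I.coef a c ⊗ₜ[F] (I.coef d b ∘ₗ antipode F)) w • I.coef c d
      = twoSided F K w (I.coef a b) := by
  induction w using TensorProduct.induction_on with
  | zero => simp
  | add x y hx hy =>
    simp only [map_add, LinearMap.add_apply, add_smul, Finset.sum_add_distrib, ← hx, ← hy]
  | tmul p q =>
    ext k
    rw [twoSided_tmul]
    change _ = I.rep (p * k * antipode F q) a b
    rw [map_mul, map_mul, Matrix.mul_apply]
    simp only [LinearMap.sum_apply, LinearMap.smul_apply, TensorProduct.dualDistrib_apply,
      smul_eq_mul, Matrix.mul_apply, Finset.sum_mul]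
    rw [Finset.sum_comm]
    refine Finset.sum_congr rfl fun d _ => Finset.sum_congr rfl fun c _ => ?_
    exact mul_right_comm (I.rep p a c) (I.rep (antipode F q) d b) (I.rep k c d)

end TwoSided

section Holonomies

variable {F K : Type*} [Field F] [Ring K] [HopfAlgebra F K] [FiniteDimensional F K]
variable {V E : Type*} [DecidableEq V] [Fintype E] [DecidableEq E]
variable (Γ : CiliatedRibbonGraph V E) (ρ : E → Bool) {R : (K ⊗[F] K)ˣ} {g : K}
variable (hg : IsPivotal F g) (hR : IsRMatrix R)
include hg hR

/-- The computation is made in an admissible orientation. If that is e⁻¹, the order of the ends in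
the tensor is flipped back at the end. -/
theorem gaugeAct_holOp (v : V) (e : E) (h : K) (α : Module.Dual F K) :
    gaugeAct Γ v h (holOp Γ ρ R e α (totalOne F K Γ))
      = holOp Γ ρ R e (twoSided F K (Γ.gaugeTensor v (e, true) h) α) (totalOne F K Γ) := by
  obtain ⟨b, hb⟩ := exists_admissible Γ e
  rw [holOp_eq Γ ρ hg hR hb, gaugeAct_edgeOp Γ ρ hg hR, ← gaugeTensor_eq Γ v hb]
  cases b
  · rw [← flip_gaugeTensor]
    exact congrArg (fun β => edgeOp Γ ρ R (e, false) β (totalOne F K Γ)) (twoSided_flip _ α)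
  · rfl

theorem gaugeAct_holMap (v : V) (x : E × Bool) (h : K) (α : Module.Dual F K) :
    gaugeAct Γ v h (holMap Γ ρ R g x α (totalOne F K Γ))
      = holMap Γ ρ R g x (twoSided F K (Γ.gaugeTensor v x h) α) (totalOne F K Γ) := by
  obtain ⟨e, _ | _⟩ := x
  · have hm : ∀ β, holMap Γ ρ R g (e, false) β = holOp Γ ρ R e (revDual g β) := fun _ => rfl
    rw [hm, hm, gaugeAct_holOp Γ ρ hg hR, ← flip_gaugeTensor, twoSided_flip_revDual hg]
  · exact gaugeAct_holOp Γ ρ hg hR v e h α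

theorem covariant_holMap (v : V) (x : E × Bool) (α : Module.Dual F K) :
    Covariant (gaugeAct Γ v) (totalMul Γ (R : K ⊗[F] K) ρ)
      (holMap Γ ρ R g x α (totalOne F K Γ)) := by
  have key : ∀ e β, Covariant (gaugeAct Γ v) (totalMul Γ (R : K ⊗[F] K) ρ)
      (holOp Γ ρ R e β (totalOne F K Γ)) := by
    intro e β
    obtain ⟨b, hb⟩ := exists_admissible Γ e
    rw [holOp_eq Γ ρ hg hR hb]
    exact covariant_edgeOp Γ ρ hg hR v _ β
  obtain ⟨e, _ | _⟩ := x
  · exact key e (revDual g α)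
  · exact key e α

variable {P : Set (MatRep F K)}

theorem gaugeAct_orbit_holonomy (v : V) (h : K) (I : P) (x : E × Bool) (a b : Fin I.1.dim) :
    gaugeAct Γ v h (orbit Γ ρ hg hR P (holonomy Γ R g I x a b))
      = orbit Γ ρ hg hR P (∑ c, ∑ d, TensorProduct.dualDistrib F K K
          (I.1.coef a c ⊗ₜ[F] (I.1.coef d b ∘ₗ antipode F)) (Γ.gaugeTensor v x h)
            • holonomy Γ R g I x c d) := by
  rw [orbit_apply, realize_holonomy, gaugeAct_holMap Γ ρ hg hR, ← sum_dualDistrib_coef]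
  simp only [map_sum, map_smul, LinearMap.sum_apply, LinearMap.smul_apply, orbit_apply,
    realize_holonomy]

/-- Holonomies are covariant as products of covariant functions of edge ends; scalars are covariant
because the unit is invariant; products follow from `Covariant.mul`. -/
theorem covariant_orbit (v : V) (l : LatticeAlgebra Γ R g P) :
    Covariant (gaugeAct Γ v) (totalMul Γ (R : K ⊗[F] K) ρ) (orbit Γ ρ hg hR P l) := by
  induction l using lattice_induction with
  | holonomy I x a b =>
    rw [orbit_apply, realize_holonomy]
    exact covariant_holMap Γ ρ hg hR v x _
  | scalar r =>
    rw [Algebra.algebraMap_eq_smul_one, map_smul, orbit_one]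
    refine Covariant.smul r fun h => ?_
    have e : totalMul Γ (R : K ⊗[F] K) ρ ∘ₗ (gaugeAct Γ v).flip (totalOne F K Γ)
        = (counit : K →ₗ[F] F).smulRight (1 : TotalEnd F K Γ) := by
      ext1 k
      rw [LinearMap.comp_apply, LinearMap.flip_apply, gaugeAct_totalOne, map_smul,
        one_totalMul Γ ρ hR]
      rfl
    rw [one_totalMul Γ ρ hR, mul_one]
    have h1 := LinearMap.congr_fun (counit_conv (B := TotalEnd F K Γ) (gaugeAct Γ v)) h
    rw [← e] at h1
    exact h1.symm
  | add l l' h h' => rw [map_add]; exact h.add h'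
  | mul l l' h h' =>
    rw [orbit_mul]
    exact h.mul (totalMul_totalMul Γ ρ hg hR) h'

end Holonomies

end HopfGauge

end

noncomputable section

namespace HopfGauge

open Coalgebra HopfAlgebra

/-! ### Module algebra structures on the lattice algebra -/

theorem exists_leftInverse_of_injective {F M W : Type*} [Field F] [AddCommMonoid M] [Module F M]
    [AddCommMonoid W] [Module F W] {f : M →ₗ[F] W} (hf : Function.Injective f) :
    ∃ r : W →ₗ[F] M, ∀ x, r (f x) = x := by
  let _ := Module.addCommMonoidToAddCommGroup F (M := M)
  let _ := Module.addCommMonoidToAddCommGroup F (M := W)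
  obtain ⟨r, hr⟩ := f.exists_leftInverse_of_injective (LinearMap.ker_eq_bot.2 hf)
  exact ⟨r, LinearMap.congr_fun hr⟩

section Actions

variable {F K : Type*} [Field F] [Ring K] [HopfAlgebra F K] [FiniteDimensional F K]
variable {V E : Type*} [Fintype V] [DecidableEq V]
variable (Γ : CiliatedRibbonGraph V E) (ρ : E → Bool) {R : (K ⊗[F] K)ˣ} {g : K}
variable {P : Set (MatRep F K)}

/-! ### Uniqueness of the gauge action on the lattice algebra. -/

section Unique

variable {Γ}

theorem IsLatticeAction.single_mul
    {act : GaugeAlg F K V →ₗ[F] LatticeAlgebra Γ R g P →ₗ[F] LatticeAlgebra Γ R g P}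
    (hact : IsLatticeAction Γ R g P act) (v : V) (k : K) (x y : LatticeAlgebra Γ R g P) :
    act (PiTensorProduct.singleAlgHom v k) (x * y) = ∑ i ∈ (ℛ F k).index,
      act (PiTensorProduct.singleAlgHom v ((ℛ F k).left i)) x
        * act (PiTensorProduct.singleAlgHom v ((ℛ F k).right i)) y := by
  rw [hact.act_mul, comulPi_single, ← (ℛ F k).eq]
  simp only [map_sum, TensorProduct.map_tmul, LinearMap.mul'_apply]
  rfl

/-- The module algebra axioms determine the action of a single vertex on products from that on
holonomies, and the action of K^{⊗V} from those of single vertices. -/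
theorem IsLatticeAction.unique
    {act act' : GaugeAlg F K V →ₗ[F] LatticeAlgebra Γ R g P →ₗ[F] LatticeAlgebra Γ R g P}
    (hact : IsLatticeAction Γ R g P act) (hact' : IsLatticeAction Γ R g P act') : act = act' := by
  have key : ∀ l v k, act (PiTensorProduct.singleAlgHom v k) l
      = act' (PiTensorProduct.singleAlgHom v k) l := by
    intro l
    induction l using lattice_induction with
    | holonomy I x a b => intro v k; rw [hact.act_holonomy, hact'.act_holonomy]
    | scalar r =>
      intro v k
      rw [Algebra.algebraMap_eq_smul_one, map_smul, map_smul, hact.act_one, hact'.act_one]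
    | add l l' h h' => intro v k; rw [map_add, map_add, h, h']
    | mul l l' h h' =>
      intro v k
      rw [hact.single_mul, hact'.single_mul]
      exact Finset.sum_congr rfl fun i _ => by rw [h, h']
  refine LinearMap.ext fun h => ?_
  induction h using gauge_induction with
  | single v k => exact LinearMap.ext fun l => key l v k
  | one => exact LinearMap.ext fun l => by rw [hact.one_act, hact'.one_act]
  | mul h h' H H' => exact LinearMap.ext fun l => by rw [hact.mul_act, hact'.mul_act, H, H']
  | smul r h H => rw [map_smul, map_smul, H]
  | add h h' H H' => rw [map_add, map_add, H, H']

end Unique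

variable [Fintype E] [DecidableEq E]
variable (hg : IsPivotal F g) (hR : IsRMatrix R)

/-- Every axiom holds in ⨂ᵥ A*ᵥ on the image of `orbit` and is pulled back by injectivity. Descent
of the action to the quotient by the lattice relations never has to be checked. -/
theorem isLatticeAction_of_orbit (hinj : Function.Injective (orbit Γ ρ hg hR P))
    {act : GaugeAlg F K V →ₗ[F] LatticeAlgebra Γ R g P →ₗ[F] LatticeAlgebra Γ R g P}
    (hact : ∀ h l, orbit Γ ρ hg hR P (act h l) = totalAct Γ h (orbit Γ ρ hg hR P l)) :
    IsLatticeAction Γ R g P act := by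
  have hmul : ∀ h h' l, act (h * h') l = act h' (act h l) := by
    intro h h' l
    apply hinj
    rw [hact, hact, hact, totalAct_mul, LinearMap.comp_apply]
  have hone : ∀ l, act 1 l = l := by
    intro l
    apply hinj
    rw [hact, totalAct_one, LinearMap.id_apply]
  refine ⟨hone, hmul, fun h => ?_, fun h => ?_, fun v h I x a b => ?_⟩
  · apply hinj
    rw [hact, orbit_one, totalAct_totalOne, Algebra.algebraMap_eq_smul_one, map_smul, orbit_one]
  · induction h using gauge_induction with
    | single v k =>
      intro x y
      apply hinj
      rw [hact, totalAct_single, orbit_mul, (covariant_orbit Γ ρ hg hR v x).apply (ℛ F k),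
        comulPi_single]
      conv_rhs => rw [← (ℛ F k).eq]
      simp only [map_sum, TensorProduct.map_tmul, LinearMap.mul'_apply, orbit_mul,
        LinearMap.flip_apply, hact, AlgHom.toLinearMap_apply, totalAct_single]
    | one =>
      intro x y
      rw [comulPi_one, hone, Algebra.TensorProduct.one_def, TensorProduct.map_tmul,
        LinearMap.mul'_apply, LinearMap.flip_apply, LinearMap.flip_apply, hone, hone]
    | mul h h' H H' =>
      rw [comulPi_mul]
      exact act_mul_of_act_mul act hmul H H'
    | smul r h H => intro x y; rw [map_smul, LinearMap.smul_apply, H, map_smul, map_smul, map_smul]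
    | add h h' H H' =>
      intro x y; rw [map_add, LinearMap.add_apply, H, H', map_add, map_add, map_add]
  · apply hinj
    rw [hact, totalAct_single]
    exact gaugeAct_orbit_holonomy Γ ρ hg hR v h I x a b

theorem exists_isGaugeAction :
    ∃ a : GaugeAlg F K V →ₗ[F] EdgeFun F K E →ₗ[F] EdgeFun F K E, IsGaugeAction Γ a := by
  obtain ⟨r, hr⟩ := exists_leftInverse_of_injective (Gstar_injective (F := F) (K := K) Γ)
  refine ⟨((totalAct Γ).compl₂ (Gstar Γ)).compr₂ r, fun h x => ?_⟩
  obtain ⟨z, hz⟩ := totalAct_range_Gstar Γ h _ ⟨x, rfl⟩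
  rw [LinearMap.compr₂_apply, LinearMap.compl₂_apply, ← hz, hr]

omit [DecidableEq V] [DecidableEq E] in
theorem isGaugeAction_unique
    {a a' : GaugeAlg F K V →ₗ[F] EdgeFun F K E →ₗ[F] EdgeFun F K E}
    (ha : IsGaugeAction Γ a) (ha' : IsGaugeAction Γ a') : a = a' :=
  LinearMap.ext₂ fun h x => Gstar_injective Γ ((ha h x).trans (ha' h x).symm)

omit [DecidableEq V] [DecidableEq E] in
theorem isGaugeProduct_unique
    {m m' : EdgeFun F K E →ₗ[F] EdgeFun F K E →ₗ[F] EdgeFun F K E}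
    (hm : IsGaugeProduct Γ R ρ m) (hm' : IsGaugeProduct Γ R ρ m') : m = m' :=
  LinearMap.ext₂ fun x y => Gstar_injective Γ ((hm x y).trans (hm' x y).symm)

variable (hP : IsComplete P)
include hg hR hP

/-- That the image of G* is closed under the product is not computed directly: it is the image of
the algebra homomorphism `orbit`. -/
theorem exists_isGaugeProduct :
    ∃ m : EdgeFun F K E →ₗ[F] EdgeFun F K E →ₗ[F] EdgeFun F K E, IsGaugeProduct Γ R ρ m := by
  obtain ⟨Φ, hΦ⟩ := exists_latticeEquiv Γ ρ hg hR hP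
  refine ⟨((LinearMap.mul F (LatticeAlgebra Γ R g P)).compl₁₂ Φ.symm.toLinearMap
    Φ.symm.toLinearMap).compr₂ Φ.toLinearMap, fun x y => ?_⟩
  change Gstar Γ (Φ (Φ.symm x * Φ.symm y)) = _
  rw [hΦ, orbit_mul, ← hΦ, ← hΦ, Φ.apply_symm_apply, Φ.apply_symm_apply]

/-- Each assertion is checked after applying the injective map G*, where Φ becomes `orbit`. -/
theorem coincides_of_isComplete
    {m : EdgeFun F K E →ₗ[F] EdgeFun F K E →ₗ[F] EdgeFun F K E}
    {a : GaugeAlg F K V →ₗ[F] EdgeFun F K E →ₗ[F] EdgeFun F K E}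
    (hm : IsGaugeProduct Γ R ρ m) (ha : IsGaugeAction Γ a) : Coincides Γ R g P m a := by
  obtain ⟨Φ, hΦ⟩ := exists_latticeEquiv Γ ρ hg hR hP
  have hinj : Function.Injective (orbit Γ ρ hg hR P) := by
    intro l l' h
    rw [← hΦ, ← hΦ] at h
    exact Φ.injective (Gstar_injective Γ h)
  let act : GaugeAlg F K V →ₗ[F] LatticeAlgebra Γ R g P →ₗ[F] LatticeAlgebra Γ R g P :=
    (a.compl₂ Φ.toLinearMap).compr₂ Φ.symm.toLinearMap
  have hΦact : ∀ h l, Φ (act h l) = a h (Φ l) := fun h l => Φ.apply_symm_apply _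
  have hact : IsLatticeAction Γ R g P act := by
    refine isLatticeAction_of_orbit Γ ρ hg hR hinj fun h l => ?_
    rw [← hΦ, hΦact, ha, hΦ]
  refine ⟨Φ, ?_, fun x y => ?_, fun I e i j => ⟨?_, ?_⟩,
    ⟨act, hact, fun act' hact' => hact'.unique hact⟩, fun act' hact' h x => ?_⟩
  · apply Gstar_injective Γ
    rw [hΦ, orbit_one, Gstar_one]
  · apply Gstar_injective Γ
    rw [hΦ, orbit_mul, hm, hΦ, hΦ]
  · apply Gstar_injective Γ
    rw [hΦ, orbit_holonomy]
    rfl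
  · apply Gstar_injective Γ
    rw [hΦ, orbit_holonomy]
    rfl
  · rw [hact'.unique hact, hΦact]

end Actions

end HopfGauge

end

noncomputable section

namespace HopfGauge

open Coalgebra HopfAlgebra

/-! ### The two complete classes of representations -/

section CompleteClasses

variable {F K : Type*} [Field F] [Ring K] [HopfAlgebra F K]

/-- An explicit preimage of h is g S(h) S(g), since S² is conjugation by g up to inversion and fixes
g. -/
theorem IsPivotal.antipode_surjective {g : K} (hg : IsPivotal F g) :
    Function.Surjective (antipode F : K →ₗ[F] K) := by
  have h1 : antipode F (antipode F g) = g := by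
    rw [← one_mul (antipode F (antipode F g)), ← hg.antipode_mul, mul_assoc,
      hg.mul_antipode_antipode, ← mul_assoc, hg.antipode_mul, one_mul]
  intro h
  refine ⟨g * antipode F h * antipode F g, ?_⟩
  rw [antipode_mul_antidistrib, antipode_mul_antidistrib, h1, ← mul_assoc,
    hg.mul_antipode_antipode, mul_assoc, hg.mul_antipode, mul_one]

/-! ### The trivial representation and duals. -/

namespace MatRep

variable (F K) in
/-- The trivial representation. -/
def trivial : MatRep F K where
  dim := 1
  rep := (Algebra.ofId F (Matrix (Fin 1) (Fin 1) F)).comp (Bialgebra.counitAlgHom F K)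

theorem trivial_rep (k : K) : (trivial F K).rep k = counit (R := F) k • 1 :=
  (Algebra.algebraMap_eq_smul_one _ :
    algebraMap F (Matrix (Fin 1) (Fin 1) F) (counit (R := F) k) = _)

/-- The dual representation. -/
def dual (I : MatRep F K) : MatRep F K where
  dim := I.dim
  rep := AlgHom.ofLinearMap
    ((Matrix.transposeLinearEquiv (Fin I.dim) (Fin I.dim) F F).toLinearMap ∘ₗ
      I.rep.toLinearMap ∘ₗ antipode F)
    (by
      change (I.rep (antipode F 1)).transpose = 1
      rw [antipode_one, map_one, Matrix.transpose_one])
    (fun h k => by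
      change (I.rep (antipode F (h * k))).transpose
        = (I.rep (antipode F h)).transpose * (I.rep (antipode F k)).transpose
      rw [antipode_mul_antidistrib, map_mul, Matrix.transpose_mul])

theorem isIrreducible_trivial : (trivial F K).IsIrreducible := by
  have : IsSimpleModule F (Fin 1 → F) := isSimpleModule_iff_finrank_eq_one.2 (by simp)
  exact ⟨one_pos, fun W _ => eq_bot_or_eq_top (α := Submodule F (Fin 1 → F)) W⟩

omit [HopfAlgebra F K] [Ring K] in
-- The annihilator of a subspace invariant under all B(k) is invariant under their transposes, hence
-- is 0 or everything.
theorem eq_bot_or_eq_top_of_transpose {n : Type*} [Fintype n] [DecidableEq n]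
    {A B : K → Matrix n n F} (hAB : ∀ k, ∃ l, A k = (B l).transpose)
    (hA : ∀ W : Submodule F (n → F), (∀ k, ∀ w ∈ W, (A k).mulVec w ∈ W) → W = ⊥ ∨ W = ⊤)
    (W : Submodule F (n → F)) (hW : ∀ k, ∀ w ∈ W, (B k).mulVec w ∈ W) : W = ⊥ ∨ W = ⊤ := by
  let U : Submodule F (n → F) :=
    { carrier := {v | ∀ w ∈ W, v ⬝ᵥ w = 0}
      zero_mem' := fun w _ => zero_dotProduct w
      add_mem' := fun {a b} ha hb w hw => by rw [add_dotProduct, ha w hw, hb w hw, add_zero]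
      smul_mem' := fun c a ha w hw => by rw [smul_dotProduct, ha w hw, smul_zero] }
  have hU : ∀ k, ∀ v ∈ U, (A k).mulVec v ∈ U := by
    intro k v hv w hw
    obtain ⟨l, hl⟩ := hAB k
    rw [hl, Matrix.mulVec_transpose, ← Matrix.dotProduct_mulVec]
    exact hv _ (hW l w hw)
  rcases hA U hU with h | h
  · right
    by_contra hne
    obtain ⟨f, hf, hWf⟩ := Submodule.exists_le_ker_of_lt_top W (lt_top_iff_ne_top.2 hne)
    have hfv : ∀ w, (fun i => f fun j => if i = j then 1 else 0) ⬝ᵥ w = f w := by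
      intro w
      rw [LinearMap.pi_apply_eq_sum_univ f w]
      simp only [dotProduct, smul_eq_mul, mul_comm]
    have hv : (fun i => f fun j => if i = j then 1 else 0) ∈ U := fun w hw => by
      rw [hfv]; exact hWf hw
    rw [h, Submodule.mem_bot] at hv
    refine hf (LinearMap.ext fun w => ?_)
    rw [← hfv, hv, zero_dotProduct, LinearMap.zero_apply]
  · left
    refine (Submodule.eq_bot_iff W).2 fun w hw => dotProduct_eq_zero w fun v => ?_
    rw [dotProduct_comm]
    exact (h ▸ Submodule.mem_top : v ∈ U) w hw

/-- The dual representation involves only elements of the form S(k). As S is surjective, no operator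
of I is lost. -/
theorem IsIrreducible.dual {g : K} (hg : IsPivotal F g) {I : MatRep F K} (hI : I.IsIrreducible) :
    I.dual.IsIrreducible := by
  refine ⟨hI.1, eq_bot_or_eq_top_of_transpose (A := I.rep)
    (B := fun k => (I.rep (antipode F k)).transpose) (fun k => ?_) hI.2⟩
  obtain ⟨k, rfl⟩ := hg.antipode_surjective k
  exact ⟨k, (Matrix.transpose_transpose _).symm⟩

end MatRep

/-- Every representation is its own only summand. -/
theorem isComplete_univ : IsComplete (Set.univ : Set (MatRep F K)) where
  decomposes I := ⟨1, fun _ => ⟨I, Set.mem_univ _⟩, fun _ => 1, fun _ => 1,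
    fun _ h => by rw [mul_one, one_mul], fun _ h => by rw [mul_one, one_mul], by simp⟩
  trivial := ⟨.trivial F K, Set.mem_univ _, one_pos, MatRep.trivial_rep⟩
  dual I _ := ⟨I.dual, Set.mem_univ _, Equiv.refl _, fun _ _ _ => rfl⟩

/-! ### Simple modules as irreducible matrix representations. -/

section Simple

variable {S : Type*} [AddCommGroup S] [Module F S] [Module K S] [IsScalarTower F K S]
variable [Module.Finite F S]

variable (F K S) in
/-- The matrix representation on a finite-dimensional module. -/
def MatRep.ofModule : MatRep F K where
  dim := Module.finrank F S
  rep := (LinearMap.toMatrixAlgEquiv (Module.finBasis F S)).toAlgHom.comp (Algebra.lsmul F F S)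

theorem MatRep.ofModule_mulVec (k : K) (s : S) :
    ((MatRep.ofModule F K S).rep k).mulVec ((Module.finBasis F S).equivFun s)
      = (Module.finBasis F S).equivFun (k • s) :=
  LinearMap.toMatrix_mulVec_repr (Module.finBasis F S) (Module.finBasis F S)
    (Algebra.lsmul F F S k) s

theorem MatRep.isIrreducible_ofModule [IsSimpleModule K S] :
    (MatRep.ofModule F K S).IsIrreducible := by
  have := IsSimpleModule.nontrivial K S
  refine ⟨Module.finrank_pos (R := F) (M := S),
    fun (W : Submodule F (Fin (Module.finrank F S) → F)) hW => ?_⟩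
  let U : Submodule K S :=
    { W.comap (Module.finBasis F S).equivFun.toLinearMap with
      smul_mem' := fun k s hs => by
        change (Module.finBasis F S).equivFun (k • s) ∈ W
        rw [← MatRep.ofModule_mulVec]
        exact hW k _ hs }
  have hU : ∀ w, w ∈ W ↔ (Module.finBasis F S).equivFun.symm w ∈ U := by
    intro w
    change _ ↔ (Module.finBasis F S).equivFun ((Module.finBasis F S).equivFun.symm w) ∈ W
    rw [LinearEquiv.apply_symm_apply]
  rcases eq_bot_or_eq_top U with h | h
  · left
    refine (Submodule.eq_bot_iff W).2 fun w hw => ?_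
    rw [hU, h, Submodule.mem_bot] at hw
    exact (LinearEquiv.map_eq_zero_iff _).1 hw
  · right
    refine Submodule.eq_top_iff'.2 fun w => ?_
    rw [hU, h]
    exact Submodule.mem_top

end Simple

/-- Over a semisimple ring a finite module is a finite direct sum of simple ones. The maps C and D
are the inclusions and projections in chosen bases of the simple summands. -/
theorem exists_decomposition [IsSemisimpleRing K] (M : Type*) [AddCommGroup M] [Module F M]
    [Module K M] [IsScalarTower F K M] [Module.Finite F M] :
    ∃ (r : ℕ) (N : Fin r → {I : MatRep F K | I.IsIrreducible})
      (C : ∀ k, (Fin (N k).1.dim → F) →ₗ[F] M) (D : ∀ k, M →ₗ[F] Fin (N k).1.dim → F),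
      (∀ k (h : K) x, h • C k x = C k (((N k).1.rep h).mulVec x)) ∧
      (∀ k (h : K) m, D k (h • m) = ((N k).1.rep h).mulVec (D k m)) ∧
      ∀ m, ∑ k, C k (D k m) = m := by
  classical
  have : Module.Finite K M := Module.Finite.of_restrictScalars_finite F K M
  obtain ⟨r, S, e, hS⟩ := IsSemisimpleModule.exists_linearEquiv_fin_dfinsupp K M
  have : ∀ i, Module.Finite F (S i) := fun i =>
    inferInstanceAs (Module.Finite F ((S i).restrictScalars F))
  let b := fun i => (Module.finBasis F (S i)).equivFun
  refine ⟨r, fun i => ⟨MatRep.ofModule F K (S i), MatRep.isIrreducible_ofModule⟩,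
    fun i => (e.symm.restrictScalars F).toLinearMap ∘ₗ
      ((DFinsupp.lsingle (R := K) (M := fun i => S i) i).restrictScalars F ∘ₗ (b i).symm.toLinearMap),
    fun i => (b i).toLinearMap ∘ₗ ((DFinsupp.lapply (R := K) (M := fun i => S i) i).restrictScalars F ∘ₗ
      (e.restrictScalars F).toLinearMap), fun i h x => ?_, fun i h m => ?_, fun m => ?_⟩
  · obtain ⟨s, rfl⟩ := (b i).surjective x
    change h • e.symm (DFinsupp.lsingle (R := K) (M := fun i => S i) i ((b i).symm (b i s))) = e.symm
      (DFinsupp.lsingle (R := K) (M := fun i => S i) i ((b i).symm (((MatRep.ofModule F K (S i)).rep h).mulVec (b i s))))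
    rw [MatRep.ofModule_mulVec]
    change _ = e.symm (DFinsupp.lsingle (R := K) (M := fun i => S i) i ((b i).symm (b i (h • s))))
    rw [LinearEquiv.symm_apply_apply, LinearEquiv.symm_apply_apply, map_smul, map_smul]
  · change b i (e (h • m) i) = ((MatRep.ofModule F K (S i)).rep h).mulVec (b i (e m i))
    rw [MatRep.ofModule_mulVec, map_smul]
    rfl
  · change ∑ i, e.symm (DFinsupp.single i ((b i).symm (b i (e m i)))) = m
    simp only [LinearEquiv.symm_apply_apply]
    rw [← map_sum, LinearEquiv.symm_apply_eq]
    ext i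
    simp [DFinsupp.single_apply]

theorem decomposes_of_isSemisimpleRing [IsSemisimpleRing K] (I : MatRep F K) :
    Decomposes {I : MatRep F K | I.IsIrreducible} I.rep := by
  let φ : K →+* Module.End F (Fin I.dim → F) :=
    ((Matrix.toLinAlgEquiv' (R := F) (n := Fin I.dim)).toAlgHom.comp I.rep).toRingHom
  let _ : Module K (Fin I.dim → F) := Module.compHom _ φ
  have hsmul : ∀ (k : K) (x : Fin I.dim → F), k • x = (I.rep k).mulVec x := fun k x => rfl
  have : IsScalarTower F K (Fin I.dim → F) := ⟨fun r k x => by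
    rw [hsmul, hsmul, map_smul, Matrix.smul_mulVec]⟩
  obtain ⟨r, N, C, D, hC, hD, hCD⟩ := exists_decomposition (F := F) (K := K) (Fin I.dim → F)
  refine ⟨r, N, fun k => LinearMap.toMatrix' (C k), fun k => LinearMap.toMatrix' (D k),
    fun k h => ?_, fun k h => ?_, ?_⟩
  all_goals refine Matrix.toLin'.injective (LinearMap.ext fun x => ?_)
  · rw [Matrix.toLin'_mul, Matrix.toLin'_mul, Matrix.toLin'_toMatrix']
    exact hC k h x
  · rw [Matrix.toLin'_mul, Matrix.toLin'_mul, Matrix.toLin'_toMatrix']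
    exact hD k h x
  · rw [map_sum, LinearMap.sum_apply, Matrix.toLin'_one]
    simp only [Matrix.toLin'_mul, Matrix.toLin'_toMatrix']
    exact hCD x

theorem isComplete_irreducible [IsSemisimpleRing K] {g : K} (hg : IsPivotal F g) :
    IsComplete {I : MatRep F K | I.IsIrreducible} where
  decomposes := decomposes_of_isSemisimpleRing
  trivial := ⟨.trivial F K, MatRep.isIrreducible_trivial, one_pos, MatRep.trivial_rep⟩
  dual I hI := ⟨I.dual, hI.dual hg, Equiv.refl _, fun _ _ _ => rfl⟩

end CompleteClasses

end HopfGauge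

end

/-- The lattice algebra and the images of its generators do not involve ρ. Since Φ is an isomorphism
of algebras with these values on generators, the product m is the same for every choice of selected
ends. -/
theorem mainTheorem10 {F K : Type*} [Field F] [CharZero F] [Ring K] [HopfAlgebra F K]
    [FiniteDimensional F K]
    (R₀ : (K ⊗[F] K)ˣ) (hR₀ : IsRMatrix R₀) (ν : K) (hν : IsRibbonElement R₀ ν)
    (R : (K ⊗[F] K)ˣ) (hR : IsRMatrix R)
    {V E : Type*} [Fintype V] [DecidableEq V] [Fintype E] [DecidableEq E]
    (Γ : CiliatedRibbonGraph V E) (ρ : E → Bool) :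
    (∃! m, IsGaugeProduct Γ R ρ m) ∧ (∃! a, IsGaugeAction (F := F) (K := K) Γ a) ∧
      ∀ m a, IsGaugeProduct Γ R ρ m → IsGaugeAction Γ a →
        Coincides Γ R (grouplike R₀ ν) Set.univ m a ∧
        (IsSemisimpleRing K →
          Coincides Γ R (grouplike R₀ ν) {I : MatRep F K | I.IsIrreducible} m a) := by
  have hg : IsPivotal F (grouplike R₀ ν) := isPivotal_grouplike hR₀ hν
  -- Existence of the product needs some complete class; that of all representations is available
  -- without semisimplicity.
  obtain ⟨m, hm⟩ := exists_isGaugeProduct Γ ρ hg hR isComplete_univ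
  obtain ⟨a, ha⟩ := exists_isGaugeAction (F := F) (K := K) Γ
  refine ⟨⟨m, hm, fun m' hm' => isGaugeProduct_unique Γ ρ hm' hm⟩,
    ⟨a, ha, fun a' ha' => isGaugeAction_unique Γ ha' ha⟩, fun m a hm ha =>
    ⟨coincides_of_isComplete Γ ρ hg hR isComplete_univ hm ha, fun _ =>
      coincides_of_isComplete Γ ρ hg hR (isComplete_irreducible hg) hm ha⟩⟩
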